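/- Let $\Sigma$ be an alphabet and $\pi:(\Sigma\sqcup\Sigma^{-1})^*\to F(\Sigma)$ the canonical map to the free group. **Automata.** An involutive CNFA $\mathcal A$ consists of a finite set $Q$ of states, an initial state $q_0$, a set $F\subseteq Q$ of final states, a finite family $\delta$ of transitions $(p,X,q)$ whose labels $X$ are non-terminals of a straight-line program (truncated non-terminals being allowed in productions) producing words over $\Sigma\sqcup\Sigma^{-1}$, and an involution $\alpha\mapsto\alpha^{-1}$ of $\delta$ such that the inverse of $(p,X,q)$ goes from $q$ to $p$ and its label is the formal inverse $X^{-1}$ of $X$ as a word. $L(\mathcal A)$ is the set of products of labels along sequences of transitions from $q_0$ to a final state. $\mathcal A$ is an (involutive) CDFA if all labels are non-empty and freely reduced and two transitions that leave the same state with labels having the same first letter are equal. Let $\partial\mathcal A$ be the set of states with exactly one incoming and exactly one outgoing transition, and $$k(\mathcal A)=3\max\{0,\tfrac{|\delta|}{2}-|Q|\}+|F|+|\partial\mathcal A|+1,\qquad n(\mathcal A)=\sum_{(p,X,q)\in\delta}\tfrac{|X|}{2}.$$ **Making $\mathcal A$ minimalistic.** $\mathcal A$ is minimalistic if all labels are freely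 reduced and non-empty and no state outside $F\cup\{q_0\}$ has at most two incoming and at most two outgoing transitions. To make $\mathcal A$ minimalistic, apply, in any order until it is minimalistic, the steps: freely reduce all labels; delete all transitions with empty label, identifying their end points; delete a state outside $F\cup\{q_0\}$ that has at most one outgoing transition, or whose only transitions are a loop and its inverse, together with its transitions; replace a state $q\notin F\cup\{q_0\}$ whose outgoing transitions are exactly $(q,X,p_1)$ and $(q,Y,p_2)$ with $p_1,p_2\ne q$ by a transition $(p_1,X^{-1}Y,p_2)$ and its inverse. **Transition folds.** Let $\alpha=(p,X,q)\in\delta$. To fold $\alpha$, choose a maximal pair $(i,j)$ such that $i+j\le|X|$ and $X[:i]$, $X^{-1}[:j]$ can be read from $p$, $q$ respectively (possibly ending inside a transition) without traversing $\alpha,\alpha^{-1}$. Say they lead to position $k$ of $\beta=(r,Y,s)$ and position $l$ of $\gamma=(t,Z,u)$, where a state $x$ is represented by an added transition $(x,\epsilon,x)$ and transitions may be replaced by their inverses. Remove $\alpha,\beta,\gamma$ and their inverses, add new states $p',q'$, and add the following transitions and their inverses. * If $\beta\ne\gamma,\gamma^{-1}$: $(r,Y[:k],p')$, $(p',Y[k:],s)$,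 $(t,Z[:l],q')$, $(q',Z[l:],u)$, $(p',X[i:-j],q')$. * If $\beta=\gamma$ and $k<l$: $(r,Y[:k],p')$, $(p',Y[k:l],q')$, $(q',Y[l:],s)$, $(p',X[i:-j],q')$. * If $\beta=\gamma$ and $k=l$: $(r,Y[:k],p')$, $(p',Y[k:],s)$, $(p',X[i:i+m],q')$, $(q',X[i+m:-j-m],q')$, where $m$ is largest with $i+j+2m\le|X|$ and $X[i:i+m]=X^{-1}[j:j+m]$. Finally remove all transitions with empty label and identify their end points. **The algorithm.** Input: an involutive CNFA $\mathcal A$. 1. Make $\mathcal A$ minimalistic; call the result $\mathcal A_0$ and put $i=0$. (If $\mathcal A_0$ has no transitions, output it.) 2. Choose $\alpha_i=(p,X,q)\in\delta_i$ with $|X|$ maximal. Let $\mathcal A_i'$ be $\mathcal A_i$ with $\alpha_i^{\pm1}$ removed and with final states $F_i\cup\{p,q\}$. If $\mathcal A_i'$ is a CDFA, let $\mathcal A_i''=\mathcal A_i'$; otherwise let $\mathcal A_i''$ be the output of the algorithm applied recursively to $\mathcal A_i'$. Let $\mathcal A_i'''$ be $\mathcal A_i''$ with $\alpha_i^{\pm1}$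 added between the images of $p$ and $q$ and with the images of the states in $F_i$ as final states. 3. Fold $\alpha_i$ in $\mathcal A_i'''$ and make the result minimalistic; call it $\mathcal A_{i+1}$. If it is a CDFA, output it; otherwise increase $i$ by one and go to 2. **Proposition.** Let $\mathcal A$ be an involutive CNFA all of whose states are reachable from $q_0$, and which is non-trivial in the sense that $n(\mathcal A)>1$. Put $k=k(\mathcal A)$, $n=n(\mathcal A)$. Then, whatever choices are made, the algorithm terminates without getting stuck on input $\mathcal A$, performs at most $(2k\log n)^k$ transition folds ($\log$ is the natural logarithm; the folds in recursive calls are counted), and its output $\mathcal A_m$ is an involutive CDFA with $\pi(L(\mathcal A_m))=\pi(L(\mathcal A))$. -/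

import Mathlib

universe u

/-! ### Straight-line programs -/

/-- A symbol in a production: a terminal letter, a non-terminal `X`, or a truncated
non-terminal `X[i:j]`. -/
inductive SLPSymbol (L : Type u) (N : Type) : Type u
  | letter (a : L) : SLPSymbol L N
  | nonterm (X : N) : SLPSymbol L N
  | trunc (X : N) (i j : ℕ) : SLPSymbol L N

/-- The non-terminal occurring in a symbol, if any. -/
def SLPSymbol.nt {L : Type u} {N : Type} : SLPSymbol L N → Option N
  | .letter _ => none
  | .nonterm X => some X
  | .trunc X _ _ => some X

/-- The word of a symbol, given the words of the non-terminals. -/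
def SLPSymbol.value {L : Type u} {N : Type} (v : N → List L) : SLPSymbol L N → List L
  | .letter a => [a]
  | .nonterm X => v X
  | .trunc X i j => ((v X).take j).drop i

/-- A finite set of non-terminals with their productions, without circular references. -/
structure SLP (L : Type u) : Type (max u 1) where
  N : Type
  finite_N : Finite N
  prod : N → List (SLPSymbol L N)
  wf : WellFounded fun Y X : N => ∃ s ∈ prod X, s.nt = some Y

open Classical in
/-- The word obtained from a non-terminal by repeatedly replacing non-terminals with their
productions. -/
noncomputable def SLP.eval {L : Type u} (P : SLP L) : P.N → List L :=
  P.wf.fix fun X ih =>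
    (P.prod X).flatMap (SLPSymbol.value fun Y =>
      if h : ∃ s ∈ P.prod X, s.nt = some Y then ih Y h else [])

theorem SLP.eval_eq {L : Type u} (P : SLP L) (X : P.N) :
    P.eval X = (P.prod X).flatMap (SLPSymbol.value P.eval) := by
  classical
  unfold SLP.eval
  rw [WellFounded.fix_eq]
  rw [List.flatMap_def, List.flatMap_def]
  congr 1
  apply List.map_congr_left
  intro s hs
  cases s with
  | letter a => rfl
  | nonterm Y =>
    have h : ∃ s ∈ P.prod X, s.nt = some Y := ⟨_, hs, rfl⟩
    simp only [SLPSymbol.value]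
    rw [dif_pos h]
  | trunc Y i j =>
    have h : ∃ s ∈ P.prod X, s.nt = some Y := ⟨_, hs, rfl⟩
    simp only [SLPSymbol.value]
    rw [dif_pos h]

/-! ### Automata -/

/-- A finite automaton whose transitions are labelled by words over `L`. The transitions form a
finite family (a finite set of triples is the case of an injective family), so that distinct
transitions remain distinct when states are identified. -/
structure WordAut (L : Type u) : Type (max u 1) where
  Q : Type
  T : Type
  finite_Q : Finite Q
  finite_T : Finite T
  src : T → Q
  tgt : T → Q
  label : T → List L
  q0 : Q
  F : Set Q

/-- `A.Path K p w q`: some sequence of transitions in `K` leads from `p` to `q`, and `w` is the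
product of their labels. -/
inductive WordAut.Path {L : Type u} (A : WordAut L) (K : Set A.T) : A.Q → List L → A.Q → Prop
  | nil (p : A.Q) : A.Path K p [] p
  | cons (t : A.T) (ht : t ∈ K) (w : List L) (q : A.Q) (h : A.Path K (A.tgt t) w q) :
      A.Path K (A.src t) (A.label t ++ w) q

/-- The language `L(A)`. -/
def WordAut.lang {L : Type u} (A : WordAut L) : Set (List L) :=
  {w | ∃ q ∈ A.F, A.Path Set.univ A.q0 w q}

/-- Determinism: no label is empty, and two transitions which leave the same state and whose
labels have the same first letter are equal. -/
def WordAut.Deterministic {L : Type u} (A : WordAut L) : Prop :=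
  (∀ t, A.label t ≠ []) ∧
    ∀ t t', A.src t = A.src t' → (A.label t).head? = (A.label t').head? → t = t'

/-- Every state is reachable from the initial state. -/
def WordAut.Accessible {L : Type u} (A : WordAut L) : Prop :=
  ∀ q, ∃ w, A.Path Set.univ A.q0 w q

def WordAut.outgoing {L : Type u} (A : WordAut L) (q : A.Q) : Set A.T := {t | A.src t = q}

def WordAut.incoming {L : Type u} (A : WordAut L) (q : A.Q) : Set A.T := {t | A.tgt t = q}

/-- The states with exactly one incoming and exactly one outgoing transition. -/
def WordAut.boundary {L : Type u} (A : WordAut L) : Set A.Q :=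
  {q | (A.incoming q).ncard = 1 ∧ (A.outgoing q).ncard = 1}

/-- `k(A) = 3 max {0, |δ|/2 - |Q|} + |F| + |∂A| + 1`. -/
noncomputable def WordAut.k {L : Type u} (A : WordAut L) : ℝ :=
  3 * max 0 ((Nat.card A.T : ℝ) / 2 - (Nat.card A.Q : ℝ)) + (A.F.ncard : ℝ)
    + (A.boundary.ncard : ℝ) + 1

/-- `n(A)`: half of the sum of the lengths of the labels of all transitions. -/
noncomputable def WordAut.n {L : Type u} (A : WordAut L) : ℝ :=
  ∑ᶠ t : A.T, ((A.label t).length : ℝ) / 2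

/-- An automaton over `Σ ⊔ Σ⁻¹` with an involution on its transitions. The letter `(a, true)`
stands for `a`, the letter `(a, false)` for `a⁻¹`. -/
structure InvAut (S : Type u) : Type (max u 1) extends WordAut (S × Bool) where
  inv : T → T
  inv_inv : ∀ t, inv (inv t) = t
  src_inv : ∀ t, src (inv t) = tgt t
  label_inv : ∀ t, label (inv t) = FreeGroup.invRev (label t)

/-- A straight-line program together with, for every transition, a non-terminal which produces
its label. -/
structure Compression {L : Type u} {T : Type} (label : T → List L) : Type (max u 1) where
  slp : SLP L
  lab : T → slp.N
  eval_lab : ∀ t, slp.eval (lab t) = label t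

/-- An involutive compressed non-deterministic finite state automaton. -/
structure InvCNFA (S : Type u) : Type (max u 1) extends InvAut S where
  comp : Compression label

namespace InvAut

variable {S : Type u}

/-- The set `π(L(A))` of elements of the free group represented by accepted words. -/
def groupLang (A : InvAut S) : Set (FreeGroup S) := FreeGroup.mk '' A.lang

/-- An involutive CDFA: deterministic, with freely reduced labels. -/
def IsCDFA (A : InvAut S) : Prop :=
  A.Deterministic ∧ ∀ t, FreeGroup.IsReduced (A.label t)

theorem tgt_inv (A : InvAut S) (t : A.T) : A.tgt (A.inv t) = A.src t := by
  rw [← A.src_inv, A.inv_inv]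

/-! ### Elementary operations -/

/-- Remove the transitions in `R` and their inverses. -/
def remove (A : InvAut S) (R : Set A.T) : InvAut S where
  Q := A.Q
  T := {t : A.T // t ∉ R ∧ A.inv t ∉ R}
  finite_Q := A.finite_Q
  finite_T := by
    have := A.finite_T
    infer_instance
  src t := A.src t.1
  tgt t := A.tgt t.1
  label t := A.label t.1
  q0 := A.q0
  F := A.F
  inv t := ⟨A.inv t.1, t.2.2, by rw [A.inv_inv]; exact t.2.1⟩
  inv_inv t := Subtype.ext (A.inv_inv t.1)
  src_inv t := A.src_inv t.1
  label_inv t := A.label_inv t.1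

/-- Replace the set of final states. -/
def withFinal (A : InvAut S) (F : Set A.Q) : InvAut S :=
  { A with F := F }

/-- Add the states in `V`. -/
def addStates (A : InvAut S) (V : Type) [Finite V] : InvAut S where
  Q := A.Q ⊕ V
  T := A.T
  finite_Q := by
    have := A.finite_Q
    infer_instance
  finite_T := A.finite_T
  src t := Sum.inl (A.src t)
  tgt t := Sum.inl (A.tgt t)
  label := A.label
  q0 := Sum.inl A.q0
  F := Sum.inl '' A.F
  inv := A.inv
  inv_inv := A.inv_inv
  src_inv t := congrArg Sum.inl (A.src_inv t)
  label_inv := A.label_inv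

/-- For every `i : I` add a transition `(s i, w i, e i)` and its inverse. -/
def addEdges (A : InvAut S) (I : Type) [Finite I] (s e : I → A.Q) (w : I → List (S × Bool)) :
    InvAut S where
  Q := A.Q
  T := A.T ⊕ I × Bool
  finite_Q := A.finite_Q
  finite_T := by
    have := A.finite_T
    infer_instance
  src := Sum.elim A.src fun x => if x.2 then s x.1 else e x.1
  tgt := Sum.elim A.tgt fun x => if x.2 then e x.1 else s x.1
  label := Sum.elim A.label fun x => if x.2 then w x.1 else FreeGroup.invRev (w x.1)
  q0 := A.q0
  F := A.F
  inv := Sum.map A.inv fun x => (x.1, !x.2)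
  inv_inv t := by
    rcases t with t | ⟨i, b⟩
    · simp [A.inv_inv]
    · simp
  src_inv t := by
    rcases t with t | ⟨i, b⟩
    · simp [A.src_inv]
    · cases b <;> simp
  label_inv t := by
    rcases t with t | ⟨i, b⟩
    · simp [A.label_inv]
    · cases b <;> simp

/-- Two states are joined by a transition with empty label. -/
def EmptyJoined (A : InvAut S) (p q : A.Q) : Prop :=
  ∃ t, A.src t = p ∧ A.tgt t = q ∧ A.label t = []

/-- Remove all transitions with empty label and identify the corresponding states. -/
def contract (A : InvAut S) : InvAut S where
  Q := Quot A.EmptyJoined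
  T := {t : A.T // A.label t ≠ []}
  finite_Q := by
    have := A.finite_Q
    infer_instance
  finite_T := by
    have := A.finite_T
    infer_instance
  src t := Quot.mk _ (A.src t.1)
  tgt t := Quot.mk _ (A.tgt t.1)
  label t := A.label t.1
  q0 := Quot.mk _ A.q0
  F := Quot.mk _ '' A.F
  inv t := ⟨A.inv t.1, by
    rw [A.label_inv]
    intro h
    apply t.2
    have h2 := congrArg List.length h
    rw [FreeGroup.invRev_length] at h2
    exact List.eq_nil_of_length_eq_zero h2⟩
  inv_inv t := Subtype.ext (A.inv_inv t.1)
  src_inv t := congrArg (Quot.mk _) (A.src_inv t.1)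
  label_inv t := A.label_inv t.1

/-- Remove the state `q` and all transitions incident to it. -/
def deleteState (A : InvAut S) (q : A.Q) (h : A.q0 ≠ q) : InvAut S where
  Q := {x : A.Q // x ≠ q}
  T := {t : A.T // A.src t ≠ q ∧ A.tgt t ≠ q}
  finite_Q := by
    have := A.finite_Q
    infer_instance
  finite_T := by
    have := A.finite_T
    infer_instance
  src t := ⟨A.src t.1, t.2.1⟩
  tgt t := ⟨A.tgt t.1, t.2.2⟩
  label t := A.label t.1
  q0 := ⟨A.q0, h⟩
  F := {x | x.1 ∈ A.F}
  inv t := ⟨A.inv t.1, by rw [A.src_inv]; exact t.2.2, by rw [A.tgt_inv]; exact t.2.1⟩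
  inv_inv t := Subtype.ext (A.inv_inv t.1)
  src_inv t := Subtype.ext (A.src_inv t.1)
  label_inv t := A.label_inv t.1

open Classical in
/-- The partial map on states belonging to `deleteState`. -/
noncomputable def deleteMap (A : InvAut S) (q : A.Q) (x : A.Q) : Option {x : A.Q // x ≠ q} :=
  if h : x ≠ q then some ⟨x, h⟩ else none

open Classical in
/-- Freely reduce all labels. -/
noncomputable def reduceLabels (A : InvAut S) : InvAut S where
  Q := A.Q
  T := A.T
  finite_Q := A.finite_Q
  finite_T := A.finite_T
  src := A.src
  tgt := A.tgt
  label t := FreeGroup.reduce (A.label t)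
  q0 := A.q0
  F := A.F
  inv := A.inv
  inv_inv := A.inv_inv
  src_inv := A.src_inv
  label_inv t := by rw [A.label_inv, FreeGroup.reduce_invRev]

/-! ### Minimalistic automata -/

/-- All labels are freely reduced and non-empty, and every state which is neither initial nor
final has more than two incoming or more than two outgoing transitions. -/
def Minimalistic (A : InvAut S) : Prop :=
  (∀ t, FreeGroup.IsReduced (A.label t) ∧ A.label t ≠ []) ∧
    ¬ ∃ q, q ≠ A.q0 ∧ q ∉ A.F ∧ (A.incoming q).ncard ≤ 2 ∧ (A.outgoing q).ncard ≤ 2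

/-- The elementary steps by which an automaton is made minimalistic, with the induced partial map
on states. -/
inductive MinStep : (A B : InvAut S) → (A.Q → Option B.Q) → Prop
  /-- freely reduce the labels -/
  | reduce (A : InvAut S) : MinStep A A.reduceLabels some
  /-- remove the transitions with empty label and identify their end points -/
  | contract (A : InvAut S) : MinStep A A.contract (fun x => some (Quot.mk _ x))
  /-- remove a state with at most one outgoing transition -/
  | leaf (A : InvAut S) (q : A.Q) (hq : A.q0 ≠ q) (hF : q ∉ A.F)
      (h : (A.outgoing q).ncard ≤ 1) :
      MinStep A (A.deleteState q hq) (A.deleteMap q)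
  /-- remove a state whose only transitions are a loop and its inverse -/
  | loop (A : InvAut S) (q : A.Q) (hq : A.q0 ≠ q) (hF : q ∉ A.F) (t : A.T)
      (h : A.outgoing q = {t, A.inv t}) (ht : A.tgt t = q) :
      MinStep A (A.deleteState q hq) (A.deleteMap q)
  /-- replace a state `q` with exactly two outgoing transitions `(q, X, p₁)`, `(q, Y, p₂)`, where
  `p₁, p₂ ≠ q`, by a transition `(p₁, X⁻¹Y, p₂)` and its inverse -/
  | merge (A : InvAut S) (q : A.Q) (hq : A.q0 ≠ q) (hF : q ∉ A.F) (t₁ t₂ : A.T) (hne : t₁ ≠ t₂)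
      (h : A.outgoing q = {t₁, t₂}) (h₁ : A.tgt t₁ ≠ q) (h₂ : A.tgt t₂ ≠ q) :
      MinStep A
        ((A.addEdges Unit (fun _ => A.tgt t₁) (fun _ => A.tgt t₂)
          (fun _ => FreeGroup.invRev (A.label t₁) ++ A.label t₂)).deleteState q hq)
        (A.deleteMap q)

/-- Finite sequences of elementary steps. -/
inductive MinSteps : (A B : InvAut S) → (A.Q → Option B.Q) → Prop
  | refl (A : InvAut S) : MinSteps A A some
  | tail (A B C : InvAut S) (ρ : A.Q → Option B.Q) (σ : B.Q → Option C.Q)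
      (h : MinSteps A B ρ) (h' : MinStep B C σ) : MinSteps A C (fun x => (ρ x).bind σ)

/-- `B` is obtained by making `A` minimalistic, and `ρ` is the induced partial map on states. -/
def Minimalizes (A B : InvAut S) (ρ : A.Q → Option B.Q) : Prop :=
  MinSteps A B ρ ∧ B.Minimalistic

/-! ### Transition folds -/

/-- `A` with a transition `(q, ε, q)` (and its inverse) added for every state `q`. -/
def withTrivial (A : InvAut S) : InvAut S :=
  @addEdges S A A.Q A.finite_Q id id (fun _ => [])

/-- The word `w` determines a path from the state `p` to `β(k)`, the point at position `k` of the
transition `β`, without traversing a transition in `R`. -/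
def Determines (A : InvAut S) (R : Set A.T) (p : A.Q) (w : List (S × Bool)) (β : A.T) (k : ℕ) :
    Prop :=
  β ∉ R ∧ k ≤ (A.label β).length ∧
    ∃ u, A.Path Rᶜ p u (A.src β) ∧ w = u ++ (A.label β).take k

/-- As `Determines`, where the end point is either interior to `β`, or a state represented by a
transition `β` with empty label; a point of `β` may also be reached as a point of `β⁻¹`. -/
def LeadsTo (A : InvAut S) (R : Set A.T) (p : A.Q) (w : List (S × Bool)) (β : A.T) (k : ℕ) :
    Prop :=
  ((0 < k ∧ k < (A.label β).length) ∨ (A.label β = [] ∧ k = 0)) ∧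
    (A.Determines R p w β k ∨ A.Determines R p w (A.inv β) ((A.label β).length - k))

/-- For `α = (p, X, q)` and a pair `(i, j)`: the words `X[:i]` and `X⁻¹[:j]` determine paths from
`p` and `q`, not traversing `α` or `α⁻¹`, and `i + j ≤ |X|`. -/
def Readable (A : InvAut S) (α : A.T) (ij : ℕ × ℕ) : Prop :=
  (∃ β k, A.Determines {α, A.inv α} (A.src α) ((A.label α).take ij.1) β k) ∧
    (∃ γ l, A.Determines {α, A.inv α} (A.tgt α) ((A.label (A.inv α)).take ij.2) γ l) ∧
    ij.1 + ij.2 ≤ (A.label α).length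

/-- `middle i j X` is `X[i:-j]`. -/
def middle (i j : ℕ) (X : List (S × Bool)) : List (S × Bool) :=
  (X.take (X.length - j)).drop i

/-- Remove the transitions in `R` and their inverses, add two states `p' = Sum.inr false` and
`q' = Sum.inr true`, add the transitions `(s i, w i, e i)` and their inverses, and finally remove
the transitions with empty label and identify the corresponding states. -/
def replace (A : InvAut S) (R : Set A.T) (I : Type) [Finite I] (s e : I → A.Q ⊕ Bool)
    (w : I → List (S × Bool)) : InvAut S :=
  (((A.remove R).addStates Bool).addEdges I s e w).contract

/-- The map on states belonging to `replace`. -/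
def replaceMap (A : InvAut S) (R : Set A.T) (I : Type) [Finite I] (s e : I → A.Q ⊕ Bool)
    (w : I → List (S × Bool)) (x : A.Q) : (A.replace R I s e w).Q :=
  Quot.mk _ (Sum.inl x)

/-- Result of a transition fold in the case `β ≠ γ, γ⁻¹`: the new transitions are
`(r, Y[:k], p')`, `(p', Y[k:], s)`, `(t, Z[:l], q')`, `(q', Z[l:], u)`, `(p', X[i:-j], q')`, where
`β = (r, Y, s)` and `γ = (t, Z, u)`. -/
def foldSeparate (A : InvAut S) (α β γ : A.T) (i j k l : ℕ) :
    (B : InvAut S) × (A.Q → B.Q) :=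
  let R : Set A.T := {α, β, γ}
  let s : Fin 5 → A.Q ⊕ Bool :=
    ![.inl (A.src β), .inr false, .inl (A.src γ), .inr true, .inr false]
  let e : Fin 5 → A.Q ⊕ Bool :=
    ![.inr false, .inl (A.tgt β), .inr true, .inl (A.tgt γ), .inr true]
  let w : Fin 5 → List (S × Bool) :=
    ![(A.label β).take k, (A.label β).drop k, (A.label γ).take l, (A.label γ).drop l,
      middle i j (A.label α)]
  ⟨A.replace R (Fin 5) s e w, A.replaceMap R (Fin 5) s e w⟩

/-- Result of a transition fold in the case `β = γ`, `k < l`: the new transitions are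
`(r, Y[:k], p')`, `(p', Y[k:l], q')`, `(q', Y[l:], s)`, `(p', X[i:-j], q')`. -/
def foldSame (A : InvAut S) (α β : A.T) (i j k l : ℕ) : (B : InvAut S) × (A.Q → B.Q) :=
  let R : Set A.T := {α, β}
  let s : Fin 4 → A.Q ⊕ Bool := ![.inl (A.src β), .inr false, .inr true, .inr false]
  let e : Fin 4 → A.Q ⊕ Bool := ![.inr false, .inr true, .inl (A.tgt β), .inr true]
  let w : Fin 4 → List (S × Bool) :=
    ![(A.label β).take k, ((A.label β).take l).drop k, (A.label β).drop l,
      middle i j (A.label α)]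
  ⟨A.replace R (Fin 4) s e w, A.replaceMap R (Fin 4) s e w⟩

/-- Result of a transition fold in the case `β = γ`, `k = l`: the new transitions are
`(r, Y[:k], p')`, `(p', Y[k:], s)`, `(p', X[i:i+m], q')`, `(q', X[i+m:-j-m], q')`. -/
def foldPoint (A : InvAut S) (α β : A.T) (i j k m : ℕ) : (B : InvAut S) × (A.Q → B.Q) :=
  let R : Set A.T := {α, β}
  let s : Fin 4 → A.Q ⊕ Bool := ![.inl (A.src β), .inr false, .inr false, .inr true]
  let e : Fin 4 → A.Q ⊕ Bool := ![.inr false, .inl (A.tgt β), .inr true, .inr true]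
  let w : Fin 4 → List (S × Bool) :=
    ![(A.label β).take k, (A.label β).drop k, ((A.label α).take (i + m)).drop i,
      middle (i + m) (j + m) (A.label α)]
  ⟨A.replace R (Fin 4) s e w, A.replaceMap R (Fin 4) s e w⟩

/-- `X[i:i+m] = X⁻¹[j:j+m]`, where `X` is the label of `α` and `X[i+m:-j-m]` makes sense. -/
def Cancels (A : InvAut S) (α : A.T) (i j m : ℕ) : Prop :=
  i + j + 2 * m ≤ (A.label α).length ∧
    ((A.label α).take (i + m)).drop i = ((A.label (A.inv α)).take (j + m)).drop j

/-- The transition folds of `α = (p, X, q)`, in an automaton in which states are represented by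
transitions with empty label: `(i, j)` is a largest readable pair, and `X[:i]`, `X⁻¹[:j]` lead to
`β(k)`, `γ(l)`. -/
inductive Folds (A : InvAut S) (α : A.T) : (B : InvAut S) × (A.Q → B.Q) → Prop
  | separate (i j k l : ℕ) (β γ : A.T) (hij : Maximal (A.Readable α) (i, j))
      (hβ : A.LeadsTo {α, A.inv α} (A.src α) ((A.label α).take i) β k)
      (hγ : A.LeadsTo {α, A.inv α} (A.tgt α) ((A.label (A.inv α)).take j) γ l)
      (h : β ≠ γ) (h' : β ≠ A.inv γ) : A.Folds α (A.foldSeparate α β γ i j k l)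
  | same (i j k l : ℕ) (β : A.T) (hij : Maximal (A.Readable α) (i, j))
      (hβ : A.LeadsTo {α, A.inv α} (A.src α) ((A.label α).take i) β k)
      (hγ : A.LeadsTo {α, A.inv α} (A.tgt α) ((A.label (A.inv α)).take j) β l)
      (h : k < l) : A.Folds α (A.foldSame α β i j k l)
  | point (i j k m : ℕ) (β : A.T) (hij : Maximal (A.Readable α) (i, j))
      (hβ : A.LeadsTo {α, A.inv α} (A.src α) ((A.label α).take i) β k)
      (hγ : A.LeadsTo {α, A.inv α} (A.tgt α) ((A.label (A.inv α)).take j) β k)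
      (hm : Maximal (A.Cancels α i j) m) : A.Folds α (A.foldPoint α β i j k m)

/-- `B` is obtained from `A` by folding `α`, and `ρ` is the induced map on states. -/
def FoldsTo (A : InvAut S) (α : A.T) (B : InvAut S) (ρ : A.Q → B.Q) : Prop :=
  A.withTrivial.Folds (Sum.inl α) ⟨B, ρ⟩

end InvAut

namespace InvCNFA

variable {S : Type u}

/-! ### The conversion algorithm -/

/-- For `α = (p, X, q)`: remove `α` and `α⁻¹`, and make `p` and `q` final. -/
def cut (A : InvCNFA S) (α : A.T) : InvCNFA S where
  toInvAut := (A.toInvAut.remove {α}).withFinal (A.F ∪ {A.src α, A.tgt α})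
  comp :=
    { slp := A.comp.slp
      lab := fun t => A.comp.lab t.1
      eval_lab := fun t => A.comp.eval_lab t.1 }

/-- Add the transition `(p, X, q)` and its inverse, and replace the set of final states by `F`. -/
def restore (A : InvCNFA S) (p q : A.Q) (X : List (S × Bool)) (F : Set A.Q) : InvAut S :=
  (A.toInvAut.addEdges Unit (fun _ => p) (fun _ => q) (fun _ => X)).withFinal F

/-- The label of `α` has maximal length among the labels of all transitions. -/
def Longest (A : InvCNFA S) (α : A.T) : Prop :=
  ∀ t, (A.label t).length ≤ (A.label α).length

/-- `FoldBack A α A₂ ρ C σ`: here `A₂` is the automaton into which `A.cut α` was converted, and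
`ρ` is the induced map on states. Put `α` and `α⁻¹` back, the final states being the images of
those of `A`, fold `α`, and make the result minimalistic; the outcome is `C`, and `σ` is the
resulting partial map from the states of `A`. The straight-line programs which encode the new
labels may be chosen arbitrarily. -/
inductive FoldBack (A : InvCNFA S) (α : A.T) (A₂ : InvCNFA S) (ρ : A.Q → Option A₂.Q) :
    (C : InvCNFA S) → (A.Q → Option C.Q) → Prop
  | mk (p q : A₂.Q) (hp : ρ (A.src α) = some p) (hq : ρ (A.tgt α) = some q)
      (D : InvCNFA S) (τ : A₂.Q → D.Q)
      (hD : (A₂.restore p q (A.label α) {y | ∃ x ∈ A.F, ρ x = some y}).FoldsTo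
        (Sum.inr ((), true)) D.toInvAut τ)
      (C : InvCNFA S) (κ : D.Q → Option C.Q) (hC : D.toInvAut.Minimalizes C.toInvAut κ) :
      FoldBack A α A₂ ρ C (fun x => (ρ x).bind fun y => κ (τ y))

/-- The two kinds of tasks of the algorithm. -/
inductive Task
  /-- convert, unless the automaton is a CDFA already -/
  | ensure
  /-- iterate, starting from a minimalistic automaton: choose a longest transition, ensure that
  the rest is a CDFA, and fold, until a CDFA is obtained -/
  | loop

/-- `Run task A B ρ N`: the task, started with `A`, can end with output `B` after exactly `N`
transition folds, those in recursive calls included; `ρ` is the induced partial map on states. -/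
inductive Run : Task → (A B : InvCNFA S) → (A.Q → Option B.Q) → ℕ → Prop
  | skip (A : InvCNFA S) (h : A.IsCDFA) : Run .ensure A A some 0
  | call (A A₀ B : InvCNFA S) (ρ : A.Q → Option A₀.Q) (σ : A₀.Q → Option B.Q) (N : ℕ)
      (h : ¬ A.IsCDFA) (hm : A.toInvAut.Minimalizes A₀.toInvAut ρ) (hr : Run .loop A₀ B σ N) :
      Run .ensure A B (fun x => (ρ x).bind σ) N
  | trivial (A : InvCNFA S) (h : IsEmpty A.T) : Run .loop A A some 0
  | finish (A A₂ C : InvCNFA S) (α : A.T) (ρ : A.Q → Option A₂.Q) (σ : A.Q → Option C.Q) (N : ℕ)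
      (hα : A.Longest α) (hr : Run .ensure (A.cut α) A₂ ρ N) (hf : FoldBack A α A₂ ρ C σ)
      (h : C.IsCDFA) : Run .loop A C σ (N + 1)
  | next (A A₂ C B : InvCNFA S) (α : A.T) (ρ : A.Q → Option A₂.Q) (σ : A.Q → Option C.Q)
      (τ : C.Q → Option B.Q) (N M : ℕ)
      (hα : A.Longest α) (hr : Run .ensure (A.cut α) A₂ ρ N) (hf : FoldBack A α A₂ ρ C σ)
      (h : ¬ C.IsCDFA) (hn : Run .loop C B τ M) :
      Run .loop A B (fun x => (σ x).bind τ) (N + 1 + M)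

/-- The algorithm, applied to `A`, can output `B` after exactly `N` transition folds. -/
def Converts (A B : InvCNFA S) (N : ℕ) : Prop :=
  ∃ (A₀ : InvCNFA S) (ρ : A.Q → Option A₀.Q) (σ : A₀.Q → Option B.Q),
    A.toInvAut.Minimalizes A₀.toInvAut ρ ∧ Run .loop A₀ B σ N

/-- `Next C A`: while it iterates on `A`, the algorithm can come to iterate on `C`, in a recursive
call or as the next iteration. -/
inductive Next : InvCNFA S → InvCNFA S → Prop
  | call (A C : InvCNFA S) (α : A.T) (ρ : A.Q → Option C.Q) (hα : A.Longest α)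
      (h : ¬ (A.cut α).IsCDFA) (hm : (A.cut α).toInvAut.Minimalizes C.toInvAut ρ) : Next C A
  | iterate (A A₂ C : InvCNFA S) (α : A.T) (ρ : A.Q → Option A₂.Q) (σ : A.Q → Option C.Q)
      (N : ℕ) (hα : A.Longest α) (hr : Run .ensure (A.cut α) A₂ ρ N)
      (hf : FoldBack A α A₂ ρ C σ) (h : ¬ C.IsCDFA) : Next C A

/-- Whatever choices are made, the algorithm does not run forever on `A` and does not get stuck:
it can produce an output; there is no infinite chain of iterations and recursive calls; and in
every iteration that can occur, for each choice of a longest transition `α`, the remaining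
automaton can be converted, and for each outcome of this `α` can be folded back. -/
def Halts (A : InvCNFA S) : Prop :=
  (∃ (B : InvCNFA S) (N : ℕ), A.Converts B N) ∧
    ∀ (A₀ : InvCNFA S) (ρ : A.Q → Option A₀.Q), A.toInvAut.Minimalizes A₀.toInvAut ρ →
      Acc Next A₀ ∧
        ∀ C, Relation.ReflTransGen (fun X Y => Next Y X) A₀ C →
          ∀ α : C.T, C.Longest α →
            (∃ (A₂ : InvCNFA S) (σ : C.Q → Option A₂.Q) (N : ℕ),
              Run .ensure (C.cut α) A₂ σ N) ∧
            ∀ (A₂ : InvCNFA S) (σ : C.Q → Option A₂.Q) (N : ℕ),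
              Run .ensure (C.cut α) A₂ σ N →
                ∃ (D : InvCNFA S) (τ : C.Q → Option D.Q), FoldBack C α A₂ σ D τ

end InvCNFA

/-! ### Finite sums -/

/-! The algorithm is Stallings folding with long labels. The proof rests on one invariant
(connections), one decreasing measure (total label length) and two weighted Euler characteristics.

Correctness. Two states are connected by `g` in the free group if some path between them has a label
representing `g` (`Conn`). As transitions have inverses, the connections form a groupoid, and π(L)
is read off from it. Making an automaton minimalistic, folding, and the composite of cutting α,
converting the rest and putting α back all induce partial maps on states which are defined on the
initial and the final states and which preserve and reflect connections (`ConnPres`). The ends of a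
cut transition become final exactly so that they survive the recursive call. Reachability from the
initial state is not inherited by the rest; the weaker property `Anchored`, that every state is
connected with an initial or final one (a mark), is.

Termination. If a fold leaves a piece of α over, maximality of the pair `(i, j)` makes the result
deterministic. Hence the algorithm goes on only when α has been absorbed completely (`full`), and
then the total label length has dropped by twice the length of α. A recursive call loses as much by
omitting α, so both kinds of successors are smaller (`Next.step`).

Number of folds. For a union of components write E for half the number of transitions, V for the
number of states and m for the number of marks. None of the maps above increases E − V or m. `Bnd A
l κ` says that 3(E − V) + m ≤ l and 3(E − V) + 2m ≤ κ on all unions of components. In a minimalistic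
automaton unmarked states have at least three outgoing transitions, whence E ≤ κ. So a longest label
has at least 1/κ of the size (half the total length), and passing to a successor lowers the
logarithm of the size by at least 1/(κ − 1/2) (`lg_add_le`). Call α final if removing it isolates
one of its ends. Cutting a final α keeps both bounds (`FinalEdge.bndOn`), and the iteration stops
after its fold. Cutting any other α removes an edge and creates at most two marks: l drops by one, κ
grows by one (`bndOn_cutAut_one`, `bndOn_cutAut_two`). At l = 0 every transition is final and fewer
than κ folds occur (`Cost.add_one_le`).

Let Φ_l(y) bound the number of folds plus one at level l, where y = log(size/2), sizes below two
being treated as two. By `Cost.level_step` it suffices that Φ_{l-1}(y) + Φ_l(y) ≤ Φ_l(y + 1/(κ −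
1/2)). The start is l = k, κ = 2k, and l + κ = 3k at all levels. The functions 3k·C(3k−1, l)·(y +
log 2)^l satisfy the recursion (`Cost.le_level`), and for l = k the coefficient is 2k·C(3k, k) ≤
(2k)^k if k ≥ 4. For k = 1, 2, 3 this is too weak; there the lowest relevant levels (1, 2), (1, 5),
(1, 8) are analysed by hand (`Cost.le_one_two`, `Cost.le_of_subStar`, `Cost.le_of_one_eight`).
Finally, reachability makes the first minimalistic automaton connected, and its parameter `rank` is
at most k(A). -/

theorem finsum_sum_type {α β : Type*} [Finite α] [Finite β] (f : α ⊕ β → ℕ) :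
    ∑ᶠ x, f x = ∑ᶠ a, f (Sum.inl a) + ∑ᶠ b, f (Sum.inr b) := by
  classical
  have := Fintype.ofFinite α
  have := Fintype.ofFinite β
  simp only [finsum_eq_sum_of_fintype, Fintype.sum_sum_type]

theorem finsum_subtype_add_compl {α : Type*} [Finite α] (P : α → Prop) (f : α → ℕ) :
    ∑ᶠ a, f a = ∑ᶠ a : {a // P a}, f a + ∑ᶠ a : {a // ¬ P a}, f a := by
  classical
  have := Fintype.ofFinite α
  simp only [finsum_eq_sum_of_fintype]
  exact (Fintype.sum_subtype_add_sum_subtype P f).symm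

theorem sum_le_finsum_of_injective {α ι : Type*} [Finite α] [Fintype ι] (f : α → ℕ) (g : ι → α)
    (hg : Function.Injective g) : ∑ i, f (g i) ≤ ∑ᶠ a, f a := by
  classical
  have := Fintype.ofFinite α
  rw [finsum_eq_sum_of_fintype, ← Finset.sum_image (f := f) (s := Finset.univ) (g := g)
    (fun a _ b _ h => hg h)]
  exact Finset.sum_le_sum_of_subset (Finset.subset_univ _)

theorem sum_eq_finsum_of_injective {α ι : Type*} [Finite α] [Fintype ι] (f : α → ℕ) (g : ι → α)
    (hg : Function.Injective g) (h : ∀ a, f a ≠ 0 → ∃ i, g i = a) :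
    ∑ i, f (g i) = ∑ᶠ a, f a := by
  classical
  have := Fintype.ofFinite α
  rw [finsum_eq_sum_of_fintype, ← Finset.sum_image (f := f) (s := Finset.univ) (g := g)
    (fun a _ b _ h => hg h)]
  apply Finset.sum_subset (Finset.subset_univ _)
  intro a _ ha
  by_contra h0
  obtain ⟨i, hi⟩ := h a h0
  exact ha (Finset.mem_image.2 ⟨i, Finset.mem_univ _, hi⟩)

theorem finsum_subtype_add_le {α ι : Type*} [Finite α] [Fintype ι] (P : α → Prop) (f : α → ℕ)
    (g : ι → α) (hg : Function.Injective g) (hP : ∀ i, ¬ P (g i)) :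
    ∑ᶠ a : {a // P a}, f a + ∑ i, f (g i) ≤ ∑ᶠ a, f a := by
  rw [finsum_subtype_add_compl P f]
  apply Nat.add_le_add_left
  exact sum_le_finsum_of_injective (fun a : {a // ¬ P a} => f a) (fun i => ⟨g i, hP i⟩)
    (fun a b h => hg (congrArg Subtype.val h))

theorem finsum_subtype_add_eq {α ι : Type*} [Finite α] [Fintype ι] (P : α → Prop) (f : α → ℕ)
    (g : ι → α) (hg : Function.Injective g) (hP : ∀ i, ¬ P (g i))
    (h : ∀ a, ¬ P a → f a ≠ 0 → ∃ i, g i = a) :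
    ∑ᶠ a : {a // P a}, f a + ∑ i, f (g i) = ∑ᶠ a, f a := by
  rw [finsum_subtype_add_compl P f]
  congr 1
  refine sum_eq_finsum_of_injective (fun a : {a // ¬ P a} => f a) (fun i => ⟨g i, hP i⟩)
    (fun a b h => hg (congrArg Subtype.val h)) ?_
  rintro ⟨a, ha⟩ h0
  obtain ⟨i, hi⟩ := h a ha h0
  exact ⟨i, Subtype.ext hi⟩

theorem finsum_subtype_le {α : Type*} [Finite α] (P : α → Prop) (f : α → ℕ) :
    ∑ᶠ a : {a // P a}, f a ≤ ∑ᶠ a, f a := by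
  rw [finsum_subtype_add_compl P f]
  exact Nat.le_add_right _ _

theorem finsum_mono_nat {α : Type*} [Finite α] {f g : α → ℕ} (h : ∀ a, f a ≤ g a) :
    ∑ᶠ a, f a ≤ ∑ᶠ a, g a := by
  have := Fintype.ofFinite α
  simp only [finsum_eq_sum_of_fintype]
  exact Finset.sum_le_sum fun a _ => h a

theorem finsum_add_nat {α : Type*} [Finite α] (f g : α → ℕ) :
    ∑ᶠ a, (f a + g a) = ∑ᶠ a, f a + ∑ᶠ a, g a := by
  have := Fintype.ofFinite α
  simp only [finsum_eq_sum_of_fintype]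
  exact Finset.sum_add_distrib

theorem le_finsum_nat {α : Type*} [Finite α] (f : α → ℕ) (a : α) : f a ≤ ∑ᶠ a, f a := by
  have := Fintype.ofFinite α
  simp only [finsum_eq_sum_of_fintype]
  exact Finset.single_le_sum (f := f) (fun _ _ => Nat.zero_le _) (Finset.mem_univ a)

namespace InvAut

variable {S : Type u}

instance (A : InvAut S) : Finite A.Q := A.finite_Q

instance (A : InvAut S) : Finite A.T := A.finite_T

/-! ### Connections -/

/-- `A.Conn p g q`: the element `g` of the free group is represented by the label of a path
from `p` to `q`. -/
inductive Conn (A : InvAut S) : A.Q → FreeGroup S → A.Q → Prop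
  | nil (p : A.Q) : A.Conn p 1 p
  | cons (t : A.T) (g : FreeGroup S) (q : A.Q) (h : A.Conn (A.tgt t) g q) :
      A.Conn (A.src t) (FreeGroup.mk (A.label t) * g) q

theorem Conn.trans {A : InvAut S} {p q r : A.Q} {g h : FreeGroup S} (h₁ : A.Conn p g q)
    (h₂ : A.Conn q h r) : A.Conn p (g * h) r := by
  induction h₁ with
  | nil p => simpa using h₂
  | cons t g q _ ih => rw [mul_assoc]; exact .cons t _ _ (ih h₂)

theorem Conn.single {A : InvAut S} (t : A.T) :
    A.Conn (A.src t) (FreeGroup.mk (A.label t)) (A.tgt t) := by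
  simpa using Conn.cons t 1 _ (.nil _)

theorem mk_label_inv (A : InvAut S) (t : A.T) :
    FreeGroup.mk (A.label (A.inv t)) = (FreeGroup.mk (A.label t))⁻¹ := by
  rw [A.label_inv, FreeGroup.inv_mk]

theorem Conn.symm {A : InvAut S} {p q : A.Q} {g : FreeGroup S} (h : A.Conn p g q) :
    A.Conn q g⁻¹ p := by
  induction h with
  | nil p => simpa using Conn.nil p
  | cons t g q _ ih =>
    rw [mul_inv_rev, ← A.mk_label_inv]
    apply ih.trans
    have := Conn.single (A.inv t)
    rwa [A.src_inv, A.tgt_inv] at this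

theorem Conn.of_path {A : InvAut S} {K : Set A.T} {p q : A.Q} {w : List (S × Bool)}
    (h : A.Path K p w q) : A.Conn p (FreeGroup.mk w) q := by
  induction h with
  | nil p => exact .nil p
  | cons t ht w q _ ih => rw [← FreeGroup.mul_mk]; exact .cons t _ _ ih

theorem Conn.exists_path {A : InvAut S} {p q : A.Q} {g : FreeGroup S} (h : A.Conn p g q) :
    ∃ w, A.Path Set.univ p w q ∧ FreeGroup.mk w = g := by
  induction h with
  | nil p => exact ⟨[], .nil p, rfl⟩
  | cons t g q _ ih =>
    obtain ⟨w, hw, rfl⟩ := ih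
    exact ⟨_, .cons t (Set.mem_univ t) w q hw, FreeGroup.mul_mk.symm⟩

theorem groupLang_eq (A : InvAut S) : A.groupLang = {g | ∃ q ∈ A.F, A.Conn A.q0 g q} := by
  ext g
  constructor
  · rintro ⟨w, ⟨q, hq, h⟩, rfl⟩
    exact ⟨q, hq, Conn.of_path h⟩
  · rintro ⟨q, hq, h⟩
    obtain ⟨w, hw, rfl⟩ := h.exists_path
    exact ⟨w, ⟨q, hq, hw⟩, rfl⟩

/-- Connections are transported along maps of states with offsets in the free group. -/
theorem Conn.map {A B : InvAut S} (b : A.Q → B.Q) (o : A.Q → FreeGroup S)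
    (hbo : ∀ t, B.Conn (b (A.src t))
      (o (A.src t) * FreeGroup.mk (A.label t) * (o (A.tgt t))⁻¹) (b (A.tgt t)))
    {p q : A.Q} {g : FreeGroup S} (h : A.Conn p g q) :
    B.Conn (b p) (o p * g * (o q)⁻¹) (b q) := by
  induction h with
  | nil p => simpa using Conn.nil (b p)
  | cons t g q _ ih =>
    have := (hbo t).trans ih
    simpa [mul_assoc] using this

theorem Conn.map' {A B : InvAut S} (b : A.Q → B.Q)
    (hb : ∀ t, B.Conn (b (A.src t)) (FreeGroup.mk (A.label t)) (b (A.tgt t)))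
    {p q : A.Q} {g : FreeGroup S} (h : A.Conn p g q) : B.Conn (b p) g (b q) := by
  simpa using Conn.map b (fun _ => 1) (by simpa using hb) h

/-- Every state is connected with the initial state or a final state. -/
def marks (A : InvAut S) : Set A.Q := A.F ∪ {A.q0}

/-- Takes the place of reachability from the initial state, which is lost when a transition is cut.
This property persists because the ends of the cut transition become final. -/
def Anchored (A : InvAut S) : Prop := ∀ x, ∃ g, ∃ y ∈ A.marks, A.Conn x g y

theorem anchored_of_accessible {A : InvAut S} (h : A.Accessible) : A.Anchored := by
  intro x
  obtain ⟨w, hw⟩ := h x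
  exact ⟨_, A.q0, Or.inr rfl, (Conn.of_path hw).symm⟩

theorem Conn.eq_of_outgoing_empty {A : InvAut S} {p q : A.Q} {g : FreeGroup S}
    (h : A.Conn p g q) (hp : A.outgoing p = ∅) : p = q := by
  cases h with
  | nil => rfl
  | cons t g q h =>
    exact absurd (show t ∈ A.outgoing (A.src t) from rfl) (by rw [hp]; exact Set.notMem_empty _)

/-! ### Saturated sets of states -/

/-- Since transitions have inverses, these are the unions of connected components. All counts below
are made on such sets, so that bounds can be applied to single components. -/
def Saturated (A : InvAut S) (h : Set A.Q) : Prop := ∀ t, A.src t ∈ h → A.tgt t ∈ h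

theorem Saturated.conn {A : InvAut S} {h : Set A.Q} (hh : A.Saturated h) {p q : A.Q}
    {g : FreeGroup S} (hc : A.Conn p g q) : p ∈ h ↔ q ∈ h := by
  induction hc with
  | nil => rfl
  | cons t g q _ ih =>
    rw [← ih]
    refine ⟨hh t, fun ht => ?_⟩
    have := hh (A.inv t)
    rw [A.src_inv, A.tgt_inv] at this
    exact this ht

theorem Saturated.src_iff_tgt {A : InvAut S} {h : Set A.Q} (hh : A.Saturated h) (t : A.T) :
    A.src t ∈ h ↔ A.tgt t ∈ h := hh.conn (.single t)

theorem saturated_univ (A : InvAut S) : A.Saturated Set.univ := fun _ _ => trivial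

theorem Saturated.inter {A : InvAut S} {h h' : Set A.Q} (hh : A.Saturated h)
    (hh' : A.Saturated h') : A.Saturated (h ∩ h') := fun t ht => ⟨hh t ht.1, hh' t ht.2⟩

/-- The states connected with `x`. -/
def component (A : InvAut S) (x : A.Q) : Set A.Q := {y | ∃ g, A.Conn x g y}

theorem mem_component_self (A : InvAut S) (x : A.Q) : x ∈ A.component x := ⟨1, .nil x⟩

theorem saturated_component (A : InvAut S) (x : A.Q) : A.Saturated (A.component x) := by
  rintro t ⟨g, hg⟩
  exact ⟨_, hg.trans (.single t)⟩

open Classical in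
/-- The sum of a weight of labels over the transitions between states in `h`. -/
noncomputable def wt (A : InvAut S) (h : Set A.Q) (φ : List (S × Bool) → ℕ) : ℕ :=
  ∑ᶠ t : A.T, if A.src t ∈ h then φ (A.label t) else 0

/-- The number of transitions between states in `h`. -/
noncomputable def tc (A : InvAut S) (h : Set A.Q) : ℕ := A.wt h fun _ => 1

/-- The total length of the labels of transitions between states in `h`. -/
noncomputable def ls (A : InvAut S) (h : Set A.Q) : ℕ := A.wt h List.length

/-- The number of marked states in `h`. -/
noncomputable def mc (A : InvAut S) (h : Set A.Q) : ℕ := (h ∩ A.marks).ncard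

theorem tc_eq_ncard (A : InvAut S) (h : Set A.Q) : A.tc h = {t | A.src t ∈ h}.ncard := by
  classical
  have := Fintype.ofFinite A.T
  rw [tc, wt, finsum_eq_sum_of_fintype, Finset.sum_boole, Set.ncard_eq_toFinset_card']
  simp

theorem tc_univ (A : InvAut S) : A.tc Set.univ = Nat.card A.T := by
  rw [tc_eq_ncard, ← Set.ncard_univ]; rfl

theorem wt_inter_add_diff (A : InvAut S) (h k : Set A.Q) (φ : List (S × Bool) → ℕ) :
    A.wt (h ∩ k) φ + A.wt (h \ k) φ = A.wt h φ := by
  classical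
  rw [wt, wt, wt, ← finsum_add_nat]
  congr 1; funext t
  by_cases h1 : A.src t ∈ h <;> by_cases h2 : A.src t ∈ k <;> simp [h1, h2]

theorem mc_inter_add_diff (A : InvAut S) (h k : Set A.Q) :
    A.mc (h ∩ k) + A.mc (h \ k) = A.mc h := by
  unfold mc
  rw [← Set.ncard_inter_add_ncard_sdiff_eq_ncard (h ∩ A.marks) k (Set.toFinite _)]
  congr 2 <;> ext x <;> simp only [Set.mem_inter_iff, Set.mem_sdiff] <;> tauto

theorem ncard_outgoing_eq (A : InvAut S) (q : A.Q) :
    (A.incoming q).ncard = (A.outgoing q).ncard := by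
  apply Set.ncard_congr (fun t _ => A.inv t)
  · intro t ht; exact (A.src_inv t).trans ht
  · intro s t _ _ h; rw [← A.inv_inv s, ← A.inv_inv t, h]
  · intro t ht; exact ⟨A.inv t, (A.tgt_inv t).trans ht, A.inv_inv t⟩

theorem inv_injective (A : InvAut S) : Function.Injective A.inv := fun s t h => by
  rw [← A.inv_inv s, ← A.inv_inv t, h]

/-! ### Counting the states which are reached from a set of roots -/

/-- Reachability of a root in a given number of steps. -/
def RootIn (A : InvAut S) (J : Set A.T) (root : Set A.Q) : ℕ → A.Q → Prop
  | 0, x => x ∈ root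
  | n + 1, x => ∃ t ∈ J, A.src t = x ∧ A.RootIn J root n (A.tgt t)

/-- A spanning forest: each non-root selects the first transition, within `J`, of a shortest path to
a root. The distance drops along it, so no selected transition is the inverse of another, and the
selected ones together with their inverses are pairwise distinct. -/
theorem two_mul_ncard_diff_roots_le (A : InvAut S) (J : Set A.T) (root c : Set A.Q)
    (hJ : ∀ t ∈ J, A.inv t ∈ J) (hc : A.Saturated c)
    (hroot : ∀ x ∈ c, ∃ n, A.RootIn J root n x) :
    2 * (c \ root).ncard ≤ {t | t ∈ J ∧ A.src t ∈ c}.ncard := by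
  classical
  -- The target of `t` reaches a root in `m` steps, whereas `x` does not in `m` or fewer; the
  -- alternative `False` is void.
  have key : ∀ x : (c \ root : Set A.Q), ∃ t ∈ J, A.src t = x ∧
      ∀ n, A.RootIn J root n (A.tgt t) → False ∨ ∃ m, A.RootIn J root m (A.tgt t) ∧
        ∀ k ≤ m, ¬ A.RootIn J root k x := by
    rintro ⟨x, hx, hxr⟩
    have hn := Nat.find_spec (hroot x hx)
    have hmin := fun k => Nat.find_min (hroot x hx) (m := k)
    revert hn hmin
    rcases Nat.find (hroot x hx) with _ | n
    · intro hn; exact absurd hn hxr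
    · rintro ⟨t, ht, hs, hn⟩ hmin
      exact ⟨t, ht, hs, fun _ _ => Or.inr ⟨n, hn, fun k hk => hmin k (by omega)⟩⟩
  choose f hfJ hfs hf using key
  -- If two choices were mutually inverse, each of the two states would be strictly nearer to the
  -- roots than the other.
  have hdist : ∀ x y, A.inv (f x) ≠ f y := by
    intro x y h
    have hxy : A.tgt (f x) = y := by rw [← A.src_inv, h, hfs]
    have hyx : A.tgt (f y) = x := by rw [← h, A.tgt_inv, hfs]
    obtain ⟨n, hn⟩ := hroot y y.2.1
    obtain ⟨n', hn'⟩ := hroot x x.2.1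
    rcases hf x n (by rw [hxy]; exact hn) with h | ⟨m, hm, hm'⟩
    · exact h
    rcases hf y n' (by rw [hyx]; exact hn') with h | ⟨k, hk, hk'⟩
    · exact h
    rw [hxy] at hm
    rw [hyx] at hk
    have h1 : k < m ∨ m ≤ k := lt_or_ge k m
    rcases h1 with h1 | h1
    · exact hm' k h1.le hk
    · exact hk' m h1 hm
  have hinj : Function.Injective (fun z : (c \ root : Set A.Q) × Bool =>
      if z.2 then f z.1 else A.inv (f z.1)) := by
    have h0 : ∀ x y, f x = f y → x = y := fun x y h => by
      apply Subtype.ext; rw [← hfs x, ← hfs y, h]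
    rintro ⟨x, _ | _⟩ ⟨y, _ | _⟩ h
    · simp only [Bool.false_eq_true, if_false] at h
      rw [h0 x y (A.inv_injective h)]
    · simp only [Bool.false_eq_true, if_false, if_true] at h
      exact absurd h (hdist x y)
    · simp only [Bool.false_eq_true, if_false, if_true] at h
      exact absurd h.symm (hdist y x)
    · simp only [if_true] at h
      rw [h0 x y h]
  have hcard : 2 * (c \ root).ncard = Nat.card ((c \ root : Set A.Q) × Bool) := by
    rw [Nat.card_prod, Nat.card_coe_set_eq]; simp [mul_comm]
  rw [hcard, ← Set.ncard_univ, ← Set.ncard_image_of_injective _ hinj]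
  apply Set.ncard_le_ncard _ (Set.toFinite _)
  rintro _ ⟨⟨x, b⟩, -, rfl⟩
  cases b
  · simp only [Bool.false_eq_true, if_false]
    exact ⟨hJ _ (hfJ x), by rw [A.src_inv]; exact hc _ (by rw [hfs]; exact x.2.1)⟩
  · simp only [if_true]
    exact ⟨hfJ x, by rw [hfs]; exact x.2.1⟩

end InvAut

/-! ### Reduced words -/

namespace FreeGroup

theorem IsReduced.invRev' {S : Type*} {w : List (S × Bool)} (h : IsReduced w) :
    IsReduced (invRev w) := by
  classical
  rw [isReduced_iff_reduce_eq] at h ⊢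
  rw [reduce_invRev, h]

theorem getLast?_invRev {S : Type*} (w : List (S × Bool)) :
    (invRev w).getLast? = w.head?.map fun a => (a.1, !a.2) := by
  simp [invRev]

theorem head?_invRev {S : Type*} (w : List (S × Bool)) :
    (invRev w).head? = w.getLast?.map fun a => (a.1, !a.2) := by
  simp [invRev]

theorem isReduced_append_iff {S : Type*} {v w : List (S × Bool)} :
    IsReduced (v ++ w) ↔ IsReduced v ∧ IsReduced w ∧
      ∀ a ∈ v.getLast?, ∀ b ∈ w.head?, b ≠ (a.1, !a.2) := by
  rw [IsReduced, List.isChain_append]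
  refine and_congr Iff.rfl (and_congr Iff.rfl (forall₄_congr ?_))
  rintro ⟨a, x⟩ - ⟨b, y⟩ -
  simp only [ne_eq, Prod.mk.injEq, not_and]
  constructor
  · rintro h rfl; have := h rfl; subst this; cases x <;> simp
  · rintro h rfl; have := h rfl; revert this; cases x <;> cases y <;> simp

theorem isReduced_invRev_append {S : Type*} {v w : List (S × Bool)} (hv : IsReduced v)
    (hw : IsReduced w) (h : v.head? ≠ w.head?) : IsReduced (invRev v ++ w) := by
  rw [isReduced_append_iff]
  refine ⟨hv.invRev', hw, fun a ha b hb => ?_⟩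
  rw [getLast?_invRev] at ha
  rcases hv' : v.head? with _ | c
  · simp [hv'] at ha
  · simp only [hv', Option.map_some, Option.mem_def, Option.some.injEq] at ha
    subst ha
    rintro rfl
    rw [hv', Option.mem_def.1 hb] at h
    simp at h

/-- A word equal to its formal inverse represents an element with trivial square, and free groups
are torsion-free. Consequently no transition of a minimalistic automaton is its own inverse. -/
theorem IsReduced.invRev_ne {S : Type*} {w : List (S × Bool)} (h : IsReduced w) (hw : w ≠ []) :
    invRev w ≠ w := by
  intro e
  have h1 : (mk w) * (mk w) = 1 := by
    nth_rw 1 [← e]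
    rw [← inv_mk, inv_mul_cancel]
  have h2 : mk w = 1 := by
    rw [← pow_two] at h1
    by_contra h3
    exact (pow_left_injective (M := FreeGroup S) (n := 2) two_ne_zero).ne h3 (by simpa using h1)
  classical
  have h3 : reduce w = [] := by rw [← toWord_mk, h2, toWord_one]
  rw [h.reduce_eq] at h3
  exact hw h3

end FreeGroup

namespace InvAut

variable {S : Type u}

/-! ### Maps between automata which preserve the connections -/

def Corr {A B : InvAut S} (ρ : A.Q → Option B.Q) (h : Set A.Q) (h' : Set B.Q) : Prop :=
  ∀ x y, ρ x = some y → (x ∈ h ↔ y ∈ h')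

/-- The part of the behaviour of a partial map on states which concerns connections. -/
structure ConnPres (A B : InvAut S) (ρ : A.Q → Option B.Q) : Prop where
  init : ρ A.q0 = some B.q0
  surv : ∀ x ∈ A.F, ∃ y, ρ x = some y
  final : B.F = {y | ∃ x ∈ A.F, ρ x = some y}
  conn : ∀ {x x' : A.Q} {y y' : B.Q} {g : FreeGroup S}, ρ x = some y → ρ x' = some y' →
    (A.Conn x g x' ↔ B.Conn y g y')
  isol : ∀ x y, ρ x = some y → A.outgoing x = ∅ → B.outgoing y = ∅
  anch : B.Anchored

/-- A partial map on states which preserves connections and does not increase the complexity of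
saturated sets. -/
structure Pres (A B : InvAut S) (ρ : A.Q → Option B.Q) : Prop extends ConnPres A B ρ where
  -- Twice the difference of edges and states does not grow; the inequality is arranged so that no
  -- natural number is subtracted.
  mono : ∀ h, A.Saturated h → ∃ h', B.Saturated h' ∧ Corr ρ h h' ∧
    B.tc h' + 2 * h.ncard ≤ A.tc h + 2 * h'.ncard ∧ B.ls h' ≤ A.ls h

theorem ConnPres.marks {A B : InvAut S} {ρ : A.Q → Option B.Q} (P : ConnPres A B ρ) (y : B.Q) :
    y ∈ B.marks ↔ ∃ x ∈ A.marks, ρ x = some y := by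
  constructor
  · rintro (hy | rfl)
    · rw [P.final] at hy
      obtain ⟨x, hx, h⟩ := hy
      exact ⟨x, Or.inl hx, h⟩
    · exact ⟨A.q0, Or.inr rfl, P.init⟩
  · rintro ⟨x, hx | rfl, h⟩
    · left; rw [P.final]; exact ⟨x, hx, h⟩
    · right; have := P.init; rw [h] at this; simpa using this

theorem ConnPres.mark_surv {A B : InvAut S} {ρ : A.Q → Option B.Q} (P : ConnPres A B ρ) {x : A.Q}
    (hx : x ∈ A.marks) : ∃ y ∈ B.marks, ρ x = some y := by
  have : ∃ y, ρ x = some y := by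
    rcases hx with hx | rfl
    · exact P.surv x hx
    · exact ⟨_, P.init⟩
  obtain ⟨y, hy⟩ := this
  exact ⟨y, (P.marks y).2 ⟨x, hx, hy⟩, hy⟩

/-- A saturated set of states is determined by the marked states in it. -/
theorem Saturated.eq_of_marks {B : InvAut S} (hB : B.Anchored) {h h' : Set B.Q}
    (hh : B.Saturated h) (hh' : B.Saturated h') (H : ∀ y ∈ B.marks, y ∈ h ↔ y ∈ h') : h = h' := by
  ext x
  obtain ⟨g, y, hy, hc⟩ := hB x
  rw [hh.conn hc, hh'.conn hc, H y hy]

/-- Each mark of `B` is the image of a mark of `A`, and in an anchored automaton a saturated set is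
determined by its marks. -/
theorem ConnPres.corr_unique {A B : InvAut S} {ρ : A.Q → Option B.Q} (P : ConnPres A B ρ)
    {h : Set A.Q} {h₁ h₂ : Set B.Q} (s₁ : B.Saturated h₁) (s₂ : B.Saturated h₂)
    (c₁ : Corr ρ h h₁) (c₂ : Corr ρ h h₂) : h₁ = h₂ := by
  apply s₁.eq_of_marks P.anch s₂
  intro y hy
  obtain ⟨x, -, hx⟩ := (P.marks y).1 hy
  rw [← c₁ x y hx, c₂ x y hx]

/-- Marks always survive, so they decide: a state is taken if it is connected with a mark whose
image lies in `h'`. -/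
theorem ConnPres.exists_pullback {A B : InvAut S} {ρ : A.Q → Option B.Q} (P : ConnPres A B ρ)
    (hA : A.Anchored) {h' : Set B.Q} (s' : B.Saturated h') :
    ∃ h, A.Saturated h ∧ Corr ρ h h' := by
  refine ⟨{x | ∃ m ∈ A.marks, ∃ y ∈ h', ρ m = some y ∧ ∃ g, A.Conn x g m}, ?_, ?_⟩
  · rintro t ⟨m, hm, y, hy, hρ, g, hc⟩
    exact ⟨m, hm, y, hy, hρ, _, (Conn.single t).symm.trans hc⟩
  · intro x y hxy
    constructor
    · rintro ⟨m, hm, y', hy', hρ, g, hc⟩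
      exact (s'.conn ((P.conn hxy hρ).1 hc)).2 hy'
    · intro hy
      obtain ⟨g, m, hm, hc⟩ := hA x
      obtain ⟨y', -, hy'⟩ := P.mark_surv hm
      exact ⟨m, hm, y', (s'.conn ((P.conn hxy hy').1 hc)).1 hy, hy', g, hc⟩

theorem ConnPres.mc_le {A B : InvAut S} {ρ : A.Q → Option B.Q} (P : ConnPres A B ρ)
    {h : Set A.Q} {h' : Set B.Q} (c : Corr ρ h h') : B.mc h' ≤ A.mc h := by
  have : some '' (h' ∩ B.marks) ⊆ ρ '' (h ∩ A.marks) := by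
    rintro _ ⟨y, ⟨hy, hm⟩, rfl⟩
    obtain ⟨x, hx, hxy⟩ := (P.marks y).1 hm
    exact ⟨x, ⟨(c x y hxy).2 hy, hx⟩, hxy⟩
  rw [mc, mc, ← Set.ncard_image_of_injective _ (Option.some_injective _)]
  exact (Set.ncard_le_ncard this (Set.toFinite _)).trans (Set.ncard_image_le (Set.toFinite _))

theorem ConnPres.groupLang {A B : InvAut S} {ρ : A.Q → Option B.Q} (P : ConnPres A B ρ) :
    B.groupLang = A.groupLang := by
  rw [groupLang_eq, groupLang_eq]
  ext g
  constructor
  · rintro ⟨y, hy, h⟩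
    rw [P.final] at hy
    obtain ⟨x, hx, hxy⟩ := hy
    exact ⟨x, hx, (P.conn P.init hxy).2 h⟩
  · rintro ⟨x, hx, h⟩
    obtain ⟨y, hxy⟩ := P.surv x hx
    refine ⟨y, ?_, (P.conn P.init hxy).1 h⟩
    rw [P.final]
    exact ⟨x, hx, hxy⟩

theorem ConnPres.refl {A : InvAut S} (hA : A.Anchored) : ConnPres A A some where
  init := rfl
  surv := fun x _ => ⟨x, rfl⟩
  final := by ext y; simp
  conn := by rintro x x' y y' g ⟨⟩ ⟨⟩; rfl
  isol := by rintro x y ⟨⟩ h; exact h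
  anch := hA

theorem ConnPres.trans {A B C : InvAut S} {ρ : A.Q → Option B.Q} {σ : B.Q → Option C.Q}
    (P : ConnPres A B ρ) (P' : ConnPres B C σ) : ConnPres A C (fun x => (ρ x).bind σ) where
  init := by simp [P.init, P'.init]
  surv := by
    intro x hx
    obtain ⟨y, hy⟩ := P.surv x hx
    obtain ⟨z, hz⟩ := P'.surv y (by rw [P.final]; exact ⟨x, hx, hy⟩)
    exact ⟨z, by simp [hy, hz]⟩
  final := by
    ext z
    rw [P'.final]
    constructor
    · rintro ⟨y, hy, hz⟩
      rw [P.final] at hy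
      obtain ⟨x, hx, hxy⟩ := hy
      exact ⟨x, hx, by simp [hxy, hz]⟩
    · rintro ⟨x, hx, hz⟩
      simp only [Option.bind_eq_some_iff] at hz
      obtain ⟨y, hy, hz⟩ := hz
      exact ⟨y, by rw [P.final]; exact ⟨x, hx, hy⟩, hz⟩
  conn := by
    intro x x' z z' g h h'
    simp only [Option.bind_eq_some_iff] at h h'
    obtain ⟨y, hy, hz⟩ := h
    obtain ⟨y', hy', hz'⟩ := h'
    rw [P.conn hy hy', P'.conn hz hz']
  isol := by
    intro x z h hx
    simp only [Option.bind_eq_some_iff] at h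
    obtain ⟨y, hy, hz⟩ := h
    exact P'.isol y z hz (P.isol x y hy hx)
  anch := P'.anch

theorem Pres.refl {A : InvAut S} (hA : A.Anchored) : Pres A A some where
  toConnPres := .refl hA
  mono := fun h hh => ⟨h, hh, by rintro x y ⟨⟩; rfl, le_rfl, le_rfl⟩

theorem Corr.trans {A B C : InvAut S} {ρ : A.Q → Option B.Q} {σ : B.Q → Option C.Q}
    {h : Set A.Q} {h' : Set B.Q} {h'' : Set C.Q} (c : Corr ρ h h') (c' : Corr σ h' h'') :
    Corr (fun x => (ρ x).bind σ) h h'' := by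
  intro x z hz
  simp only [Option.bind_eq_some_iff] at hz
  obtain ⟨y, hy, hz⟩ := hz
  rw [c x y hy, c' y z hz]

theorem Pres.trans {A B C : InvAut S} {ρ : A.Q → Option B.Q} {σ : B.Q → Option C.Q}
    (P : Pres A B ρ) (P' : Pres B C σ) : Pres A C (fun x => (ρ x).bind σ) where
  toConnPres := P.toConnPres.trans P'.toConnPres
  mono := by
    intro h hh
    obtain ⟨h', hh', c, a, b⟩ := P.mono h hh
    obtain ⟨h'', hh'', c', a', b'⟩ := P'.mono h' hh'
    exact ⟨h'', hh'', c.trans c', by omega, b'.trans b⟩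

theorem ConnPres.corr_univ {A B : InvAut S} {ρ : A.Q → Option B.Q} (P : ConnPres A B ρ)
    {h' : Set B.Q} (s : B.Saturated h') (c : Corr ρ Set.univ h') : h' = Set.univ :=
  P.corr_unique s B.saturated_univ c (fun _ _ _ => by simp)

theorem Pres.ls_univ_le {A B : InvAut S} {ρ : A.Q → Option B.Q} (P : Pres A B ρ) :
    B.ls Set.univ ≤ A.ls Set.univ := by
  obtain ⟨h', s, c, -, h⟩ := P.mono _ A.saturated_univ
  rwa [P.corr_univ s c] at h

/-- For maps between states which are onto, the properties of anchors are inherited. -/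
theorem ConnPres.mk' {A B : InvAut S} {ρ : A.Q → Option B.Q} (hA : A.Anchored)
    (init : ρ A.q0 = some B.q0) (surv : ∀ x ∈ A.F, ∃ y, ρ x = some y)
    (final : B.F = {y | ∃ x ∈ A.F, ρ x = some y})
    (conn : ∀ {x x' : A.Q} {y y' : B.Q} {g : FreeGroup S}, ρ x = some y → ρ x' = some y' →
      (A.Conn x g x' ↔ B.Conn y g y'))
    (isol : ∀ x y, ρ x = some y → A.outgoing x = ∅ → B.outgoing y = ∅)
    (onto : ∀ y, ∃ x g y', ρ x = some y' ∧ B.Conn y g y') : ConnPres A B ρ where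
  init := init
  surv := surv
  final := final
  conn := conn
  isol := isol
  anch := by
    intro y
    obtain ⟨x, g', y', hx, hg'⟩ := onto y
    obtain ⟨g, m, hm, hc⟩ := hA x
    rcases hm with hm | rfl
    · obtain ⟨z, hz⟩ := surv m hm
      refine ⟨g' * g, z, Or.inl ?_, hg'.trans ((conn hx hz).1 hc)⟩
      rw [final]; exact ⟨m, hm, hz⟩
    · exact ⟨g' * g, B.q0, Or.inr rfl, hg'.trans ((conn hx init).1 hc)⟩

/-- All states but one have at most one outgoing transition. -/
def SubStar (A : InvAut S) : Prop :=
  ∃ v, ∀ t t', A.src t = A.src t' → A.src t ≠ v → t = t'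

/-- The properties of a single step of making an automaton minimalistic. -/
structure StepPres (A B : InvAut S) (ρ : A.Q → Option B.Q) : Prop extends ConnPres A B ρ where
  mono : ∀ h, A.Saturated h → ∃ h', B.Saturated h' ∧ Corr ρ h h' ∧
    B.tc h' + 2 * h.ncard ≤ A.tc h + 2 * h'.ncard ∧ B.ls h' ≤ A.ls h ∧ B.tc h' ≤ A.tc h
  cdfa : A.IsCDFA → B.IsCDFA
  subStar : A.SubStar → B.SubStar

theorem StepPres.refl {A : InvAut S} (hA : A.Anchored) : StepPres A A some where
  toConnPres := .refl hA
  mono := fun h hh => ⟨h, hh, by rintro x y ⟨⟩; rfl, le_rfl, le_rfl, le_rfl⟩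
  cdfa := id
  subStar := id

theorem StepPres.trans {A B C : InvAut S} {ρ : A.Q → Option B.Q} {σ : B.Q → Option C.Q}
    (P : StepPres A B ρ) (P' : StepPres B C σ) : StepPres A C (fun x => (ρ x).bind σ) where
  toConnPres := P.toConnPres.trans P'.toConnPres
  mono := by
    intro h hh
    obtain ⟨h', hh', c, a, b, d⟩ := P.mono h hh
    obtain ⟨h'', hh'', c', a', b', d'⟩ := P'.mono h' hh'
    exact ⟨h'', hh'', c.trans c', by omega, b'.trans b, d'.trans d⟩
  cdfa := fun h => P'.cdfa (P.cdfa h)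
  subStar := fun h => P'.subStar (P.subStar h)

theorem StepPres.toPres {A B : InvAut S} {ρ : A.Q → Option B.Q} (P : StepPres A B ρ) :
    Pres A B ρ where
  toConnPres := P.toConnPres
  mono := fun h hh => by
    obtain ⟨h', hh', c, a, b, -⟩ := P.mono h hh
    exact ⟨h', hh', c, a, b⟩

theorem StepPres.card_T_le {A B : InvAut S} {ρ : A.Q → Option B.Q} (P : StepPres A B ρ) :
    Nat.card B.T ≤ Nat.card A.T := by
  obtain ⟨h', s, c, -, -, h⟩ := P.mono _ A.saturated_univ
  rw [P.corr_univ s c] at h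
  rwa [tc_univ, tc_univ] at h

/-! ### Reduction of the labels -/

theorem stepPres_reduceLabels {A : InvAut S} (hA : A.Anchored) :
    StepPres A A.reduceLabels some := by
  classical
  have hconn : ∀ x g x', A.Conn x g x' ↔ A.reduceLabels.Conn x g x' := by
    intro x g x'
    constructor
    · apply Conn.map' (A := A) (B := A.reduceLabels) id
      intro t
      have := Conn.single (A := A.reduceLabels) t
      simp only [reduceLabels, FreeGroup.reduce.self] at this
      exact this
    · apply Conn.map' (A := A.reduceLabels) (B := A) id
      intro t
      have := Conn.single (A := A) t
      rw [← FreeGroup.reduce.self] at this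
      exact this
  refine { toConnPres := .mk' hA rfl (fun x _ => ⟨x, rfl⟩) ?_ ?_ ?_ ?_, mono := ?_, cdfa := ?_,
           subStar := ?_ }
  · ext y
    constructor
    · intro h; exact ⟨y, h, rfl⟩
    · rintro ⟨x, h, ⟨⟩⟩; exact h
  · rintro x x' y y' g ⟨⟩ ⟨⟩; exact hconn _ _ _
  · rintro x y ⟨⟩ h; exact h
  · intro y; exact ⟨y, 1, y, rfl, .nil y⟩
  · intro h hh
    refine ⟨h, hh, by rintro x y ⟨⟩; rfl, le_rfl, ?_, le_rfl⟩
    apply finsum_mono_nat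
    intro t
    have h1 := FreeGroup.Red.length_le (FreeGroup.reduce.red (L := A.label t))
    by_cases ht : A.src t ∈ h
    · rw [if_pos ht]; exact (if_pos ht).trans_le h1
    · exact (if_neg ht).trans_le (Nat.zero_le _)
  · intro h
    have e : ∀ t, A.reduceLabels.label t = A.label t := fun t => by
      simp only [reduceLabels, (h.2 t).reduce_eq]
    refine ⟨⟨fun t => ?_, fun t t' h1 h2 => ?_⟩, fun t => ?_⟩
    · rw [e]; exact h.1.1 t
    · rw [e, e] at h2; exact h.1.2 t t' h1 h2
    · rw [e]; exact h.2 t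
  · exact id

/-! ### Contraction of the transitions with empty label -/

theorem conn_one_of_quot_eq {A : InvAut S} {x y : A.Q}
    (h : Quot.mk A.EmptyJoined x = Quot.mk A.EmptyJoined y) : A.Conn x 1 y := by
  have h' := Quot.eqvGen_exact h
  clear h
  induction h' with
  | rel x y h =>
    obtain ⟨t, rfl, rfl, h⟩ := h
    have := Conn.single t
    rw [h] at this
    exact this
  | refl x => exact .nil x
  | symm x y _ ih => simpa using ih.symm
  | trans x y z _ _ ih ih' =>
    simpa using ih.trans ih'

theorem rootIn_of_quot_eq {A : InvAut S} {x y : A.Q}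
    (h : Quot.mk A.EmptyJoined x = Quot.mk A.EmptyJoined y) (root : Set A.Q) :
    (∃ n, A.RootIn {t | A.label t = []} root n y) →
      ∃ n, A.RootIn {t | A.label t = []} root n x := by
  have h' := Quot.eqvGen_exact h
  clear h
  have main : (∃ n, A.RootIn {t | A.label t = []} root n y) ↔
      ∃ n, A.RootIn {t | A.label t = []} root n x := by
    induction h' with
    | rel x y h =>
      obtain ⟨t, rfl, rfl, h⟩ := h
      constructor
      · rintro ⟨n, hn⟩; exact ⟨n + 1, t, h, rfl, hn⟩
      · rintro ⟨n, hn⟩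
        refine ⟨n + 1, A.inv t, ?_, A.src_inv t, by rwa [A.tgt_inv]⟩
        simp only [Set.mem_ofPred_eq, A.label_inv, h]; rfl
    | refl x => rfl
    | symm x y _ ih => exact ih.symm
    | trans x y z _ _ ih ih' =>
      exact ih'.trans ih
  exact main.1

/-- Identified states are joined by a path all of whose labels are empty, which represents 1. -/
theorem conn_contract_iff {A : InvAut S} {x x' : A.Q} {g : FreeGroup S} :
    A.contract.Conn (Quot.mk _ x) g (Quot.mk _ x') ↔ A.Conn x g x' := by
  constructor
  · intro h
    have key : ∀ {p q : A.contract.Q} {g : FreeGroup S}, A.contract.Conn p g q →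
        ∀ x x', Quot.mk _ x = p → Quot.mk _ x' = q → A.Conn x g x' := by
      intro p q g h
      induction h with
      | nil p => rintro x x' rfl h; exact conn_one_of_quot_eq h.symm
      | cons t g q _ ih =>
        intro x x' hx hx'
        have h1 : A.Conn x 1 (A.src t.1) := conn_one_of_quot_eq hx
        have h2 := h1.trans ((Conn.single t.1).trans (ih (A.tgt t.1) x' rfl hx'))
        rw [one_mul] at h2
        exact h2
    exact key h x x' rfl rfl
  · intro h
    apply Conn.map' (A := A) (B := A.contract) (Quot.mk _) _ h
    intro t
    by_cases ht : A.label t = []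
    · rw [ht, Quot.sound (show A.EmptyJoined _ _ from ⟨t, rfl, rfl, ht⟩)]
      exact .nil _
    · exact Conn.single (A := A.contract) ⟨t, ht⟩

theorem mem_image_quot_iff {A : InvAut S} {h : Set A.Q} (hh : A.Saturated h) {x : A.Q} :
    (Quot.mk A.EmptyJoined x) ∈ Quot.mk A.EmptyJoined '' h ↔ x ∈ h := by
  constructor
  · rintro ⟨y, hy, hxy⟩
    exact (hh.conn (conn_one_of_quot_eq hxy)).1 hy
  · exact fun hx => ⟨x, hx, rfl⟩

theorem saturated_contract {A : InvAut S} {h : Set A.Q} (hh : A.Saturated h) :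
    A.contract.Saturated (Quot.mk A.EmptyJoined '' h) := by
  intro t ht
  exact (mem_image_quot_iff hh).2 (hh t.1 ((mem_image_quot_iff hh).1 ht))

theorem finsum_boole {α : Type*} [Finite α] (p : α → Prop) [DecidablePred p] :
    ∑ᶠ a : α, (if p a then 1 else 0) = {a | p a}.ncard := by
  classical
  have := Fintype.ofFinite α
  rw [finsum_eq_sum_of_fintype, Finset.sum_boole, Set.ncard_eq_toFinset_card']
  simp

theorem wt_contract {A : InvAut S} {h : Set A.Q} (hh : A.Saturated h)
    (φ : List (S × Bool) → ℕ) :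
    A.contract.wt (Quot.mk A.EmptyJoined '' h) φ
      + φ [] * {t | A.label t = [] ∧ A.src t ∈ h}.ncard = A.wt h φ := by
  classical
  rw [wt, wt, finsum_subtype_add_compl (fun t => A.label t ≠ [])]
  congr 1
  · apply finsum_congr
    intro t
    have := mem_image_quot_iff hh (x := A.src t.1)
    exact if_congr this rfl rfl
  · have e : ∀ t : {t // ¬ A.label t ≠ []}, (if A.src t ∈ h then φ (A.label t) else 0)
        = φ [] * (if A.src t ∈ h then 1 else 0) := by
      rintro ⟨t, ht⟩
      have ht := not_not.1 ht
      by_cases h' : A.src t ∈ h <;> simp [h', ht]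
    rw [finsum_congr e]
    have := Fintype.ofFinite {t // ¬ A.label t ≠ []}
    rw [finsum_eq_sum_of_fintype, ← Finset.mul_sum, ← finsum_eq_sum_of_fintype, finsum_boole,
      ← Set.ncard_image_of_injective _ Subtype.val_injective]
    congr 2
    ext t
    simp only [Set.mem_ofPred_eq, Set.mem_image, Subtype.exists, exists_and_left, exists_prop,
      not_not]
    constructor
    · rintro ⟨h1, h2⟩; exact ⟨t, h2, h1, rfl⟩
    · rintro ⟨_, h2, h1, rfl⟩; exact ⟨h1, h2⟩

/-- A class of `s` states is held together by at least `s - 1` pairs of mutually inverse empty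
transitions. The spanning forest of the empty transitions, rooted at the chosen representatives of
the classes, makes this precise. -/
theorem ncard_contract {A : InvAut S} {h : Set A.Q} (hh : A.Saturated h) :
    2 * h.ncard ≤ 2 * (Quot.mk A.EmptyJoined '' h).ncard
      + {t | A.label t = [] ∧ A.src t ∈ h}.ncard := by
  classical
  let root : Set A.Q := {x | (Quot.mk A.EmptyJoined x).out = x}
  have h1 := A.two_mul_ncard_diff_roots_le {t | A.label t = []} root h (fun t ht => by
    simp only [Set.mem_ofPred_eq] at ht ⊢
    rw [A.label_inv, ht]; rfl) hh (fun x hx => by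
      refine rootIn_of_quot_eq (y := (Quot.mk A.EmptyJoined x).out) (Quot.out_eq _).symm root
        ⟨0, ?_⟩
      change (Quot.mk A.EmptyJoined (Quot.mk A.EmptyJoined x).out).out = _
      rw [Quot.out_eq])
  have h2 : (h ∩ root).ncard ≤ (Quot.mk A.EmptyJoined '' h).ncard := by
    have : Set.InjOn (Quot.mk A.EmptyJoined) (h ∩ root) := by
      rintro x ⟨-, hx⟩ y ⟨-, hy⟩ hxy
      rw [← show _ = x from hx, hxy]
      exact hy
    rw [← this.ncard_image]
    exact Set.ncard_le_ncard (Set.image_mono Set.inter_subset_left) (Set.toFinite _)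
  have h3 := Set.ncard_inter_add_ncard_sdiff_eq_ncard h root (Set.toFinite _)
  simp only [Set.mem_ofPred_eq] at h1
  omega

theorem quot_eq_of_forall_ne_nil {A : InvAut S} {x y : A.Q}
    (hx : ∀ t, A.src t = x → A.label t ≠ [])
    (h : Quot.mk A.EmptyJoined x = Quot.mk A.EmptyJoined y) : x = y := by
  have key : ∀ {n : ℕ} {z : A.Q}, A.RootIn {t | A.label t = []} {y} n z → z = x → x = y := by
    intro n z hn hz
    cases n with
    | zero => exact hz.symm.trans hn
    | succ n =>
      obtain ⟨t, ht, hs, -⟩ := hn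
      exact absurd ht (hx t (hs.trans hz))
  obtain ⟨n, hn⟩ := rootIn_of_quot_eq h {y} ⟨0, rfl⟩
  exact key hn rfl

theorem stepPres_contract {A : InvAut S} (hA : A.Anchored) :
    StepPres A A.contract (fun x => some (Quot.mk _ x)) := by
  refine { toConnPres := .mk' hA rfl (fun x _ => ⟨_, rfl⟩) ?_ ?_ ?_ ?_, mono := ?_, cdfa := ?_,
           subStar := ?_ }
  · ext y
    constructor
    · rintro ⟨x, h, rfl⟩; exact ⟨x, h, rfl⟩
    · rintro ⟨x, h, ⟨⟩⟩; exact ⟨x, h, rfl⟩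
  · rintro x x' y y' g ⟨⟩ ⟨⟩; exact conn_contract_iff.symm
  · rintro x y ⟨⟩ h
    ext t
    simp only [Set.mem_empty_iff_false, iff_false]
    intro ht
    have h1 : x = A.src t.1 := by
      refine quot_eq_of_forall_ne_nil (fun t' ht' => ?_) (Eq.symm ht)
      exact absurd (show t' ∈ A.outgoing x from ht') (by rw [h]; exact Set.notMem_empty _)
    exact absurd (show t.1 ∈ A.outgoing x from h1.symm) (by rw [h]; exact Set.notMem_empty _)
  · intro y
    obtain ⟨x, rfl⟩ := Quot.exists_rep y
    exact ⟨x, 1, _, rfl, .nil _⟩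
  · intro h hh
    have h1 := wt_contract hh fun _ => 1
    have h2 := wt_contract hh List.length
    have h3 := ncard_contract hh
    simp only [List.length_nil, zero_mul, one_mul] at h1 h2
    refine ⟨_, saturated_contract hh, ?_, ?_, h2.le, ?_⟩
    · rintro x y ⟨⟩
      exact (mem_image_quot_iff hh).symm
    · unfold tc
      change _ ≤ _ + 2 * (Quot.mk A.EmptyJoined '' h).ncard
      omega
    · unfold tc; omega
  · intro h
    refine ⟨⟨fun t => t.2, fun t t' h1 h2 => ?_⟩, fun t => h.2 t.1⟩
    exact Subtype.ext (h.1.2 _ _ (quot_eq_of_forall_ne_nil (fun t _ => h.1.1 t) h1) h2)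
  · rintro ⟨v, hv⟩
    refine ⟨Quot.mk _ v, fun t t' h1 h2 => ?_⟩
    have h0 : A.src t.1 ≠ v := fun h => h2 (congrArg _ h)
    -- Away from the centre `v`, the transition `t` is the only one leaving its source, and its
    -- label is not empty; so this source is alone in its class.
    have h1' : A.src t.1 = A.src t'.1 := by
      refine quot_eq_of_forall_ne_nil (fun u hu => ?_) h1
      rw [← hv t.1 u hu.symm h0]
      exact t.2
    exact Subtype.ext (hv _ _ h1' h0)

end InvAut

namespace InvAut

variable {S : Type u}

/-! ### Removal of a state -/

theorem deleteMap_eq_some {A : InvAut S} {q x : A.Q} {y : {x : A.Q // x ≠ q}} :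
    A.deleteMap q x = some y ↔ x = y.1 := by
  classical
  rw [deleteMap]
  split_ifs with h
  · simp [Subtype.ext_iff]
  · obtain ⟨y, hy⟩ := y
    simp only [not_not, ne_eq] at h
    simp [h, hy.symm]

theorem wt_deleteState_add_le {ι : Type} [Fintype ι] {A : InvAut S} {q : A.Q} {hq : A.q0 ≠ q}
    {h : Set A.Q} (φ : List (S × Bool) → ℕ) (g : ι → A.T) (hg : Function.Injective g)
    (h₁ : ∀ i, A.src (g i) = q ∨ A.tgt (g i) = q) (h₂ : ∀ i, A.src (g i) ∈ h) :
    (A.deleteState q hq).wt {x | x.1 ∈ h} φ + ∑ i, φ (A.label (g i)) ≤ A.wt h φ := by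
  classical
  have := finsum_subtype_add_le (fun t => A.src t ≠ q ∧ A.tgt t ≠ q)
    (fun t => if A.src t ∈ h then φ (A.label t) else 0) g hg (fun i => by
      have := h₁ i; tauto)
  simp only [h₂, if_true] at this
  exact this

theorem wt_deleteState_le {A : InvAut S} {q : A.Q} {hq : A.q0 ≠ q}
    {h : Set A.Q} (φ : List (S × Bool) → ℕ) :
    (A.deleteState q hq).wt {x | x.1 ∈ h} φ ≤ A.wt h φ := by
  simpa using wt_deleteState_add_le (hq := hq) φ (fun i : Fin 0 => i.elim0)
    (fun i => i.elim0) (fun i => i.elim0) (fun i => i.elim0)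

theorem ncard_deleteState {Q : Type} [Finite Q] (q : Q) (h : Set Q) :
    {x : {x : Q // x ≠ q} | x.1 ∈ h}.ncard = (h \ {q}).ncard := by
  rw [← Set.ncard_image_of_injective _ Subtype.val_injective]
  congr 1
  ext x
  simp

theorem saturated_deleteState {A : InvAut S} {q : A.Q} {hq : A.q0 ≠ q} {h : Set A.Q}
    (hh : A.Saturated h) : (A.deleteState q hq).Saturated {x | x.1 ∈ h} :=
  fun t ht => hh t.1 ht

theorem wt_addEdges {A : InvAut S} {I : Type} [Finite I] {s e : I → A.Q}
    {w : I → List (S × Bool)} {h : Set A.Q} (φ : List (S × Bool) → ℕ) [DecidablePred (· ∈ h)] :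
    (A.addEdges I s e w).wt h φ = A.wt h φ + ∑ᶠ i, ((if s i ∈ h then φ (w i) else 0)
      + (if e i ∈ h then φ (FreeGroup.invRev (w i)) else 0)) := by
  classical
  have := Fintype.ofFinite I
  refine (finsum_sum_type (fun t => if (A.addEdges I s e w).src t ∈ h
    then φ ((A.addEdges I s e w).label t) else 0)).trans ?_
  unfold wt
  congr 1
  rw [finsum_eq_sum_of_fintype, finsum_eq_sum_of_fintype, Fintype.sum_prod_type]
  apply Finset.sum_congr rfl
  intro i _
  rw [Fintype.sum_bool]
  simp only [addEdges, Sum.elim_inr, if_true, Bool.false_eq_true, if_false]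

theorem conn_of_deleteState {A : InvAut S} {q : A.Q} {hq : A.q0 ≠ q}
    {x y : (A.deleteState q hq).Q} {g : FreeGroup S} (h : (A.deleteState q hq).Conn x g y) :
    A.Conn x.1 g y.1 :=
  Conn.map' (A := A.deleteState q hq) (B := A) Subtype.val (fun t => Conn.single t.1) h

/-- Transport of connections where only one of each transition and its inverse is considered. -/
theorem Conn.map_of_or {A B : InvAut S} (b : A.Q → B.Q) (o : A.Q → FreeGroup S)
    (hbo : ∀ t, B.Conn (b (A.src t))
        (o (A.src t) * FreeGroup.mk (A.label t) * (o (A.tgt t))⁻¹) (b (A.tgt t)) ∨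
      B.Conn (b (A.tgt t))
        (o (A.tgt t) * FreeGroup.mk (A.label (A.inv t)) * (o (A.src t))⁻¹) (b (A.src t)))
    {p q : A.Q} {g : FreeGroup S} (h : A.Conn p g q) :
    B.Conn (b p) (o p * g * (o q)⁻¹) (b q) := by
  refine Conn.map b o (fun t => ?_) h
  rcases hbo t with h | h
  · exact h
  · have := h.symm
    rw [mk_label_inv] at this
    simpa [mul_assoc] using this

/-- Connections after the removal of a state `q`, where a path through `q` can be replaced. -/
theorem conn_deleteState {A : InvAut S} {q : A.Q} {hq : A.q0 ≠ q} (p : A.Q) (hp : p ≠ q)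
    (o : FreeGroup S)
    (ho : ∀ t, A.src t = q → ∃ h : A.tgt t ≠ q, (A.deleteState q hq).Conn ⟨p, hp⟩
      (o * FreeGroup.mk (A.label t)) ⟨A.tgt t, h⟩)
    {x y : (A.deleteState q hq).Q} {g : FreeGroup S} (h : A.Conn x.1 g y.1) :
    (A.deleteState q hq).Conn x g y := by
  classical
  let b : A.Q → (A.deleteState q hq).Q := fun z => if h : z ≠ q then ⟨z, h⟩ else ⟨p, hp⟩
  let oo : A.Q → FreeGroup S := fun z => if z ≠ q then 1 else o
  have hb : ∀ z (hz : z ≠ q), b z = ⟨z, hz⟩ := fun z hz => dif_pos hz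
  have hb' : b q = ⟨p, hp⟩ := dif_neg (by simp)
  have hoo : ∀ z (hz : z ≠ q), oo z = 1 := fun z hz => if_pos hz
  have hoo' : oo q = o := if_neg (by simp)
  have key : ∀ t, A.src t = q → (A.deleteState q hq).Conn (b (A.src t))
      (oo (A.src t) * FreeGroup.mk (A.label t) * (oo (A.tgt t))⁻¹) (b (A.tgt t)) := by
    intro t ht
    obtain ⟨h1, h2⟩ := ho t ht
    rw [ht, hb', hb _ h1, hoo', hoo _ h1]
    simpa using h2
  have main := Conn.map_of_or (A := A) (B := A.deleteState q hq) b oo (fun t => ?_) h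
  · rw [hb _ x.2, hb _ y.2, hoo _ x.2, hoo _ y.2] at main
    rw [one_mul, inv_one, mul_one] at main
    exact main
  · by_cases h1 : A.src t = q
    · exact Or.inl (key t h1)
    · by_cases h2 : A.tgt t = q
      · right
        have := key (A.inv t) (by rw [A.src_inv, h2])
        rwa [A.src_inv, A.tgt_inv] at this
      · left
        rw [hb _ h1, hb _ h2, hoo _ h1, hoo _ h2]
        have := Conn.single (A := A.deleteState q hq) ⟨t, h1, h2⟩
        rw [one_mul, inv_one, mul_one]
        exact this

theorem connPres_of_val {A B : InvAut S} (hA : A.Anchored) {ρ : A.Q → Option B.Q}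
    (v : B.Q → A.Q) (hρ : ∀ x y, ρ x = some y ↔ x = v y) (h0 : v B.q0 = A.q0)
    (hF : ∀ x ∈ A.F, ∃ y, v y = x) (hF' : ∀ y, y ∈ B.F ↔ v y ∈ A.F)
    (conn : ∀ {y y' g}, A.Conn (v y) g (v y') ↔ B.Conn y g y')
    (isol : ∀ y, A.outgoing (v y) = ∅ → B.outgoing y = ∅) : ConnPres A B ρ := by
  refine .mk' hA ((hρ _ _).2 h0.symm) ?_ ?_ ?_ ?_ ?_
  · intro x hx
    obtain ⟨y, hy⟩ := hF x hx
    exact ⟨y, (hρ _ _).2 hy.symm⟩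
  · ext y
    rw [hF']
    constructor
    · intro hy; exact ⟨v y, hy, (hρ _ _).2 rfl⟩
    · rintro ⟨x, hx, hxy⟩; rw [(hρ _ _).1 hxy] at hx; exact hx
  · intro x x' y y' g hy hy'
    rw [(hρ _ _).1 hy, (hρ _ _).1 hy', conn]
  · intro x y hy hx
    rw [(hρ _ _).1 hy] at hx
    exact isol y hx
  · intro y
    exact ⟨v y, 1, y, (hρ _ _).2 rfl, .nil _⟩

/-- A state which is not marked is joined to another state. -/
theorem Anchored.exists_tgt_ne {A : InvAut S} (hA : A.Anchored) {q : A.Q} (hq : A.q0 ≠ q)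
    (hF : q ∉ A.F) : ∃ t, A.src t = q ∧ A.tgt t ≠ q := by
  by_contra! h
  have hs : A.Saturated {q} := fun t ht => h t ht
  obtain ⟨g, y, hy, hc⟩ := hA q
  have := (hs.conn hc).1 rfl
  rcases hy with hy | hy
  · exact hF (this ▸ hy)
  · exact hq (hy.symm.trans this)

theorem outgoing_ne_empty_of_tgt {A : InvAut S} {x : A.Q} {t : A.T} (h : A.tgt t = x) :
    A.outgoing x ≠ ∅ := by
  intro e
  have : A.inv t ∈ A.outgoing x := (A.src_inv t).trans h
  rw [e] at this
  exact this

/-- Anchoring forces the only outgoing transition to lead to another state. So the state disappears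
together with one pair of inverse transitions, and a path through it merely turns back. -/
theorem stepPres_leaf {A : InvAut S} (hA : A.Anchored) (q : A.Q) (hq : A.q0 ≠ q) (hF : q ∉ A.F)
    (h : (A.outgoing q).ncard ≤ 1) : StepPres A (A.deleteState q hq) (A.deleteMap q) := by
  obtain ⟨t, ht, htq⟩ := hA.exists_tgt_ne hq hF
  have huniq : ∀ t', A.src t' = q → t' = t := fun t' ht' =>
    (Set.ncard_le_one (Set.toFinite _)).1 h t' ht' t ht
  refine { toConnPres := ?_, mono := ?_, cdfa := ?_, subStar := ?_ }
  · refine connPres_of_val hA Subtype.val (fun x y => deleteMap_eq_some) rfl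
      (fun x hx => ⟨⟨x, fun h => hF (h ▸ hx)⟩, rfl⟩) (fun y => Iff.rfl)
      (fun {y y' g} => ⟨fun hc => ?_, conn_of_deleteState⟩) ?_
    · refine conn_deleteState (A.tgt t) htq (FreeGroup.mk (A.label t))⁻¹ (fun t' ht' => ?_) hc
      rw [huniq t' ht', inv_mul_cancel]
      exact ⟨htq, .nil _⟩
    · intro y hy
      rw [Set.eq_empty_iff_forall_notMem] at hy ⊢
      intro t ht
      exact hy t.1 (congrArg Subtype.val ht)
  · intro k hk
    refine ⟨_, saturated_deleteState hk, fun x y hxy => by rw [deleteMap_eq_some.1 hxy]; rfl, ?_,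
      wt_deleteState_le _, wt_deleteState_le _⟩
    change _ ≤ _ + 2 * {x : {x // x ≠ q} | x.1 ∈ k}.ncard
    rw [ncard_deleteState]
    by_cases hqk : q ∈ k
    · have h1 := Set.ncard_sdiff_singleton_add_one hqk (Set.toFinite _)
      have h2 : Function.Injective ![t, A.inv t] := by
        have hne : t ≠ A.inv t := fun e => htq (by rw [← A.src_inv, ← e, ht])
        intro a b hab
        fin_cases a <;> fin_cases b <;> simp_all
      have h3 := wt_deleteState_add_le (A := A) (hq := hq) (h := k) (fun _ => 1) _ h2 (by
        intro i
        fin_cases i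
        · exact Or.inl ht
        · exact Or.inr ((A.tgt_inv t).trans ht)) (by
        intro i
        fin_cases i
        · exact ht ▸ hqk
        · have := hk t (ht ▸ hqk)
          rw [← A.src_inv] at this
          exact this)
      simp only [Finset.sum_const, Finset.card_univ, Fintype.card_fin, smul_eq_mul] at h3
      unfold tc
      omega
    · rw [Set.sdiff_singleton_eq_self hqk]
      have := wt_deleteState_le (A := A) (hq := hq) (h := k) (fun _ => 1)
      unfold tc
      omega
  · intro h
    refine ⟨⟨fun t => h.1.1 t.1, fun t t' h1 h2 => ?_⟩, fun t => h.2 t.1⟩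
    exact Subtype.ext (h.1.2 _ _ (congrArg Subtype.val h1) h2)
  · rintro ⟨v, hv⟩
    classical
    by_cases hvq : v = q
    · refine ⟨⟨A.q0, hq⟩, fun t t' h1 h2 => Subtype.ext (hv _ _ (congrArg Subtype.val h1) ?_)⟩
      rw [hvq]; exact t.2.1
    · exact ⟨⟨v, hvq⟩, fun t t' h1 h2 => Subtype.ext (hv _ _ (congrArg Subtype.val h1)
        (fun e => h2 (Subtype.ext e)))⟩

/-- A path through `q` either turns back or passes from one neighbour to the other, where the new
transition replaces it. One state is lost, four transitions become two, and the total length is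
kept. In a CDFA the labels X and Y begin differently, so X⁻¹Y is already reduced, and the new
transitions begin like those that used to lead into `q`; hence no new conflict arises. -/
theorem stepPres_merge {A : InvAut S} (hA : A.Anchored) (q : A.Q) (hq : A.q0 ≠ q) (hF : q ∉ A.F)
    (t₁ t₂ : A.T) (hne : t₁ ≠ t₂) (h : A.outgoing q = {t₁, t₂}) (h₁ : A.tgt t₁ ≠ q)
    (h₂ : A.tgt t₂ ≠ q) :
    StepPres A
      ((A.addEdges Unit (fun _ => A.tgt t₁) (fun _ => A.tgt t₂)
        (fun _ => FreeGroup.invRev (A.label t₁) ++ A.label t₂)).deleteState q hq)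
      (A.deleteMap q) := by
  set A' := A.addEdges Unit (fun _ => A.tgt t₁) (fun _ => A.tgt t₂)
        (fun _ => FreeGroup.invRev (A.label t₁) ++ A.label t₂) with hA'
  have s₁ : A.src t₁ = q := by
    have : t₁ ∈ A.outgoing q := by rw [h]; exact Or.inl rfl
    exact this
  have s₂ : A.src t₂ = q := by
    have : t₂ ∈ A.outgoing q := by rw [h]; exact Or.inr rfl
    exact this
  have hout : ∀ t, A.src t = q → t = t₁ ∨ t = t₂ := fun t ht => by
    have : t ∈ A.outgoing q := ht
    rw [h] at this; exact this
  have hnew : ∀ (P : (A'.deleteState q hq).T → Prop),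
      (∀ t (h1 : A.src t ≠ q) (h2 : A.tgt t ≠ q), P ⟨Sum.inl t, h1, h2⟩) →
      P ⟨Sum.inr ((), true), h₁, h₂⟩ → P ⟨Sum.inr ((), false), h₂, h₁⟩ → ∀ t, P t := by
    rintro P a b c ⟨t | ⟨⟨⟩, _ | _⟩, hh1, hh2⟩
    · exact a t hh1 hh2
    · exact c
    · exact b
  have hconn1 : ∀ {x g y}, A.Conn x g y → A'.Conn x g y := fun h =>
    Conn.map' (A := A) (B := A') id (fun t => Conn.single (A := A') (Sum.inl t)) h
  have hlab : FreeGroup.mk (FreeGroup.invRev (A.label t₁) ++ A.label t₂)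
      = (FreeGroup.mk (A.label t₁))⁻¹ * FreeGroup.mk (A.label t₂) := by
    rw [← FreeGroup.mul_mk, FreeGroup.inv_mk]
  have hc12 : A.Conn (A.tgt t₁) (FreeGroup.mk (FreeGroup.invRev (A.label t₁) ++ A.label t₂))
      (A.tgt t₂) := by
    rw [hlab]
    have h1 := (Conn.single t₁).symm
    have h2 := Conn.single t₂
    rw [s₁] at h1
    rw [s₂] at h2
    exact h1.trans h2
  have hconn2 : ∀ {x g y}, A'.Conn x g y → A.Conn x g y := fun h => by
    refine Conn.map' (A := A') (B := A) id ?_ h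
    rintro (t | ⟨⟨⟩, _ | _⟩)
    · exact Conn.single t
    · have := hc12.symm
      rw [FreeGroup.inv_mk] at this
      exact this
    · exact hc12
  have hnewedge := Conn.single (A := A'.deleteState q hq) ⟨Sum.inr ((), true), h₁, h₂⟩
  refine { toConnPres := ?_, mono := ?_, cdfa := ?_, subStar := ?_ }
  · refine connPres_of_val hA (B := A'.deleteState q hq) Subtype.val
      (fun x y => deleteMap_eq_some) rfl
      (fun x hx => ⟨⟨x, fun h => hF (h ▸ hx)⟩, rfl⟩) (fun y => Iff.rfl)
      (fun {y y' g} => ⟨fun hc => ?_, fun hc => hconn2 (conn_of_deleteState hc)⟩) ?_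
    -- Here `q` is represented by the target of `t₁`; the offset X⁻¹ turns X into 1 and Y into the
    -- new label X⁻¹Y.
    · refine conn_deleteState (A := A') (hq := hq) (A.tgt t₁) h₁ (FreeGroup.mk (A.label t₁))⁻¹ ?_
        (hconn1 hc)
      rintro (t | ⟨⟨⟩, _ | _⟩) ht
      · rcases hout t ht with rfl | rfl
        · refine ⟨h₁, ?_⟩
          have : (FreeGroup.mk (A.label t))⁻¹ * FreeGroup.mk (A'.label (Sum.inl t)) = 1 :=
            inv_mul_cancel _
          rw [this]
          exact .nil _
        · refine ⟨h₂, ?_⟩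
          have := hnewedge
          rw [show (A'.deleteState q hq).label ⟨Sum.inr ((), true), h₁, h₂⟩ = _ from rfl] at this
          change (A'.deleteState q hq).Conn _ ((FreeGroup.mk (A.label t₁))⁻¹ *
            FreeGroup.mk (A.label t)) _
          rw [← hlab]
          exact this
      · exact absurd ht h₂
      · exact absurd ht h₁
    · intro y hy
      rw [Set.eq_empty_iff_forall_notMem]
      refine hnew _ ?_ ?_ ?_
      · intro t h1 h2 ht
        have : t ∈ A.outgoing y.1 := congrArg Subtype.val ht
        rw [hy] at this; exact this
      · intro ht
        exact outgoing_ne_empty_of_tgt (congrArg Subtype.val ht) hy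
      · intro ht
        exact outgoing_ne_empty_of_tgt (congrArg Subtype.val ht) hy
  · intro k hk
    classical
    have hk' : A'.Saturated k := by
      rintro (t | ⟨⟨⟩, _ | _⟩) ht
      · exact hk t ht
      · exact (hk.conn hc12).2 ht
      · exact (hk.conn hc12).1 ht
    have e : ∀ φ, A'.wt k φ = A.wt k φ + ((if A.tgt t₁ ∈ k
        then φ (FreeGroup.invRev (A.label t₁) ++ A.label t₂) else 0) + (if A.tgt t₂ ∈ k
        then φ (FreeGroup.invRev (FreeGroup.invRev (A.label t₁) ++ A.label t₂)) else 0)) := by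
      intro φ
      refine (wt_addEdges φ).trans ?_
      rw [finsum_unique]
    have key : (A'.deleteState q hq).tc {x | x.1 ∈ k} + (if q ∈ k then 2 else 0) ≤ A.tc k ∧
        (A'.deleteState q hq).ls {x | x.1 ∈ k} ≤ A.ls k := by
      by_cases hqk : q ∈ k
      · have k1 : A.tgt t₁ ∈ k := hk t₁ (s₁ ▸ hqk)
        have k2 : A.tgt t₂ ∈ k := hk t₂ (s₂ ▸ hqk)
        have hinj : Function.Injective ![t₁, A.inv t₁, t₂, A.inv t₂] := by
          have n1 : ∀ a b, A.src a = q → A.tgt b ≠ q → a ≠ A.inv b := fun a b ha hb e =>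
            hb (by rw [← A.src_inv, ← e, ha])
          have n11 := n1 _ _ s₁ h₁
          have n12 := n1 _ _ s₁ h₂
          have n21 := n1 _ _ s₂ h₁
          have n22 := n1 _ _ s₂ h₂
          have n3 : A.inv t₁ ≠ A.inv t₂ := fun e => hne (A.inv_injective e)
          intro a b hab
          fin_cases a <;> fin_cases b <;> first
            | rfl
            | exact (hne hab).elim
            | exact (hne hab.symm).elim
            | exact (n3 hab).elim
            | exact (n3 hab.symm).elim
            | exact (n11 hab).elim
            | exact (n11 hab.symm).elim
            | exact (n12 hab).elim
            | exact (n12 hab.symm).elim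
            | exact (n21 hab).elim
            | exact (n21 hab.symm).elim
            | exact (n22 hab).elim
            | exact (n22 hab.symm).elim
        have hinj' : Function.Injective (fun i => (Sum.inl (![t₁, A.inv t₁, t₂, A.inv t₂] i)
            : A'.T)) := fun a b hab => hinj (Sum.inl_injective hab)
        have main := fun φ => wt_deleteState_add_le (A := A') (hq := hq) (h := k) φ _ hinj' (by
          intro i
          fin_cases i
          · exact Or.inl s₁
          · exact Or.inr ((A.tgt_inv _).trans s₁)
          · exact Or.inl s₂
          · exact Or.inr ((A.tgt_inv _).trans s₂)) (by
          intro i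
          fin_cases i
          · exact s₁ ▸ hqk
          · exact (A.src_inv _).symm ▸ k1
          · exact s₂ ▸ hqk
          · exact (A.src_inv _).symm ▸ k2)
        have m1 := main fun _ => 1
        have m2 := main List.length
        rw [e] at m1 m2
        have l1 : ∀ t, A'.label (Sum.inl t) = A.label t := fun _ => rfl
        simp only [Fin.sum_univ_four, l1, Matrix.cons_val_zero, Matrix.cons_val_one,
          Matrix.cons_val, A.label_inv, FreeGroup.invRev_length, List.length_append, k1, k2,
          if_true] at m1 m2
        simp only [hqk, if_true]
        have a1 : ∀ b a : ℕ, b + (1 + 1 + 1 + 1) ≤ a + (1 + 1) → b + 2 ≤ a := by omega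
        have a2 : ∀ b a l l' : ℕ, b + (l + l + l' + l') ≤ a + (l + l' + (l + l')) → b ≤ a := by
          omega
        exact ⟨a1 _ _ m1, a2 _ _ _ _ m2⟩
      · have k1 : A.tgt t₁ ∉ k := fun h => hqk (s₁ ▸ (hk.src_iff_tgt t₁).2 h)
        have k2 : A.tgt t₂ ∉ k := fun h => hqk (s₂ ▸ (hk.src_iff_tgt t₂).2 h)
        have main := fun φ => wt_deleteState_le (A := A') (hq := hq) (h := k) φ
        have m1 := main fun _ => 1
        have m2 := main List.length
        rw [e] at m1 m2
        simp only [k1, k2, if_false] at m1 m2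
        simp only [hqk, if_false]
        exact ⟨m1, m2⟩
    refine ⟨_, saturated_deleteState hk',
      fun x y hxy => by rw [deleteMap_eq_some.1 hxy]; rfl, ?_, key.2, ?_⟩
    · change _ ≤ _ + 2 * {x : {x // x ≠ q} | x.1 ∈ k}.ncard
      rw [ncard_deleteState]
      have key1 := key.1
      by_cases hqk : q ∈ k
      · have h1 := Set.ncard_sdiff_singleton_add_one hqk (Set.toFinite _)
        simp only [hqk, if_true] at key1
        have a1 : ∀ b a n m : ℕ, b + 2 ≤ a → m + 1 = n → b + 2 * n ≤ a + 2 * m := by omega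
        exact a1 _ _ _ _ key1 h1
      · rw [Set.sdiff_singleton_eq_self hqk]
        simp only [hqk, if_false] at key1
        exact Nat.add_le_add_right key1 _
    · exact (Nat.le_add_right _ _).trans key.1
  · intro hd
    have hne' : (A.label t₁).head? ≠ (A.label t₂).head? := fun e =>
      hne (hd.1.2 _ _ (s₁.trans s₂.symm) e)
    have hred := FreeGroup.isReduced_invRev_append (hd.2 t₁) (hd.2 t₂) hne'
    have n1 := hd.1.1 t₁
    have n2 := hd.1.1 t₂
    have c1 : (A'.deleteState q hq).label ⟨Sum.inr ((), true), h₁, h₂⟩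
        = A.label (A.inv t₁) ++ A.label t₂ := by rw [A.label_inv]; rfl
    have c2 : (A'.deleteState q hq).label ⟨Sum.inr ((), false), h₂, h₁⟩
        = A.label (A.inv t₂) ++ A.label t₁ := by
      rw [A.label_inv]
      change FreeGroup.invRev (FreeGroup.invRev (A.label t₁) ++ A.label t₂) = _
      rw [FreeGroup.invRev_append, FreeGroup.invRev_invRev]
    have d1 : ((A'.deleteState q hq).label ⟨Sum.inr ((), true), h₁, h₂⟩).head?
        = (A.label (A.inv t₁)).head? := by
      rw [c1, List.head?_append_of_ne_nil _ (hd.1.1 _)]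
    have d2 : ((A'.deleteState q hq).label ⟨Sum.inr ((), false), h₂, h₁⟩).head?
        = (A.label (A.inv t₂)).head? := by
      rw [c2, List.head?_append_of_ne_nil _ (hd.1.1 _)]
    have old : ∀ (u t : A.T) (_ : A.tgt u = q) (_ : A.tgt t ≠ q), A.src t = A.src u →
        (A.label t).head? = (A.label u).head? → False := fun u t hu ht a b =>
      ht (hd.1.2 _ _ a b ▸ hu)
    have i1 := (A.tgt_inv t₁).trans s₁
    have i2 := (A.tgt_inv t₂).trans s₂
    have e12 : A.src (A.inv t₁) = A.src (A.inv t₂) →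
        (A.label (A.inv t₁)).head? = (A.label (A.inv t₂)).head? → False := fun a b =>
      hne (A.inv_injective (hd.1.2 _ _ a b))
    have v1 := A.src_inv t₁
    have v2 := A.src_inv t₂
    refine ⟨⟨hnew _ (fun t _ _ => hd.1.1 t) ?_ ?_, ?_⟩, hnew _ (fun t _ _ => hd.2 t) hred ?_⟩
    · rw [c1]; exact fun e => n2 (List.append_eq_nil_iff.1 e).2
    · rw [c2]; exact fun e => n1 (List.append_eq_nil_iff.1 e).2
    · refine hnew _ ?_ ?_ ?_
      · intro t ht ht'
        refine hnew _ ?_ ?_ ?_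
        · intro t' hh hh' a b
          exact Subtype.ext (congrArg Sum.inl (hd.1.2 t t' (congrArg Subtype.val a) b))
        · intro a b
          rw [d1] at b
          exact (old _ t i1 ht' ((congrArg Subtype.val a).trans v1.symm) b).elim
        · intro a b
          rw [d2] at b
          exact (old _ t i2 ht' ((congrArg Subtype.val a).trans v2.symm) b).elim
      · refine hnew _ ?_ (fun _ _ => rfl) ?_
        · intro t ht ht' a b
          rw [d1] at b
          exact (old _ t i1 ht' ((congrArg Subtype.val a.symm).trans v1.symm) b.symm).elim
        · intro a b
          rw [d1, d2] at b
          exact (e12 (v1.trans ((congrArg Subtype.val a).trans v2.symm)) b).elim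
      · refine hnew _ ?_ ?_ (fun _ _ => rfl)
        · intro t ht ht' a b
          rw [d2] at b
          exact (old _ t i2 ht' ((congrArg Subtype.val a.symm).trans v2.symm) b.symm).elim
        · intro a b
          rw [d1, d2] at b
          exact (e12 (v1.trans ((congrArg Subtype.val a.symm).trans v2.symm)) b.symm).elim
    · exact hred.invRev'
  · rintro ⟨v, hv⟩
    classical
    have v1 := A.src_inv t₁
    have v2 := A.src_inv t₂
    have i1 := (A.tgt_inv t₁).trans s₁
    have i2 := (A.tgt_inv t₂).trans s₂
    have old : ∀ (u t : A.T) (_ : A.tgt u = q) (_ : A.tgt t ≠ q), A.src t = A.src u →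
        A.src t ≠ v → False := fun u t hu ht a b => ht (hv _ _ a b ▸ hu)
    have main : ∀ t t' : (A'.deleteState q hq).T, (A'.deleteState q hq).src t =
        (A'.deleteState q hq).src t' → ((A'.deleteState q hq).src t).1 ≠ v → t = t' := by
      refine hnew _ ?_ ?_ ?_
      · intro t ht ht'
        refine hnew _ ?_ ?_ ?_
        · intro t' hh hh' a b
          exact Subtype.ext (congrArg Sum.inl (hv t t' (congrArg Subtype.val a) b))
        · intro a b
          exact (old _ t i1 ht' ((congrArg Subtype.val a).trans v1.symm) b).elim
        · intro a b
          exact (old _ t i2 ht' ((congrArg Subtype.val a).trans v2.symm) b).elim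
      · refine hnew _ ?_ (fun _ _ => rfl) ?_
        · intro t ht ht' a b
          rw [a] at b
          exact (old _ t i1 ht' ((congrArg Subtype.val a.symm).trans v1.symm) b).elim
        · intro a b
          exact (hne (A.inv_injective (hv _ _ (v1.trans ((congrArg Subtype.val a).trans v2.symm))
            (v1.symm ▸ b)))).elim
      · refine hnew _ ?_ ?_ (fun _ _ => rfl)
        · intro t ht ht' a b
          rw [a] at b
          exact (old _ t i2 ht' ((congrArg Subtype.val a.symm).trans v2.symm) b).elim
        · intro a b
          exact (hne.symm (A.inv_injective (hv _ _
            (v2.trans ((congrArg Subtype.val a).trans v1.symm)) (v2.symm ▸ b)))).elim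
    by_cases hvq : v = q
    · exact ⟨⟨A.q0, hq⟩, fun t t' h1 _ => main t t' h1
        (by rw [hvq]; exact ((A'.deleteState q hq).src t).2)⟩
    · exact ⟨⟨v, hvq⟩, fun t t' h1 h2 => main t t' h1 (fun e => h2 (Subtype.ext e))⟩

/-- The step that deletes an isolated loop never applies to an anchored automaton: its state would
form a component without a mark. -/
theorem MinStep.stepPres {A B : InvAut S} {ρ : A.Q → Option B.Q} (h : MinStep A B ρ)
    (hA : A.Anchored) : StepPres A B ρ := by
  cases h with
  | reduce => exact stepPres_reduceLabels hA
  | contract => exact stepPres_contract hA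
  | leaf q hq hF h => exact stepPres_leaf hA q hq hF h
  | loop q hq hF t h ht =>
    exfalso
    obtain ⟨t', ht', hne⟩ := hA.exists_tgt_ne hq hF
    have h1 : t' ∈ A.outgoing q := ht'
    have hs : A.src t = q := by
      have : t ∈ A.outgoing q := by rw [h]; exact Or.inl rfl
      exact this
    rw [h] at h1
    rcases h1 with rfl | rfl
    · exact hne ht
    · exact hne ((A.tgt_inv t).trans hs)
  | merge q hq hF t₁ t₂ hne h h₁ h₂ => exact stepPres_merge hA q hq hF t₁ t₂ hne h h₁ h₂

theorem MinSteps.stepPres {A B : InvAut S} {ρ : A.Q → Option B.Q} (h : MinSteps A B ρ)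
    (hA : A.Anchored) : StepPres A B ρ := by
  induction h with
  | refl => exact .refl hA
  | tail B C ρ σ _ h' ih => exact ih.trans (h'.stepPres ih.anch)

end InvAut

namespace InvAut

variable {S : Type u}

/-! ### Every automaton can be made minimalistic -/

theorem MinSteps.trans {A B C : InvAut S} {ρ : A.Q → Option B.Q} {σ : B.Q → Option C.Q}
    (h : MinSteps A B ρ) (h' : MinSteps B C σ) : MinSteps A C (fun x => (ρ x).bind σ) := by
  induction h' with
  | refl => simpa using h
  | tail C D σ τ _ hs ih =>
    have := MinSteps.tail _ _ _ _ τ ih hs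
    simpa only [Option.bind_assoc] using this

theorem inv_ne {A : InvAut S} {t : A.T} (h : FreeGroup.IsReduced (A.label t))
    (h' : A.label t ≠ []) : A.inv t ≠ t := fun e =>
  h.invRev_ne h' (by rw [← A.label_inv, e])

/-- Reducing and contracting do not add states. If the result is not minimalistic, some unmarked
state has at most two outgoing transitions and can be deleted, so induction on the number of states
applies. If one of the two is a loop, the other must be its inverse, because a non-empty reduced
word differs from its formal inverse. -/
theorem exists_minimalizes (A : InvAut S) : ∃ B ρ, Minimalizes A B ρ := by
  classical
  induction hn : Nat.card A.Q using Nat.strong_induction_on generalizing A with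
  | _ n ih =>
  set A₁ := A.reduceLabels.contract with hA₁
  have hlab : ∀ t, FreeGroup.IsReduced (A₁.label t) ∧ A₁.label t ≠ [] := by
    intro t
    refine ⟨?_, t.2⟩
    change FreeGroup.IsReduced (FreeGroup.reduce (A.label t.1))
    rw [FreeGroup.isReduced_iff_reduce_eq, FreeGroup.reduce.idem]
  have hcard : Nat.card A₁.Q ≤ n := by
    rw [← hn]
    exact Nat.card_le_card_of_surjective (Quot.mk A.reduceLabels.EmptyJoined) Quot.mk_surjective
  have hsteps : MinSteps A A₁ _ := ((MinSteps.refl A).tail _ _ _ _ _ (MinStep.reduce A)).tail _ _ _ _ _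
    (MinStep.contract A.reduceLabels)
  by_cases hmin : A₁.Minimalistic
  · exact ⟨A₁, _, hsteps, hmin⟩
  have hq : ∃ q, q ≠ A₁.q0 ∧ q ∉ A₁.F ∧ (A₁.incoming q).ncard ≤ 2 ∧ (A₁.outgoing q).ncard ≤ 2 := by
    by_contra h
    exact hmin ⟨hlab, h⟩
  obtain ⟨q, hq0, hqF, -, hq2⟩ := hq
  have hsmall : Nat.card {x : A₁.Q // x ≠ q} < n := by
    refine lt_of_lt_of_le ?_ hcard
    apply Finite.card_subtype_lt (x := q)
    simp
  have main : ∃ (A₂ : InvAut S) (σ : A₁.Q → Option A₂.Q), MinStep A₁ A₂ σ ∧ Nat.card A₂.Q < n := by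
    rcases Nat.lt_or_ge (A₁.outgoing q).ncard 2 with h | h
    · exact ⟨_, _, .leaf A₁ q hq0.symm hqF (by omega), hsmall⟩
    · obtain ⟨t₁, t₂, hne, ho⟩ := Set.ncard_eq_two.1 (le_antisymm hq2 h)
      have key : ∀ t₁ t₂, t₁ ≠ t₂ → A₁.outgoing q = {t₁, t₂} → A₁.tgt t₁ = q →
          ∃ (A₂ : InvAut S) (σ : A₁.Q → Option A₂.Q), MinStep A₁ A₂ σ ∧ Nat.card A₂.Q < n := by
        intro t₁ t₂ hne ho h1
        have h2 : A₁.inv t₁ ∈ A₁.outgoing q := (A₁.src_inv t₁).trans h1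
        rw [ho] at h2
        have h3 := h2.resolve_left (inv_ne (hlab t₁).1 (hlab t₁).2)
        rw [Set.mem_singleton_iff] at h3
        exact ⟨_, _, .loop A₁ q hq0.symm hqF t₁ (by rw [ho, h3]) h1, hsmall⟩
      by_cases h1 : A₁.tgt t₁ = q
      · exact key t₁ t₂ hne ho h1
      by_cases h2 : A₁.tgt t₂ = q
      · exact key t₂ t₁ hne.symm (by rw [ho, Set.pair_comm]) h2
      exact ⟨_, _, .merge A₁ q hq0.symm hqF t₁ t₂ hne ho h1 h2, hsmall⟩
  obtain ⟨A₂, σ, hσ, hc⟩ := main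
  obtain ⟨B, ρ, hB, hB'⟩ := ih _ hc A₂ rfl
  exact ⟨B, _, (hsteps.tail _ _ _ _ _ hσ).trans hB, hB'⟩

/-- The words in a finite family can be encoded in a straight-line program. -/
def compression {L : Type u} {T : Type} [Finite T] (label : T → List L) :
    Compression label where
  slp :=
    { N := T
      finite_N := inferInstance
      prod := fun t => (label t).map .letter
      wf := ⟨fun X => ⟨X, fun Y ⟨s, hs, h⟩ => by
        obtain ⟨a, -, rfl⟩ := List.mem_map.1 hs
        exact absurd h (by simp [SLPSymbol.nt])⟩⟩ }
  lab := id
  eval_lab := fun t => by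
    rw [SLP.eval_eq]
    simp only [id]
    induction label t with
    | nil => rfl
    | cons a l ih => simpa [SLPSymbol.value] using ih

def toCNFA (A : InvAut S) : InvCNFA S where
  toInvAut := A
  comp := compression A.label

end InvAut

namespace InvAut

variable {S : Type u}

/-! ### Replacing transitions -/

/-- The automaton from which `replace` is obtained by removing empty labels. -/
abbrev preReplace (A : InvAut S) (R : Set A.T) (I : Type) [Finite I] (s e : I → A.Q ⊕ Bool)
    (w : I → List (S × Bool)) : InvAut S :=
  ((A.remove R).addStates Bool).addEdges I s e w

theorem Conn.cast {A : InvAut S} {p p' q q' : A.Q} {g : FreeGroup S} (h : A.Conn p g q)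
    (hp : p = p') (hq : q = q') : A.Conn p' g q' := hp ▸ hq ▸ h

section

variable {W : InvAut S} {R : Set W.T} {I : Type} [Finite I] {s e : I → W.Q ⊕ Bool}
  {w : I → List (S × Bool)}

/-- The new states are moved back onto states of `W` by `b`, and `o` records the labels of the ways
there. It remains to check that each new transition turns into a connection of `W`. -/
theorem conn_of_preReplace (b : Bool → W.Q) (o : Bool → FreeGroup S)
    (h : ∀ i, W.Conn (Sum.elim id b (s i)) (Sum.elim (fun _ => 1) o (s i) * FreeGroup.mk (w i)
      * (Sum.elim (fun _ => 1) o (e i))⁻¹) (Sum.elim id b (e i))) {x y : W.Q} {g : FreeGroup S}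
    (hc : (W.preReplace R I s e w).Conn (Sum.inl x) g (Sum.inl y)) : W.Conn x g y := by
  have main := Conn.map_of_or (A := W.preReplace R I s e w) (B := W) (Sum.elim id b)
    (Sum.elim (fun _ => 1) o) (fun t => ?_) hc
  · have main' : W.Conn x (1 * g * 1⁻¹) y := main
    simpa using main'
  · rcases t with t | ⟨i, _ | _⟩
    · left
      have := Conn.single t.1
      change W.Conn (W.src t.1) (1 * FreeGroup.mk (W.label t.1) * 1⁻¹) (W.tgt t.1)
      simpa using this
    · right; exact h i
    · left; exact h i

theorem conn_preReplace (h : ∀ t ∈ R, (W.preReplace R I s e w).Conn (Sum.inl (W.src t))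
      (FreeGroup.mk (W.label t)) (Sum.inl (W.tgt t))) {x y : W.Q} {g : FreeGroup S}
    (hc : W.Conn x g y) : (W.preReplace R I s e w).Conn (Sum.inl x) g (Sum.inl y) := by
  refine Conn.map' (A := W) (B := W.preReplace R I s e w) Sum.inl (fun t => ?_) hc
  by_cases h1 : t ∈ R
  · exact h t h1
  by_cases h2 : W.inv t ∈ R
  · have := (h _ h2).symm
    rw [mk_label_inv, _root_.inv_inv] at this
    exact this.cast (congrArg Sum.inl (W.tgt_inv t)) (congrArg Sum.inl (W.src_inv t))
  · exact Conn.single (A := W.preReplace R I s e w) (Sum.inl ⟨t, h1, h2⟩)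

/-- The set of states of `preReplace` which belongs to a set of states. -/
def liftSet {Q : Type} (h : Set Q) (p : Prop) : Set (Q ⊕ Bool) :=
  {x | Sum.elim (· ∈ h) (fun _ => p) x}

/-- Everything that is added or removed belongs to one component, and `p` says whether this
component lies in `h`. Both orientations are counted, hence the factor 2. -/
theorem wt_preReplace_le {ι : Type} [Fintype ι] {h : Set W.Q} {p : Prop} [Decidable p]
    (φ : List (S × Bool) → ℕ) (hφ : ∀ l, φ (FreeGroup.invRev l) = φ l)
    (hs : ∀ i, s i ∈ liftSet h p ↔ p) (he : ∀ i, e i ∈ liftSet h p ↔ p)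
    (g : ι → W.T) (hg : Function.Injective (fun z : ι × Bool => if z.2 then g z.1 else W.inv (g z.1)))
    (hR : ∀ i, g i ∈ R) (hh : W.Saturated h) (hgp : ∀ i, W.src (g i) ∈ h ↔ p) :
    (W.preReplace R I s e w).wt (liftSet h p) φ + (if p then 2 * ∑ i, φ (W.label (g i)) else 0)
      ≤ W.wt h φ + (if p then 2 * ∑ᶠ i, φ (w i) else 0) := by
  classical
  have := Fintype.ofFinite I
  have h1 : (W.preReplace R I s e w).wt (liftSet h p) φ
      = ((W.remove R).addStates Bool).wt (liftSet h p) φ + (if p then 2 * ∑ᶠ i, φ (w i) else 0) := by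
    refine (wt_addEdges φ).trans ?_
    refine congrArg₂ (· + ·) rfl ?_
    have e1 : (if p then 2 * ∑ᶠ i, φ (w i) else 0) = ∑ᶠ i, if p then 2 * φ (w i) else 0 := by
      rw [finsum_eq_sum_of_fintype, finsum_eq_sum_of_fintype]
      split_ifs with hp
      · rw [Finset.mul_sum]
      · simp
    rw [e1]
    refine finsum_congr fun i => ?_
    by_cases hp : p
    · refine (congrArg₂ (· + ·) (if_pos ((hs i).2 hp)) (if_pos ((he i).2 hp))).trans ?_
      rw [hφ, if_pos hp, two_mul]
    · refine (congrArg₂ (· + ·) (if_neg fun h => hp ((hs i).1 h))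
        (if_neg fun h => hp ((he i).1 h))).trans ?_
      rw [if_neg hp]
  have h2 : ((W.remove R).addStates Bool).wt (liftSet h p) φ
      = ∑ᶠ t : {t : W.T // t ∉ R ∧ W.inv t ∉ R}, if W.src t ∈ h then φ (W.label t) else 0 := by
    unfold wt
    exact finsum_congr fun t => if_congr Iff.rfl rfl rfl
  have h3 := finsum_subtype_add_le (fun t => t ∉ R ∧ W.inv t ∉ R)
    (fun t => if W.src t ∈ h then φ (W.label t) else 0) _ hg (by
      rintro ⟨i, _ | _⟩
      · simp [W.inv_inv, hR]
      · simp [hR])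
  have h4 : (∑ z : ι × Bool, if W.src (if z.2 then g z.1 else W.inv (g z.1)) ∈ h
      then φ (W.label (if z.2 then g z.1 else W.inv (g z.1))) else 0)
      = if p then 2 * ∑ i, φ (W.label (g i)) else 0 := by
    rw [Fintype.sum_prod_type]
    split_ifs with hp
    · rw [Finset.mul_sum]
      apply Finset.sum_congr rfl
      intro i _
      have a1 : W.src (g i) ∈ h := (hgp i).2 hp
      have a2 : W.src (W.inv (g i)) ∈ h := by rw [W.src_inv]; exact hh _ a1
      simp only [Fintype.sum_bool, if_true, Bool.false_eq_true, if_false, a1, a2, W.label_inv, hφ]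
      ring
    · apply Finset.sum_eq_zero
      intro i _
      have a1 : W.src (g i) ∉ h := fun h => hp ((hgp i).1 h)
      have a2 : W.src (W.inv (g i)) ∉ h := by
        rw [W.src_inv]; exact fun h' => a1 ((hh.src_iff_tgt _).2 h')
      simp [a1, a2]
  rw [h1, h2, ← h4]
  unfold wt
  omega

end

/-! ### The common part of the three kinds of folds -/

/-- The properties of an automaton in which trivial loops have been added everywhere, and which
becomes deterministic when `α` and the trivial loops are removed. -/
structure FoldSetup (W : InvAut S) (α : W.T) : Prop where
  red : ∀ t, FreeGroup.IsReduced (W.label t)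
  triv : ∀ t, W.label t = [] → W.src t = W.tgt t
  ne : W.label α ≠ []
  inv_ne : ∀ t, W.inv t ≠ t
  uniq : ∀ t t', W.label t = [] → W.label t' = [] → W.src t = W.src t' → t = t' ∨ t = W.inv t'
  det : ∀ t t', t ∉ ({α, W.inv α} : Set W.T) → t' ∉ ({α, W.inv α} : Set W.T) → W.label t ≠ [] →
    W.label t' ≠ [] → W.src t = W.src t' → (W.label t).head? = (W.label t').head? → t = t'

/-- Some transition other than `α`, its inverse and trivial loops leaves `y`. -/
def HasOff (W : InvAut S) (α : W.T) (y : W.Q) : Prop :=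
  ∃ t, t ∉ ({α, W.inv α} : Set W.T) ∧ W.label t ≠ [] ∧ W.src t = y

open Classical in
/-- The indicator of non-empty words. -/
noncomputable def neWeight (l : List (S × Bool)) : ℕ := if l = [] then 0 else 1

theorem neWeight_invRev (l : List (S × Bool)) : neWeight (FreeGroup.invRev l) = neWeight l := by
  classical
  have : FreeGroup.invRev l = [] ↔ l = [] := by
    rw [← List.length_eq_zero_iff, FreeGroup.invRev_length, List.length_eq_zero_iff]
  simp only [neWeight, this]

theorem wt_neWeight {A : InvAut S} (hA : ∀ t, A.label t ≠ []) (h : Set A.Q) :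
    A.wt h neWeight = A.tc h := by
  classical
  unfold tc wt
  exact finsum_congr fun t => by rw [neWeight, if_neg (hA t)]

open Classical in
/-- The map which identifies `b` with `a`. -/
noncomputable def glue {Z : Type} (a b u : Z) : Z := if u = b then a else u

theorem ncard_le_ncard_image_glue {Z : Type} [Finite Z] (a b : Z) (U : Set Z) :
    U.ncard ≤ (glue a b '' U).ncard + 1 := by
  classical
  have h : U ⊆ insert b (glue a b '' U) := by
    intro u hu
    by_cases hub : u = b
    · exact Or.inl hub
    · exact Or.inr ⟨u, hu, if_neg hub⟩
  exact (Set.ncard_le_ncard h (Set.toFinite _)).trans (Set.ncard_insert_le _ _)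

theorem ncard_liftSet {Q : Type} [Finite Q] (h : Set Q) (p : Prop) [Decidable p]
    (P : Bool → Q ⊕ Bool) :
    h.ncard + (if p then {c | P c = Sum.inr c}.ncard else 0)
      ≤ (Sum.elim Sum.inl P '' liftSet h p).ncard := by
  classical
  have h1 : Sum.inl '' h ∪ Sum.inr '' {c | p ∧ P c = Sum.inr c} ⊆
      (Sum.elim Sum.inl P '' liftSet h p : Set (Q ⊕ Bool)) := by
    rintro _ (⟨x, hx, rfl⟩ | ⟨c, ⟨hp, hc⟩, rfl⟩)
    · exact ⟨Sum.inl x, hx, rfl⟩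
    · exact ⟨Sum.inr c, hp, hc⟩
  refine le_trans ?_ (Set.ncard_le_ncard h1 (Set.toFinite _))
  rw [Set.ncard_union_eq, Set.ncard_image_of_injective _ Sum.inl_injective,
    Set.ncard_image_of_injective _ Sum.inr_injective]
  · split_ifs with hp <;> simp [hp]
  · rw [Set.disjoint_left]
    rintro _ ⟨x, hx, rfl⟩ ⟨c, -, hc⟩
    exact absurd hc (by simp)

/-- What has to be verified for each of the three kinds of folds. The new state `Sum.inr c` is
represented by `P c`, which is a state or a new state; the transitions which are replaced are
the `g i` and their inverses. -/
structure FoldCase (W : InvAut S) (α : W.T) (R : Set W.T) (I : Type) [Finite I]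
    (s e : I → W.Q ⊕ Bool) (w : I → List (S × Bool)) (P : Bool → W.Q ⊕ Bool) (full : Prop)
    (ι : Type) [Fintype ι] (g : ι → W.T) : Prop where
  setup : FoldSetup W α
  conn : ∀ {x y g}, (W.preReplace R I s e w).Conn (Sum.inl x) g (Sum.inl y) ↔ W.Conn x g y
  inr : ∀ c, ∃ x g, (W.preReplace R I s e w).Conn (Sum.inr c) g (Sum.inl x)
  -- An empty piece joins states that are represented alike, unless it is the whole remainder of α;
  -- the latter case, `full`, glues `p'` and `q'`.
  emp : ∀ i, w i = [] → Sum.elim Sum.inl P (s i) = Sum.elim Sum.inl P (e i) ∨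
    full ∧ s i = Sum.inr false ∧ e i = Sum.inr true
  quot_inl : ∀ c y, P c = Sum.inl y →
    Quot.mk (W.preReplace R I s e w).EmptyJoined (Sum.inr c) = Quot.mk _ (Sum.inl y)
  quot_full : full → (W.preReplace R I s e w).EmptyJoined (Sum.inr false) (Sum.inr true)
  red : ∀ i, FreeGroup.IsReduced (w i)
  det : ∀ t t', (W.preReplace R I s e w).label t ≠ [] → (W.preReplace R I s e w).label t' ≠ [] →
    (Sum.elim Sum.inl P ((W.preReplace R I s e w).src t) : W.Q ⊕ Bool)
      = Sum.elim Sum.inl P ((W.preReplace R I s e w).src t') →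
    ((W.preReplace R I s e w).label t).head? = ((W.preReplace R I s e w).label t').head? → t = t'
  start : ∀ t y, (W.preReplace R I s e w).label t ≠ [] →
    (Sum.elim Sum.inl P ((W.preReplace R I s e w).src t) : W.Q ⊕ Bool) = Sum.inl y →
    (∃ u, u ∉ ({α, W.inv α} : Set W.T) ∧ W.label u ≠ [] ∧ W.src u = y ∧
      ((W.preReplace R I s e w).label t).head? = (W.label u).head?) ∨
      ¬ full ∧ ∃ c, P c = Sum.inl y
  isol : ∀ c y, P c = Sum.inl y → HasOff W α y ∨ y = W.src α ∨ y = W.tgt α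
  isol_src : ¬ HasOff W α (W.src α) → full → P false = Sum.inl (W.src α)
  isol_tgt : ¬ HasOff W α (W.tgt α) → full → P true = Sum.inl (W.tgt α)
  mem_s : ∀ h, W.Saturated h → ∀ i, s i ∈ liftSet h (W.src α ∈ h) ↔ W.src α ∈ h
  mem_e : ∀ h, W.Saturated h → ∀ i, e i ∈ liftSet h (W.src α ∈ h) ↔ W.src α ∈ h
  mem_g : ∀ h, W.Saturated h → ∀ i, W.src (g i) ∈ h ↔ W.src α ∈ h
  inj : Function.Injective (fun z : ι × Bool => if z.2 then g z.1 else W.inv (g z.1))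
  g_mem : ∀ i, g i ∈ R
  count : ∑ᶠ i, neWeight (w i) ≤ ∑ i, neWeight (W.label (g i)) + {c | P c = Sum.inr c}.ncard
  -- Gluing `p'` and `q'` costs one state, so one more transition has to have disappeared.
  count_full : full →
    ∑ᶠ i, neWeight (w i) + 1 ≤ ∑ i, neWeight (W.label (g i)) + {c | P c = Sum.inr c}.ncard
  length : ∑ᶠ i, (w i).length ≤ ∑ i, (W.label (g i)).length
  length_full : full → ∑ᶠ i, (w i).length + (W.label α).length ≤ ∑ i, (W.label (g i)).length

namespace FoldCase

variable {W : InvAut S} {α : W.T} {R : Set W.T} {I : Type} [Finite I]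
  {s e : I → W.Q ⊕ Bool} {w : I → List (S × Bool)} {P : Bool → W.Q ⊕ Bool} {full : Prop}
  {ι : Type} [Fintype ι] {g : ι → W.T}

open Classical in
/-- The representative of a state in the result of a fold. -/
noncomputable def rep (W : InvAut S) (P : Bool → W.Q ⊕ Bool) (full : Prop) (x : W.Q ⊕ Bool) :
    W.Q ⊕ Bool :=
  if full then glue (P false) (P true) (Sum.elim Sum.inl P x) else Sum.elim Sum.inl P x

/-- The contraction identifies no more than `rep` does. This is what the proof of determinism and
the lower bound for the number of states both need. -/
theorem rep_eq (H : FoldCase W α R I s e w P full ι g) {x y : W.Q ⊕ Bool}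
    (h : Quot.mk (W.preReplace R I s e w).EmptyJoined x = Quot.mk _ y) :
    rep W P full x = rep W P full y := by
  have h' := Quot.eqvGen_exact h
  clear h
  induction h' with
  | rel x y h =>
    have key : ∀ i, w i = [] → rep W P full (s i) = rep W P full (e i) := by
      intro i hi
      unfold rep
      rcases H.emp i hi with h | ⟨h1, h2, h3⟩
      · rw [h]
      · rw [if_pos h1, if_pos h1, h2, h3, Sum.elim_inr, Sum.elim_inr, glue, glue, if_pos rfl]
        split_ifs <;> rfl
    obtain ⟨t, rfl, rfl, h⟩ := h
    rcases t with t | ⟨i, _ | _⟩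
    · exact congrArg (fun z => rep W P full (Sum.inl z)) (H.setup.triv t.1 h)
    · have h1 : FreeGroup.invRev (w i) = [] := h
      rw [← List.length_eq_zero_iff, FreeGroup.invRev_length, List.length_eq_zero_iff] at h1
      exact (key i h1).symm
    · exact key i h
  | refl x => rfl
  | symm x y _ ih => exact ih.symm
  | trans x y z _ _ ih ih' => exact ih.trans ih'

theorem conn' (H : FoldCase W α R I s e w P full ι g) {x y : W.Q} {k : FreeGroup S} :
    (W.replace R I s e w).Conn (W.replaceMap R I s e w x) k (W.replaceMap R I s e w y) ↔
      W.Conn x k y :=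
  conn_contract_iff.trans H.conn

theorem onto (H : FoldCase W α R I s e w P full ι g) (z : (W.replace R I s e w).Q) :
    ∃ x k, (W.replace R I s e w).Conn z k (W.replaceMap R I s e w x) := by
  obtain ⟨z | c, rfl⟩ := Quot.exists_rep z
  · exact ⟨z, 1, .nil _⟩
  · obtain ⟨x, k, hk⟩ := H.inr c
    exact ⟨x, k, conn_contract_iff.2 hk⟩

theorem reduced (H : FoldCase W α R I s e w P full ι g) (t : (W.replace R I s e w).T) :
    FreeGroup.IsReduced ((W.replace R I s e w).label t) := by
  obtain ⟨t | ⟨i, _ | _⟩, h⟩ := t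
  · exact H.setup.red t.1
  · exact (H.red i).invRev'
  · exact H.red i

/-- By the field `det`, a conflict can come only from gluing `p'` with `q'`. If one end of α has no
other transition, nothing can be read from it: the corresponding point is that end itself, where no
transition of the result starts, and gluing it is harmless. -/
theorem isCDFA (H : FoldCase W α R I s e w P full ι g)
    (h : full → ¬ HasOff W α (W.src α) ∨ ¬ HasOff W α (W.tgt α)) :
    (W.replace R I s e w).IsCDFA := by
  classical
  refine ⟨⟨fun t => t.2, fun t t' h1 h2 => Subtype.ext (H.det _ _ t.2 t'.2 ?_ h2)⟩, H.reduced⟩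
  have hr := H.rep_eq h1
  unfold rep at hr
  by_cases hf : full
  · rw [if_pos hf, if_pos hf] at hr
    have hne : ∀ c y, P c = Sum.inl y → ¬ HasOff W α y → ∀ t : (W.replace R I s e w).T,
        (Sum.elim Sum.inl P ((W.preReplace R I s e w).src t.1) : W.Q ⊕ Bool) ≠ P c := by
      intro c y hc hy t ht
      rcases H.start t.1 y t.2 (ht.trans hc) with ⟨u, a, b, d, -⟩ | h
      · exact hy ⟨u, a, b, d⟩
      · exact h.1 hf
    unfold glue at hr
    rcases h hf with h' | h'
    · have n := hne false _ (H.isol_src h' hf) h'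
      have n1 := n t
      have n2 := n t'
      split_ifs at hr with c1 c2 c2
      · exact c1.trans c2.symm
      · exact absurd hr.symm n2
      · exact absurd hr n1
      · exact hr
    · have n := hne true _ (H.isol_tgt h' hf) h'
      rwa [if_neg (n t), if_neg (n t')] at hr
  · rwa [if_neg hf, if_neg hf] at hr

/-- The centre is the point where `p'` and `q'` are glued. Elsewhere each transition of the result
begins like a transition of `W` at the same state, and by hypothesis there is only one of these. -/
theorem subStar (H : FoldCase W α R I s e w P full ι g) (hf : full)
    (h : ∀ t t', t ∉ ({α, W.inv α} : Set W.T) → t' ∉ ({α, W.inv α} : Set W.T) →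
      W.label t ≠ [] → W.label t' ≠ [] → W.src t = W.src t' → t = t') :
    (W.replace R I s e w).SubStar := by
  classical
  refine ⟨Quot.mk _ (Sum.inr false), fun t t' h1 h2 => ?_⟩
  have hr := H.rep_eq h1
  have hc : ∀ c, Quot.mk (W.preReplace R I s e w).EmptyJoined (Sum.inr c)
      = Quot.mk _ (Sum.inr false) := by
    rintro (_ | _)
    · rfl
    · exact (Quot.sound (H.quot_full hf)).symm
  have hP : ∀ (x : W.Q ⊕ Bool) c, Sum.elim Sum.inl P x = P c →
      Quot.mk (W.preReplace R I s e w).EmptyJoined x = Quot.mk _ (Sum.inr false) := by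
    rintro (x | c') c hx
    · exact (H.quot_inl c x hx.symm).symm.trans (hc c)
    · exact hc c'
  have n1 : ∀ c, (Sum.elim Sum.inl P ((W.preReplace R I s e w).src t.1) : W.Q ⊕ Bool) ≠ P c :=
    fun c h => h2 (hP _ c h)
  have n2 : ∀ c, (Sum.elim Sum.inl P ((W.preReplace R I s e w).src t'.1) : W.Q ⊕ Bool) ≠ P c :=
    fun c h => h2 (h1.trans (hP _ c h))
  unfold rep at hr
  rw [if_pos hf, if_pos hf] at hr
  unfold glue at hr
  rw [if_neg (n1 true), if_neg (n2 true)] at hr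
  have hinl : ∃ y, (Sum.elim Sum.inl P ((W.preReplace R I s e w).src t.1) : W.Q ⊕ Bool)
      = Sum.inl y := by
    rcases hsrc : (W.preReplace R I s e w).src t.1 with y | c
    · exact ⟨y, rfl⟩
    · exact absurd (congrArg (Sum.elim Sum.inl P) hsrc) (n1 c)
  obtain ⟨y, hy⟩ := hinl
  rcases H.start t.1 y t.2 hy with ⟨u, a1, a2, a3, a4⟩ | h'
  · rcases H.start t'.1 y t'.2 (hr.symm.trans hy) with ⟨u', b1, b2, b3, b4⟩ | h'
    · have := h u u' a1 b1 a2 b2 (a3.trans b3.symm)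
      subst this
      exact Subtype.ext (H.det _ _ t.2 t'.2 hr (a4.trans b4.symm))
    · exact absurd hf h'.1
  · exact absurd hf h'.1

theorem outgoing_eq_empty (H : FoldCase W α R I s e w P full ι g) {x : W.Q}
    (hx : ¬ HasOff W α x) (h1 : x ≠ W.src α) (h2 : x ≠ W.tgt α) :
    (W.replace R I s e w).outgoing (W.replaceMap R I s e w x) = ∅ := by
  classical
  have hP : ∀ c, P c ≠ Sum.inl x := by
    intro c hc
    rcases H.isol c x hc with h | h | h
    · exact hx h
    · exact h1 h
    · exact h2 h
  rw [Set.eq_empty_iff_forall_notMem]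
  intro t ht
  have hr := H.rep_eq ht
  have key : (Sum.elim Sum.inl P ((W.preReplace R I s e w).src t.1) : W.Q ⊕ Bool)
      = Sum.inl x := by
    unfold rep at hr
    by_cases hf : full
    · rw [if_pos hf, if_pos hf] at hr
      have hr' : glue (P false) (P true) (Sum.elim Sum.inl P ((W.preReplace R I s e w).src t.1))
          = Sum.inl x := hr.trans (if_neg (hP true).symm)
      unfold glue at hr'
      split_ifs at hr' with c1
      · exact absurd hr' (hP false)
      · exact hr'
    · rwa [if_neg hf, if_neg hf] at hr
  rcases H.start t.1 x t.2 key with ⟨u, a, b, d, -⟩ | ⟨-, c, hc⟩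
  · exact hx ⟨u, a, b, d⟩
  · exact hP c hc

/-- The corresponding set is the image of `liftSet h p`. Its weights are controlled by
`wt_preReplace_le`, and its number of states is at least that of the values of `rep`. The weight
`neWeight` ignores the auxiliary trivial loops. -/
theorem mono (H : FoldCase W α R I s e w P full ι g) {h : Set W.Q} (hh : W.Saturated h) :
    ∃ h' : Set (W.replace R I s e w).Q, (W.replace R I s e w).Saturated h' ∧
      (∀ x, W.replaceMap R I s e w x ∈ h' ↔ x ∈ h) ∧
      (W.replace R I s e w).tc h' + 2 * h.ncard ≤ W.wt h neWeight + 2 * h'.ncard ∧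
      (W.replace R I s e w).ls h' ≤ W.ls h ∧
      (full → W.src α ∈ h →
        (W.replace R I s e w).ls h' + 2 * (W.label α).length ≤ W.ls h) := by
  classical
  set p : Prop := W.src α ∈ h with hp
  have hs0 : (W.preReplace R I s e w).Saturated (liftSet h p) := by
    rintro (t | ⟨i, _ | _⟩) ht
    · exact hh t.1 ht
    · exact (H.mem_s h hh i).2 ((H.mem_e h hh i).1 ht)
    · exact (H.mem_e h hh i).2 ((H.mem_s h hh i).1 ht)
  have hw := fun φ hφ => wt_preReplace_le (R := R) (s := s) (e := e) (w := w) (p := p) φ hφ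
    (H.mem_s h hh) (H.mem_e h hh) g H.inj H.g_mem hh (H.mem_g h hh)
  have w1 := hw neWeight neWeight_invRev
  have w2 := hw List.length (fun _ => FreeGroup.invRev_length)
  have c1 := wt_contract hs0 neWeight
  have c2 := wt_contract hs0 List.length
  have c3 := wt_neWeight (A := W.replace R I s e w) (fun t => t.2)
    (Quot.mk (W.preReplace R I s e w).EmptyJoined '' liftSet h p)
  have hnil : neWeight ([] : List (S × Bool)) = 0 := if_pos rfl
  rw [hnil, zero_mul, add_zero] at c1
  rw [List.length_nil, zero_mul, add_zero] at c2
  refine ⟨Quot.mk (W.preReplace R I s e w).EmptyJoined '' liftSet h p, saturated_contract hs0,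
    fun x => mem_image_quot_iff hs0, ?_, ?_, ?_⟩
  · have hN := ncard_liftSet h p P
    have hcard : (rep W P full '' liftSet h p).ncard ≤
        (Quot.mk (W.preReplace R I s e w).EmptyJoined '' liftSet h p).ncard := by
      let f : Quot (W.preReplace R I s e w).EmptyJoined → W.Q ⊕ Bool :=
        Quot.lift (rep W P full) (fun a b hab => H.rep_eq (Quot.sound hab))
      have : rep W P full '' liftSet h p =
          f '' (Quot.mk (W.preReplace R I s e w).EmptyJoined '' liftSet h p) :=
        (Set.image_image f (Quot.mk (W.preReplace R I s e w).EmptyJoined) (liftSet h p)).symm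
      rw [this]
      exact Set.ncard_image_le (Set.toFinite _)
    have c13 := c3.symm.trans c1
    have arith : ∀ tD n0 nh nD wB wW a b q : ℕ, tD = wB → wB + 2 * a ≤ wW + 2 * b →
        nh + q ≤ n0 → n0 ≤ nD → b ≤ a + q → tD + 2 * nh ≤ wW + 2 * nD := by omega
    have arith' : ∀ tD n0 nh nD wB wW a b q : ℕ, tD = wB → wB + 2 * a ≤ wW + 2 * b →
        nh + q ≤ n0 → n0 ≤ nD + 1 → b + 1 ≤ a + q → tD + 2 * nh ≤ wW + 2 * nD := by omega
    by_cases hpp : p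
    · simp only [if_pos hpp] at w1 hN
      by_cases hf : full
      · have hg := ncard_le_ncard_image_glue (P false) (P true)
          (Sum.elim Sum.inl P '' liftSet h p)
        have hg := hg.trans_eq (congrArg (fun U => Set.ncard U + 1) (Set.image_image _ _ _))
        have e1 : rep W P full = fun x => glue (P false) (P true) (Sum.elim Sum.inl P x) := by
          funext x; exact if_pos hf
        rw [← e1] at hg
        exact arith' _ _ _ _ _ _ _ _ _ c13 w1 hN (hg.trans (Nat.add_le_add_right hcard 1))
          (H.count_full hf)
      · have e1 : rep W P full = Sum.elim Sum.inl P := by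
          funext x; exact if_neg hf
        rw [e1] at hcard
        exact arith _ _ _ _ _ _ _ _ _ c13 w1 hN hcard H.count
    · simp only [if_neg hpp, add_zero] at w1 hN
      have : h.ncard ≤ (rep W P full '' liftSet h p).ncard := by
        have e1 : Sum.inl '' h ⊆ rep W P full '' liftSet h p := by
          rintro _ ⟨x, hx, rfl⟩
          refine ⟨Sum.inl x, hx, ?_⟩
          unfold rep
          split_ifs with hf
          · refine if_neg fun hc => hpp ?_
            exact (hs0.conn (conn_one_of_quot_eq (H.quot_inl true x hc.symm))).2 hx
          · rfl
        rw [← Set.ncard_image_of_injective h (Sum.inl_injective (β := Bool))]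
        exact Set.ncard_le_ncard e1 (Set.toFinite _)
      have arith3 : ∀ tD nh nD wB wW : ℕ, tD = wB → wB ≤ wW → nh ≤ nD →
        tD + 2 * nh ≤ wW + 2 * nD := by omega
      exact arith3 _ _ _ _ _ c13 w1 (this.trans hcard)
  · have l := H.length
    refine c2.le.trans ?_
    have arith : ∀ wB lW a b : ℕ, wB + 2 * a ≤ lW + 2 * b → b ≤ a → wB ≤ lW := by omega
    split_ifs at w2
    · exact arith _ _ _ _ w2 l
    · exact w2
  · intro hf hpp
    have l := H.length_full hf
    simp only [if_pos hpp] at w2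
    have arith : ∀ lD wB lW a b n : ℕ, lD = wB → wB + 2 * a ≤ lW + 2 * b → b + n ≤ a →
      lD + 2 * n ≤ lW := by omega
    exact arith _ _ _ _ _ _ c2 w2 l

end FoldCase

end InvAut

/-! ### Letters of words -/

namespace FreeGroup

variable {S : Type*}

/-- The inverse of a letter. -/
def invLetter (a : S × Bool) : S × Bool := (a.1, !a.2)

theorem invLetter_invLetter (a : S × Bool) : invLetter (invLetter a) = a := by
  simp [invLetter]

theorem invLetter_ne (a : S × Bool) : invLetter a ≠ a := by
  obtain ⟨a, b⟩ := a
  cases b <;> simp [invLetter]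

theorem IsReduced.getElem?_succ_ne {w : List (S × Bool)} (h : IsReduced w) {n : ℕ}
    (hn : n + 1 < w.length) : w[n + 1]? ≠ w[n]?.map invLetter := by
  have h1 := h
  rw [← List.take_append_drop (n + 1) w, isReduced_append_iff] at h1
  intro e
  rw [List.getElem?_eq_getElem hn, List.getElem?_eq_getElem (by omega : n < w.length),
    Option.map_some, Option.some.injEq] at e
  refine h1.2.2 w[n] ?_ w[n + 1] ?_ e
  · rw [Option.mem_def, List.getLast?_take]
    simp [List.getElem?_eq_getElem (by omega : n < w.length)]
  · rw [Option.mem_def, List.head?_drop, List.getElem?_eq_getElem hn]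

theorem head?_invRev_take {w : List (S × Bool)} {k : ℕ} (h0 : 0 < k) (hk : k ≤ w.length) :
    (invRev (w.take k)).head? = w[k - 1]?.map invLetter := by
  rw [head?_invRev, List.getLast?_take, if_neg h0.ne',
    List.getElem?_eq_getElem (by omega : k - 1 < w.length)]
  rfl

theorem getElem?_invRev {w : List (S × Bool)} {n : ℕ} (hn : n < w.length) :
    (invRev w)[n]? = w[w.length - 1 - n]?.map invLetter := by
  have h1 : n < (w.map fun g : S × Bool => (g.1, !g.2)).length := by simpa using hn
  rw [invRev, List.getElem?_reverse h1, List.getElem?_map, List.length_map]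
  rfl

theorem take_invRev {w : List (S × Bool)} (j : ℕ) :
    (invRev w).take j = invRev (w.drop (w.length - j)) := by
  rcases le_or_gt j w.length with hj | hj
  · have h := invRev_append (L₁ := w.take (w.length - j)) (L₂ := w.drop (w.length - j))
    rw [List.take_append_drop] at h
    rw [h, List.take_append_of_le_length (by rw [invRev_length, List.length_drop]; omega),
      List.take_of_length_le (by rw [invRev_length, List.length_drop]; omega)]
  · rw [List.take_of_length_le (by rw [invRev_length]; omega),
      show w.length - j = 0 by omega, List.drop_zero]

theorem drop_invRev {w : List (S × Bool)} (j : ℕ) :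
    (invRev w).drop j = invRev (w.take (w.length - j)) := by
  rcases le_or_gt j w.length with hj | hj
  · have h := invRev_append (L₁ := w.take (w.length - j)) (L₂ := w.drop (w.length - j))
    rw [List.take_append_drop] at h
    rw [h, List.drop_append_of_le_length (by rw [invRev_length, List.length_drop]; omega),
      List.drop_eq_nil_of_le (by rw [invRev_length, List.length_drop]; omega), List.nil_append]
  · rw [List.drop_eq_nil_of_le (by rw [invRev_length]; omega),
      show w.length - j = 0 by omega, List.take_zero]
    rfl

theorem mk_take_mul_mk_drop (w : List (S × Bool)) (k : ℕ) :
    mk (w.take k) * mk (w.drop k) = mk w := by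
  rw [mul_mk, List.take_append_drop]

theorem mk_eq_take_middle (w : List (S × Bool)) {i j : ℕ} (h : i + j ≤ w.length) :
    mk w = mk (w.take i) * mk (InvAut.middle i j w) * (mk ((invRev w).take j))⁻¹ := by
  have h1 : w.take i = (w.take (w.length - j)).take i := by
    rw [List.take_take, min_eq_left (by omega)]
  rw [take_invRev, inv_mk, invRev_invRev, InvAut.middle, h1, mk_take_mul_mk_drop,
    mk_take_mul_mk_drop]

end FreeGroup

namespace InvAut

open FreeGroup (invLetter)

variable {S : Type u}

theorem label_inv_eq_nil {A : InvAut S} {t : A.T} : A.label (A.inv t) = [] ↔ A.label t = [] := by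
  rw [A.label_inv, ← List.length_eq_zero_iff, FreeGroup.invRev_length, List.length_eq_zero_iff]

theorem length_label_inv (A : InvAut S) (t : A.T) :
    (A.label (A.inv t)).length = (A.label t).length := by
  rw [A.label_inv, FreeGroup.invRev_length]

/-- The transitions other than `α` and its inverse. -/
abbrev Off (W : InvAut S) (α t : W.T) : Prop := t ∉ ({α, W.inv α} : Set W.T)

theorem Off.inv {W : InvAut S} {α t : W.T} (h : W.Off α t) : W.Off α (W.inv t) := by
  rintro (h' | h')
  · exact h (Or.inr (by rw [← h', W.inv_inv]; rfl))
  · exact h (Or.inl (W.inv_injective h'))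

theorem off_of_inv {W : InvAut S} {α t : W.T} (h : W.Off α (W.inv t)) : W.Off α t := by
  have := h.inv
  rwa [W.inv_inv] at this

/-! ### Points which are reached without traversing a transition -/

section LeadsTo

variable {W : InvAut S} {α β : W.T} {p : W.Q} {u : List (S × Bool)} {k : ℕ}

theorem Path.conn_remove {q : W.Q} (h : W.Path ({α, W.inv α} : Set W.T)ᶜ p u q) :
    (W.remove {α}).Conn p (FreeGroup.mk u) q := by
  induction h with
  | nil p => exact .nil (A := W.remove {α}) p
  | cons t ht w q _ ih =>
    rw [← FreeGroup.mul_mk]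
    have h1 : t ∉ ({α} : Set W.T) := fun h => ht (Or.inl h)
    have h2 : W.inv t ∉ ({α} : Set W.T) := fun h => (Off.inv (W := W) ht) (Or.inl h)
    exact Conn.cons (A := W.remove {α}) ⟨t, h1, h2⟩ _ _ ih

theorem LeadsTo.off (h : W.LeadsTo {α, W.inv α} p u β k) : W.Off α β := by
  rcases h.2 with h | h
  · exact h.1
  · exact off_of_inv h.1

theorem LeadsTo.le (h : W.LeadsTo {α, W.inv α} p u β k) : k ≤ (W.label β).length := by
  rcases h.1 with h | h
  · exact h.2.le
  · rw [h.2]; exact Nat.zero_le _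

theorem LeadsTo.inv (h : W.LeadsTo {α, W.inv α} p u β k) :
    W.LeadsTo {α, W.inv α} p u (W.inv β) ((W.label β).length - k) := by
  have hle := h.le
  refine ⟨?_, ?_⟩
  · rcases h.1 with h | h
    · left; rw [W.length_label_inv]; omega
    · right; rw [label_inv_eq_nil, h.1, h.2]; simp
  · rcases h.2 with h' | h'
    · right
      rw [W.inv_inv, W.length_label_inv, Nat.sub_sub_self hle]
      exact h'
    · left; exact h'

/-- Walk to the point and then back to the source of β. If the point was reached along β⁻¹,
completing β⁻¹ does this. Since α is not traversed, the connection is still available when α is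
taken out. -/
theorem LeadsTo.conn_remove (h : W.LeadsTo {α, W.inv α} p u β k) :
    (W.remove {α}).Conn p (FreeGroup.mk u * (FreeGroup.mk ((W.label β).take k))⁻¹) (W.src β) := by
  have hoff := h.off
  have hle := h.le
  rcases h.2 with ⟨-, -, v, hv, rfl⟩ | ⟨-, -, v, hv, rfl⟩
  · rw [← FreeGroup.mul_mk, mul_inv_cancel_right]
    exact Path.conn_remove hv
  · have h1 := Path.conn_remove hv
    have h2 : β ∉ ({α} : Set W.T) := fun h => hoff (Or.inl h)
    have h3 : W.inv β ∉ ({α} : Set W.T) := fun h => hoff.inv (Or.inl h)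
    have h4 : (W.remove {α}).Conn (W.src (W.inv β)) (FreeGroup.mk (W.label (W.inv β)))
        (W.tgt (W.inv β)) := Conn.single (A := W.remove {α}) ⟨W.inv β, h3, by rw [W.inv_inv]; exact h2⟩
    have h5 := (h1.trans h4).cast rfl (W.tgt_inv β)
    suffices e : FreeGroup.mk (v ++ (W.label (W.inv β)).take ((W.label β).length - k))
        * (FreeGroup.mk ((W.label β).take k))⁻¹ = FreeGroup.mk v * FreeGroup.mk (W.label (W.inv β)) by
      rw [e]; exact h5
    rw [← FreeGroup.mul_mk, W.label_inv, FreeGroup.take_invRev, Nat.sub_sub_self hle,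
      mul_assoc]
    congr 1
    rw [mul_inv_eq_iff_eq_mul, ← FreeGroup.inv_mk, ← FreeGroup.inv_mk, eq_inv_mul_iff_mul_eq,
      mul_inv_eq_iff_eq_mul, FreeGroup.mk_take_mul_mk_drop]

theorem conn_of_conn_remove {q : W.Q} {g : FreeGroup S} (h : (W.remove {α}).Conn p g q) :
    W.Conn p g q :=
  Conn.map' (A := W.remove {α}) (B := W) id (fun t => Conn.single t.1) h

theorem Path.eq_or_hasOff (H : FoldSetup W α) {q : W.Q}
    (h : W.Path ({α, W.inv α} : Set W.T)ᶜ p u q) : q = p ∨ HasOff W α q := by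
  induction h with
  | nil p => exact Or.inl rfl
  | cons t ht w q _ ih =>
    rcases ih with rfl | ih
    · by_cases h0 : W.label t = []
      · exact Or.inl (H.triv t h0).symm
      · exact Or.inr ⟨W.inv t, Off.inv (W := W) ht, fun h => h0 (label_inv_eq_nil.1 h), W.src_inv t⟩
    · exact Or.inr ih

theorem Path.eq_of_not_hasOff (H : FoldSetup W α) {q : W.Q}
    (h : W.Path ({α, W.inv α} : Set W.T)ᶜ p u q) (hp : ¬ HasOff W α p) : q = p := by
  induction h with
  | nil p => rfl
  | cons t ht w q _ ih =>
    by_cases h0 : W.label t = []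
    · rw [H.triv t h0] at hp ⊢
      exact ih hp
    · exact absurd ⟨t, ht, h0, rfl⟩ hp

theorem LeadsTo.isol (H : FoldSetup W α) (h : W.LeadsTo {α, W.inv α} p u β k)
    (h0 : W.label β = []) : HasOff W α (W.src β) ∨ W.src β = p := by
  rcases h.2 with ⟨-, -, v, hv, -⟩ | ⟨-, -, v, hv, -⟩
  · exact (Path.eq_or_hasOff H hv).symm
  · rw [W.src_inv, ← H.triv β h0] at hv
    exact (Path.eq_or_hasOff H hv).symm

/-- From such a state only trivial loops can be traversed, so the reading never leaves it. -/
theorem LeadsTo.of_not_hasOff (H : FoldSetup W α) (h : W.LeadsTo {α, W.inv α} p u β k)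
    (hp : ¬ HasOff W α p) : W.label β = [] ∧ W.src β = p := by
  have hoff := h.off
  have key : W.label β = [] := by
    by_contra h0
    rcases h.2 with ⟨-, -, v, hv, -⟩ | ⟨-, -, v, hv, -⟩
    · exact hp ⟨β, hoff, h0, Path.eq_of_not_hasOff H hv hp⟩
    · exact hp ⟨W.inv β, hoff.inv, fun h => h0 (label_inv_eq_nil.1 h),
        Path.eq_of_not_hasOff H hv hp⟩
  refine ⟨key, ?_⟩
  rcases h.2 with ⟨-, -, v, hv, -⟩ | ⟨-, -, v, hv, -⟩
  · exact Path.eq_of_not_hasOff H hv hp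
  · rw [W.src_inv, ← H.triv β key] at hv
    exact Path.eq_of_not_hasOff H hv hp

variable {X : List (S × Bool)} {i : ℕ}

/-- The next letter of a word which cannot be read any further. -/
theorem LeadsTo.head?_ne (H : FoldSetup W α) (h : W.LeadsTo {α, W.inv α} p (X.take i) β k)
    (hX : ¬ ∃ β' k', W.Determines {α, W.inv α} p (X.take (i + 1)) β' k') (h0 : W.label β = [])
    (t : W.T) (ht : W.Off α t) (ht0 : W.label t ≠ []) (hs : W.src t = W.src β) :
    (W.label t).head? ≠ X[i]? := by
  intro e
  obtain ⟨v, hv, hvX⟩ : ∃ v, W.Path ({α, W.inv α} : Set W.T)ᶜ p v (W.src β) ∧ X.take i = v := by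
    rcases h.2 with ⟨-, -, v, hv, hvX⟩ | ⟨-, -, v, hv, hvX⟩
    · exact ⟨v, hv, by rw [hvX, h0]; simp⟩
    · rw [W.src_inv, ← H.triv β h0] at hv
      exact ⟨v, hv, by rw [hvX, label_inv_eq_nil.2 h0]; simp⟩
  refine hX ⟨t, 1, ht, List.length_pos_iff.2 ht0, v, hs ▸ hv, ?_⟩
  rw [List.take_add_one, hvX, ← e]
  congr 1
  rcases hl : W.label t with _ | ⟨a, l⟩
  · exact absurd hl ht0
  · rfl

/-- Two directions leave an interior point of β. Continuing along β would prolong a reading that is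
supposed to stop; returning is impossible because X is reduced and has just come that way. -/
theorem LeadsTo.getElem?_ne (h : W.LeadsTo {α, W.inv α} p (X.take i) β k)
    (hXr : FreeGroup.IsReduced X) (hi : i < X.length)
    (hX : ¬ ∃ β' k', W.Determines {α, W.inv α} p (X.take (i + 1)) β' k')
    (h0 : 0 < k ∧ k < (W.label β).length) :
    X[i]? ≠ (W.label β)[k]? ∧ X[i]? ≠ (W.label β)[k - 1]?.map invLetter := by
  have key : ∀ (β : W.T) (k : ℕ), 0 < k → k < (W.label β).length →
      W.Determines {α, W.inv α} p (X.take i) β k →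
      X[i]? ≠ (W.label β)[k]? ∧ X[i]? ≠ (W.label β)[k - 1]?.map invLetter := by
    rintro β k h0 hk ⟨hoff, -, v, hv, hvX⟩
    constructor
    · intro e
      refine hX ⟨β, k + 1, hoff, hk, v, hv, ?_⟩
      rw [List.take_add_one, hvX, List.take_add_one, List.append_assoc, e]
    · have hl := congrArg List.length hvX
      rw [List.length_take, List.length_append, List.length_take, min_eq_left hi.le,
        min_eq_left hk.le] at hl
      have e1 : (W.label β)[k - 1]? = X[i - 1]? := by
        have e2 : (X.take i)[i - 1]? = X[i - 1]? := List.getElem?_take_of_lt (by omega)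
        rw [← e2, hvX, List.getElem?_append_right (by omega), List.getElem?_take_of_lt (by omega)]
        congr 1
        omega
      rw [e1]
      have := hXr.getElem?_succ_ne (n := i - 1) (by omega)
      rwa [Nat.sub_add_cancel (by omega)] at this
  rcases h.2 with h' | h'
  · exact key β k h0.1 h0.2 h'
  · have h1 := key (W.inv β) _ (by omega) (by rw [W.length_label_inv]; omega) h'
    rw [W.label_inv, FreeGroup.getElem?_invRev (by omega), FreeGroup.getElem?_invRev (by omega),
      Option.map_map, show (W.label β).length - 1 - ((W.label β).length - k) = k - 1 by omega,
      show (W.label β).length - 1 - ((W.label β).length - k - 1) = k by omega] at h1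
    have e : invLetter ∘ invLetter = (id : S × Bool → S × Bool) :=
      funext FreeGroup.invLetter_invLetter
    rw [e, Option.map_id, id] at h1
    exact h1.symm

end LeadsTo

/-! ### Germs of transitions -/

/-- The germs of transitions at the states and the new states of a fold. -/
inductive Germ (T : Type)
  | start (t : T)
  | back (c : Bool)
  | fwd (c : Bool)
  | mid (c : Bool)

namespace Germ

variable {W : InvAut S}

def loc (P : Bool → W.Q ⊕ Bool) : Germ W.T → W.Q ⊕ Bool
  | start t => Sum.inl (W.src t)
  | back c => Sum.inr c
  | fwd c => Sum.inr c
  | mid c => P c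

def hd (hb hf hm : Bool → Option (S × Bool)) : Germ W.T → Option (S × Bool)
  | start t => (W.label t).head?
  | back c => hb c
  | fwd c => hf c
  | mid c => hm c

def Valid (α : W.T) (v : Bool → Prop) (vm : Prop) : Germ W.T → Prop
  | start t => W.Off α t ∧ W.label t ≠ []
  | back c => v c
  | fwd c => v c
  | mid _ => vm

/-- Conflicts between two old germs are excluded by `H.det`. Otherwise `h₁` treats the two pieces of
a divided transition, `h₂` and `h₃` an end of the remainder against an old germ or a piece, and `h₄`
the two ends of the remainder when they meet. -/
theorem eq_of_loc_of_hd {α : W.T} (H : FoldSetup W α) {P : Bool → W.Q ⊕ Bool}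
    {hb hf hm : Bool → Option (S × Bool)} {v : Bool → Prop} {vm : Prop}
    (h₁ : ∀ c, v c → hb c ≠ hf c)
    (h₂ : vm → ∀ c y, P c = Sum.inl y → ∀ t, W.Off α t → W.label t ≠ [] → W.src t = y →
      (W.label t).head? ≠ hm c)
    (h₃ : vm → ∀ b c, v c → P b = Sum.inr c → hm b ≠ hf c ∧ hm b ≠ hb c)
    (h₄ : vm → P false = P true → hm false ≠ hm true)
    (x y : Germ W.T) (hx : x.Valid α v vm) (hy : y.Valid α v vm) (hl : x.loc P = y.loc P)
    (hh : x.hd hb hf hm = y.hd hb hf hm) : x = y := by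
  rcases x with t | c | c | c <;> rcases y with t' | c' | c' | c' <;>
    simp only [loc, hd, Valid, Sum.inl.injEq, Sum.inr.injEq, reduceCtorEq] at hx hy hl hh
  · rw [H.det t t' hx.1 hy.1 hx.2 hy.2 hl hh]
  · exact absurd hh (h₂ hy c' _ hl.symm t hx.1 hx.2 rfl)
  · rw [hl]
  · subst hl; exact absurd hh (h₁ c hx)
  · exact absurd hh.symm (h₃ hy c' c hx hl.symm).2
  · subst hl; exact absurd hh.symm (h₁ c hx)
  · rw [hl]
  · exact absurd hh.symm (h₃ hy c' c hx hl.symm).1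
  · exact absurd hh.symm (h₂ hx c _ hl t' hy.1 hy.2 rfl)
  · exact absurd hh (h₃ hx c c' hy hl).2
  · exact absurd hh (h₃ hx c c' hy hl).1
  · cases c <;> cases c'
    · rfl
    · exact absurd hh (h₄ hx hl)
    · exact absurd hh.symm (h₄ hx hl.symm)
    · rfl

end Germ

end InvAut

namespace InvAut

open FreeGroup (invLetter)

variable {S : Type u}

theorem ncard_setOf_bool (p : Bool → Prop) [DecidablePred p] :
    {c | p c}.ncard = (if p false then 1 else 0) + (if p true then 1 else 0) := by
  rw [← finsum_boole, finsum_eq_sum_of_fintype, Fintype.sum_bool, add_comm]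

theorem neWeight_nil : neWeight ([] : List (S × Bool)) = 0 := if_pos rfl

theorem neWeight_of_ne {l : List (S × Bool)} (h : l ≠ []) : neWeight l = 1 := if_neg h

theorem neWeight_le_one (l : List (S × Bool)) : neWeight l ≤ 1 := by
  unfold neWeight; split_ifs <;> omega

theorem isReduced_take {w : List (S × Bool)} (h : FreeGroup.IsReduced w) (k : ℕ) :
    FreeGroup.IsReduced (w.take k) := h.infix (List.take_prefix k w).isInfix

theorem isReduced_drop {w : List (S × Bool)} (h : FreeGroup.IsReduced w) (k : ℕ) :
    FreeGroup.IsReduced (w.drop k) := h.infix (List.drop_suffix k w).isInfix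

theorem head?_take_of_ne {w : List (S × Bool)} {k : ℕ} (h : w.take k ≠ []) :
    (w.take k).head? = w.head? := by
  rcases w with _ | ⟨a, w⟩
  · simp
  · rcases k with _ | k
    · simp at h
    · rfl

section Middle

variable {X : List (S × Bool)} {i j : ℕ}

theorem length_middle : (middle i j X).length = X.length - j - i := by
  simp [middle]

theorem middle_ne_nil_iff : middle i j X ≠ [] ↔ i + j < X.length := by
  rw [← List.length_pos_iff, length_middle]
  omega

theorem head?_middle (h : i + j < X.length) : (middle i j X).head? = X[i]? := by
  rw [middle, List.head?_drop, List.getElem?_take_of_lt (by omega)]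

theorem invRev_middle (h : i + j ≤ X.length) :
    FreeGroup.invRev (middle i j X) = middle j i (FreeGroup.invRev X) := by
  have e1 : middle i j X = (X.drop i).take ((X.drop i).length - j) := by
    rw [middle, List.drop_take, List.length_drop]
    congr 1
    omega
  have e2 := FreeGroup.take_invRev (w := X) (X.length - i)
  rw [show X.length - (X.length - i) = i by omega] at e2
  rw [e1, ← FreeGroup.drop_invRev, ← e2, middle, FreeGroup.invRev_length]

theorem isReduced_middle (h : FreeGroup.IsReduced X) : FreeGroup.IsReduced (middle i j X) :=
  isReduced_drop (isReduced_take h _) _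

end Middle

section Common

variable {W : InvAut S} {α β γ : W.T} {i j k l : ℕ}

/-- As there is room for one more letter, `(i + 1, j)` would be a larger readable pair. -/
theorem not_determines_src (hij : Maximal (W.Readable α) (i, j))
    (h : i + j < (W.label α).length) :
    ¬ ∃ β' k', W.Determines {α, W.inv α} (W.src α) ((W.label α).take (i + 1)) β' k' := by
  intro h'
  have h1 : W.Readable α (i + 1, j) := ⟨h', hij.1.2.1, by simp only; omega⟩
  have h2 := (hij.2 h1 ⟨Nat.le_succ i, le_rfl⟩).1
  simp at h2

theorem not_determines_tgt (hij : Maximal (W.Readable α) (i, j))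
    (h : i + j < (W.label α).length) :
    ¬ ∃ β' k', W.Determines {α, W.inv α} (W.tgt α) ((W.label (W.inv α)).take (j + 1)) β' k' := by
  intro h'
  have h1 : W.Readable α (i, j + 1) := ⟨hij.1.1, h', by simp only; omega⟩
  have h2 := (hij.2 h1 ⟨le_rfl, Nat.le_succ j⟩).2
  simp at h2

variable {R : Set W.T} {I : Type} [Finite I] {s e : I → W.Q ⊕ Bool} {w : I → List (S × Bool)}

theorem conn_preReplace_of_remove
    (hR : ∀ t ∈ R, t ≠ α → (W.preReplace R I s e w).Conn (Sum.inl (W.src t))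
      (FreeGroup.mk (W.label t)) (Sum.inl (W.tgt t))) {x y : W.Q} {g : FreeGroup S}
    (h : (W.remove {α}).Conn x g y) :
    (W.preReplace R I s e w).Conn (Sum.inl x) g (Sum.inl y) := by
  refine Conn.map' (A := W.remove {α}) (B := W.preReplace R I s e w) Sum.inl ?_ h
  rintro ⟨t, ht, ht'⟩
  by_cases h1 : t ∈ R
  · exact hR t h1 ht
  by_cases h2 : W.inv t ∈ R
  · have := (hR _ h2 ht').symm
    rw [mk_label_inv, _root_.inv_inv] at this
    exact this.cast (congrArg Sum.inl (W.tgt_inv t)) (congrArg Sum.inl (W.src_inv t))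
  · exact Conn.single (A := W.preReplace R I s e w) (Sum.inl ⟨t, h1, h2⟩)

/-- The transition α is recovered as the product of X[:i], X[i:-j] and the inverse of X⁻¹[:j]. The
outer factors avoid α, hence survive, and the middle one is supplied by `h₃`. -/
theorem conn_preReplace_iff
    (hβ : W.LeadsTo {α, W.inv α} (W.src α) ((W.label α).take i) β k)
    (hγ : W.LeadsTo {α, W.inv α} (W.tgt α) ((W.label (W.inv α)).take j) γ l)
    (hij : i + j ≤ (W.label α).length) (z₁ z₂ : W.Q ⊕ Bool)
    (hR : ∀ t ∈ R, t ≠ α → (W.preReplace R I s e w).Conn (Sum.inl (W.src t))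
      (FreeGroup.mk (W.label t)) (Sum.inl (W.tgt t)))
    (h₁ : (W.preReplace R I s e w).Conn (Sum.inl (W.src β))
      (FreeGroup.mk ((W.label β).take k)) z₁)
    (h₂ : (W.preReplace R I s e w).Conn (Sum.inl (W.src γ))
      (FreeGroup.mk ((W.label γ).take l)) z₂)
    (h₃ : (W.preReplace R I s e w).Conn z₁ (FreeGroup.mk (middle i j (W.label α))) z₂)
    (b : Bool → W.Q) (o : Bool → FreeGroup S)
    (h : ∀ i, W.Conn (Sum.elim id b (s i)) (Sum.elim (fun _ => 1) o (s i) * FreeGroup.mk (w i)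
      * (Sum.elim (fun _ => 1) o (e i))⁻¹) (Sum.elim id b (e i))) {x y : W.Q} {g : FreeGroup S} :
    (W.preReplace R I s e w).Conn (Sum.inl x) g (Sum.inl y) ↔ W.Conn x g y := by
  refine ⟨conn_of_preReplace b o h, conn_preReplace fun t ht => ?_⟩
  by_cases hα : t = α
  · subst hα
    have c₁ := (conn_preReplace_of_remove hR hβ.conn_remove).trans h₁
    have c₂ := (conn_preReplace_of_remove hR hγ.conn_remove).trans h₂
    rw [inv_mul_cancel_right] at c₁ c₂
    have c := (c₁.trans h₃).trans c₂.symm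
    rw [W.label_inv, ← FreeGroup.mk_eq_take_middle _ hij] at c
    exact c
  · exact hR t ht hα

theorem conn_middle
    (hβ : W.LeadsTo {α, W.inv α} (W.src α) ((W.label α).take i) β k)
    (hγ : W.LeadsTo {α, W.inv α} (W.tgt α) ((W.label (W.inv α)).take j) γ l)
    (hij : i + j ≤ (W.label α).length) :
    W.Conn (W.src β) (FreeGroup.mk ((W.label β).take k) * FreeGroup.mk (middle i j (W.label α))
      * (FreeGroup.mk ((W.label γ).take l))⁻¹) (W.src γ) := by
  have h := ((conn_of_conn_remove hβ.conn_remove).symm.trans (.single α)).trans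
    (conn_of_conn_remove hγ.conn_remove)
  rw [FreeGroup.mk_eq_take_middle _ hij, W.label_inv] at h
  convert h using 1
  group

theorem LeadsTo.mem_iff {p : W.Q} {u : List (S × Bool)}
    (hβ : W.LeadsTo {α, W.inv α} p u β k) {h : Set W.Q} (hh : W.Saturated h) :
    W.src β ∈ h ↔ p ∈ h := (hh.conn (conn_of_conn_remove hβ.conn_remove)).symm

open Classical in
/-- The representative of a point of `β`. -/
noncomputable def ptRep (W : InvAut S) (β : W.T) (c : Bool) : W.Q ⊕ Bool :=
  if W.label β = [] then Sum.inl (W.src β) else Sum.inr c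

theorem ptRep_of_nil {c : Bool} (h : W.label β = []) : W.ptRep β c = Sum.inl (W.src β) := if_pos h

theorem ptRep_of_ne {c : Bool} (h : W.label β ≠ []) : W.ptRep β c = Sum.inr c := if_neg h

theorem ptRep_eq_inl {c : Bool} {y : W.Q} : W.ptRep β c = Sum.inl y ↔
    W.label β = [] ∧ W.src β = y := by
  unfold ptRep
  split_ifs with h <;> simp [h]

theorem ptRep_eq_inr {c d : Bool} : W.ptRep β c = Sum.inr d ↔ W.label β ≠ [] ∧ c = d := by
  unfold ptRep
  split_ifs with h <;> simp [h]

/-- Each non-empty transition of the result, with its direction, is encoded by the germ with which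
it starts; `unger` recovers it, so different transitions have different germs. Determinism is
thereby reduced to `Germ.eq_of_loc_of_hd`. -/
theorem germ_det_start (H : FoldSetup W α) (hα : α ∈ R) {P : Bool → W.Q ⊕ Bool} {full : Prop}
    {hb hf hm : Bool → Option (S × Bool)} {v : Bool → Prop} {vm : Prop}
    (germ : I × Bool → Germ W.T) (unger : Germ W.T → (W.preReplace R I s e w).T)
    (hun : ∀ t, w t.1 ≠ [] → unger (germ t) = Sum.inr t)
    (hun' : ∀ t, unger (.start t.1) = Sum.inl t)
    (hval : ∀ i, w i ≠ [] →
      ((germ (i, true)).Valid α v vm ∧ Sum.elim Sum.inl P (s i) = (germ (i, true)).loc P ∧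
        (w i).head? = (germ (i, true)).hd hb hf hm) ∧
      ((germ (i, false)).Valid α v vm ∧ Sum.elim Sum.inl P (e i) = (germ (i, false)).loc P ∧
        (FreeGroup.invRev (w i)).head? = (germ (i, false)).hd hb hf hm))
    (hvm : vm → ¬ full)
    (h₁ : ∀ c, v c → hb c ≠ hf c)
    (h₂ : vm → ∀ c y, P c = Sum.inl y → ∀ t, W.Off α t → W.label t ≠ [] → W.src t = y →
      (W.label t).head? ≠ hm c)
    (h₃ : vm → ∀ b c, v c → P b = Sum.inr c → hm b ≠ hf c ∧ hm b ≠ hb c)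
    (h₄ : vm → P false = P true → hm false ≠ hm true) :
    (∀ t t', (W.preReplace R I s e w).label t ≠ [] → (W.preReplace R I s e w).label t' ≠ [] →
      (Sum.elim Sum.inl P ((W.preReplace R I s e w).src t) : W.Q ⊕ Bool)
        = Sum.elim Sum.inl P ((W.preReplace R I s e w).src t') →
      ((W.preReplace R I s e w).label t).head? = ((W.preReplace R I s e w).label t').head? →
        t = t') ∧
    ∀ t y, (W.preReplace R I s e w).label t ≠ [] →
      (Sum.elim Sum.inl P ((W.preReplace R I s e w).src t) : W.Q ⊕ Bool) = Sum.inl y →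
      (∃ u, u ∉ ({α, W.inv α} : Set W.T) ∧ W.label u ≠ [] ∧ W.src u = y ∧
        ((W.preReplace R I s e w).label t).head? = (W.label u).head?) ∨
        ¬ full ∧ ∃ c, P c = Sum.inl y := by
  have key : ∀ t, (W.preReplace R I s e w).label t ≠ [] → ∃ g : Germ W.T, unger g = t ∧
      g.Valid α v vm ∧
      (Sum.elim Sum.inl P ((W.preReplace R I s e w).src t) : W.Q ⊕ Bool) = g.loc P ∧
      ((W.preReplace R I s e w).label t).head? = g.hd hb hf hm := by
    rintro (t | ⟨i, _ | _⟩) ht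
    · refine ⟨.start t.1, hun' t, ⟨?_, ht⟩, rfl, rfl⟩
      rintro (h | h)
      · exact t.2.1 (h ▸ hα)
      · exact t.2.2 (by rw [h, W.inv_inv]; exact hα)
    · have hw : w i ≠ [] := fun h => ht (by
        change FreeGroup.invRev (w i) = []
        rw [h]; rfl)
      exact ⟨germ (i, false), hun (i, false) hw, (hval i hw).2⟩
    · exact ⟨germ (i, true), hun (i, true) ht, (hval i ht).1⟩
  constructor
  · intro t t' ht ht' hl hh
    obtain ⟨g, hg, a, b, c⟩ := key t ht
    obtain ⟨g', hg', a', b', c'⟩ := key t' ht'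
    rw [← hg, ← hg', Germ.eq_of_loc_of_hd H h₁ h₂ h₃ h₄ g g' a a' (b.symm.trans (hl.trans b'))
      (c.symm.trans (hh.trans c'))]
  · intro t y ht hl
    obtain ⟨g, hg, a, b, c⟩ := key t ht
    have hloc := b.symm.trans hl
    rcases g with u | d | d | d
    · exact Or.inl ⟨u, a.1, a.2, Sum.inl_injective hloc, c⟩
    · exact absurd hloc (by simp [Germ.loc])
    · exact absurd hloc (by simp [Germ.loc])
    · exact Or.inr ⟨hvm a, d, hloc⟩

theorem ite_injective_of_forall {ι : Type} (H : FoldSetup W α) (g : ι → W.T)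
    (h : ∀ a b, a ≠ b → g a ≠ g b ∧ g a ≠ W.inv (g b)) :
    Function.Injective (fun z : ι × Bool => if z.2 then g z.1 else W.inv (g z.1)) := by
  have h1 : ∀ a b, g a = g b → a = b := fun a b e => by
    by_contra hab; exact (h a b hab).1 e
  have h2 : ∀ a b, g a ≠ W.inv (g b) := fun a b e => by
    by_cases hab : a = b
    · rw [hab] at e; exact H.inv_ne _ e.symm
    · exact (h a b hab).2 e
  rintro ⟨a, _ | _⟩ ⟨b, _ | _⟩ hab
  · rw [h1 a b (W.inv_injective hab)]
  · exact absurd hab.symm (h2 b a)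
  · exact absurd hab (h2 a b)
  · rw [h1 a b hab]

/-! Pieces of the transition which contains a point -/

theorem LeadsTo.take_ne {p : W.Q} {u : List (S × Bool)}
    (hβ : W.LeadsTo {α, W.inv α} p u β k) :
    (W.label β).take k = [] ↔ W.label β = [] := by
  rcases hβ.1 with h | h
  · have h1 : (W.label β).take k ≠ [] := by
      rw [← List.length_pos_iff, List.length_take]; omega
    have h2 : W.label β ≠ [] := by rw [← List.length_pos_iff]; omega
    simp [h1, h2]
  · simp [h.1]

theorem LeadsTo.drop_ne {p : W.Q} {u : List (S × Bool)}
    (hβ : W.LeadsTo {α, W.inv α} p u β k) :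
    (W.label β).drop k = [] ↔ W.label β = [] := by
  rcases hβ.1 with h | h
  · have h1 : (W.label β).drop k ≠ [] := by
      rw [← List.length_pos_iff, List.length_drop]; omega
    have h2 : W.label β ≠ [] := by rw [← List.length_pos_iff]; omega
    simp [h1, h2]
  · simp [h.1]

theorem LeadsTo.interior {p : W.Q} {u : List (S × Bool)}
    (hβ : W.LeadsTo {α, W.inv α} p u β k) (h : W.label β ≠ []) :
    0 < k ∧ k < (W.label β).length := by
  rcases hβ.1 with h' | h'
  · exact h'
  · exact absurd h'.1 h

theorem neWeight_congr {v w : List (S × Bool)} (h : v = [] ↔ w = []) :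
    neWeight v = neWeight w := by
  unfold neWeight; simp only [h]

theorem head?_invRev_drop {Y : List (S × Bool)} {k : ℕ} (hk : k < Y.length) :
    (FreeGroup.invRev (Y.drop k)).head? = (FreeGroup.invRev Y).head? := by
  have h := FreeGroup.take_invRev (w := Y) (Y.length - k)
  rw [Nat.sub_sub_self hk.le] at h
  rw [← h, head?_take_of_ne]
  rw [← List.length_pos_iff, List.length_take, FreeGroup.invRev_length]
  omega

end Common

end InvAut

/-! ### The fold between points of two different transitions -/

namespace InvAut

open FreeGroup (invLetter)

variable {S : Type u} {W : InvAut S} {α β γ : W.T} {i j k l : ℕ}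

theorem fin_cases_prod {n : ℕ} {P : Fin n × Bool → Prop} (h : ∀ i, P (i, true) ∧ P (i, false)) :
    ∀ t, P t := by
  rintro ⟨i, _ | _⟩
  exacts [(h i).2, (h i).1]

open Classical in
-- A point is an old state if it lies on a trivial loop and a genuinely new state otherwise. Each
-- genuinely new point divides a non-empty transition in two, so it pays for the additional piece;
-- the remainder of α takes the place of α. If the remainder is empty, α is lost, which pays for
-- gluing the two points.
theorem foldCase_separate (H : FoldSetup W α) (hij : Maximal (W.Readable α) (i, j))
    (hβ : W.LeadsTo {α, W.inv α} (W.src α) ((W.label α).take i) β k)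
    (hγ : W.LeadsTo {α, W.inv α} (W.tgt α) ((W.label (W.inv α)).take j) γ l)
    (h : β ≠ γ) (h' : β ≠ W.inv γ) :
    FoldCase W α ({α, β, γ} : Set W.T) (Fin 5)
      ![.inl (W.src β), .inr false, .inl (W.src γ), .inr true, .inr false]
      ![.inr false, .inl (W.tgt β), .inr true, .inl (W.tgt γ), .inr true]
      ![(W.label β).take k, (W.label β).drop k, (W.label γ).take l, (W.label γ).drop l,
        middle i j (W.label α)]
      (fun c => if c then W.ptRep γ c else W.ptRep β c) (middle i j (W.label α) = [])
      (Fin 3) ![α, β, γ] := by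
  set s : Fin 5 → W.Q ⊕ Bool :=
    ![.inl (W.src β), .inr false, .inl (W.src γ), .inr true, .inr false] with hs
  set e : Fin 5 → W.Q ⊕ Bool :=
    ![.inr false, .inl (W.tgt β), .inr true, .inl (W.tgt γ), .inr true] with he
  set w : Fin 5 → List (S × Bool) :=
    ![(W.label β).take k, (W.label β).drop k, (W.label γ).take l, (W.label γ).drop l,
        middle i j (W.label α)] with hw
  set R : Set W.T := {α, β, γ} with hR
  set B := W.preReplace R (Fin 5) s e w with hB
  have hle : i + j ≤ (W.label α).length := hij.1.2.2
  have oβ := hβ.off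
  have oγ := hγ.off
  have edge : ∀ n, B.Conn (s n) (FreeGroup.mk (w n)) (e n) := fun n =>
    Conn.single (A := B) (Sum.inr (n, true))
  have cβ : B.Conn (Sum.inl (W.src β)) (FreeGroup.mk (W.label β)) (Sum.inl (W.tgt β)) := by
    have := (edge 0).trans (edge 1)
    rw [show FreeGroup.mk (w 0) * FreeGroup.mk (w 1) = _ from
      FreeGroup.mk_take_mul_mk_drop (W.label β) k] at this
    exact this
  have cγ : B.Conn (Sum.inl (W.src γ)) (FreeGroup.mk (W.label γ)) (Sum.inl (W.tgt γ)) := by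
    have := (edge 2).trans (edge 3)
    rw [show FreeGroup.mk (w 2) * FreeGroup.mk (w 3) = _ from
      FreeGroup.mk_take_mul_mk_drop (W.label γ) l] at this
    exact this
  have hPf : (fun c => if c = true then W.ptRep γ c else W.ptRep β c) false = W.ptRep β false := rfl
  have hPt : (fun c => if c = true then W.ptRep γ c else W.ptRep β c) true = W.ptRep γ true := rfl
  generalize (fun c => if c = true then W.ptRep γ c else W.ptRep β c) = P at hPf hPt
  -- At each state there is only one trivial loop up to inversion, so different β and γ represent
  -- different points.
  have hPne : P false ≠ P true := by
    rw [hPf, hPt]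
    unfold ptRep
    split_ifs with h1 h2 h2
    · intro e
      rcases H.uniq β γ h1 h2 (Sum.inl_injective e) with h3 | h3
      · exact h h3
      · exact h' h3
    · simp
    · simp
    · simp
  have rα := H.red α
  have rα' := H.red (W.inv α)
  have ds : _ ∧ _ := germ_det_start (s := s) (e := e) (w := w) H (show α ∈ R from Or.inl rfl) (P := P)
    (full := middle i j (W.label α) = [])
    (hb := fun c => if c then (W.label γ)[l - 1]?.map invLetter
      else (W.label β)[k - 1]?.map invLetter)
    (hf := fun c => if c then (W.label γ)[l]? else (W.label β)[k]?)
    (hm := fun c => if c then (W.label (W.inv α))[j]? else (W.label α)[i]?)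
    (v := fun c => if c then W.label γ ≠ [] else W.label β ≠ [])
    (vm := middle i j (W.label α) ≠ [])
    -- For each of the five new transitions and its inverse, the germ with which it starts; the next
    -- function decodes the germs, with an arbitrary value on those that do not occur.
    (fun z => if z.2 then ![.start β, .fwd false, .start γ, .fwd true, .mid false] z.1
      else ![.back false, .start (W.inv β), .back true, .start (W.inv γ), .mid true] z.1)
    (fun g => match g with
      | .start t => if t = β then Sum.inr (0, true) else if t = W.inv β then Sum.inr (1, false)
        else if t = γ then Sum.inr (2, true) else if t = W.inv γ then Sum.inr (3, false)
        else if ht : t ∉ R ∧ W.inv t ∉ R then Sum.inl ⟨t, ht⟩ else Sum.inr (0, true)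
      | .back c => if c then Sum.inr (2, false) else Sum.inr (0, false)
      | .fwd c => if c then Sum.inr (3, true) else Sum.inr (1, true)
      | .mid c => if c then Sum.inr (4, false) else Sum.inr (4, true))
    ?_ ?_ ?_ ?_ ?_ ?_ ?_ ?_
  rotate_left
  · refine fin_cases_prod fun n => ?_
    have n1 := H.inv_ne β
    have n2 := H.inv_ne γ
    have n3 : W.inv β ≠ γ := fun e => h' (by rw [← e, W.inv_inv])
    have n4 : W.inv β ≠ W.inv γ := fun e => h (W.inv_injective e)
    fin_cases n <;> refine ⟨fun _ => ?_, fun _ => ?_⟩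
    · exact if_pos rfl
    · rfl
    · rfl
    · exact (if_neg n1).trans (if_pos rfl)
    · exact (if_neg h.symm).trans ((if_neg n3.symm).trans (if_pos rfl))
    · rfl
    · rfl
    · exact (if_neg h'.symm).trans ((if_neg n4.symm).trans ((if_neg n2).trans (if_pos rfl)))
    · rfl
    · rfl
  · rintro ⟨t, h1, h2⟩
    have m1 : t ≠ β := fun e => h1 (by rw [e]; exact Or.inr (Or.inl rfl))
    have m2 : t ≠ W.inv β := fun e => h2 (by rw [e, W.inv_inv]; exact Or.inr (Or.inl rfl))
    have m3 : t ≠ γ := fun e => h1 (by rw [e]; exact Or.inr (Or.inr rfl))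
    have m4 : t ≠ W.inv γ := fun e => h2 (by rw [e, W.inv_inv]; exact Or.inr (Or.inr rfl))
    exact (if_neg m1).trans ((if_neg m2).trans ((if_neg m3).trans ((if_neg m4).trans
      (dif_pos ⟨h1, h2⟩))))
  · intro n hn
    fin_cases n
    · have h0 : W.label β ≠ [] := fun e => hn (hβ.take_ne.2 e)
      have hk := hβ.interior h0
      exact ⟨⟨⟨oβ, h0⟩, rfl, head?_take_of_ne hn⟩, h0, hPf.trans (ptRep_of_ne h0),
        FreeGroup.head?_invRev_take hk.1 hk.2.le⟩
    · have h0 : W.label β ≠ [] := fun e => hn (hβ.drop_ne.2 e)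
      have hk := hβ.interior h0
      exact ⟨⟨h0, hPf.trans (ptRep_of_ne h0), List.head?_drop ..⟩,
        ⟨oβ.inv, fun e => h0 (label_inv_eq_nil.1 e)⟩, congrArg Sum.inl (W.src_inv β).symm,
        (head?_invRev_drop hk.2).trans (congrArg _ (W.label_inv β).symm)⟩
    · have h0 : W.label γ ≠ [] := fun e => hn (hγ.take_ne.2 e)
      have hk := hγ.interior h0
      exact ⟨⟨⟨oγ, h0⟩, rfl, head?_take_of_ne hn⟩, h0, hPt.trans (ptRep_of_ne h0),
        FreeGroup.head?_invRev_take hk.1 hk.2.le⟩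
    · have h0 : W.label γ ≠ [] := fun e => hn (hγ.drop_ne.2 e)
      have hk := hγ.interior h0
      exact ⟨⟨h0, hPt.trans (ptRep_of_ne h0), List.head?_drop ..⟩,
        ⟨oγ.inv, fun e => h0 (label_inv_eq_nil.1 e)⟩, congrArg Sum.inl (W.src_inv γ).symm,
        (head?_invRev_drop hk.2).trans (congrArg _ (W.label_inv γ).symm)⟩
    · have h0 := middle_ne_nil_iff.1 hn
      refine ⟨⟨hn, rfl, head?_middle h0⟩, hn, rfl, ?_⟩
      refine (congrArg List.head? (invRev_middle hle)).trans ?_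
      rw [← W.label_inv]
      exact head?_middle (by rw [W.length_label_inv]; omega)
  · exact fun h => h
  · rintro (_ | _) hc
    · have hk := hβ.interior hc
      have := (H.red β).getElem?_succ_ne (n := k - 1) (by omega)
      rw [Nat.sub_add_cancel (by omega)] at this
      exact this.symm
    · have hk := hγ.interior hc
      have := (H.red γ).getElem?_succ_ne (n := l - 1) (by omega)
      rw [Nat.sub_add_cancel (by omega)] at this
      exact this.symm
  · rintro hm (_ | _) y hy t ht ht0 hts
    · rw [hPf, ptRep_eq_inl] at hy
      exact hβ.head?_ne H (not_determines_src hij (middle_ne_nil_iff.1 hm)) hy.1 t ht ht0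
        (hts.trans hy.2.symm)
    · rw [hPt, ptRep_eq_inl] at hy
      exact hγ.head?_ne H (not_determines_tgt hij (middle_ne_nil_iff.1 hm)) hy.1 t ht ht0
        (hts.trans hy.2.symm)
  · intro hm b c hc hbc
    have h0 := middle_ne_nil_iff.1 hm
    cases b
    · rw [hPf, ptRep_eq_inr] at hbc
      obtain ⟨h1, rfl⟩ := hbc
      exact hβ.getElem?_ne rα (by omega) (not_determines_src hij h0) (hβ.interior h1)
    · rw [hPt, ptRep_eq_inr] at hbc
      obtain ⟨h1, rfl⟩ := hbc
      exact hγ.getElem?_ne rα' (by rw [W.length_label_inv]; omega) (not_determines_tgt hij h0)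
        (hγ.interior h1)
  · intro _ h; exact absurd h hPne
  have src_mem : ∀ {k : Set W.Q}, W.Saturated k → (W.tgt α ∈ k ↔ W.src α ∈ k) := fun hk =>
    (hk.src_iff_tgt α).symm
  refine { setup := H, conn := ?_, inr := ?_, emp := ?_, quot_inl := ?_, quot_full := ?_,
           red := ?_, det := ds.1, start := ds.2, isol := ?_, isol_src := ?_, isol_tgt := ?_,
           mem_s := ?_, mem_e := ?_, mem_g := ?_, inj := ?_, g_mem := ?_, count := ?_,
           count_full := ?_, length := ?_, length_full := ?_ }
  · refine conn_preReplace_iff hβ hγ hle (Sum.inr false) (Sum.inr true) ?_ (edge 0) (edge 2)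
      (edge 4) (fun c => if c then W.src γ else W.src β)
      (fun c => if c then FreeGroup.mk ((W.label γ).take l) else FreeGroup.mk ((W.label β).take k))
      ?_
    · rintro t (rfl | rfl | rfl) ht
      · exact absurd rfl ht
      · exact cβ
      · exact cγ
    · intro n
      fin_cases n
      · change W.Conn (W.src β) (1 * FreeGroup.mk ((W.label β).take k) * (FreeGroup.mk ((W.label β).take k))⁻¹) (W.src β)
        rw [one_mul, mul_inv_cancel]
        exact .nil _
      · change W.Conn (W.src β) (FreeGroup.mk ((W.label β).take k) * FreeGroup.mk ((W.label β).drop k) * 1⁻¹) (W.tgt β)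
        rw [FreeGroup.mk_take_mul_mk_drop, inv_one, mul_one]
        exact .single β
      · change W.Conn (W.src γ) (1 * FreeGroup.mk ((W.label γ).take l) * (FreeGroup.mk ((W.label γ).take l))⁻¹) (W.src γ)
        rw [one_mul, mul_inv_cancel]
        exact .nil _
      · change W.Conn (W.src γ) (FreeGroup.mk ((W.label γ).take l) * FreeGroup.mk ((W.label γ).drop l) * 1⁻¹) (W.tgt γ)
        rw [FreeGroup.mk_take_mul_mk_drop, inv_one, mul_one]
        exact .single γ
      · exact conn_middle hβ hγ hle
  · rintro (_ | _)
    · exact ⟨_, _, (edge 0).symm⟩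
    · exact ⟨_, _, (edge 2).symm⟩
  · intro n hn
    fin_cases n
    · left
      exact ((ptRep_of_nil (hβ.take_ne.1 hn)).symm.trans hPf.symm)
    · left
      have h0 := hβ.drop_ne.1 hn
      exact hPf.trans ((ptRep_of_nil h0).trans (congrArg Sum.inl (H.triv β h0)))
    · left
      exact ((ptRep_of_nil (hγ.take_ne.1 hn)).symm.trans hPt.symm)
    · left
      have h0 := hγ.drop_ne.1 hn
      exact hPt.trans ((ptRep_of_nil h0).trans (congrArg Sum.inl (H.triv γ h0)))
    · exact Or.inr ⟨hn, rfl, rfl⟩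
  · rintro (_ | _) y hy
    · rw [hPf, ptRep_eq_inl] at hy
      refine Quot.sound ⟨Sum.inr (0, false), rfl, congrArg Sum.inl hy.2, ?_⟩
      change FreeGroup.invRev ((W.label β).take k) = []
      rw [hy.1]; simp [FreeGroup.invRev]
    · rw [hPt, ptRep_eq_inl] at hy
      refine Quot.sound ⟨Sum.inr (2, false), rfl, congrArg Sum.inl hy.2, ?_⟩
      change FreeGroup.invRev ((W.label γ).take l) = []
      rw [hy.1]; simp [FreeGroup.invRev]
  · intro hf
    exact ⟨Sum.inr (4, true), rfl, rfl, hf⟩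
  · intro n
    fin_cases n
    · exact isReduced_take (H.red β) k
    · exact isReduced_drop (H.red β) k
    · exact isReduced_take (H.red γ) l
    · exact isReduced_drop (H.red γ) l
    · exact isReduced_middle rα
  · rintro (_ | _) y hy
    · rw [hPf, ptRep_eq_inl] at hy
      rw [← hy.2]
      exact (hβ.isol H hy.1).imp id Or.inl
    · rw [hPt, ptRep_eq_inl] at hy
      rw [← hy.2]
      exact (hγ.isol H hy.1).imp id Or.inr
  · intro hp _
    have := hβ.of_not_hasOff H hp
    rw [hPf, ptRep_of_nil this.1, this.2]
  · intro hp _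
    have := hγ.of_not_hasOff H hp
    rw [hPt, ptRep_of_nil this.1, this.2]
  · intro m hm n
    fin_cases n
    · exact hβ.mem_iff hm
    · exact Iff.rfl
    · exact (hγ.mem_iff hm).trans (src_mem hm)
    · exact Iff.rfl
    · exact Iff.rfl
  · intro m hm n
    fin_cases n
    · exact Iff.rfl
    · exact (hm.src_iff_tgt β).symm.trans (hβ.mem_iff hm)
    · exact Iff.rfl
    · exact (hm.src_iff_tgt γ).symm.trans ((hγ.mem_iff hm).trans (src_mem hm))
    · exact Iff.rfl
  · intro m hm n
    fin_cases n
    · exact Iff.rfl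
    · exact hβ.mem_iff hm
    · exact (hγ.mem_iff hm).trans (src_mem hm)
  · apply ite_injective_of_forall H
    have n1 : α ≠ β := fun e => oβ (Or.inl e.symm)
    have n2 : α ≠ γ := fun e => oγ (Or.inl e.symm)
    have n3 : α ≠ W.inv β := fun e => oβ.inv (Or.inl e.symm)
    have n4 : α ≠ W.inv γ := fun e => oγ.inv (Or.inl e.symm)
    have n5 : β ≠ W.inv α := fun e => oβ (Or.inr e)
    have n6 : γ ≠ W.inv α := fun e => oγ (Or.inr e)
    have n7 : γ ≠ W.inv β := fun e => h' (by rw [e, W.inv_inv])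
    intro a b hab
    fin_cases a <;> fin_cases b
    · exact absurd rfl hab
    · exact ⟨n1, n3⟩
    · exact ⟨n2, n4⟩
    · exact ⟨n1.symm, n5⟩
    · exact absurd rfl hab
    · exact ⟨h, h'⟩
    · exact ⟨n2.symm, n6⟩
    · exact ⟨h.symm, n7⟩
    · exact absurd rfl hab
  · intro n
    fin_cases n
    · exact Or.inl rfl
    · exact Or.inr (Or.inl rfl)
    · exact Or.inr (Or.inr rfl)
  all_goals
    have nc : {c | P c = Sum.inr c}.ncard = neWeight (W.label β) + neWeight (W.label γ) := by
      rw [ncard_setOf_bool, hPf, hPt]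
      simp only [ptRep_eq_inr, and_true, neWeight, ite_not]
    have a1 := neWeight_congr hβ.take_ne
    have a2 := neWeight_congr hβ.drop_ne
    have a3 := neWeight_congr hγ.take_ne
    have a4 := neWeight_congr hγ.drop_ne
    have a5 := neWeight_of_ne H.ne
    have a6 := neWeight_le_one (middle i j (W.label α))
    have lβ := hβ.le
    have lγ := hγ.le
    have lm := length_middle (i := i) (j := j) (X := W.label α)
    try intro hf
    rw [finsum_eq_sum_of_fintype, Fin.sum_univ_five, Fin.sum_univ_three]
  · rw [nc]
    change neWeight ((W.label β).take k) + neWeight ((W.label β).drop k)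
      + neWeight ((W.label γ).take l) + neWeight ((W.label γ).drop l)
      + neWeight (middle i j (W.label α)) ≤ neWeight (W.label α) + neWeight (W.label β)
      + neWeight (W.label γ) + _
    omega
  · have a7 : neWeight (middle i j (W.label α)) = 0 := by rw [hf, neWeight_nil]
    rw [nc]
    change neWeight ((W.label β).take k) + neWeight ((W.label β).drop k)
      + neWeight ((W.label γ).take l) + neWeight ((W.label γ).drop l)
      + neWeight (middle i j (W.label α)) + 1 ≤ neWeight (W.label α) + neWeight (W.label β)
      + neWeight (W.label γ) + _
    omega
  · change ((W.label β).take k).length + ((W.label β).drop k).length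
      + ((W.label γ).take l).length + ((W.label γ).drop l).length
      + (middle i j (W.label α)).length ≤ (W.label α).length + (W.label β).length
      + (W.label γ).length
    simp only [List.length_take, List.length_drop]
    omega
  · change ((W.label β).take k).length + ((W.label β).drop k).length
      + ((W.label γ).take l).length + ((W.label γ).drop l).length
      + (middle i j (W.label α)).length + (W.label α).length ≤ (W.label α).length
      + (W.label β).length + (W.label γ).length
    rw [hf]
    simp only [List.length_take, List.length_drop, List.length_nil]
    omega

end InvAut

/-! ### The fold between two points of the same transition -/

namespace InvAut

open FreeGroup (invLetter)

variable {S : Type u} {W : InvAut S} {α β γ : W.T} {i j k l : ℕ}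

open Classical in
-- Because of `k < l` the label of β is not empty, so both points are interior, both new states are
-- genuinely new, and β is divided into three non-empty pieces.
theorem foldCase_same (H : FoldSetup W α) (hij : Maximal (W.Readable α) (i, j))
    (hβ : W.LeadsTo {α, W.inv α} (W.src α) ((W.label α).take i) β k)
    (hγ : W.LeadsTo {α, W.inv α} (W.tgt α) ((W.label (W.inv α)).take j) β l)
    (h : k < l) :
    FoldCase W α ({α, β} : Set W.T) (Fin 4)
      ![.inl (W.src β), .inr false, .inr true, .inr false]
      ![.inr false, .inr true, .inl (W.tgt β), .inr true]
      ![(W.label β).take k, ((W.label β).take l).drop k, (W.label β).drop l,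
        middle i j (W.label α)]
      Sum.inr (middle i j (W.label α) = []) (Fin 2) ![α, β] := by
  set s : Fin 4 → W.Q ⊕ Bool := ![.inl (W.src β), .inr false, .inr true, .inr false] with hs
  set e : Fin 4 → W.Q ⊕ Bool := ![.inr false, .inr true, .inl (W.tgt β), .inr true] with he
  set w : Fin 4 → List (S × Bool) :=
    ![(W.label β).take k, ((W.label β).take l).drop k, (W.label β).drop l,
        middle i j (W.label α)] with hw
  set R : Set W.T := {α, β} with hR
  set B := W.preReplace R (Fin 4) s e w with hB
  have hle : i + j ≤ (W.label α).length := hij.1.2.2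
  have oβ := hβ.off
  have hne : W.label β ≠ [] := fun e => by
    have := hγ.le
    rw [e, List.length_nil] at this
    omega
  have hk := hβ.interior hne
  have hl := hγ.interior hne
  have n1 := H.inv_ne β
  have hmid : ((W.label β).take l).drop k ≠ [] := by
    rw [← List.length_pos_iff, List.length_drop, List.length_take]
    omega
  have emid : FreeGroup.mk ((W.label β).take k) * FreeGroup.mk (((W.label β).take l).drop k)
      = FreeGroup.mk ((W.label β).take l) := by
    have : (W.label β).take k = ((W.label β).take l).take k := by
      rw [List.take_take, min_eq_left h.le]
    rw [this, FreeGroup.mk_take_mul_mk_drop]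
  have edge : ∀ n, B.Conn (s n) (FreeGroup.mk (w n)) (e n) := fun n =>
    Conn.single (A := B) (Sum.inr (n, true))
  have cl : B.Conn (Sum.inl (W.src β)) (FreeGroup.mk ((W.label β).take l)) (Sum.inr true) := by
    have := (edge 0).trans (edge 1)
    rw [show FreeGroup.mk (w 0) * FreeGroup.mk (w 1) = _ from emid] at this
    exact this
  have cβ : B.Conn (Sum.inl (W.src β)) (FreeGroup.mk (W.label β)) (Sum.inl (W.tgt β)) := by
    have := cl.trans (edge 2)
    rw [show FreeGroup.mk ((W.label β).take l) * FreeGroup.mk (w 2) = _ from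
      FreeGroup.mk_take_mul_mk_drop (W.label β) l] at this
    exact this
  have rα := H.red α
  have rα' := H.red (W.inv α)
  have ds : _ ∧ _ := germ_det_start (s := s) (e := e) (w := w) H (show α ∈ R from Or.inl rfl)
    (P := Sum.inr) (full := middle i j (W.label α) = [])
    (hb := fun c => if c then (W.label β)[l - 1]?.map invLetter
      else (W.label β)[k - 1]?.map invLetter)
    (hf := fun c => if c then (W.label β)[l]? else (W.label β)[k]?)
    (hm := fun c => if c then (W.label (W.inv α))[j]? else (W.label α)[i]?)
    (v := fun _ => True)
    (vm := middle i j (W.label α) ≠ [])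
    (fun z => if z.2 then ![.start β, .fwd false, .fwd true, .mid false] z.1
      else ![.back false, .back true, .start (W.inv β), .mid true] z.1)
    (fun g => match g with
      | .start t => if t = β then Sum.inr (0, true) else if t = W.inv β then Sum.inr (2, false)
        else if ht : t ∉ R ∧ W.inv t ∉ R then Sum.inl ⟨t, ht⟩ else Sum.inr (0, true)
      | .back c => if c then Sum.inr (1, false) else Sum.inr (0, false)
      | .fwd c => if c then Sum.inr (2, true) else Sum.inr (1, true)
      | .mid c => if c then Sum.inr (3, false) else Sum.inr (3, true))
    ?_ ?_ ?_ ?_ ?_ ?_ ?_ ?_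
  rotate_left
  · refine fin_cases_prod fun n => ?_
    fin_cases n <;> refine ⟨fun _ => ?_, fun _ => ?_⟩
    · exact if_pos rfl
    · rfl
    · rfl
    · rfl
    · rfl
    · exact (if_neg n1).trans (if_pos rfl)
    · rfl
    · rfl
  · rintro ⟨t, h1, h2⟩
    have m1 : t ≠ β := fun e => h1 (by rw [e]; exact Or.inr rfl)
    have m2 : t ≠ W.inv β := fun e => h2 (by rw [e, W.inv_inv]; exact Or.inr rfl)
    exact (if_neg m1).trans ((if_neg m2).trans (dif_pos ⟨h1, h2⟩))
  · intro n hn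
    fin_cases n
    · exact ⟨⟨⟨oβ, hne⟩, rfl, head?_take_of_ne hn⟩, trivial, rfl,
        FreeGroup.head?_invRev_take hk.1 hk.2.le⟩
    · refine ⟨⟨trivial, rfl, ?_⟩, trivial, rfl, ?_⟩
      · change (((W.label β).take l).drop k).head? = (W.label β)[k]?
        rw [List.head?_drop, List.getElem?_take_of_lt h]
      · change (FreeGroup.invRev (((W.label β).take l).drop k)).head?
          = (W.label β)[l - 1]?.map invLetter
        have hlen : ((W.label β).take l).length = l := by rw [List.length_take]; omega
        rw [head?_invRev_drop (by rw [hlen]; exact h), FreeGroup.head?_invRev_take hl.1 hl.2.le]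
    · exact ⟨⟨trivial, rfl, List.head?_drop ..⟩,
        ⟨oβ.inv, fun e => hne (label_inv_eq_nil.1 e)⟩, congrArg Sum.inl (W.src_inv β).symm,
        (head?_invRev_drop hl.2).trans (congrArg _ (W.label_inv β).symm)⟩
    · have h0 := middle_ne_nil_iff.1 hn
      refine ⟨⟨hn, rfl, head?_middle h0⟩, hn, rfl, ?_⟩
      refine (congrArg List.head? (invRev_middle hle)).trans ?_
      rw [← W.label_inv]
      exact head?_middle (by rw [W.length_label_inv]; omega)
  · exact fun h => h
  · rintro (_ | _) hc
    · have := (H.red β).getElem?_succ_ne (n := k - 1) (by omega)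
      rw [Nat.sub_add_cancel (by omega)] at this
      exact this.symm
    · have := (H.red β).getElem?_succ_ne (n := l - 1) (by omega)
      rw [Nat.sub_add_cancel (by omega)] at this
      exact this.symm
  · intro hm c y hy
    exact absurd hy (by simp)
  · intro hm b c hc hbc
    have h0 := middle_ne_nil_iff.1 hm
    obtain rfl := Sum.inr_injective hbc
    cases b
    · exact hβ.getElem?_ne rα (by omega) (not_determines_src hij h0) hk
    · exact hγ.getElem?_ne rα' (by rw [W.length_label_inv]; omega) (not_determines_tgt hij h0) hl
  · intro _ h; exact absurd h (by simp)
  have src_mem : ∀ {k : Set W.Q}, W.Saturated k → (W.tgt α ∈ k ↔ W.src α ∈ k) := fun hk =>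
    (hk.src_iff_tgt α).symm
  refine { setup := H, conn := ?_, inr := ?_, emp := ?_, quot_inl := ?_, quot_full := ?_,
           red := ?_, det := ds.1, start := ds.2, isol := ?_, isol_src := ?_, isol_tgt := ?_,
           mem_s := ?_, mem_e := ?_, mem_g := ?_, inj := ?_, g_mem := ?_, count := ?_,
           count_full := ?_, length := ?_, length_full := ?_ }
  · refine conn_preReplace_iff hβ hγ hle (Sum.inr false) (Sum.inr true) ?_ (edge 0) cl
      (edge 3) (fun _ => W.src β)
      (fun c => if c then FreeGroup.mk ((W.label β).take l) else FreeGroup.mk ((W.label β).take k))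
      ?_
    · rintro t (rfl | rfl) ht
      · exact absurd rfl ht
      · exact cβ
    · intro n
      fin_cases n
      · change W.Conn (W.src β) (1 * FreeGroup.mk ((W.label β).take k) * (FreeGroup.mk ((W.label β).take k))⁻¹) (W.src β)
        rw [one_mul, mul_inv_cancel]
        exact .nil _
      · change W.Conn (W.src β) (FreeGroup.mk ((W.label β).take k) * FreeGroup.mk (((W.label β).take l).drop k) * (FreeGroup.mk ((W.label β).take l))⁻¹) (W.src β)
        rw [emid, mul_inv_cancel]
        exact .nil _
      · change W.Conn (W.src β) (FreeGroup.mk ((W.label β).take l) * FreeGroup.mk ((W.label β).drop l) * 1⁻¹) (W.tgt β)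
        rw [FreeGroup.mk_take_mul_mk_drop, inv_one, mul_one]
        exact .single β
      · exact conn_middle hβ hγ hle
  · rintro (_ | _)
    · exact ⟨_, _, (edge 0).symm⟩
    · exact ⟨_, _, cl.symm⟩
  · intro n hn
    fin_cases n
    · exact absurd (hβ.take_ne.1 hn) hne
    · exact absurd hn hmid
    · exact absurd (hγ.drop_ne.1 hn) hne
    · exact Or.inr ⟨hn, rfl, rfl⟩
  · intro c y hy
    exact absurd hy (by simp)
  · intro hf
    exact ⟨Sum.inr (3, true), rfl, rfl, hf⟩
  · intro n
    fin_cases n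
    · exact isReduced_take (H.red β) k
    · exact isReduced_drop (isReduced_take (H.red β) l) k
    · exact isReduced_drop (H.red β) l
    · exact isReduced_middle rα
  · intro c y hy
    exact absurd hy (by simp)
  · intro hp _
    exact absurd (hβ.of_not_hasOff H hp).1 hne
  · intro hp _
    exact absurd (hγ.of_not_hasOff H hp).1 hne
  · intro m hm n
    fin_cases n
    · exact hβ.mem_iff hm
    · exact Iff.rfl
    · exact Iff.rfl
    · exact Iff.rfl
  · intro m hm n
    fin_cases n
    · exact Iff.rfl
    · exact Iff.rfl
    · exact (hm.src_iff_tgt β).symm.trans (hβ.mem_iff hm)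
    · exact Iff.rfl
  · intro m hm n
    fin_cases n
    · exact Iff.rfl
    · exact hβ.mem_iff hm
  · apply ite_injective_of_forall H
    have n1 : α ≠ β := fun e => oβ (Or.inl e.symm)
    have n3 : α ≠ W.inv β := fun e => oβ.inv (Or.inl e.symm)
    have n5 : β ≠ W.inv α := fun e => oβ (Or.inr e)
    intro a b hab
    fin_cases a <;> fin_cases b
    · exact absurd rfl hab
    · exact ⟨n1, n3⟩
    · exact ⟨n1.symm, n5⟩
    · exact absurd rfl hab
  · intro n
    fin_cases n
    · exact Or.inl rfl
    · exact Or.inr rfl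
  all_goals
    have nc : {c : Bool | (Sum.inr c : W.Q ⊕ Bool) = Sum.inr c}.ncard = 2 := by
      rw [ncard_setOf_bool, if_pos rfl, if_pos rfl]
    have a1 := neWeight_le_one ((W.label β).take k)
    have a2 := neWeight_le_one (((W.label β).take l).drop k)
    have a4 := neWeight_le_one ((W.label β).drop l)
    have a3 := neWeight_of_ne hne
    have a5 := neWeight_of_ne H.ne
    have a6 := neWeight_le_one (middle i j (W.label α))
    have lm := length_middle (i := i) (j := j) (X := W.label α)
    try intro hf
    rw [finsum_eq_sum_of_fintype, Fin.sum_univ_four, Fin.sum_univ_two]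
  · rw [nc]
    change neWeight ((W.label β).take k) + neWeight (((W.label β).take l).drop k)
      + neWeight ((W.label β).drop l)
      + neWeight (middle i j (W.label α)) ≤ neWeight (W.label α) + neWeight (W.label β) + _
    omega
  · have a7 : neWeight (middle i j (W.label α)) = 0 := by rw [hf, neWeight_nil]
    rw [nc]
    change neWeight ((W.label β).take k) + neWeight (((W.label β).take l).drop k)
      + neWeight ((W.label β).drop l)
      + neWeight (middle i j (W.label α)) + 1 ≤ neWeight (W.label α) + neWeight (W.label β) + _
    omega
  · change ((W.label β).take k).length + (((W.label β).take l).drop k).length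
      + ((W.label β).drop l).length
      + (middle i j (W.label α)).length ≤ (W.label α).length + (W.label β).length
    simp only [List.length_take, List.length_drop]
    omega
  · change ((W.label β).take k).length + (((W.label β).take l).drop k).length
      + ((W.label β).drop l).length
      + (middle i j (W.label α)).length + (W.label α).length ≤ (W.label α).length
      + (W.label β).length
    rw [hf]
    simp only [List.length_take, List.length_drop, List.length_nil]
    omega

end InvAut

/-! ### The fold at a single point -/

namespace InvAut

open FreeGroup (invLetter)

variable {S : Type u} {W : InvAut S} {α β γ : W.T} {i j k l : ℕ}

theorem mk_middle_eq (X : List (S × Bool)) (i j m : ℕ) (h : i + j + 2 * m ≤ X.length) :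
    FreeGroup.mk (middle i j X) = FreeGroup.mk ((X.take (i + m)).drop i)
      * FreeGroup.mk (middle (i + m) (j + m) X)
      * (FreeGroup.mk (((FreeGroup.invRev X).take (j + m)).drop j))⁻¹ := by
  have h1 := FreeGroup.mk_eq_take_middle X (i := i) (j := j) (by omega)
  have h2 := FreeGroup.mk_eq_take_middle X (i := i + m) (j := j + m) (by omega)
  have key : ∀ (Y : List (S × Bool)) (a : ℕ), FreeGroup.mk (Y.take (a + m))
      = FreeGroup.mk (Y.take a) * FreeGroup.mk ((Y.take (a + m)).drop a) := by
    intro Y a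
    have e : Y.take a = (Y.take (a + m)).take a := by
      rw [List.take_take, min_eq_left (by omega)]
    rw [e, FreeGroup.mk_take_mul_mk_drop]
  rw [key X i, key (FreeGroup.invRev X) j, h1] at h2
  rw [mul_inv_rev] at h2
  have h3 := congrArg (fun g => (FreeGroup.mk (X.take i))⁻¹ * g
    * FreeGroup.mk ((FreeGroup.invRev X).take j)) h2
  simp only [mul_assoc, inv_mul_cancel_left, inv_mul_cancel, mul_one] at h3
  rw [h3, mul_assoc]

/-- According to the number of letters left after cancelling: if there are at least two, equality
would contradict the maximality of `m`; if there is one, a letter is not its own inverse; if there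
is none, X is reduced. -/
theorem getElem?_ne_of_maximal_cancels {m : ℕ} (H : FoldSetup W α)
    (hm : Maximal (W.Cancels α i j) m) (h : i + j < (W.label α).length) :
    (W.label α)[i + m]? ≠ (W.label (W.inv α))[j + m]? := by
  have hle := hm.1.1
  have heq := hm.1.2
  have rα := H.red α
  rw [W.label_inv, FreeGroup.getElem?_invRev (by omega)]
  rcases Nat.lt_or_ge (i + j + 2 * m + 1) (W.label α).length with h1 | h1
  · intro e
    have : W.Cancels α i j (m + 1) := by
      refine ⟨by omega, ?_⟩
      rw [← add_assoc, ← add_assoc, List.take_add_one, List.take_add_one, List.drop_append,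
        List.drop_append, heq, e, W.label_inv, FreeGroup.getElem?_invRev (by omega)]
      congr 1
      rw [List.length_take, List.length_take, FreeGroup.invRev_length]
      congr 1
      omega
    have := hm.2 this (Nat.le_succ m)
    omega
  · rcases Nat.lt_or_ge (i + j + 2 * m) (W.label α).length with h2 | h2
    · have e : (W.label α).length - 1 - (j + m) = i + m := by omega
      rw [e, List.getElem?_eq_getElem (by omega), Option.map_some]
      simpa using (FreeGroup.invLetter_ne _).symm
    · have e : (W.label α).length - 1 - (j + m) = i + m - 1 := by omega
      have := rα.getElem?_succ_ne (n := i + m - 1) (by omega)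
      rw [e]
      rwa [Nat.sub_add_cancel (by omega)] at this

open Classical in
-- The remainder X[i:-j] has the form U V U⁻¹ with U of length `m`. It becomes a stem U with a loop
-- V at its end, and running along stem, loop and stem again recovers it. Different points are never
-- glued here, so `full` is `False`. For `m = 0` the stem is empty and `q'` is represented like
-- `p'`.
theorem foldCase_point {m : ℕ} (H : FoldSetup W α) (hij : Maximal (W.Readable α) (i, j))
    (hβ : W.LeadsTo {α, W.inv α} (W.src α) ((W.label α).take i) β k)
    (hγ : W.LeadsTo {α, W.inv α} (W.tgt α) ((W.label (W.inv α)).take j) β k)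
    (hm : Maximal (W.Cancels α i j) m) :
    FoldCase W α ({α, β} : Set W.T) (Fin 4)
      ![.inl (W.src β), .inr false, .inr false, .inr true]
      ![.inr false, .inl (W.tgt β), .inr true, .inr true]
      ![(W.label β).take k, (W.label β).drop k, ((W.label α).take (i + m)).drop i,
        middle (i + m) (j + m) (W.label α)]
      (fun c => if c ∧ m ≠ 0 then Sum.inr true else W.ptRep β false) False (Fin 2) ![α, β] := by
  set s : Fin 4 → W.Q ⊕ Bool := ![.inl (W.src β), .inr false, .inr false, .inr true] with hs
  set e : Fin 4 → W.Q ⊕ Bool := ![.inr false, .inl (W.tgt β), .inr true, .inr true] with he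
  set w : Fin 4 → List (S × Bool) :=
    ![(W.label β).take k, (W.label β).drop k, ((W.label α).take (i + m)).drop i,
        middle (i + m) (j + m) (W.label α)] with hw
  set R : Set W.T := {α, β} with hR
  set B := W.preReplace R (Fin 4) s e w with hB
  have hle : i + j ≤ (W.label α).length := hij.1.2.2
  have hlem := hm.1.1
  have hcan := hm.1.2
  have oβ := hβ.off
  have n1 := H.inv_ne β
  have hlenU : (((W.label α).take (i + m)).drop i).length = m := by
    rw [List.length_drop, List.length_take]; omega
  have hU : ((W.label α).take (i + m)).drop i = [] ↔ m = 0 := by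
    rw [← List.length_eq_zero_iff, hlenU]
  have emid : FreeGroup.mk (middle i j (W.label α)) = FreeGroup.mk (((W.label α).take (i + m)).drop i)
      * FreeGroup.mk (middle (i + m) (j + m) (W.label α))
      * (FreeGroup.mk (((W.label α).take (i + m)).drop i))⁻¹ := by
    rw [mk_middle_eq _ i j m hlem, ← W.label_inv, ← hcan]
  have edge : ∀ n, B.Conn (s n) (FreeGroup.mk (w n)) (e n) := fun n =>
    Conn.single (A := B) (Sum.inr (n, true))
  have cm : B.Conn (Sum.inr false) (FreeGroup.mk (middle i j (W.label α))) (Sum.inr false) := by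
    rw [emid]
    exact ((edge 2).trans (edge 3)).trans (edge 2).symm
  have cβ : B.Conn (Sum.inl (W.src β)) (FreeGroup.mk (W.label β)) (Sum.inl (W.tgt β)) := by
    have := (edge 0).trans (edge 1)
    rw [show FreeGroup.mk (w 0) * FreeGroup.mk (w 1) = _ from
      FreeGroup.mk_take_mul_mk_drop (W.label β) k] at this
    exact this
  have rα := H.red α
  have rα' := H.red (W.inv α)
  have hPf : (fun c : Bool => if c ∧ m ≠ 0 then Sum.inr true else W.ptRep β false) false
      = W.ptRep β false := if_neg (by simp)
  have hPt : m = 0 → (fun c : Bool => if c ∧ m ≠ 0 then Sum.inr true else W.ptRep β false) true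
      = W.ptRep β false := fun h => if_neg (by simp [h])
  have hPt' : m ≠ 0 → (fun c : Bool => if c ∧ m ≠ 0 then Sum.inr true else W.ptRep β false) true
      = Sum.inr true := fun h => if_pos ⟨rfl, h⟩
  generalize (fun c : Bool => if c ∧ m ≠ 0 then Sum.inr true else W.ptRep β false) = P
    at hPf hPt hPt'
  have hPinl : ∀ c y, P c = Sum.inl y → W.label β = [] ∧ W.src β = y ∧ (c = true → m = 0) := by
    rintro (_ | _) y hy
    · rw [hPf, ptRep_eq_inl] at hy
      exact ⟨hy.1, hy.2, fun h => absurd h (by simp)⟩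
    · by_cases h : m = 0
      · rw [hPt h, ptRep_eq_inl] at hy
        exact ⟨hy.1, hy.2, fun _ => h⟩
      · rw [hPt' h] at hy
        exact absurd hy (by simp)
  have ds : _ ∧ _ := germ_det_start (s := s) (e := e) (w := w) H (show α ∈ R from Or.inl rfl)
    (P := P) (full := False)
    (hb := fun c => if c then (W.label α)[i + m - 1]?.map invLetter
      else (W.label β)[k - 1]?.map invLetter)
    (hf := fun c => if c then (W.label α)[i + m]? else (W.label β)[k]?)
    (hm := fun c => if c then (W.label (W.inv α))[j + m]? else (W.label α)[i]?)
    (v := fun c => if c then m ≠ 0 else W.label β ≠ [])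
    (vm := i + j < (W.label α).length)
    -- Without a stem the loop itself starts at the point of β, so it takes over the germ of the
    -- stem.
    (fun z => if z.2 then ![.start β, .fwd false, .mid false,
        if m = 0 then .mid false else .fwd true] z.1
      else ![.back false, .start (W.inv β), .back true, .mid true] z.1)
    (fun g => match g with
      | .start t => if t = β then Sum.inr (0, true) else if t = W.inv β then Sum.inr (1, false)
        else if ht : t ∉ R ∧ W.inv t ∉ R then Sum.inl ⟨t, ht⟩ else Sum.inr (0, true)
      | .back c => if c then Sum.inr (2, false) else Sum.inr (0, false)
      | .fwd c => if c then Sum.inr (3, true) else Sum.inr (1, true)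
      | .mid c => if c then Sum.inr (3, false)
        else if m = 0 then Sum.inr (3, true) else Sum.inr (2, true))
    ?_ ?_ ?_ ?_ ?_ ?_ ?_ ?_
  rotate_left
  · refine fin_cases_prod fun n => ?_
    fin_cases n <;> refine ⟨fun hn => ?_, fun _ => ?_⟩
    · exact if_pos rfl
    · rfl
    · rfl
    · exact (if_neg n1).trans (if_pos rfl)
    · exact if_neg fun h => hn (hU.2 h)
    · rfl
    · by_cases h : m = 0 <;> simp [h] <;> rfl
    · rfl
  · rintro ⟨t, h1, h2⟩
    have m1 : t ≠ β := fun e => h1 (by rw [e]; exact Or.inr rfl)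
    have m2 : t ≠ W.inv β := fun e => h2 (by rw [e, W.inv_inv]; exact Or.inr rfl)
    exact (if_neg m1).trans ((if_neg m2).trans (dif_pos ⟨h1, h2⟩))
  · intro n hn
    fin_cases n
    · have h0 : W.label β ≠ [] := fun e => hn (hβ.take_ne.2 e)
      have hk := hβ.interior h0
      exact ⟨⟨⟨oβ, h0⟩, rfl, head?_take_of_ne hn⟩, h0, hPf.trans (ptRep_of_ne h0),
        FreeGroup.head?_invRev_take hk.1 hk.2.le⟩
    · have h0 : W.label β ≠ [] := fun e => hn (hβ.drop_ne.2 e)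
      have hk := hβ.interior h0
      exact ⟨⟨h0, hPf.trans (ptRep_of_ne h0), List.head?_drop ..⟩,
        ⟨oβ.inv, fun e => h0 (label_inv_eq_nil.1 e)⟩, congrArg Sum.inl (W.src_inv β).symm,
        (head?_invRev_drop hk.2).trans (congrArg _ (W.label_inv β).symm)⟩
    · have h0 : m ≠ 0 := fun e => hn (hU.2 e)
      refine ⟨⟨?_, rfl, ?_⟩, h0, hPt' h0, ?_⟩
      · change i + j < (W.label α).length
        omega
      · change (((W.label α).take (i + m)).drop i).head? = (W.label α)[i]?
        rw [List.head?_drop, List.getElem?_take_of_lt (by omega)]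
      · change (FreeGroup.invRev (((W.label α).take (i + m)).drop i)).head?
          = (W.label α)[i + m - 1]?.map invLetter
        rw [head?_invRev_drop (by rw [List.length_take]; omega),
          FreeGroup.head?_invRev_take (by omega) (by omega)]
    · have h0 := middle_ne_nil_iff.1 hn
      refine ⟨?_, ?_, rfl, ?_⟩
      · by_cases h1 : m = 0
        · have e1 : (if m = 0 then Germ.mid false else Germ.fwd true : Germ W.T) = .mid false :=
            if_pos h1
          change (if m = 0 then Germ.mid false else Germ.fwd true : Germ W.T).Valid _ _ _ ∧
            _ = (if m = 0 then Germ.mid false else Germ.fwd true : Germ W.T).loc P ∧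
            _ = (if m = 0 then Germ.mid false else Germ.fwd true : Germ W.T).hd _ _ _
          rw [e1]
          refine ⟨?_, (hPt h1).trans hPf.symm, (head?_middle h0).trans ?_⟩
          · change i + j < (W.label α).length
            omega
          · rw [h1]; rfl
        · have e1 : (if m = 0 then Germ.mid false else Germ.fwd true : Germ W.T) = .fwd true :=
            if_neg h1
          change (if m = 0 then Germ.mid false else Germ.fwd true : Germ W.T).Valid _ _ _ ∧
            _ = (if m = 0 then Germ.mid false else Germ.fwd true : Germ W.T).loc P ∧
            _ = (if m = 0 then Germ.mid false else Germ.fwd true : Germ W.T).hd _ _ _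
          rw [e1]
          exact ⟨h1, hPt' h1, head?_middle h0⟩
      · change i + j < (W.label α).length
        omega
      · refine (congrArg List.head? (invRev_middle (by omega))).trans ?_
        rw [← W.label_inv]
        exact head?_middle (by rw [W.length_label_inv]; omega)
  · exact fun _ h => h
  · rintro (_ | _) hc
    · have hk := hβ.interior hc
      have := (H.red β).getElem?_succ_ne (n := k - 1) (by omega)
      rw [Nat.sub_add_cancel (by omega)] at this
      exact this.symm
    · have hc' : m ≠ 0 := hc
      have := rα.getElem?_succ_ne (n := i + m - 1) (by omega)
      rw [Nat.sub_add_cancel (by omega)] at this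
      exact this.symm
  · rintro hv c y hy t ht ht0 hts
    obtain ⟨h1, h2, h3⟩ := hPinl c y hy
    cases c
    · exact hβ.head?_ne H (not_determines_src hij hv) h1 t ht ht0 (hts.trans h2.symm)
    · have := hγ.head?_ne H (not_determines_tgt hij hv) h1 t ht ht0 (hts.trans h2.symm)
      rw [← add_zero j, ← h3 rfl] at this
      exact this
  · intro hv b c hc hbc
    cases b
    · rw [hPf, ptRep_eq_inr] at hbc
      obtain ⟨h1, rfl⟩ := hbc
      exact hβ.getElem?_ne rα (by omega) (not_determines_src hij hv) (hβ.interior h1)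
    · by_cases h : m = 0
      · rw [hPt h, ptRep_eq_inr] at hbc
        obtain ⟨h1, rfl⟩ := hbc
        have := hγ.getElem?_ne rα' (by rw [W.length_label_inv]; omega) (not_determines_tgt hij hv)
          (hβ.interior h1)
        rw [← add_zero j, ← h] at this
        exact this
      · rw [hPt' h] at hbc
        obtain rfl := Sum.inr_injective hbc
        refine ⟨(getElem?_ne_of_maximal_cancels H hm hv).symm, ?_⟩
        have h1 := rα'.getElem?_succ_ne (n := j + m - 1) (by rw [W.length_label_inv]; omega)
        have h2 : (W.label (W.inv α))[j + m - 1]? = (W.label α)[i + m - 1]? := by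
          have e1 := congrArg (fun l : List (S × Bool) => l[m - 1]?) hcan
          simp only [List.getElem?_drop] at e1
          rw [List.getElem?_take_of_lt (by omega), List.getElem?_take_of_lt (by omega)] at e1
          rw [show j + m - 1 = j + (m - 1) by omega, show i + m - 1 = i + (m - 1) by omega, e1]
        rw [h2, Nat.sub_add_cancel (by omega)] at h1
        exact h1
  · intro hv hPP
    have h : m = 0 := by
      by_contra h
      rw [hPf, hPt' h, ptRep_eq_inr] at hPP
      exact absurd hPP.2 (by simp)
    have := getElem?_ne_of_maximal_cancels H hm hv
    have e0 : i + m = i := by omega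
    rw [e0] at this
    exact this
  have src_mem : ∀ {k : Set W.Q}, W.Saturated k → (W.tgt α ∈ k ↔ W.src α ∈ k) := fun hk =>
    (hk.src_iff_tgt α).symm
  have q0 : W.label β = [] →
      Quot.mk B.EmptyJoined (Sum.inr false) = Quot.mk _ (Sum.inl (W.src β)) := by
    intro h0
    refine Quot.sound ⟨Sum.inr (0, false), rfl, rfl, ?_⟩
    change FreeGroup.invRev ((W.label β).take k) = []
    rw [h0]; simp [FreeGroup.invRev]
  refine { setup := H, conn := ?_, inr := ?_, emp := ?_, quot_inl := ?_, quot_full := False.elim,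
           red := ?_, det := ds.1, start := ds.2, isol := ?_, isol_src := fun _ => False.elim,
           isol_tgt := fun _ => False.elim,
           mem_s := ?_, mem_e := ?_, mem_g := ?_, inj := ?_, g_mem := ?_, count := ?_,
           count_full := False.elim, length := ?_, length_full := False.elim }
  · refine conn_preReplace_iff hβ hγ hle (Sum.inr false) (Sum.inr false) ?_ (edge 0) (edge 0)
      cm (fun _ => W.src β)
      (fun c => if c then FreeGroup.mk ((W.label β).take k)
        * FreeGroup.mk (((W.label α).take (i + m)).drop i) else FreeGroup.mk ((W.label β).take k))
      ?_
    · rintro t (rfl | rfl) ht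
      · exact absurd rfl ht
      · exact cβ
    · intro n
      fin_cases n
      · change W.Conn (W.src β) (1 * FreeGroup.mk ((W.label β).take k) * (FreeGroup.mk ((W.label β).take k))⁻¹) (W.src β)
        rw [one_mul, mul_inv_cancel]
        exact .nil _
      · change W.Conn (W.src β) (FreeGroup.mk ((W.label β).take k) * FreeGroup.mk ((W.label β).drop k) * 1⁻¹) (W.tgt β)
        rw [FreeGroup.mk_take_mul_mk_drop, inv_one, mul_one]
        exact .single β
      · change W.Conn (W.src β) (FreeGroup.mk ((W.label β).take k)
          * FreeGroup.mk (((W.label α).take (i + m)).drop i) * (FreeGroup.mk ((W.label β).take k)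
          * FreeGroup.mk (((W.label α).take (i + m)).drop i))⁻¹) (W.src β)
        rw [mul_inv_cancel]
        exact .nil _
      · change W.Conn (W.src β) (FreeGroup.mk ((W.label β).take k)
          * FreeGroup.mk (((W.label α).take (i + m)).drop i)
          * FreeGroup.mk (middle (i + m) (j + m) (W.label α)) * (FreeGroup.mk ((W.label β).take k)
          * FreeGroup.mk (((W.label α).take (i + m)).drop i))⁻¹) (W.src β)
        have := conn_middle hβ hγ hle
        rw [emid] at this
        rw [mul_inv_rev]
        simpa only [mul_assoc] using this
  · rintro (_ | _)
    · exact ⟨_, _, (edge 0).symm⟩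
    · exact ⟨_, _, ((edge 0).trans (edge 2)).symm⟩
  · intro n hn
    left
    fin_cases n
    · exact ((ptRep_of_nil (hβ.take_ne.1 hn)).symm.trans hPf.symm)
    · have h0 := hβ.drop_ne.1 hn
      exact hPf.trans ((ptRep_of_nil h0).trans (congrArg Sum.inl (H.triv β h0)))
    · exact hPf.trans (hPt (hU.1 hn)).symm
    · rfl
  · intro c y hy
    obtain ⟨h1, rfl, h3⟩ := hPinl c y hy
    cases c
    · exact q0 h1
    · refine Eq.trans (Eq.symm (Quot.sound ⟨Sum.inr (2, true), rfl, rfl, ?_⟩)) (q0 h1)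
      exact hU.2 (h3 rfl)
  · intro n
    fin_cases n
    · exact isReduced_take (H.red β) k
    · exact isReduced_drop (H.red β) k
    · exact isReduced_drop (isReduced_take rα _) i
    · exact isReduced_middle rα
  · intro c y hy
    obtain ⟨h1, rfl, h3⟩ := hPinl c y hy
    exact (hβ.isol H h1).imp id Or.inl
  · intro m hm n
    fin_cases n
    · exact hβ.mem_iff hm
    · exact Iff.rfl
    · exact Iff.rfl
    · exact Iff.rfl
  · intro m hm n
    fin_cases n
    · exact Iff.rfl
    · exact (hm.src_iff_tgt β).symm.trans (hβ.mem_iff hm)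
    · exact Iff.rfl
    · exact Iff.rfl
  · intro m hm n
    fin_cases n
    · exact Iff.rfl
    · exact hβ.mem_iff hm
  · apply ite_injective_of_forall H
    have n1 : α ≠ β := fun e => oβ (Or.inl e.symm)
    have n3 : α ≠ W.inv β := fun e => oβ.inv (Or.inl e.symm)
    have n5 : β ≠ W.inv α := fun e => oβ (Or.inr e)
    intro a b hab
    fin_cases a <;> fin_cases b
    · exact absurd rfl hab
    · exact ⟨n1, n3⟩
    · exact ⟨n1.symm, n5⟩
    · exact absurd rfl hab
  · intro n
    fin_cases n
    · exact Or.inl rfl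
    · exact Or.inr rfl
  · have nc : {c | P c = Sum.inr c}.ncard = neWeight (W.label β)
        + neWeight (((W.label α).take (i + m)).drop i) := by
      rw [ncard_setOf_bool, hPf]
      congr 1
      · simp only [ptRep_eq_inr, and_true, neWeight, ite_not]
      · by_cases h : m = 0
        · rw [hU.2 h, neWeight_nil, hPt h, if_neg]
          rw [ptRep_eq_inr]
          simp
        · rw [hPt' h, if_pos rfl, neWeight_of_ne fun e => h (hU.1 e)]
    have a1 := neWeight_congr hβ.take_ne
    have a2 := neWeight_congr hβ.drop_ne
    have a5 := neWeight_of_ne H.ne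
    have a6 := neWeight_le_one (middle (i + m) (j + m) (W.label α))
    rw [finsum_eq_sum_of_fintype, Fin.sum_univ_four, Fin.sum_univ_two, nc]
    change neWeight ((W.label β).take k) + neWeight ((W.label β).drop k)
      + neWeight (((W.label α).take (i + m)).drop i)
      + neWeight (middle (i + m) (j + m) (W.label α)) ≤ neWeight (W.label α)
      + neWeight (W.label β) + _
    omega
  · have lβ := hβ.le
    have lm := length_middle (i := i + m) (j := j + m) (X := W.label α)
    rw [finsum_eq_sum_of_fintype, Fin.sum_univ_four, Fin.sum_univ_two]
    change ((W.label β).take k).length + ((W.label β).drop k).length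
      + (((W.label α).take (i + m)).drop i).length
      + (middle (i + m) (j + m) (W.label α)).length ≤ (W.label α).length + (W.label β).length
    rw [hlenU, lm]
    simp only [List.length_take, List.length_drop]
    omega

end InvAut

namespace InvAut

variable {S : Type u}

/-! ### Folding a transition of an automaton whose other transitions form a CDFA -/

/-- All labels are reduced and non-empty, and the transitions other than `α` and its inverse are
deterministic. -/
structure NearCDFA (A : InvAut S) (α : A.T) : Prop where
  red : ∀ t, FreeGroup.IsReduced (A.label t)
  ne : ∀ t, A.label t ≠ []
  det : ∀ t t', A.Off α t → A.Off α t' → A.src t = A.src t' →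
    (A.label t).head? = (A.label t').head? → t = t'

theorem withTrivial_off_inl {A : InvAut S} {α t : A.T} :
    A.withTrivial.Off (Sum.inl α) (Sum.inl t) ↔ A.Off α t :=
  not_congr (or_congr Sum.inl_injective.eq_iff Sum.inl_injective.eq_iff)

theorem withTrivial_off_inr {A : InvAut S} {α : A.T} (x : A.Q × Bool) :
    A.withTrivial.Off (Sum.inl α) (Sum.inr x) := by
  rintro (h | h) <;> cases h

theorem withTrivial_label_inr {A : InvAut S} (x : A.Q × Bool) :
    A.withTrivial.label (Sum.inr x) = [] := by
  obtain ⟨x, _ | _⟩ := x <;> rfl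

theorem withTrivial_src_inr {A : InvAut S} (x : A.Q × Bool) :
    A.withTrivial.src (Sum.inr x) = x.1 := by
  obtain ⟨x, _ | _⟩ := x <;> rfl

theorem withTrivial_tgt_inr {A : InvAut S} (x : A.Q × Bool) :
    A.withTrivial.tgt (Sum.inr x) = x.1 := by
  obtain ⟨x, _ | _⟩ := x <;> rfl

theorem NearCDFA.foldSetup {A : InvAut S} {α : A.T} (N : A.NearCDFA α) :
    FoldSetup A.withTrivial (Sum.inl α) where
  red := by
    rintro (t | x)
    · exact N.red t
    · rw [withTrivial_label_inr]; exact FreeGroup.IsReduced.nil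
  triv := by
    rintro (t | x) h
    · exact absurd h (N.ne t)
    · rw [withTrivial_src_inr, withTrivial_tgt_inr]
  ne := N.ne α
  inv_ne := by
    rintro (t | ⟨x, b⟩) h
    · exact inv_ne (N.red t) (N.ne t) (Sum.inl_injective h)
    · have h1 : (x, !b) = (x, b) := Sum.inr_injective h
      cases b <;> simp at h1
  uniq := by
    rintro (t | ⟨x, b⟩) (t' | ⟨x', b'⟩) h h' hs
    · exact absurd h (N.ne t)
    · exact absurd h (N.ne t)
    · exact absurd h' (N.ne t')
    · rw [withTrivial_src_inr, withTrivial_src_inr] at hs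
      obtain rfl : x = x' := hs
      cases b <;> cases b' <;> first | exact Or.inl rfl | exact Or.inr rfl
  det := by
    rintro (t | x) (t' | x') o o' h h' hs hh
    · exact congrArg Sum.inl (N.det t t' (withTrivial_off_inl.1 o) (withTrivial_off_inl.1 o')
        hs hh)
    · exact absurd (withTrivial_label_inr x') h'
    · exact absurd (withTrivial_label_inr x) h
    · exact absurd (withTrivial_label_inr x) h

theorem NearCDFA.hasOff_iff {A : InvAut S} {α : A.T} (N : A.NearCDFA α) {y : A.Q} :
    HasOff A.withTrivial (Sum.inl α) y ↔ ∃ t, A.Off α t ∧ A.src t = y := by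
  constructor
  · rintro ⟨t | x, o, h, hs⟩
    · exact ⟨t, withTrivial_off_inl.1 o, hs⟩
    · exact absurd (withTrivial_label_inr x) h
  · rintro ⟨t, o, hs⟩
    exact ⟨Sum.inl t, withTrivial_off_inl.2 o, N.ne t, hs⟩

theorem conn_withTrivial {A : InvAut S} {x y : A.Q} {g : FreeGroup S} :
    A.withTrivial.Conn x g y ↔ A.Conn x g y := by
  constructor
  · refine Conn.map' (A := A.withTrivial) (B := A) id ?_
    rintro (t | x)
    · exact Conn.single (A := A) t
    · rw [withTrivial_src_inr, withTrivial_tgt_inr, withTrivial_label_inr]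
      exact Conn.nil _
  · exact Conn.map' (A := A) (B := A.withTrivial) id fun t => Conn.single (A := A.withTrivial) (Sum.inl t)

theorem saturated_withTrivial {A : InvAut S} {h : Set A.Q} (hh : A.Saturated h) :
    A.withTrivial.Saturated h := by
  rintro (t | x) ht
  · exact hh t ht
  · rw [withTrivial_tgt_inr]; rwa [withTrivial_src_inr] at ht

theorem wt_withTrivial {A : InvAut S} {φ : List (S × Bool) → ℕ} (hφ : φ [] = 0) (h : Set A.Q) :
    A.withTrivial.wt h φ = A.wt h φ := by
  classical
  have h1 := wt_addEdges (A := A) (I := A.Q) (s := id) (e := id) (w := fun _ => []) (h := h) φ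
  have h2 : FreeGroup.invRev ([] : List (S × Bool)) = [] := rfl
  simp only [h2, hφ, ite_self, add_zero, finsum_zero] at h1
  exact h1

/-- What is known about the result `D` of a transition fold; `full` says that the folded transition
has been absorbed completely. -/
structure FoldResult (A : InvAut S) (α : A.T) (D : InvAut S) (τ : A.Q → D.Q) (full : Prop) :
    Prop where
  init : τ A.q0 = D.q0
  final : D.F = τ '' A.F
  conn : ∀ {x y g}, D.Conn (τ x) g (τ y) ↔ A.Conn x g y
  onto : ∀ z, ∃ x g, D.Conn z g (τ x)
  red : ∀ t, FreeGroup.IsReduced (D.label t)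
  ne : ∀ t, D.label t ≠ []
  isCDFA : (full → (∀ t, A.Off α t → A.src t ≠ A.src α) ∨ ∀ t, A.Off α t → A.src t ≠ A.tgt α) →
    D.IsCDFA
  subStar : full → (∀ t t', A.Off α t → A.Off α t' → A.src t = A.src t' → t = t') → D.SubStar
  isol : ∀ x, A.outgoing x = ∅ → D.outgoing (τ x) = ∅
  mono : ∀ h, A.Saturated h → ∃ h', D.Saturated h' ∧ (∀ x, τ x ∈ h' ↔ x ∈ h) ∧
    D.tc h' + 2 * h.ncard ≤ A.tc h + 2 * h'.ncard ∧ D.ls h' ≤ A.ls h ∧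
      (full → A.src α ∈ h → D.ls h' + 2 * (A.label α).length ≤ A.ls h)

theorem FoldCase.foldResult {A : InvAut S} {α : A.T} (N : A.NearCDFA α)
    {R : Set A.withTrivial.T} {I : Type} [Finite I]
    {s e : I → A.withTrivial.Q ⊕ Bool} {w : I → List (S × Bool)}
    {P : Bool → A.withTrivial.Q ⊕ Bool} {full : Prop} {ι : Type} [Fintype ι]
    {g : ι → A.withTrivial.T}
    (H : FoldCase A.withTrivial (Sum.inl α) R I s e w P full ι g) :
    FoldResult A α (A.withTrivial.replace R I s e w) (A.withTrivial.replaceMap R I s e w) full where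
  init := rfl
  final := Set.image_image _ _ _
  conn := H.conn'.trans conn_withTrivial
  onto := H.onto
  red := H.reduced
  ne := fun t => t.2
  isCDFA := fun h => H.isCDFA fun hf => (h hf).imp
    (fun h' => fun h'' => by
      obtain ⟨t, o, hs⟩ := N.hasOff_iff.1 h''
      exact h' t o hs)
    (fun h' => fun h'' => by
      obtain ⟨t, o, hs⟩ := N.hasOff_iff.1 h''
      exact h' t o hs)
  subStar := fun hf h => H.subStar hf (by
    rintro (t | x) (t' | x') o o' l l' hs
    · exact congrArg Sum.inl (h t t' (withTrivial_off_inl.1 o) (withTrivial_off_inl.1 o') hs)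
    · exact absurd (withTrivial_label_inr x') l'
    · exact absurd (withTrivial_label_inr x) l
    · exact absurd (withTrivial_label_inr x) l)
  isol := fun x hx => by
    have h0 : ∀ t, A.src t ≠ x := fun t ht => (hx ▸ ht : t ∈ (∅ : Set A.T))
    refine H.outgoing_eq_empty (fun h => ?_) (fun h => h0 α h.symm) fun h => ?_
    · obtain ⟨t, -, hs⟩ := N.hasOff_iff.1 h
      exact h0 t hs
    · exact h0 (A.inv α) ((A.src_inv α).trans h.symm)
  mono := fun h hh => by
    obtain ⟨h', s', c, m1, m2, m3⟩ := H.mono (saturated_withTrivial hh)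
    have e1 : A.withTrivial.wt h neWeight = A.tc h :=
      (wt_withTrivial (if_pos rfl) h).trans (wt_neWeight N.ne h)
    have e2 : A.withTrivial.ls h = A.ls h := wt_withTrivial rfl h
    refine ⟨h', s', c, m1.trans_eq (congrArg (· + 2 * h'.ncard) e1), m2.trans_eq e2, fun hf hα => ?_⟩
    exact (m3 hf hα).trans_eq e2

theorem FoldsTo.foldResult {A : InvAut S} {α : A.T} (N : A.NearCDFA α) {D : InvAut S}
    {τ : A.Q → D.Q} (h : A.FoldsTo α D τ) : ∃ full, FoldResult A α D τ full := by
  have key : ∀ X : (B : InvAut S) × (A.withTrivial.Q → B.Q), A.withTrivial.Folds (Sum.inl α) X →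
      ∃ full, FoldResult A α X.1 X.2 full := by
    rintro X (⟨i, j, k, l, β, γ, hij, hβ, hγ, h, h'⟩ | ⟨i, j, k, l, β, hij, hβ, hγ, h⟩ |
      ⟨i, j, k, m, β, hij, hβ, hγ, hm⟩)
    · exact ⟨_, (foldCase_separate N.foldSetup hij hβ hγ h h').foldResult N⟩
    · exact ⟨_, (foldCase_same N.foldSetup hij hβ hγ h).foldResult N⟩
    · exact ⟨_, (foldCase_point N.foldSetup hij hβ hγ hm).foldResult N⟩
  exact key _ h

theorem Path.snoc {A : InvAut S} {K : Set A.T} {p q : A.Q} {v : List (S × Bool)}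
    (h : A.Path K p v q) (t : A.T) (ht : t ∈ K) (hs : A.src t = q) :
    A.Path K p (v ++ A.label t) (A.tgt t) := by
  induction h with
  | nil p =>
    subst hs
    have := WordAut.Path.cons (A := A.toWordAut) t ht [] _ (.nil _)
    simpa using this
  | cons t' ht' w q h ih =>
    rw [List.append_assoc]
    exact .cons t' ht' _ _ (ih hs)

/-- Positions at an end of a transition are states, which are represented by their trivial loops. -/
theorem Determines.exists_leadsTo {A : InvAut S} {α : A.T} {p : A.Q} {w : List (S × Bool)}
    {β : A.withTrivial.T} {k : ℕ}
    (h : A.withTrivial.Determines {Sum.inl α, A.withTrivial.inv (Sum.inl α)} p w β k) :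
    ∃ γ l, A.withTrivial.LeadsTo {Sum.inl α, A.withTrivial.inv (Sum.inl α)} p w γ l := by
  obtain ⟨hR, hk, v, hv, rfl⟩ := h
  have triv : ∀ (x : A.Q) (u : List (S × Bool)),
      A.withTrivial.Path ({Sum.inl α, A.withTrivial.inv (Sum.inl α)} : Set A.withTrivial.T)ᶜ p u x →
      ∃ γ l, A.withTrivial.LeadsTo {Sum.inl α, A.withTrivial.inv (Sum.inl α)} p u γ l := by
    intro x u hu
    have hl := withTrivial_label_inr (A := A) (x, true)
    refine ⟨Sum.inr (x, true), 0, Or.inr ⟨hl, rfl⟩, Or.inl ⟨withTrivial_off_inr _, Nat.zero_le _,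
      u, hu, ?_⟩⟩
    rw [List.take_zero, List.append_nil]
  by_cases h0 : k = 0
  · subst h0
    rw [List.take_zero, List.append_nil]
    exact triv _ _ hv
  by_cases h1 : k = (A.withTrivial.label β).length
  · subst h1
    rw [List.take_length]
    exact triv _ _ (Path.snoc hv β hR rfl)
  · exact ⟨β, k, Or.inl ⟨Nat.pos_of_ne_zero h0, lt_of_le_of_ne hk h1⟩, Or.inl ⟨hR, hk, v, hv, rfl⟩⟩

theorem exists_maximal_cancels {A : InvAut S} {α : A.T} {i j : ℕ}
    (h : i + j ≤ (A.label α).length) : ∃ m, Maximal (A.Cancels α i j) m := by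
  have hf : {m | A.Cancels α i j m}.Finite := by
    refine (Set.finite_le_nat (A.label α).length).subset fun m hm => ?_
    have := hm.1
    change m ≤ (A.label α).length
    omega
  have h0 : A.Cancels α i j 0 := by
    refine ⟨by omega, ?_⟩
    rw [List.drop_eq_nil_of_le, List.drop_eq_nil_of_le] <;> simp
  obtain ⟨m, -, hm⟩ := hf.exists_le_maximal h0
  exact ⟨m, hm⟩

theorem exists_maximal_readable {A : InvAut S} {α : A.T} :
    ∃ ij, Maximal (A.withTrivial.Readable (Sum.inl α)) ij := by
  have hf : {ij | A.withTrivial.Readable (Sum.inl α) ij}.Finite := by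
    refine ((Set.finite_le_nat (A.label α).length).prod
      (Set.finite_le_nat (A.label α).length)).subset fun ij hij => ?_
    have h := hij.2.2
    have h1 : (A.withTrivial.label (Sum.inl α)) = A.label α := rfl
    rw [h1] at h
    exact ⟨by change ij.1 ≤ _; omega, by change ij.2 ≤ _; omega⟩
  have det : ∀ x : A.Q, ∃ β k, A.withTrivial.Determines
      {Sum.inl α, A.withTrivial.inv (Sum.inl α)} x [] β k := fun x =>
    ⟨Sum.inr (x, true), 0, withTrivial_off_inr _, Nat.zero_le _, [], .nil (A := A.withTrivial.toWordAut) x,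
      by rw [List.take_zero, List.append_nil]⟩
  obtain ⟨m, -, hm⟩ := hf.exists_le_maximal
    (show A.withTrivial.Readable (Sum.inl α) (0, 0) from ⟨det _, det _, Nat.zero_le _⟩)
  exact ⟨m, hm⟩

/-- Reading nothing is possible and lengths are bounded, so a maximal pair exists. Replacing a
transition by its inverse brings β = γ⁻¹ and `k > l` into one of the three cases. -/
theorem exists_foldsTo (A : InvAut S) (α : A.T) : ∃ D τ, A.FoldsTo α D τ := by
  obtain ⟨⟨i, j⟩, hij⟩ := exists_maximal_readable (A := A) (α := α)
  suffices ∃ X, A.withTrivial.Folds (Sum.inl α) X by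
    obtain ⟨⟨D, τ⟩, h⟩ := this
    exact ⟨D, τ, h⟩
  obtain ⟨⟨_, _, h1⟩, ⟨_, _, h2⟩, h3⟩ := hij.1
  obtain ⟨β, k, hβ⟩ := h1.exists_leadsTo
  obtain ⟨γ, l, hγ⟩ := h2.exists_leadsTo
  clear h1 h2
  have key : ∀ (β : A.withTrivial.T) (k l : ℕ),
      A.withTrivial.LeadsTo {Sum.inl α, A.withTrivial.inv (Sum.inl α)}
        (A.withTrivial.src (Sum.inl α)) ((A.withTrivial.label (Sum.inl α)).take i) β k →
      A.withTrivial.LeadsTo {Sum.inl α, A.withTrivial.inv (Sum.inl α)}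
        (A.withTrivial.tgt (Sum.inl α))
        ((A.withTrivial.label (A.withTrivial.inv (Sum.inl α))).take j) β l →
      ∃ X, A.withTrivial.Folds (Sum.inl α) X := by
    intro β k l hβ hγ
    rcases lt_trichotomy k l with h | h | h
    · exact ⟨_, .same i j k l β hij hβ hγ h⟩
    · subst h
      obtain ⟨m, hm⟩ := exists_maximal_cancels h3
      exact ⟨_, .point i j k m β hij hβ hγ hm⟩
    -- On β⁻¹ the two positions occur in the opposite order.
    · have := hβ.le
      exact ⟨_, .same i j _ _ _ hij hβ.inv hγ.inv (by omega)⟩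
  by_cases h : β = γ
  · subst h
    exact key _ _ _ hβ hγ
  by_cases h' : β = A.withTrivial.inv γ
  · subst h'
    exact key _ _ _ hβ hγ.inv
  · exact ⟨_, .separate i j k l β γ hij hβ hγ h h'⟩

end InvAut

namespace InvAut

variable {S : Type u}

/-! ### Cutting a transition and putting it back -/

/-- Remove `α` and its inverse, and make its end points final. -/
abbrev cutAut (A : InvAut S) (α : A.T) : InvAut S :=
  (A.remove {α}).withFinal (A.F ∪ {A.src α, A.tgt α})

/-- Add a transition and its inverse, and replace the set of final states. -/
abbrev restoreAut (A : InvAut S) (p q : A.Q) (X : List (S × Bool)) (F : Set A.Q) : InvAut S :=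
  (A.addEdges Unit (fun _ => p) (fun _ => q) (fun _ => X)).withFinal F

theorem off_iff_remove {A : InvAut S} {α t : A.T} :
    A.Off α t ↔ t ∉ ({α} : Set A.T) ∧ A.inv t ∉ ({α} : Set A.T) := by
  constructor
  · exact fun h => ⟨fun e => h (Or.inl e), fun e => h.inv (Or.inl e)⟩
  · rintro ⟨h1, h2⟩ (e | e)
    · exact h1 e
    · exact h2 (by rw [show t = A.inv α from e]; exact A.inv_inv α)

theorem conn_of_cutAut {A : InvAut S} {α : A.T} {x y : A.Q} {g : FreeGroup S}
    (h : (A.cutAut α).Conn x g y) : A.Conn x g y :=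
  Conn.map' (A := A.cutAut α) (B := A) id (fun t => Conn.single (A := A) t.1) h

/-- Follow a path to a mark until α or its inverse is about to be traversed. The state reached then
is an end of α and has become final. -/
theorem anchored_cutAut {A : InvAut S} (hA : A.Anchored) (α : A.T) : (A.cutAut α).Anchored := by
  suffices ∀ (x : A.Q) g y, y ∈ A.marks → A.Conn x g y →
      ∃ g, ∃ y ∈ (A.cutAut α).marks, (A.cutAut α).Conn x g y from fun x =>
    let ⟨g, y, hy, h⟩ := hA x
    this x g y hy h
  intro x g y hy h
  induction h with
  | nil p => exact ⟨1, p, hy.imp Or.inl id, .nil (A := A.cutAut α) p⟩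
  | cons t g q h ih =>
    by_cases ht : A.Off α t
    · obtain ⟨g', y', hy', h'⟩ := ih hy
      exact ⟨_, y', hy', .cons (A := A.cutAut α) ⟨t, off_iff_remove.1 ht⟩ _ _ h'⟩
    · refine ⟨1, A.src t, Or.inl (Or.inr ?_), .nil (A := A.cutAut α) _⟩
      rcases not_not.1 ht with e | e
      · exact Or.inl (congrArg A.src e)
      · exact Or.inr ((congrArg A.src e).trans (A.src_inv α))

theorem saturated_cutAut {A : InvAut S} {α : A.T} {h : Set A.Q} (hh : A.Saturated h) :
    (A.cutAut α).Saturated h := fun t ht => hh t.1 ht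

theorem wt_cutAut {A : InvAut S} {α : A.T} (hα : A.inv α ≠ α) {h : Set A.Q}
    (hh : A.Saturated h) {φ : List (S × Bool) → ℕ} (hφ : ∀ w, φ (FreeGroup.invRev w) = φ w)
    [Decidable (A.src α ∈ h)] :
    (A.cutAut α).wt h φ + (if A.src α ∈ h then 2 * φ (A.label α) else 0) = A.wt h φ := by
  classical
  have key := finsum_subtype_add_eq (fun t : A.T => t ∉ ({α} : Set A.T) ∧ A.inv t ∉ ({α} : Set A.T))
    (fun t => if A.src t ∈ h then φ (A.label t) else 0)
    (fun b : Bool => if b then α else A.inv α) (by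
      intro b b' e
      cases b <;> cases b' <;> simp at e ⊢
      · exact hα e
      · exact hα e.symm) (by
      intro b
      rw [← off_iff_remove]
      cases b
      · exact fun h => h (Or.inr rfl)
      · exact fun h => h (Or.inl rfl)) (by
      intro t ht _
      rw [← off_iff_remove] at ht
      rcases not_not.1 ht with e | e
      · exact ⟨true, (if_pos rfl).trans e.symm⟩
      · exact ⟨false, (if_neg Bool.false_ne_true).trans e.symm⟩)
  unfold wt
  rw [← key]
  refine congrArg₂ (· + ·) rfl ?_
  have h1 : A.tgt α ∈ h ↔ A.src α ∈ h := (hh.src_iff_tgt α).symm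
  rw [Fintype.sum_bool]
  simp only [if_true, Bool.false_eq_true, if_false, A.src_inv, A.label_inv, hφ, h1]
  split_ifs <;> omega

theorem wt_restoreAut {A : InvAut S} {p q : A.Q} {X : List (S × Bool)} {F : Set A.Q} {h : Set A.Q}
    (hpq : p ∈ h ↔ q ∈ h) {φ : List (S × Bool) → ℕ} (hφ : ∀ w, φ (FreeGroup.invRev w) = φ w)
    [Decidable (p ∈ h)] :
    (A.restoreAut p q X F).wt h φ = A.wt h φ + (if p ∈ h then 2 * φ X else 0) := by
  classical
  refine (wt_addEdges (A := A) (I := Unit) (s := fun _ => p) (e := fun _ => q) (w := fun _ => X)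
    (h := h) φ).trans ?_
  rw [finsum_unique, hφ]
  congr 1
  by_cases hp : p ∈ h
  · rw [if_pos hp, if_pos (hpq.1 hp), if_pos hp, two_mul]
  · rw [if_neg hp, if_neg (fun h => hp (hpq.2 h)), if_neg hp]

section

variable {A A₂ : InvAut S} {α : A.T} {ρ : A.Q → Option A₂.Q} {p q : A₂.Q} {F : Set A₂.Q}

theorem conn_restoreAut_of_conn {x y : A₂.Q} {g : FreeGroup S} {X : List (S × Bool)}
    (h : A₂.Conn x g y) : (A₂.restoreAut p q X F).Conn x g y :=
  Conn.map' (A := A₂) (B := A₂.restoreAut p q X F) id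
    (fun t => Conn.single (A := A₂.restoreAut p q X F) (Sum.inl t)) h

theorem conn_restoreAut_iff (P : ConnPres (A.cutAut α) A₂ ρ) (hp : ρ (A.src α) = some p)
    (hq : ρ (A.tgt α) = some q) {x x' : A.Q} {y y' : A₂.Q} {g : FreeGroup S}
    (hx : ρ x = some y) (hx' : ρ x' = some y') :
    A.Conn x g x' ↔ (A₂.restoreAut p q (A.label α) F).Conn y g y' := by
  have eα : (A₂.restoreAut p q (A.label α) F).Conn p (FreeGroup.mk (A.label α)) q :=
    Conn.single (A := A₂.restoreAut p q (A.label α) F) (Sum.inr ((), true))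
  constructor
  · have key : ∀ x g, A.Conn x g x' → ∃ x₁ y₁ g₁ g₂, g = g₁ * g₂ ∧ (A.cutAut α).Conn x g₁ x₁ ∧
        ρ x₁ = some y₁ ∧ (A₂.restoreAut p q (A.label α) F).Conn y₁ g₂ y' := by
      intro x g h
      induction h with
      | nil x => exact ⟨x, y', 1, 1, (mul_one 1).symm, .nil (A := A.cutAut α) x, hx', .nil _⟩
      | cons t g _ h ih =>
        obtain ⟨x₁, y₁, g₁, g₂, rfl, h1, h2, h3⟩ := ih hx'
        by_cases ht : A.Off α t
        · exact ⟨x₁, y₁, _, g₂, (mul_assoc _ _ _).symm,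
            .cons (A := A.cutAut α) ⟨t, off_iff_remove.1 ht⟩ _ _ h1, h2, h3⟩
        · rcases not_not.1 ht with e | e
          · obtain rfl : t = α := e
            refine ⟨A.src t, p, 1, _, (one_mul _).symm, .nil (A := A.cutAut t) _, hp, ?_⟩
            exact eα.trans ((conn_restoreAut_of_conn ((P.conn hq h2).1 h1)).trans h3)
          · obtain rfl : t = A.inv α := e
            refine ⟨A.tgt α, q, 1, _, (one_mul _).symm, ?_, hq, ?_⟩
            · exact Conn.cast (Conn.nil (A := A.cutAut α) (A.tgt α)) (A.src_inv α).symm rfl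
            · rw [mk_label_inv]
              rw [A.tgt_inv] at h1
              exact eα.symm.trans ((conn_restoreAut_of_conn ((P.conn hp h2).1 h1)).trans h3)
    intro h
    obtain ⟨x₁, y₁, g₁, g₂, rfl, h1, h2, h3⟩ := key x g h
    exact (conn_restoreAut_of_conn ((P.conn hx h2).1 h1)).trans h3
  · have key : ∀ y g, (A₂.restoreAut p q (A.label α) F).Conn y g y' → ∃ x₁ y₁ g₁ g₂, g = g₁ * g₂ ∧
        A₂.Conn y g₁ y₁ ∧ ρ x₁ = some y₁ ∧ A.Conn x₁ g₂ x' := by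
      intro y g h
      induction h with
      | nil y => exact ⟨x', y, 1, 1, (mul_one 1).symm, .nil (A := A₂) y, hx', .nil _⟩
      | cons t g _ h ih =>
        obtain ⟨x₁, y₁, g₁, g₂, rfl, h1, h2, h3⟩ := ih hx'
        rcases t with t | ⟨_, _ | _⟩
        · exact ⟨x₁, y₁, _, g₂, (mul_assoc _ _ _).symm, .cons (A := A₂) t _ _ h1, h2, h3⟩
        · refine ⟨A.tgt α, q, 1, _, (one_mul _).symm, .nil (A := A₂) q, hq, ?_⟩
          have := (Conn.single (A := A) (A.inv α)).cast (A.src_inv α) (A.tgt_inv α)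
          rw [A.label_inv] at this
          exact this.trans ((conn_of_cutAut ((P.conn hp h2).2 h1)).trans h3)
        · refine ⟨A.src α, p, 1, _, (one_mul _).symm, .nil (A := A₂) p, hp, ?_⟩
          exact (Conn.single α).trans ((conn_of_cutAut ((P.conn hq h2).2 h1)).trans h3)
    intro h
    obtain ⟨x₁, y₁, g₁, g₂, rfl, h1, h2, h3⟩ := key y g h
    exact (conn_of_cutAut ((P.conn hx h2).2 h1)).trans h3

theorem ConnPres.eq_of_outgoing_empty {B : InvAut S} {σ : A.Q → Option B.Q} (P : ConnPres A B σ)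
    {x x' : A.Q} {y : B.Q} (hx : σ x = some y) (hx' : σ x' = some y) (h : A.outgoing x = ∅) :
    x = x' :=
  ((P.conn hx hx').2 (.nil y)).eq_of_outgoing_empty h

theorem outgoing_cutAut_empty {x : A.Q} (hx : A.outgoing x = ∅) :
    (A.cutAut α).outgoing x = ∅ :=
  Set.eq_empty_of_forall_notMem fun t ht => (hx ▸ (ht : t.1 ∈ A.outgoing x) : t.1 ∈ (∅ : Set A.T))

/-- Putting α back adds the same amounts to both sides of the inequalities, as the images of its
ends lie in `h'` exactly when the ends lie in `h`. -/
theorem pres_restoreAut (hA : A.Anchored) (hα : A.inv α ≠ α) (P : Pres (A.cutAut α) A₂ ρ)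
    (hp : ρ (A.src α) = some p) (hq : ρ (A.tgt α) = some q)
    (hF : F = {y | ∃ x ∈ A.F, ρ x = some y}) :
    Pres A (A₂.restoreAut p q (A.label α) F) ρ := by
  classical
  refine ⟨ConnPres.mk' hA P.init (fun x hx => P.surv x (Or.inl hx)) hF
    (fun hx hx' => conn_restoreAut_iff P.toConnPres hp hq hx hx') ?_ ?_, ?_⟩
  · intro x y hx ho
    have h1 := outgoing_cutAut_empty (α := α) ho
    have h2 := P.isol x y hx h1
    have h0 : ∀ t, A.src t ≠ x := fun t ht => (ho ▸ ht : t ∈ (∅ : Set A.T))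
    refine Set.eq_empty_of_forall_notMem ?_
    rintro (t | ⟨_, _ | _⟩) ht
    · exact (h2 ▸ ht : t ∈ (∅ : Set A₂.T))
    · have : q = y := ht
      subst this
      exact h0 (A.inv α) ((A.src_inv α).trans
        (P.toConnPres.eq_of_outgoing_empty hx hq h1).symm)
    · have : p = y := ht
      subst this
      exact h0 α (P.toConnPres.eq_of_outgoing_empty hx hp h1).symm
  · intro y
    obtain ⟨g, m, hm, h⟩ := P.anch y
    obtain ⟨x, -, hx⟩ := (P.marks m).1 hm
    exact ⟨x, g, m, hx, conn_restoreAut_of_conn h⟩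
  · intro h hh
    obtain ⟨h', s', c, m1, m2⟩ := P.mono h (saturated_cutAut hh)
    have i1 : A.src α ∈ h ↔ p ∈ h' := c _ _ hp
    have i2 : A.tgt α ∈ h ↔ q ∈ h' := c _ _ hq
    have i3 := hh.src_iff_tgt α
    have i4 : p ∈ h' ↔ q ∈ h' := i1.symm.trans (i3.trans i2)
    have w1 := wt_cutAut hα hh (φ := fun _ => 1) (fun _ => rfl)
    have w2 := wt_cutAut hα hh (φ := List.length) (fun _ => FreeGroup.invRev_length)
    have w3 := wt_restoreAut (A := A₂) (X := A.label α) (F := F) i4 (φ := fun _ => 1) (fun _ => rfl)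
    have w4 := wt_restoreAut (A := A₂) (X := A.label α) (F := F) i4 (φ := List.length)
      (fun _ => FreeGroup.invRev_length)
    refine ⟨h', ?_, c, ?_, ?_⟩
    · rintro (t | ⟨_, _ | _⟩) ht
      · exact s' t ht
      · exact i4.2 ht
      · exact i4.1 ht
    · change (A₂.restoreAut p q (A.label α) F).wt h' (fun _ => 1) + _ ≤ A.wt h (fun _ => 1) + _
      rw [w3, ← w1]
      change (A.cutAut α).ls h ≥ _ at m2
      by_cases hs : A.src α ∈ h
      · rw [if_pos hs, if_pos (i1.1 hs)]
        have arith : ∀ a b c d e : ℕ, a + b ≤ c + d → a + e + b ≤ c + e + d := by omega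
        exact arith _ _ _ _ _ m1
      · rw [if_neg hs, if_neg (fun h => hs (i1.2 h))]
        exact m1
    · change (A₂.restoreAut p q (A.label α) F).wt h' List.length ≤ A.wt h List.length
      rw [w4, ← w2]
      by_cases hs : A.src α ∈ h
      · rw [if_pos hs, if_pos (i1.1 hs)]
        exact Nat.add_le_add_right m2 _
      · rw [if_neg hs, if_neg (fun h => hs (i1.2 h))]
        exact m2

theorem off_restoreAut {X : List (S × Bool)} {t : (A₂.restoreAut p q X F).T}
    (h : (A₂.restoreAut p q X F).Off (Sum.inr ((), true)) t) : ∃ t', t = Sum.inl t' := by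
  rcases t with t | ⟨_, _ | _⟩
  · exact ⟨t, rfl⟩
  · exact absurd (Or.inr rfl) h
  · exact absurd (Or.inl rfl) h

theorem nearCDFA_restoreAut (h : A₂.IsCDFA) {X : List (S × Bool)} (hX : FreeGroup.IsReduced X)
    (hX' : X ≠ []) : (A₂.restoreAut p q X F).NearCDFA (Sum.inr ((), true)) where
  red := by
    rintro (t | ⟨_, _ | _⟩)
    · exact h.2 t
    · exact hX.invRev'
    · exact hX
  ne := by
    rintro (t | ⟨_, _ | _⟩)
    · exact h.1.1 t
    · intro e
      have e' : FreeGroup.invRev X = [] := e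
      rw [← List.length_eq_zero_iff, FreeGroup.invRev_length, List.length_eq_zero_iff] at e'
      exact hX' e'
    · exact hX'
  det := by
    intro t t' o o' hs hh
    obtain ⟨t, rfl⟩ := off_restoreAut o
    obtain ⟨t', rfl⟩ := off_restoreAut o'
    exact congrArg Sum.inl (h.1.2 t t' hs hh)

end

/-- Every state has at most one outgoing transition. -/
def Unbranched (A : InvAut S) : Prop := ∀ t t', A.src t = A.src t' → t = t'

end InvAut

/-! ### One iteration as a map that preserves connections -/

namespace InvAut

variable {S : Type u}

theorem FoldResult.pres {A D : InvAut S} {α : A.T} {τ : A.Q → D.Q} {full : Prop}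
    (H : FoldResult A α D τ full) (hA : A.Anchored) : Pres A D (fun x => some (τ x)) where
  toConnPres := ConnPres.mk' hA (congrArg some H.init) (fun x _ => ⟨_, rfl⟩)
    (by
      rw [H.final]
      ext y
      exact exists_congr fun x => and_congr_right fun _ => (Option.some_inj).symm)
    (by rintro x x' _ _ g ⟨⟩ ⟨⟩; exact H.conn.symm)
    (by rintro x _ ⟨⟩ h; exact H.isol x h)
    (fun z => by
      obtain ⟨x, g, h⟩ := H.onto z
      exact ⟨x, g, _, rfl, h⟩)
  mono := fun h hh => by
    obtain ⟨h', s', c, m1, m2, -⟩ := H.mono h hh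
    exact ⟨h', s', by rintro x _ ⟨⟩; exact (c x).symm, m1, m2⟩

theorem ConnPres.mono_unique {A B : InvAut S} {ρ : A.Q → Option B.Q} (P : Pres A B ρ)
    {h : Set A.Q} (hh : A.Saturated h) {h' : Set B.Q} (s' : B.Saturated h') (c : Corr ρ h h') :
    B.tc h' + 2 * h.ncard ≤ A.tc h + 2 * h'.ncard ∧ B.ls h' ≤ A.ls h := by
  obtain ⟨h'', s'', c'', m⟩ := P.mono h hh
  rwa [P.toConnPres.corr_unique s' s'' c c'']

end InvAut

namespace InvCNFA

open InvAut

variable {S : Type u}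

/-- What is known about the outcome `C` of one iteration on `A` with the longest transition `α`. -/
structure StepResult (A : InvCNFA S) (α : A.T) (A₂ C : InvCNFA S) (σ : A.Q → Option C.Q) :
    Prop where
  minimalistic : C.Minimalistic
  pres : Pres A.toInvAut C.toInvAut σ
  isCDFA : (A.cut α).outgoing (A.src α) = ∅ ∨ (A.cut α).outgoing (A.tgt α) = ∅ → C.IsCDFA
  ls_add_le : ¬ C.IsCDFA → ∀ h h', A.Saturated h → C.Saturated h' → Corr σ h h' → A.src α ∈ h →
    C.ls h' + 2 * (A.label α).length ≤ A.ls h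
  subStar : ¬ C.IsCDFA → A₂.Unbranched → C.SubStar

/-- A fold that is not full yields a CDFA, and making it minimalistic keeps this. So an outcome that
is not a CDFA forces `full`, which gives the loss of length and, over an unbranched automaton, the
shape `SubStar`. An end of α isolated by the cut stays isolated during the conversion (`isol`), and
then the fold cannot fail. -/
theorem FoldBack.stepResult {A : InvCNFA S} {α : A.T} {A₂ C : InvCNFA S} {ρ : A.Q → Option A₂.Q}
    {σ : A.Q → Option C.Q} (hf : FoldBack A α A₂ ρ C σ) (hA : A.Anchored)
    (hmin : A.Minimalistic) (P : Pres (A.cut α).toInvAut A₂.toInvAut ρ) (h₂ : A₂.IsCDFA) :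
    StepResult A α A₂ C σ := by
  classical
  cases hf
  rename_i p q hp hq D τ hD κ hC
  have hred := (hmin.1 α).1
  have hne := (hmin.1 α).2
  have hα : A.inv α ≠ α := inv_ne hred hne
  have P3 := pres_restoreAut hA hα P hp hq rfl
  obtain ⟨full, H⟩ := FoldsTo.foldResult (nearCDFA_restoreAut h₂ hred hne) hD
  have hMin := hC.1.stepPres (H.pres P3.anch).anch
  have key : ¬ C.IsCDFA → full := fun h => by
    by_contra hf
    exact h (hMin.cdfa (H.isCDFA fun h => absurd h hf))
  have hpres := (P3.trans (H.pres P3.anch)).trans hMin.toPres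
  have hσ : (fun x => (ρ x).bind fun y => κ (τ y)) =
      fun x => ((ρ x).bind fun y => some (τ y)).bind κ := by
    funext x
    cases ρ x <;> rfl
  rw [hσ]
  refine ⟨hC.2, hpres, fun h => hMin.cdfa (H.isCDFA fun _ => ?_), fun hn h h' hh s' c hs => ?_,
    fun hn hu => hMin.subStar (H.subStar (key hn) ?_)⟩
  · refine h.imp (fun h => ?_) (fun h => ?_)
    · have h0 := P.isol _ _ hp h
      intro t ht hs
      obtain ⟨t, rfl⟩ := off_restoreAut ht
      exact (h0 ▸ hs : t ∈ (∅ : Set A₂.T))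
    · have h0 := P.isol _ _ hq h
      intro t ht hs
      obtain ⟨t, rfl⟩ := off_restoreAut ht
      exact (h0 ▸ hs : t ∈ (∅ : Set A₂.T))
  · obtain ⟨h₃, s₃, c₃, -, m₃⟩ := P3.mono h hh
    obtain ⟨h₄, s₄, c₄, -, -, m₄⟩ := H.mono h₃ s₃
    obtain ⟨h₅, s₅, c₅, -, m₅, -⟩ := hMin.mono h₄ s₄
    have hcorr : Corr (fun x => ((ρ x).bind fun y => some (τ y)).bind κ) h h₅ := by
      refine (c₃.trans (h'' := h₄) ?_).trans c₅
      rintro x _ ⟨⟩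
      exact (c₄ x).symm
    rw [hpres.toConnPres.corr_unique s' s₅ c hcorr]
    have h1 := m₄ (key hn) ((c₃ _ _ hp).1 hs)
    have h2 : D.ls h₄ + 2 * (A.label α).length ≤ A.ls h := h1.trans m₃
    exact (Nat.add_le_add_right m₅ _).trans h2
  · intro t t' ht ht' hs
    obtain ⟨t, rfl⟩ := off_restoreAut ht
    obtain ⟨t', rfl⟩ := off_restoreAut ht'
    exact congrArg Sum.inl (hu t t' hs)

theorem isCDFA_of_isEmpty {A : InvCNFA S} (h : IsEmpty A.T) : A.IsCDFA :=
  ⟨⟨fun t => isEmptyElim t, fun t => isEmptyElim t⟩, fun t => isEmptyElim t⟩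

theorem anchored_cut {A : InvCNFA S} (hA : A.Anchored) (α : A.T) : (A.cut α).Anchored :=
  anchored_cutAut hA α

theorem Run.pres_and_isCDFA {task : Task} {A B : InvCNFA S} {ρ : A.Q → Option B.Q} {N : ℕ}
    (h : Run task A B ρ N) (hA : A.Anchored) (hmin : task = .loop → A.Minimalistic) :
    Pres A.toInvAut B.toInvAut ρ ∧ B.IsCDFA := by
  induction h with
  | skip A h => exact ⟨.refl hA, h⟩
  | call A A₀ B ρ σ N h hm hr ih =>
    have P := hm.1.stepPres hA
    obtain ⟨P', hB⟩ := ih P.anch fun _ => hm.2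
    exact ⟨P.toPres.trans P', hB⟩
  | trivial A h => exact ⟨.refl hA, isCDFA_of_isEmpty h⟩
  | finish A A₂ C α ρ σ N hα hr hf h ih =>
    obtain ⟨P, h₂⟩ := ih (anchored_cut hA α) (by rintro ⟨⟩)
    exact ⟨(hf.stepResult hA (hmin rfl) P h₂).pres, h⟩
  | next A A₂ C B α ρ σ τ N M hα hr hf h hn ih ih' =>
    obtain ⟨P, h₂⟩ := ih (anchored_cut hA α) (by rintro ⟨⟩)
    have H := hf.stepResult hA (hmin rfl) P h₂
    obtain ⟨P', hB⟩ := ih' H.pres.anch fun _ => H.minimalistic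
    exact ⟨H.pres.trans P', hB⟩

theorem FoldBack.stepResult_of_run {A : InvCNFA S} {α : A.T} {A₂ C : InvCNFA S}
    {ρ : A.Q → Option A₂.Q} {σ : A.Q → Option C.Q} {N : ℕ} (hf : FoldBack A α A₂ ρ C σ)
    (hA : A.Anchored) (hmin : A.Minimalistic) (hr : Run .ensure (A.cut α) A₂ ρ N) :
    StepResult A α A₂ C σ := by
  obtain ⟨P, h₂⟩ := hr.pres_and_isCDFA (anchored_cut hA α) (by rintro ⟨⟩)
  exact hf.stepResult hA hmin P h₂

theorem Converts.isCDFA_and_groupLang {A B : InvCNFA S} {N : ℕ} (h : A.Converts B N)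
    (hA : A.Anchored) : B.IsCDFA ∧ B.groupLang = A.groupLang := by
  obtain ⟨A₀, ρ, σ, hm, hr⟩ := h
  have P := hm.1.stepPres hA
  obtain ⟨P', hB⟩ := hr.pres_and_isCDFA P.anch fun _ => hm.2
  exact ⟨hB, P'.groupLang.trans P.groupLang⟩

/-! ### Termination -/

theorem ls_cut_add (A : InvCNFA S) (hmin : A.Minimalistic) (α : A.T) {h : Set A.Q}
    (hh : A.Saturated h) (hα : A.src α ∈ h) :
    (A.cut α).ls h + 2 * (A.label α).length = A.ls h := by
  classical
  have := wt_cutAut (inv_ne (hmin.1 α).1 (hmin.1 α).2) hh (φ := List.length)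
    (fun _ => FreeGroup.invRev_length)
  rw [if_pos hα] at this
  exact this

theorem length_pos (A : InvCNFA S) (hmin : A.Minimalistic) (α : A.T) : 0 < (A.label α).length :=
  List.length_pos_iff.2 (hmin.1 α).2

theorem ls_cut_lt (A : InvCNFA S) (hmin : A.Minimalistic) (α : A.T) :
    (A.cut α).ls Set.univ < A.ls Set.univ := by
  have h1 := ls_cut_add A hmin α (saturated_univ _) trivial
  have h2 := length_pos A hmin α
  have arith : ∀ a b c : ℕ, a + 2 * b = c → 0 < b → a < c := by omega
  exact arith _ _ _ h1 h2

theorem StepResult.ls_lt {A : InvCNFA S} {α : A.T} {A₂ C : InvCNFA S} {σ : A.Q → Option C.Q}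
    (H : StepResult A α A₂ C σ) (hmin : A.Minimalistic) (h : ¬ C.IsCDFA) :
    C.ls Set.univ < A.ls Set.univ := by
  have h1 := H.ls_add_le h Set.univ Set.univ (saturated_univ _) (saturated_univ _)
    (fun _ _ _ => Iff.rfl) trivial
  have h2 := length_pos A hmin α
  omega

theorem exists_longest (A : InvCNFA S) (h : ¬ IsEmpty A.T) : ∃ α, A.Longest α := by
  have := not_isEmpty_iff.1 h
  exact Finite.exists_max fun t => (A.label t).length

/-- Cutting has made both ends of α final, hence `surv` provides their images. -/
theorem exists_foldBack (A : InvCNFA S) (α : A.T) {A₂ : InvCNFA S} {ρ : A.Q → Option A₂.Q}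
    (P : Pres (A.cut α).toInvAut A₂.toInvAut ρ) :
    ∃ (C : InvCNFA S) (σ : A.Q → Option C.Q), FoldBack A α A₂ ρ C σ := by
  obtain ⟨p, hp⟩ := P.surv (A.src α) (Or.inr (Or.inl rfl))
  obtain ⟨q, hq⟩ := P.surv (A.tgt α) (Or.inr (Or.inr rfl))
  obtain ⟨D, τ, hD⟩ := exists_foldsTo
    (A₂.restore p q (A.label α) {y | ∃ x ∈ A.F, ρ x = some y}) (Sum.inr ((), true))
  obtain ⟨C, κ, hC⟩ := exists_minimalizes D
  exact ⟨C.toCNFA, _, .mk p q hp hq D.toCNFA τ hD C.toCNFA κ hC⟩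

/-- Induction on the total label length, which is smaller both for the automaton of a recursive call
and for the next iteration. -/
theorem exists_run_loop (A : InvCNFA S) (hA : A.Anchored) (hmin : A.Minimalistic) :
    ∃ (B : InvCNFA S) (ρ : A.Q → Option B.Q) (N : ℕ), Run .loop A B ρ N := by
  induction hn : A.ls Set.univ using Nat.strong_induction_on generalizing A with
  | _ n ih =>
  subst hn
  by_cases h : IsEmpty A.T
  · exact ⟨A, some, 0, .trivial A h⟩
  obtain ⟨α, hα⟩ := exists_longest A h
  have hrun : ∃ (A₂ : InvCNFA S) (ρ : (A.cut α).Q → Option A₂.Q) (N : ℕ),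
      Run .ensure (A.cut α) A₂ ρ N := by
    by_cases hc : (A.cut α).IsCDFA
    · exact ⟨_, _, _, .skip _ hc⟩
    · obtain ⟨A₀, ρ, hm⟩ := exists_minimalizes (A.cut α).toInvAut
      have P := hm.1.stepPres (anchored_cut hA α)
      obtain ⟨B, σ, N, hB⟩ := ih _ (P.toPres.ls_univ_le.trans_lt (ls_cut_lt A hmin α)) A₀.toCNFA
        P.anch hm.2 rfl
      exact ⟨B, _, N, .call _ A₀.toCNFA _ _ _ _ hc hm hB⟩
  obtain ⟨A₂, ρ, N, hr⟩ := hrun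
  obtain ⟨P, h₂⟩ := hr.pres_and_isCDFA (anchored_cut hA α) (by rintro ⟨⟩)
  obtain ⟨C, σ, hf⟩ := exists_foldBack A α P
  have H := hf.stepResult hA hmin P h₂
  by_cases hc : C.IsCDFA
  · exact ⟨_, _, _, .finish A A₂ C α ρ σ N hα hr hf hc⟩
  · obtain ⟨B, τ, M, hB⟩ := ih _ (H.ls_lt hmin hc) C H.pres.anch H.minimalistic rfl
    exact ⟨_, _, _, .next A A₂ C B α ρ σ τ N M hα hr hf hc hB⟩

theorem exists_run_ensure (A : InvCNFA S) (hA : A.Anchored) :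
    ∃ (B : InvCNFA S) (ρ : A.Q → Option B.Q) (N : ℕ), Run .ensure A B ρ N := by
  by_cases hc : A.IsCDFA
  · exact ⟨_, _, _, .skip _ hc⟩
  · obtain ⟨A₀, ρ, hm⟩ := exists_minimalizes A.toInvAut
    obtain ⟨B, σ, N, hB⟩ := exists_run_loop A₀.toCNFA (hm.1.stepPres hA).anch hm.2
    exact ⟨B, _, N, .call _ A₀.toCNFA _ _ _ _ hc hm hB⟩

theorem Next.step {A C : InvCNFA S} (h : Next C A) (hA : A.Anchored) (hmin : A.Minimalistic) :
    C.Anchored ∧ C.Minimalistic ∧ C.ls Set.univ < A.ls Set.univ := by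
  obtain ⟨_, _, α, ρ, hα, h, hm⟩ | ⟨_, A₂, _, α, ρ, σ, N, hα, hr, hf, h⟩ := h
  · have P := hm.1.stepPres (anchored_cut hA α)
    exact ⟨P.anch, hm.2, P.toPres.ls_univ_le.trans_lt (ls_cut_lt A hmin α)⟩
  · have H := hf.stepResult_of_run hA hmin hr
    exact ⟨H.pres.anch, H.minimalistic, H.ls_lt hmin h⟩

theorem acc_next (A : InvCNFA S) (hA : A.Anchored) (hmin : A.Minimalistic) : Acc Next A := by
  induction hn : A.ls Set.univ using Nat.strong_induction_on generalizing A with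
  | _ n ih =>
  subst hn
  refine ⟨_, fun C h => ?_⟩
  obtain ⟨h1, h2, h3⟩ := h.step hA hmin
  exact ih _ h3 C h1 h2 rfl

theorem halts_of_anchored (A : InvCNFA S) (hA : A.Anchored) : A.Halts := by
  refine ⟨?_, fun A₀ ρ hm => ?_⟩
  · obtain ⟨A₀, ρ, hm⟩ := exists_minimalizes A.toInvAut
    obtain ⟨B, σ, N, hB⟩ := exists_run_loop A₀.toCNFA (hm.1.stepPres hA).anch hm.2
    exact ⟨B, N, A₀.toCNFA, ρ, σ, hm, hB⟩
  · have h₀ := (hm.1.stepPres hA).anch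
    refine ⟨acc_next A₀ h₀ hm.2, fun C hC => ?_⟩
    have hgood : C.Anchored ∧ C.Minimalistic := by
      induction hC with
      | refl => exact ⟨h₀, hm.2⟩
      | tail _ hs ih =>
        obtain ⟨h1, h2, -⟩ := hs.step ih.1 ih.2
        exact ⟨h1, h2⟩
    intro α _
    refine ⟨exists_run_ensure _ (anchored_cut hgood.1 α), fun A₂ σ N hr => ?_⟩
    exact exists_foldBack C α (hr.pres_and_isCDFA (anchored_cut hgood.1 α) (by rintro ⟨⟩)).1

end InvCNFA

namespace InvAut

variable {S : Type u}

/-! ### Counting transitions and marked states -/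

/-- The number of transitions which leave a state. -/
noncomputable def deg (A : InvAut S) (x : A.Q) : ℕ := (A.outgoing x).ncard

/-- Every state which is not marked has at least three outgoing transitions. -/
def Thick (A : InvAut S) : Prop := ∀ x, x ∉ A.marks → 3 ≤ A.deg x

theorem Minimalistic.thick {A : InvAut S} (h : A.Minimalistic) : A.Thick := by
  intro x hx
  by_contra hd
  have hd' : (A.outgoing x).ncard ≤ 2 := by unfold deg at hd; omega
  exact h.2 ⟨x, fun e => hx (Or.inr e), fun e => hx (Or.inl e),
    (A.ncard_outgoing_eq x).trans_le hd', hd'⟩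

theorem one_le_deg {A : InvAut S} {x : A.Q} (t : A.T) (h : A.src t = x) : 1 ≤ A.deg x :=
  (Set.ncard_pos (Set.toFinite _)).2 ⟨t, h⟩

theorem two_le_deg {A : InvAut S} {x : A.Q} {t t' : A.T} (h : A.src t = x) (h' : A.src t' = x)
    (hne : t ≠ t') : 2 ≤ A.deg x := by
  rw [← Set.ncard_pair hne]
  exact Set.ncard_le_ncard (by rintro _ (rfl | rfl) <;> assumption) (Set.toFinite _)

theorem eq_of_deg_le_one {A : InvAut S} {x : A.Q} {t t' : A.T} (h : A.deg x ≤ 1)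
    (ht : A.src t = x) (ht' : A.src t' = x) : t = t' := by
  by_contra hne
  have := two_le_deg ht ht' hne
  omega

theorem deg_eq_zero {A : InvAut S} {x : A.Q} : A.deg x = 0 ↔ A.outgoing x = ∅ :=
  Set.ncard_eq_zero (Set.toFinite _)

theorem tc_eq_sum (A : InvAut S) (h : Set A.Q) [Fintype A.Q] [DecidablePred (· ∈ h)] :
    A.tc h = ∑ x with x ∈ h, A.deg x := by
  classical
  have := Fintype.ofFinite A.T
  rw [tc_eq_ncard, Set.ncard_eq_toFinset_card']
  rw [Finset.card_eq_sum_card_fiberwise (f := A.src) (t := Finset.univ.filter (· ∈ h))]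
  · refine Finset.sum_congr rfl fun x hx => ?_
    rw [deg, Set.ncard_eq_toFinset_card']
    congr 1
    ext t
    simp only [Finset.mem_filter, Set.mem_toFinset, Set.mem_ofPred_eq, WordAut.outgoing]
    constructor
    · exact fun h => Set.mem_toFinset.2 h.2
    · intro ht
      have ht' := Set.mem_toFinset.1 ht
      obtain rfl : A.src t = x := ht'
      exact ⟨(Finset.mem_filter.1 hx).2, rfl⟩
  · intro t ht
    simpa using ht

theorem mul_ncard_le_tc (A : InvAut S) (h : Set A.Q) (m : ℕ) (hm : ∀ x ∈ h, m ≤ A.deg x) :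
    m * h.ncard ≤ A.tc h := by
  classical
  have := Fintype.ofFinite A.Q
  rw [tc_eq_sum, Set.ncard_eq_toFinset_card', mul_comm, ← smul_eq_mul]
  have : h.toFinset = Finset.univ.filter (· ∈ h) := by ext; simp
  rw [this]
  exact Finset.card_nsmul_le_sum _ _ _ fun x hx => hm x (Finset.mem_filter.1 hx).2

theorem tc_le_mul_ncard (A : InvAut S) (h : Set A.Q) (m : ℕ) (hm : ∀ x ∈ h, A.deg x ≤ m) :
    A.tc h ≤ m * h.ncard := by
  classical
  have := Fintype.ofFinite A.Q
  rw [tc_eq_sum, Set.ncard_eq_toFinset_card', mul_comm, ← smul_eq_mul]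
  have : h.toFinset = Finset.univ.filter (· ∈ h) := by ext; simp
  rw [this]
  exact Finset.sum_le_card_nsmul _ _ _ fun x hx => hm x (Finset.mem_filter.1 hx).2

theorem tc_union {A : InvAut S} {h k : Set A.Q} (hd : Disjoint h k) :
    A.tc (h ∪ k) = A.tc h + A.tc k := by
  have := A.wt_inter_add_diff (h ∪ k) h fun _ => 1
  rw [Set.union_inter_cancel_left, Set.union_sdiff_cancel_left hd.le_bot] at this
  exact this.symm

theorem mc_union {A : InvAut S} {h k : Set A.Q} (hd : Disjoint h k) :
    A.mc (h ∪ k) = A.mc h + A.mc k := by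
  have := A.mc_inter_add_diff (h ∪ k) h
  rw [Set.union_inter_cancel_left, Set.union_sdiff_cancel_left hd.le_bot] at this
  exact this.symm

theorem tc_singleton (A : InvAut S) (x : A.Q) : A.tc {x} = A.deg x := A.tc_eq_ncard {x}

theorem mc_le_ncard (A : InvAut S) (h : Set A.Q) : A.mc h ≤ h.ncard :=
  Set.ncard_le_ncard Set.inter_subset_left (Set.toFinite _)

theorem mc_add_ncard_diff (A : InvAut S) (h : Set A.Q) :
    A.mc h + (h \ A.marks).ncard = h.ncard :=
  Set.ncard_inter_add_ncard_sdiff_eq_ncard h A.marks (Set.toFinite _)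

/-- A thick set of states without isolated states has many transitions. -/
theorem Thick.three_mul_ncard_le {A : InvAut S} (hA : A.Thick) (h : Set A.Q)
    (h1 : ∀ x ∈ h, 1 ≤ A.deg x) : 3 * h.ncard ≤ A.tc h + 2 * A.mc h := by
  have e := A.wt_inter_add_diff h A.marks fun _ => 1
  have m1 := A.mul_ncard_le_tc (h ∩ A.marks) 1 fun x hx => h1 x hx.1
  have m2 := A.mul_ncard_le_tc (h \ A.marks) 3 fun x hx => hA x hx.2
  have m3 := A.mc_add_ncard_diff h
  unfold mc at *
  unfold tc at *
  omega

/-- Isolated states may be discarded. On the others thickness gives 3V ≤ tc + 2m; combining twice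
this inequality with 3tc + 4m ≤ 6V + b leaves tc ≤ b. -/
theorem tc_le_of_bound {A : InvAut S} (hA : A.Thick) {d : Set A.Q} {b : ℕ}
    (hd : A.Saturated d)
    (h : ∀ h, A.Saturated h → h ⊆ d → 3 * A.tc h + 4 * A.mc h ≤ 6 * h.ncard + b) :
    A.tc d ≤ b := by
  set k : Set A.Q := d ∩ {x | 1 ≤ A.deg x} with hk
  have hs : A.Saturated k := fun t ht =>
    ⟨hd t ht.1, one_le_deg (A.inv t) (A.src_inv t)⟩
  have h1 := h k hs Set.inter_subset_left
  have h2 := hA.three_mul_ncard_le k fun x hx => hx.2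
  have h3 : A.tc d = A.tc k := by
    have e := A.wt_inter_add_diff d {x | 1 ≤ A.deg x} fun _ => 1
    rw [← hk] at e
    have : A.tc (d \ {x | 1 ≤ A.deg x}) ≤ 0 * (d \ {x | 1 ≤ A.deg x}).ncard :=
      A.tc_le_mul_ncard _ 0 fun x hx => by
        have := hx.2
        simp only [Set.mem_ofPred_eq, not_le] at this
        omega
    unfold tc at *
    omega
  omega

/-- No transition between states in `c` joins two states with only one outgoing transition. -/
def NoSegment (A : InvAut S) (c : Set A.Q) : Prop :=
  ∀ t, A.src t ∈ c → 2 ≤ A.deg (A.src t) ∨ 2 ≤ A.deg (A.tgt t)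

/-- The transitions in `c` between states with at least two outgoing transitions. -/
def inner (A : InvAut S) (c : Set A.Q) : Set A.T :=
  {t | A.src t ∈ c ∧ 2 ≤ A.deg (A.src t) ∧ 2 ≤ A.deg (A.tgt t)}

/-- Here `L` counts the leaves, which are marked by thickness, `a` and `b` the marked and the
unmarked states with at least two outgoing transitions, and `N` the transitions leaving the latter
states. Without segments each leaf hangs on a branching state, so `N` consists of `L` and the inner
transitions. What is used later is the identity 3tc + 2m − 6V = |inner| + 2(N − 2a − 3b), whose last
term is non-negative; the final clause improves this at a state of larger degree. Below, 3tc + 2m −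
6V is called the excess. -/
theorem Thick.counts {A : InvAut S} (hA : A.Thick) {c : Set A.Q} (hc : A.Saturated c)
    (h1 : ∀ x ∈ c, 1 ≤ A.deg x) (hseg : A.NoSegment c) :
    ∃ N L a b : ℕ, A.tc c = N + L ∧ c.ncard = L + a + b ∧ A.mc c = L + a ∧
      N = L + (A.inner c).ncard ∧ a + b = (c ∩ {x | 2 ≤ A.deg x}).ncard ∧ 2 * a + 3 * b ≤ N ∧
      ∀ x ∈ c, 2 ≤ A.deg x → (x ∈ A.marks → 2 * a + 3 * b + A.deg x ≤ N + 2) ∧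
        (x ∉ A.marks → 2 * a + 3 * b + A.deg x ≤ N + 3) := by
  classical
  set D : Set A.Q := {x | 2 ≤ A.deg x} with hD
  have hleaf : ∀ x ∈ c \ D, A.deg x = 1 := fun x hx => by
    have h2 := h1 x hx.1
    have h3 : ¬ 2 ≤ A.deg x := hx.2
    omega
  have e1 := A.wt_inter_add_diff c D fun _ => 1
  have e2 := Set.ncard_inter_add_ncard_sdiff_eq_ncard c D (Set.toFinite _)
  have e3 := A.mc_inter_add_diff c D
  have e4 : A.tc (c \ D) = (c \ D).ncard := by
    refine le_antisymm ?_ ?_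
    · simpa using A.tc_le_mul_ncard (c \ D) 1 fun x hx => (hleaf x hx).le
    · simpa using A.mul_ncard_le_tc (c \ D) 1 fun x hx => (hleaf x hx).ge
  have e5 : A.mc (c \ D) = (c \ D).ncard := by
    unfold mc
    congr 1
    refine Set.inter_eq_left.2 fun x hx => ?_
    by_contra hm
    have := hA x hm
    have := hleaf x hx
    omega
  have e6 := A.mc_add_ncard_diff (c ∩ D)
  have e7 : A.tc (c ∩ D) = (A.inner c).ncard + (c \ D).ncard := by
    rw [← e4, tc_eq_ncard, tc_eq_ncard]
    have : {t | A.src t ∈ c ∩ D} = A.inner c ∪ A.inv '' {t | A.src t ∈ c \ D} := by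
      ext t
      constructor
      · rintro ⟨hc', hd⟩
        by_cases h : 2 ≤ A.deg (A.tgt t)
        · exact Or.inl ⟨hc', hd, h⟩
        · refine Or.inr ⟨A.inv t, ⟨?_, ?_⟩, A.inv_inv t⟩
          · rw [A.src_inv]; exact hc t hc'
          · rw [A.src_inv]; exact h
      · rintro (⟨hc', hd, -⟩ | ⟨t, ⟨hc', hd⟩, rfl⟩)
        · exact ⟨hc', hd⟩
        · have hs : A.src (A.inv t) = A.tgt t := A.src_inv t
          refine ⟨?_, ?_⟩
          · rw [hs]; exact hc t hc'
          · rw [hs]; exact (hseg t hc').resolve_left hd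
    rw [this, Set.ncard_union_eq, Set.ncard_image_of_injective _ A.inv_injective]
    rw [Set.disjoint_left]
    rintro _ ⟨-, -, h⟩ ⟨t, ⟨-, hd⟩, rfl⟩
    rw [A.tgt_inv] at h
    exact hd h
  have key : ∀ h : Set A.Q, h ⊆ c ∩ D →
      2 * A.mc h + 3 * (h \ A.marks).ncard ≤ A.tc h := by
    intro h hh
    have e := A.wt_inter_add_diff h A.marks fun _ => 1
    have m1 := A.mul_ncard_le_tc (h ∩ A.marks) 2 fun x hx => (hh hx.1).2
    have m2 := A.mul_ncard_le_tc (h \ A.marks) 3 fun x hx => hA x hx.2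
    unfold mc
    unfold tc at *
    omega
  refine ⟨A.tc (c ∩ D), (c \ D).ncard, A.mc (c ∩ D), ((c ∩ D) \ A.marks).ncard, ?_, ?_, ?_, ?_,
    e6, key _ subset_rfl, fun x hx hx2 => ?_⟩
  · rw [← e4]; exact e1.symm
  · omega
  · omega
  · omega
  · have hmem : {x} ⊆ c ∩ D := Set.singleton_subset_iff.2 ⟨hx, hx2⟩
    have k1 := key ((c ∩ D) \ {x}) Set.sdiff_subset
    have k2 := A.wt_inter_add_diff (c ∩ D) {x} fun _ => 1
    have k3 := A.mc_inter_add_diff (c ∩ D) {x}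
    have k4 := Set.ncard_inter_add_ncard_sdiff_eq_ncard ((c ∩ D) \ A.marks) {x} (Set.toFinite _)
    rw [Set.inter_eq_right.2 hmem] at k2 k3
    have k5 := A.tc_singleton x
    have k6 : ((c ∩ D) \ A.marks) \ {x} = ((c ∩ D) \ {x}) \ A.marks := by
      ext y; simp only [Set.mem_sdiff]; tauto
    rw [k6] at k4
    have k7 : x ∈ A.marks → A.mc {x} = 1 ∧ ((c ∩ D) \ A.marks ∩ {x}).ncard = 0 := by
      intro hm
      refine ⟨?_, ?_⟩
      · rw [mc, Set.inter_eq_left.2 (Set.singleton_subset_iff.2 hm), Set.ncard_singleton]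
      · rw [Set.ncard_eq_zero (Set.toFinite _), Set.eq_empty_iff_forall_notMem]
        rintro y ⟨hy, rfl⟩
        exact hy.2 hm
    have k8 : x ∉ A.marks → A.mc {x} = 0 ∧ ((c ∩ D) \ A.marks ∩ {x}).ncard = 1 := by
      intro hm
      refine ⟨?_, ?_⟩
      · rw [mc, Set.ncard_eq_zero (Set.toFinite _), Set.eq_empty_iff_forall_notMem]
        rintro y ⟨rfl, hy⟩
        exact hm hy
      · rw [Set.inter_eq_right.2 (Set.singleton_subset_iff.2 (show x ∈ (c ∩ D) \ A.marks from ⟨⟨hx, hx2⟩, hm⟩)), Set.ncard_singleton]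
    unfold tc at *
    refine ⟨fun hm => ?_, fun hm => ?_⟩
    · obtain ⟨a1, a2⟩ := k7 hm
      omega
    · obtain ⟨a1, a2⟩ := k8 hm
      omega

end InvAut

namespace InvAut

variable {S : Type u}

/-! ### The measure which decreases in recursive calls -/

/-- A bound on a weighted count of transitions, marked states and states, for all unions of
connected components in `d`. -/
def BndOn (A : InvAut S) (d : Set A.Q) (r b : ℕ) : Prop :=
  ∀ h, A.Saturated h → h ⊆ d → 3 * A.tc h + 2 * r * A.mc h ≤ 6 * h.ncard + b

/-- Pull a saturated set back to `A`, inside `d`: there the number of marks and the difference tc −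
2V are at least as large. -/
theorem Pres.bndOn {A B : InvAut S} {ρ : A.Q → Option B.Q} (P : Pres A B ρ) (hA : A.Anchored)
    {d : Set A.Q} {d' : Set B.Q} (sd : A.Saturated d) (c : Corr ρ d d') {r b : ℕ}
    (H : A.BndOn d r b) : B.BndOn d' r b := by
  intro h' s' hd
  obtain ⟨h, s, hc⟩ := P.exists_pullback hA s'
  have c' : Corr ρ (h ∩ d) h' := fun x y hxy =>
    ⟨fun hx => (hc x y hxy).1 hx.1, fun hy => ⟨(hc x y hxy).2 hy, (c x y hxy).2 (hd hy)⟩⟩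
  have h1 := H _ (s.inter sd) Set.inter_subset_right
  have h2 := (ConnPres.mono_unique P (s.inter sd) s' c').1
  have h3 := Nat.mul_le_mul_left (2 * r) (P.mc_le c')
  omega

theorem Pres.bndOn_univ {A B : InvAut S} {ρ : A.Q → Option B.Q} (P : Pres A B ρ) (hA : A.Anchored)
    {r b : ℕ} (H : A.BndOn Set.univ r b) : B.BndOn Set.univ r b :=
  P.bndOn hA (saturated_univ _) (fun _ _ _ => Iff.rfl) H

theorem ncard_inter_insert_le {Q : Type} [Finite Q] (h M : Set Q) (u : Q) :
    ∃ i ≤ 1, (h ∩ insert u M).ncard ≤ (h ∩ M).ncard + i ∧ (u ∉ h ∨ u ∈ M → i = 0) := by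
  by_cases hu : u ∉ h ∨ u ∈ M
  · refine ⟨0, Nat.zero_le _, Set.ncard_le_ncard ?_ (Set.toFinite _), fun _ => rfl⟩
    rintro x ⟨hx, rfl | hx'⟩
    · exact ⟨hx, hu.resolve_left (not_not.2 hx)⟩
    · exact ⟨hx, hx'⟩
  · refine ⟨1, le_rfl, ?_, fun h => absurd h hu⟩
    refine le_trans (Set.ncard_le_ncard ?_ (Set.toFinite _)) (Set.ncard_insert_le u (h ∩ M))
    rintro x ⟨hx, rfl | hx'⟩
    · exact Or.inl rfl
    · exact Or.inr ⟨hx, hx'⟩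

/-- The number of transitions in `h` other than `α` and its inverse. -/
noncomputable def cutTc (A : InvAut S) (α : A.T) (h : Set A.Q) : ℕ := (A.cutAut α).tc h

/-- The number of states in `h` which are marked or end points of `α`. -/
noncomputable def cutMc (A : InvAut S) (α : A.T) (h : Set A.Q) : ℕ := (A.cutAut α).mc h

theorem bndOn_cutAut_iff {A : InvAut S} {α : A.T} {d : Set A.Q} {r b : ℕ} :
    (A.cutAut α).BndOn d r b ↔ ∀ h : Set A.Q, (A.cutAut α).Saturated h → h ⊆ d →
      3 * A.cutTc α h + 2 * r * A.cutMc α h ≤ 6 * h.ncard + b := Iff.rfl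

section Cut

variable {A : InvAut S} {α β : A.T}

theorem cutTc_union {h k : Set A.Q} (hd : Disjoint h k) :
    A.cutTc α (h ∪ k) = A.cutTc α h + A.cutTc α k := tc_union (A := A.cutAut α) hd

theorem cutMc_union {h k : Set A.Q} (hd : Disjoint h k) :
    A.cutMc α (h ∪ k) = A.cutMc α h + A.cutMc α k := mc_union (A := A.cutAut α) hd

/-- The numbers `i` and `j` count the marks newly placed on the two ends. No new mark arises at an
end outside `h` or already marked, and a loop has only one end to mark. -/
theorem mc_cutAut_le (hβ : β = α ∨ β = A.inv α) (h : Set A.Q) :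
    ∃ i ≤ 1, ∃ j ≤ 1, A.cutMc α h ≤ A.mc h + i + j ∧
      (A.src β ∉ h ∨ A.src β ∈ A.marks → i = 0) ∧ (A.tgt β ∉ h ∨ A.tgt β ∈ A.marks → j = 0) ∧
      (A.src β = A.tgt β → j = 0) := by
  obtain ⟨i, hi, h1, h2⟩ := ncard_inter_insert_le h A.marks (A.src β)
  obtain ⟨j, hj, h3, h4⟩ := ncard_inter_insert_le h (insert (A.src β) A.marks) (A.tgt β)
  refine ⟨i, hi, j, hj, ?_, h2, fun h => h4 (h.imp_right Or.inr), fun h => h4 (Or.inr (Or.inl h.symm))⟩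
  have : A.cutMc α h ≤ (h ∩ insert (A.tgt β) (insert (A.src β) A.marks)).ncard := by
    refine Set.ncard_le_ncard ?_ (Set.toFinite _)
    rintro x ⟨hx, hm⟩
    refine ⟨hx, ?_⟩
    have hm' : (x ∈ A.F ∨ x = A.src α ∨ x = A.tgt α) ∨ x = A.q0 := hm
    rcases hβ with rfl | rfl
    · rcases hm' with (h | h | h) | h
      · exact Or.inr (Or.inr (Or.inl h))
      · exact Or.inr (Or.inl h)
      · exact Or.inl h
      · exact Or.inr (Or.inr (Or.inr h))
    · rw [A.src_inv, A.tgt_inv]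
      rcases hm' with (h | h | h) | h
      · exact Or.inr (Or.inr (Or.inl h))
      · exact Or.inl h
      · exact Or.inr (Or.inl h)
      · exact Or.inr (Or.inr (Or.inr h))
  have hmc : A.mc h = (h ∩ A.marks).ncard := rfl
  exact this.trans (by omega)

theorem off_iff_of_eq_or (hβ : β = α ∨ β = A.inv α) {t : A.T} : A.Off β t ↔ A.Off α t := by
  rcases hβ with rfl | rfl
  · exact Iff.rfl
  · unfold Off
    rw [A.inv_inv, Set.pair_comm]

theorem saturated_of_cutAut {h : Set A.Q} (hβ : β = α ∨ β = A.inv α)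
    (hs : (A.cutAut α).Saturated h) (huv : A.src β ∈ h ↔ A.tgt β ∈ h) : A.Saturated h := by
  intro t ht
  by_cases ho : A.Off α t
  · exact hs ⟨t, off_iff_remove.1 ho⟩ ht
  · rw [← off_iff_of_eq_or hβ] at ho
    rcases not_not.1 ho with e | e
    · obtain rfl : t = β := e
      exact huv.1 ht
    · obtain rfl : t = A.inv β := e
      rw [A.tgt_inv]
      rw [A.src_inv] at ht
      exact huv.2 ht

theorem tc_cutAut (hα : A.inv α ≠ α) (hβ : β = α ∨ β = A.inv α) {h : Set A.Q}
    (hs : A.Saturated h) :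
    (A.src β ∈ h → A.cutTc α h + 2 = A.tc h) ∧
      (A.src β ∉ h → A.cutTc α h = A.tc h) := by
  classical
  have key := wt_cutAut hα hs (φ := fun _ => 1) (fun _ => rfl)
  have : A.src β ∈ h ↔ A.src α ∈ h := by
    rcases hβ with rfl | rfl
    · exact Iff.rfl
    · rw [A.src_inv]; exact (hs.src_iff_tgt α).symm
  refine ⟨fun hm => ?_, fun hm => ?_⟩
  · rw [if_pos (this.1 hm)] at key
    exact key
  · rw [if_neg (fun h => hm (this.2 h))] at key
    exact key

theorem outgoing_cutAut_eq_empty {x : A.Q} :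
    (A.cutAut α).outgoing x = ∅ ↔ ∀ t, A.Off α t → A.src t ≠ x := by
  constructor
  · intro h t ht hs
    have hm : (⟨t, off_iff_remove.1 ht⟩ : (A.cutAut α).T) ∈ (A.cutAut α).outgoing x := hs
    rw [h] at hm
    exact hm
  · intro h
    exact Set.eq_empty_of_forall_notMem fun t ht => h t.1 (off_iff_remove.2 t.2) ht

/-- The transition `α` has an end point with no transitions other than `α` and its inverse. -/
def FinalEdge (A : InvAut S) (α : A.T) : Prop :=
  (A.cutAut α).outgoing (A.src α) = ∅ ∨ (A.cutAut α).outgoing (A.tgt α) = ∅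

theorem FinalEdge.exists_eq (h : A.FinalEdge α) :
    ∃ β, (β = α ∨ β = A.inv α) ∧ (A.cutAut α).outgoing (A.tgt β) = ∅ := by
  rcases h with h | h
  · exact ⟨A.inv α, Or.inr rfl, by rwa [A.tgt_inv]⟩
  · exact ⟨α, Or.inl rfl, h⟩

/-- The only transition leaving this end is the inverse of β, so thickness requires a mark. -/
theorem mem_marks_of_outgoing_cutAut_empty (hA : A.Thick) (hβ : β = α ∨ β = A.inv α)
    (h : (A.cutAut α).outgoing (A.tgt β) = ∅) (hne : A.src β ≠ A.tgt β) :
    A.tgt β ∈ A.marks := by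
  by_contra hm
  have h1 := hA _ hm
  have h2 : A.deg (A.tgt β) ≤ 1 := by
    rw [deg, ← Set.ncard_singleton (A.inv β)]
    refine Set.ncard_le_ncard ?_ (Set.toFinite _)
    intro t ht
    by_cases ho : A.Off α t
    · exact absurd ht (outgoing_cutAut_eq_empty.1 h t ho)
    · rw [← off_iff_of_eq_or hβ] at ho
      rcases not_not.1 ho with e | e
      · obtain rfl : t = β := e
        exact absurd ht hne
      · exact e
  omega

/-- Let v be the end isolated by the cut; unless α is a loop, v is marked already. Removing α lowers
3tc by 6, while at most one new mark adds 2r ≤ 4. A set that contains only one end differs from a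
saturated set of `A` just in v, and adding or omitting v is accounted for by its old mark and by the
inequality 2r ≤ 6. -/
theorem FinalEdge.bndOn (hA : A.Thick) (hα : A.inv α ≠ α) (h : A.FinalEdge α) {d : Set A.Q}
    (hd : A.Saturated d) {r b : ℕ} (hr : r = 1 ∨ r = 2) (H : A.BndOn d r b) :
    (A.cutAut α).BndOn d r b := by
  obtain ⟨β, hβ, ho⟩ := h.exists_eq
  refine bndOn_cutAut_iff.2 fun k hk hkd => ?_
  obtain ⟨i, hi, j, hj, m1, m2, m3, m4⟩ := mc_cutAut_le hβ k
  have hmark := mem_marks_of_outgoing_cutAut_empty hA hβ ho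
  have hdβ := hd.src_iff_tgt β
  by_cases hiff : A.src β ∈ k ↔ A.tgt β ∈ k
  · have hs := saturated_of_cutAut hβ hk hiff
    have h1 := H k hs hkd
    have h2 := tc_cutAut hα hβ hs
    by_cases hu : A.src β ∈ k
    · have h3 := h2.1 hu
      have hj0 : j = 0 := by
        by_cases hne : A.src β = A.tgt β
        · exact m4 hne
        · exact m3 (Or.inr (hmark hne))
      rcases hr with rfl | rfl <;> omega
    · have h3 := h2.2 hu
      have hi0 := m2 (Or.inl hu)
      have hj0 := m3 (Or.inl fun h => hu (hiff.2 h))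
      rcases hr with rfl | rfl <;> omega
  · have hne : A.src β ≠ A.tgt β := fun e => hiff (by rw [e])
    have hv := hmark hne
    have hmv : A.mc {A.tgt β} = 1 := by
      rw [mc, Set.inter_eq_left.2 (Set.singleton_subset_iff.2 hv), Set.ncard_singleton]
    have htv : A.cutTc α {A.tgt β} = 0 :=
      ((A.cutAut α).tc_singleton (A.tgt β)).trans (deg_eq_zero.2 ho)
    have hj0 := m3 (Or.inr hv)
    have hsat : ∀ k' : Set A.Q, (∀ x, x ≠ A.tgt β → (x ∈ k' ↔ x ∈ k)) →
        (A.cutAut α).Saturated k' := by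
      intro k' hk' t ht
      have e1 : A.src t.1 ≠ A.tgt β := outgoing_cutAut_eq_empty.1 ho t.1 (off_iff_remove.2 t.2)
      have e2 : A.tgt t.1 ≠ A.tgt β := by
        rw [← A.src_inv]
        exact outgoing_cutAut_eq_empty.1 ho _ (Off.inv (W := A) (off_iff_remove.2 t.2))
      exact (hk' _ e2).2 (hk t ((hk' _ e1).1 ht))
    by_cases hu : A.src β ∈ k
    · have hvk : A.tgt β ∉ k := fun h => hiff ⟨fun _ => h, fun _ => hu⟩
      have hs : A.Saturated (k ∪ {A.tgt β}) :=
        saturated_of_cutAut hβ (hsat _ fun x hx => or_iff_left hx)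
          ⟨fun _ => Or.inr rfl, fun _ => Or.inl hu⟩
      have hdis : Disjoint k {A.tgt β} := Set.disjoint_singleton_right.2 hvk
      have h1 := H _ hs (Set.union_subset hkd
        (Set.singleton_subset_iff.2 (hdβ.1 (hkd hu))))
      have h2 := (tc_cutAut hα hβ hs).1 (Or.inl hu)
      have h3 := cutTc_union (α := α) hdis
      have h4 := mc_union (A := A) hdis
      have h5 : (k ∪ {A.tgt β}).ncard = k.ncard + 1 := by
        rw [Set.ncard_union_eq hdis, Set.ncard_singleton]
      rw [htv] at h3
      rcases hr with rfl | rfl <;> omega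
    · have hvk : A.tgt β ∈ k := by
        by_contra hvk
        exact hiff ⟨fun h => absurd h hu, fun h => absurd h hvk⟩
      have hs : A.Saturated (k \ {A.tgt β}) :=
        saturated_of_cutAut hβ (hsat _ fun x hx => and_iff_left hx)
          ⟨fun h => absurd h.1 hu, fun h => absurd rfl h.2⟩
      have hdis : Disjoint (k \ {A.tgt β}) {A.tgt β} := Set.disjoint_sdiff_left
      have hun : k \ {A.tgt β} ∪ {A.tgt β} = k :=
        Set.sdiff_union_of_subset (Set.singleton_subset_iff.2 hvk)
      have h1 := H _ hs (Set.sdiff_subset.trans hkd)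
      have h2 := (tc_cutAut hα hβ hs).2 fun h => hu h.1
      have h3 := cutTc_union (α := α) hdis
      have h6 := cutMc_union (α := α) hdis
      have h7 : A.cutMc α {A.tgt β} ≤ 1 := (mc_le_ncard (A.cutAut α) _).trans_eq (Set.ncard_singleton _)
      have h4 := mc_union (A := A) hdis
      have h5 : (k \ {A.tgt β} ∪ {A.tgt β}).ncard = (k \ {A.tgt β}).ncard + 1 := by
        rw [Set.ncard_union_eq hdis, Set.ncard_singleton]
      rw [hun] at h3 h4 h5 h6
      have hi0 := m2 (Or.inl hu)
      rw [htv] at h3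
      rcases hr with rfl | rfl <;> omega

/-- A state that is still unmarked is not an end of α, so it has kept all its transitions. -/
theorem thick_cutAut (hA : A.Thick) : (A.cutAut α).Thick := by
  intro x hx
  have h1 : x ∉ A.marks := fun h => hx (h.imp_left Or.inl)
  have h2 := hA x h1
  refine h2.trans ?_
  have hinj : A.outgoing x ⊆ Subtype.val '' ((A.cutAut α).outgoing x) := by
    intro t ht
    have ho : A.Off α t := by
      rintro (e | e)
      · exact hx (Or.inl (Or.inr (Or.inl (by rw [← e]; exact ht.symm))))
      · refine hx (Or.inl (Or.inr (Or.inr ?_)))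
        rw [show t = A.inv α from e] at ht
        exact (ht.symm.trans (A.src_inv α))
    exact ⟨⟨t, off_iff_remove.1 ho⟩, ht, rfl⟩
  exact (Set.ncard_le_ncard hinj (Set.toFinite _)).trans (Set.ncard_image_le (Set.toFinite _))

end Cut

end InvAut

/-! ### Cutting a transition that is not final -/

namespace InvAut

variable {S : Type u}

theorem one_le_deg_of_mem_component {A : InvAut S} {w x : A.Q} (hw : 1 ≤ A.deg w)
    (hx : x ∈ A.component w) : 1 ≤ A.deg x := by
  by_contra h
  obtain ⟨g, hg⟩ := hx
  have h0 : A.outgoing x = ∅ := deg_eq_zero.1 (by omega)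
  obtain rfl := hg.symm.eq_of_outgoing_empty h0
  omega

theorem saturated_pair_of_segment {A : InvAut S} {t : A.T} (h1 : A.deg (A.src t) ≤ 1)
    (h2 : A.deg (A.tgt t) ≤ 1) : A.Saturated {A.src t, A.tgt t} := by
  rintro t' (h | h)
  · obtain rfl := eq_of_deg_le_one h1 h rfl
    exact Or.inr rfl
  · obtain rfl := eq_of_deg_le_one h2 h (A.src_inv t)
    exact Or.inl (A.tgt_inv t)

theorem noSegment_component {A : InvAut S} {w : A.Q}
    (hw : ∀ t, A.src t = w → 2 ≤ A.deg (A.src t) ∨ 2 ≤ A.deg (A.tgt t)) :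
    A.NoSegment (A.component w) := by
  intro t ht
  by_contra h
  obtain ⟨g, hg⟩ := ht
  have hs := saturated_pair_of_segment (A := A) (t := t) (by omega) (by omega)
  rcases (hs.conn hg).2 (Or.inl rfl) with e | e
  · exact h (hw t e.symm)
  · have := hw (A.inv t) ((A.src_inv t).trans e.symm)
    rw [A.src_inv, A.tgt_inv] at this
    exact h this.symm

theorem noSegment_component_of_deg {A : InvAut S} {w : A.Q} (hw : 2 ≤ A.deg w) :
    A.NoSegment (A.component w) :=
  noSegment_component fun t ht => Or.inl (by rwa [ht])

theorem NoSegment.union {A : InvAut S} {c d : Set A.Q} (hc : A.NoSegment c) (hd : A.NoSegment d) :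
    A.NoSegment (c ∪ d) := fun t ht => ht.elim (hc t) (hd t)

theorem Saturated.union {A : InvAut S} {c d : Set A.Q} (hc : A.Saturated c) (hd : A.Saturated d) :
    A.Saturated (c ∪ d) := fun t ht => ht.imp (hc t) (hd t)

theorem Saturated.compl {A : InvAut S} {c : Set A.Q} (hc : A.Saturated c) : A.Saturated cᶜ :=
  fun t ht h => ht ((hc.src_iff_tgt t).2 h)

theorem Saturated.component_subset {A : InvAut S} {c : Set A.Q} (hc : A.Saturated c) {x : A.Q}
    (hx : x ∈ c) : A.component x ⊆ c := fun _ ⟨_, h⟩ => (hc.conn h).1 hx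

section Cut

variable {A : InvAut S} {α β : A.T}

theorem not_finalEdge_iff : ¬ A.FinalEdge α ↔
    (∃ t, A.Off α t ∧ A.src t = A.src α) ∧ ∃ t, A.Off α t ∧ A.src t = A.tgt α := by
  unfold FinalEdge
  rw [outgoing_cutAut_eq_empty, outgoing_cutAut_eq_empty]
  push Not
  exact Iff.rfl

theorem two_le_deg_src (h : ¬ A.FinalEdge α) : 2 ≤ A.deg (A.src α) := by
  obtain ⟨⟨t, ho, ht⟩, -⟩ := not_finalEdge_iff.1 h
  exact two_le_deg ht rfl fun e => ho (Or.inl e)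

theorem two_le_deg_tgt (h : ¬ A.FinalEdge α) : 2 ≤ A.deg (A.tgt α) := by
  obtain ⟨-, ⟨t, ho, ht⟩⟩ := not_finalEdge_iff.1 h
  exact two_le_deg ht (A.src_inv α) fun e => ho (Or.inr e)

theorem pair_subset_inner (h : ¬ A.FinalEdge α) {c : Set A.Q} (hc : A.Saturated c)
    (hα : A.src α ∈ c) : ({α, A.inv α} : Set A.T) ⊆ A.inner c := by
  have h1 := two_le_deg_src h
  have h2 := two_le_deg_tgt h
  rintro _ (rfl | rfl)
  · exact ⟨hα, h1, h2⟩
  · refine ⟨?_, ?_, ?_⟩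
    · rw [A.src_inv]; exact hc _ hα
    · rwa [A.src_inv]
    · rwa [A.tgt_inv]

theorem two_le_ncard_inner (hα : A.inv α ≠ α) (h : ¬ A.FinalEdge α) {c : Set A.Q}
    (hc : A.Saturated c) (hm : A.src α ∈ c) : 2 ≤ (A.inner c).ncard := by
  rw [← Set.ncard_pair hα.symm]
  exact Set.ncard_le_ncard (pair_subset_inner h hc hm) (Set.toFinite _)

/-- Neither end of α is a leaf, so α and its inverse are inner transitions, and by `Thick.counts`
the excess of a component is at least the number of these. -/
theorem Thick.le_component (hA : A.Thick) (hα : A.inv α ≠ α) (h : ¬ A.FinalEdge α) :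
    6 * (A.component (A.src α)).ncard + 2 ≤
      3 * A.tc (A.component (A.src α)) + 2 * A.mc (A.component (A.src α)) := by
  have h1 := two_le_deg_src h
  obtain ⟨N, L, a, b, e1, e2, e3, e4, -, e5, -⟩ := hA.counts (saturated_component A (A.src α))
    (fun x hx => one_le_deg_of_mem_component (by omega) hx) (noSegment_component_of_deg h1)
  have := two_le_ncard_inner hα h (saturated_component A (A.src α)) (mem_component_self _ _)
  omega

theorem deg_cutAut_add_one (hβ : β = α ∨ β = A.inv α)
    (hne : A.src β ≠ A.tgt β) : A.deg (A.tgt β) = (A.cutAut α).deg (A.tgt β) + 1 := by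
  have hset : A.outgoing (A.tgt β) =
      insert (A.inv β) (Subtype.val '' ((A.cutAut α).outgoing (A.tgt β))) := by
    ext t
    constructor
    · intro ht
      by_cases ho : A.Off α t
      · exact Or.inr ⟨⟨t, off_iff_remove.1 ho⟩, ht, rfl⟩
      · rw [← off_iff_of_eq_or hβ] at ho
        rcases not_not.1 ho with e | e
        · obtain rfl : t = β := e
          exact absurd ht hne
        · exact Or.inl e
    · rintro (rfl | ⟨t, ht, rfl⟩)
      · exact A.src_inv β
      · exact ht
  unfold deg
  rw [hset, Set.ncard_insert_of_notMem]
  · exact congrArg (· + 1) (Set.ncard_image_of_injective _ Subtype.val_injective)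
  rintro ⟨t, -, ht⟩
  have ho := (off_iff_of_eq_or hβ).2 (off_iff_remove.2 t.2)
  exact ho (Or.inr ht)

/-- If a set contains both ends, removing α lowers 3tc by 6 and two marks add 4, a gain of 2. If it
contains only one end, it is completed by the component K of the other end after the cut. The excess
of K is not negative unless K is a single edge with two leaves; but then the end had degree two in
`A`, so it was marked before, and the mark that is saved compensates. If the set contains neither
end, it is completed by the component of α, whose excess is at least 2. -/
theorem bndOn_cutAut_one (hA : A.Thick) (hα : A.inv α ≠ α) (h : ¬ A.FinalEdge α) {l : ℕ}
    (H : A.BndOn Set.univ 1 (2 * (l + 1))) : (A.cutAut α).BndOn Set.univ 1 (2 * l) := by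
  refine bndOn_cutAut_iff.2 fun k hk _ => ?_
  have hA' : (A.cutAut α).Thick := thick_cutAut hA
  have split : ∀ β, β = α ∨ β = A.inv α → A.src β ∈ k → A.tgt β ∉ k →
      3 * A.cutTc α k + 2 * 1 * A.cutMc α k ≤ 6 * k.ncard + 2 * l := by
    intro β hβ hu hv
    have hne : A.src β ≠ A.tgt β := fun e => hv (e ▸ hu)
    have key : ∃ K : Set A.Q, (A.cutAut α).Saturated K ∧ A.tgt β ∈ K ∧ Disjoint k K ∧
        (6 * K.ncard ≤ 3 * A.cutTc α K + 2 * A.cutMc α K ∨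
          A.tgt β ∈ A.marks ∧ 6 * K.ncard ≤ 3 * A.cutTc α K + 2 * A.cutMc α K + 2) := by
      have hd1 : 1 ≤ (A.cutAut α).deg (A.tgt β) := by
        obtain ⟨⟨t, ho, ht⟩, ⟨t', ho', ht'⟩⟩ := not_finalEdge_iff.1 h
        rcases hβ with rfl | rfl
        · exact one_le_deg (A := A.cutAut β) ⟨t', off_iff_remove.1 ho'⟩ ht'
        · rw [A.tgt_inv]
          exact one_le_deg (A := A.cutAut α) ⟨t, off_iff_remove.1 ho⟩ ht
      have hdis : ∀ K : Set A.Q, (A.cutAut α).Saturated K →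
          (∀ x ∈ K, ∃ g, (A.cutAut α).Conn (A.tgt β) g x) → Disjoint k K := by
        intro K _ hconn
        rw [Set.disjoint_left]
        intro x hx hxK
        obtain ⟨g, hg⟩ := hconn x hxK
        exact hv ((hk.conn hg).2 hx)
      by_cases hseg : ∀ t, (A.cutAut α).src t = A.tgt β →
          2 ≤ (A.cutAut α).deg ((A.cutAut α).src t) ∨ 2 ≤ (A.cutAut α).deg ((A.cutAut α).tgt t)
      · have hs := saturated_component (A.cutAut α) (A.tgt β)
        refine ⟨(A.cutAut α).component (A.tgt β), hs, mem_component_self (A.cutAut α) _,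
          hdis _ hs fun x hx => hx, Or.inl ?_⟩
        obtain ⟨N, L, a, b, e1, e2, e3, e4, -, e5, -⟩ := hA'.counts hs
          (fun x hx => one_le_deg_of_mem_component hd1 hx) (noSegment_component hseg)
        have arith : ∀ q t m J : ℕ, t = N + L → q = L + a + b → m = L + a → N = L + J →
            6 * q ≤ 3 * t + 2 * m := by intros; omega
        exact arith _ _ _ _ e1 e2 e3 e4
      · push Not at hseg
        obtain ⟨t, ht, h1, h2⟩ := hseg
        have hd : (A.cutAut α).deg (A.tgt β) = 1 := by
          rw [ht] at h1
          omega
        have hs := saturated_pair_of_segment (A := A.cutAut α) (t := t) (by omega) (by omega)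
        have hmem : A.tgt β ∈ ({(A.cutAut α).src t, (A.cutAut α).tgt t} : Set A.Q) := Or.inl ht.symm
        refine ⟨{(A.cutAut α).src t, (A.cutAut α).tgt t}, hs, hmem, hdis _ hs ?_, Or.inr ⟨?_, ?_⟩⟩
        · rintro x (rfl | rfl)
          · exact ⟨1, (Conn.nil (A := A.cutAut α) _).cast ht rfl⟩
          · exact ⟨_, (Conn.single (A := A.cutAut α) t).cast ht rfl⟩
        · by_contra hm
          have := hA _ hm
          rw [deg_cutAut_add_one hβ hne, hd] at this
          omega
        · have m1 := mul_ncard_le_tc (A.cutAut α) {(A.cutAut α).src t, (A.cutAut α).tgt t} 1 (by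
            rintro x (rfl | rfl)
            · exact one_le_deg t rfl
            · exact one_le_deg _ ((A.cutAut α).src_inv t))
          have m2 := hA'.three_mul_ncard_le {(A.cutAut α).src t, (A.cutAut α).tgt t} (by
            rintro x (rfl | rfl)
            · exact one_le_deg t rfl
            · exact one_le_deg _ ((A.cutAut α).src_inv t))
          have m3 : ({(A.cutAut α).src t, (A.cutAut α).tgt t} : Set (A.cutAut α).Q).ncard ≤ 2 :=
            (Set.ncard_insert_le _ _).trans (by rw [Set.ncard_singleton])
          have arith : ∀ q t m : ℕ, 1 * q ≤ t → 3 * q ≤ t + 2 * m → q ≤ 2 →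
              6 * q ≤ 3 * t + 2 * m + 2 := by intros; omega
          exact arith _ _ _ m1 m2 m3
    obtain ⟨K, sK, hvK, hdis, hK⟩ := key
    have hs : A.Saturated (k ∪ K) := saturated_of_cutAut hβ (hk.union sK)
      ⟨fun _ => Or.inr hvK, fun _ => Or.inl hu⟩
    have h1 := H _ hs (Set.subset_univ _)
    have h2 := (tc_cutAut hα hβ hs).1 (Or.inl hu)
    have h3 := cutTc_union (α := α) hdis
    have h4 := cutMc_union (α := α) hdis
    have h5 := Set.ncard_union_eq hdis (Set.toFinite _) (Set.toFinite _)
    obtain ⟨i, hi, j, hj, m1, m2, m3, m4⟩ := mc_cutAut_le hβ (k ∪ K)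
    rcases hK with hK | ⟨hm, hK⟩
    · omega
    · have := m3 (Or.inr hm)
      omega
  by_cases hu : A.src α ∈ k
  · by_cases hv : A.tgt α ∈ k
    · have hs := saturated_of_cutAut (Or.inl rfl) hk ⟨fun _ => hv, fun _ => hu⟩
      have h1 := H _ hs (Set.subset_univ _)
      have h2 := (tc_cutAut hα (Or.inl rfl) hs).1 hu
      obtain ⟨i, hi, j, hj, m1, -⟩ := mc_cutAut_le (A := A) (α := α) (Or.inl rfl) k
      omega
    · exact split α (Or.inl rfl) hu hv
  · by_cases hv : A.tgt α ∈ k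
    · exact split (A.inv α) (Or.inr rfl) (by rwa [A.src_inv]) (by rwa [A.tgt_inv])
    · have hs := saturated_of_cutAut (Or.inl rfl) hk ⟨fun h => absurd h hu, fun h => absurd h hv⟩
      have hdis : Disjoint k (A.component (A.src α)) := by
        rw [Set.disjoint_left]
        rintro x hx ⟨g, hg⟩
        exact hu ((hs.conn hg).2 hx)
      have h0 := hA.le_component hα h
      have h1 := H _ (hs.union (saturated_component A (A.src α))) (Set.subset_univ _)
      have h2 := (tc_cutAut hα (Or.inl rfl) hs).2 hu
      have h3 := tc_union (A := A) hdis
      have h4 := mc_union (A := A) hdis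
      have h5 := Set.ncard_union_eq hdis (Set.toFinite _) (Set.toFinite _)
      obtain ⟨i, hi, j, hj, m1, m2, m3, m4⟩ := mc_cutAut_le (A := A) (α := α) (Or.inl rfl) k
      have := m2 (Or.inl hu)
      have := m3 (Or.inl hv)
      omega

/-- With marks of weight 4, removing α changes the sum by −6 + 8 = 2. Thickness gives 6V ≤ 3tc + 4m
on every component without isolated states, so here the completion needs no exception for segments.
-/
theorem bndOn_cutAut_two (hA : A.Thick) (hα : A.inv α ≠ α) (h : ¬ A.FinalEdge α) {l : ℕ}
    (H : A.BndOn Set.univ 2 (2 * l)) : (A.cutAut α).BndOn Set.univ 2 (2 * (l + 1)) := by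
  refine bndOn_cutAut_iff.2 fun k hk _ => ?_
  have hA' : (A.cutAut α).Thick := thick_cutAut hA
  have split : ∀ β, β = α ∨ β = A.inv α → A.src β ∈ k → A.tgt β ∉ k →
      3 * A.cutTc α k + 2 * 2 * A.cutMc α k ≤ 6 * k.ncard + 2 * (l + 1) := by
    intro β hβ hu hv
    have hd1 : 1 ≤ (A.cutAut α).deg (A.tgt β) := by
      obtain ⟨⟨t, ho, ht⟩, ⟨t', ho', ht'⟩⟩ := not_finalEdge_iff.1 h
      rcases hβ with rfl | rfl
      · exact one_le_deg (A := A.cutAut β) ⟨t', off_iff_remove.1 ho'⟩ ht'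
      · rw [A.tgt_inv]
        exact one_le_deg (A := A.cutAut α) ⟨t, off_iff_remove.1 ho⟩ ht
    have key : ∃ K : Set A.Q, (A.cutAut α).Saturated K ∧ A.tgt β ∈ K ∧ Disjoint k K ∧
        6 * K.ncard ≤ 3 * A.cutTc α K + 4 * A.cutMc α K := by
      refine ⟨(A.cutAut α).component (A.tgt β), saturated_component (A.cutAut α) (A.tgt β),
        mem_component_self (A.cutAut α) _, ?_, ?_⟩
      · refine Set.disjoint_left.2 ?_
        rintro x hx ⟨g, hg⟩
        exact hv ((hk.conn hg).2 hx)
      · have m2 := hA'.three_mul_ncard_le _ fun x hx => one_le_deg_of_mem_component hd1 hx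
        have arith : ∀ q t m : ℕ, 3 * q ≤ t + 2 * m → 6 * q ≤ 3 * t + 4 * m := by intros; omega
        exact arith _ _ _ m2
    obtain ⟨K, sK, hvK, hdis, hK⟩ := key
    have hs : A.Saturated (k ∪ K) := saturated_of_cutAut hβ (hk.union sK)
      ⟨fun _ => Or.inr hvK, fun _ => Or.inl hu⟩
    have h1 := H _ hs (Set.subset_univ _)
    have h2 := (tc_cutAut hα hβ hs).1 (Or.inl hu)
    have h3 := cutTc_union (α := α) hdis
    have h4 := cutMc_union (α := α) hdis
    have h5 := Set.ncard_union_eq hdis (Set.toFinite _) (Set.toFinite _)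
    obtain ⟨i, hi, j, hj, m1, m2, m3, m4⟩ := mc_cutAut_le hβ (k ∪ K)
    omega
  by_cases hu : A.src α ∈ k
  · by_cases hv : A.tgt α ∈ k
    · have hs := saturated_of_cutAut (Or.inl rfl) hk ⟨fun _ => hv, fun _ => hu⟩
      have h1 := H _ hs (Set.subset_univ _)
      have h2 := (tc_cutAut hα (Or.inl rfl) hs).1 hu
      obtain ⟨i, hi, j, hj, m1, -⟩ := mc_cutAut_le (A := A) (α := α) (Or.inl rfl) k
      omega
    · exact split α (Or.inl rfl) hu hv
  · by_cases hv : A.tgt α ∈ k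
    · exact split (A.inv α) (Or.inr rfl) (by rwa [A.src_inv]) (by rwa [A.tgt_inv])
    · have hs := saturated_of_cutAut (Or.inl rfl) hk ⟨fun h => absurd h hu, fun h => absurd h hv⟩
      have h1 := H _ hs (Set.subset_univ _)
      have h2 := (tc_cutAut hα (Or.inl rfl) hs).2 hu
      obtain ⟨i, hi, j, hj, m1, m2, m3, m4⟩ := mc_cutAut_le (A := A) (α := α) (Or.inl rfl) k
      have := m2 (Or.inl hu)
      have := m3 (Or.inl hv)
      omega

end Cut

end InvAut

/-! ### The shape of automata at the lowest levels, and parity of lengths -/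

namespace InvAut

variable {S : Type u}

theorem isCDFA_of_unbranched {A : InvAut S} (h : A.Unbranched)
    (hl : ∀ t, FreeGroup.IsReduced (A.label t) ∧ A.label t ≠ []) : A.IsCDFA :=
  ⟨⟨fun t => (hl t).2, fun t t' hs _ => h t t' hs⟩, fun t => (hl t).1⟩

/-- By `Thick.counts` an excess of at most 2 means |inner| + 2(N − 2a − 3b) ≤ 2. Moreover N − 2a −
3b ≥ deg x − 3 at each branching state x. -/
theorem Thick.inner_le {A : InvAut S} (hA : A.Thick) (H : A.BndOn Set.univ 1 2) {c : Set A.Q}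
    (hc : A.Saturated c) (h1 : ∀ x ∈ c, 1 ≤ A.deg x) (hseg : A.NoSegment c) :
    (A.inner c).ncard ≤ 2 ∧ ∀ x ∈ c, 2 ≤ A.deg x → (A.inner c).ncard + 2 * A.deg x ≤ 8 := by
  obtain ⟨N, L, a, b, e1, e2, e3, e4, -, e5, e6⟩ := hA.counts hc h1 hseg
  have h := H c hc (Set.subset_univ _)
  refine ⟨by omega, fun x hx hx2 => ?_⟩
  obtain ⟨f1, f2⟩ := e6 x hx hx2
  by_cases hm : x ∈ A.marks
  · have := f1 hm
    omega
  · have := f2 hm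
    omega

section

variable {A : InvAut S} {α : A.T}

/-- The transition α and its inverse already use up the excess 2, so there is no other inner
transition, and 2 + 2 deg w ≤ 8. Uniting the components lets both statements hold for a `w` in a
different component as well. -/
theorem inner_component_union (hA : A.Thick) (hα : A.inv α ≠ α) (hf : ¬ A.FinalEdge α)
    (H : A.BndOn Set.univ 1 2) {w : A.Q} (hw : 2 ≤ A.deg w) :
    A.inner (A.component (A.src α) ∪ A.component w) = {α, A.inv α} ∧ A.deg w ≤ 3 := by
  have h2 := two_le_deg_src hf
  have hc := (saturated_component A (A.src α)).union (saturated_component A w)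
  have hm : A.src α ∈ A.component (A.src α) ∪ A.component w := Or.inl (mem_component_self _ _)
  obtain ⟨m1, m2⟩ := hA.inner_le H hc
    (fun x hx => hx.elim (one_le_deg_of_mem_component (by omega))
      (one_le_deg_of_mem_component (by omega)))
    ((noSegment_component_of_deg h2).union (noSegment_component_of_deg hw))
  have m3 := m2 w (Or.inr (mem_component_self _ _)) hw
  have m4 := two_le_ncard_inner hα hf hc hm
  refine ⟨(Set.eq_of_subset_of_ncard_le (pair_subset_inner hf hc hm) ?_ (Set.toFinite _)).symm,
    by omega⟩
  rwa [Set.ncard_pair hα.symm]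

theorem four_le_deg (hα : A.inv α ≠ α) (hl : A.src α = A.tgt α) {t t' : A.T} (hne : t ≠ t')
    (ht : A.Off α t) (ht' : A.Off α t') (hs : A.src t = A.src α) (hs' : A.src t' = A.src α) :
    4 ≤ A.deg (A.src α) := by
  have e : (insert α (insert (A.inv α) {t, t'}) : Set A.T).ncard = 4 := by
    rw [Set.ncard_insert_of_notMem, Set.ncard_insert_of_notMem, Set.ncard_pair hne]
    · rintro (h | h)
      · exact ht (Or.inr h.symm)
      · exact ht' (Or.inr h.symm)
    · rintro (h | h | h)
      · exact hα h.symm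
      · exact ht (Or.inl h.symm)
      · exact ht' (Or.inl h.symm)
  rw [← e]
  refine Set.ncard_le_ncard ?_ (Set.toFinite _)
  rintro _ (rfl | rfl | rfl | rfl)
  · rfl
  · exact (A.src_inv _).trans hl.symm
  · exact hs
  · exact hs'

/-- As α is not final, other transitions leave both its ends, so both ends are the centre and α is a
loop. Any branching left after the cut would also be at the centre, which would have degree at least
4 instead of at most 3. -/
theorem unbranched_cutAut_of_subStar (hA : A.Thick) (hα : A.inv α ≠ α) (hf : ¬ A.FinalEdge α)
    (H : A.BndOn Set.univ 1 2) (hs : A.SubStar) : (A.cutAut α).Unbranched := by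
  obtain ⟨v, hv⟩ := hs
  intro t t' hs
  by_contra hne
  have ho := off_iff_remove.2 t.2
  have ho' := off_iff_remove.2 t'.2
  have hne' : t.1 ≠ t'.1 := fun e => hne (Subtype.ext e)
  have hw : A.src t.1 = v := by
    by_contra h
    exact hne' (hv _ _ hs h)
  obtain ⟨⟨s, hso, hss⟩, ⟨s', hso', hss'⟩⟩ := not_finalEdge_iff.1 hf
  have hu : A.src α = v := by
    by_contra h
    exact hso (Or.inl (hv s α hss (by rwa [hss])))
  have hv' : A.tgt α = v := by
    by_contra h
    exact hso' (Or.inr (hv s' (A.inv α) (hss'.trans (A.src_inv α).symm) (by rwa [hss'])))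
  have h4 := four_le_deg hα (hu.trans hv'.symm) hne' ho ho' (hw.trans hu.symm)
    (hs.symm.trans (hw.trans hu.symm))
  have h3 := (inner_component_union hA hα hf H (w := A.src α) (by omega)).2
  omega

/-- Suppose `t`, `t'` branch off the same state after the cut. They lead to leaves, since no inner
transitions other than α and its inverse exist there. As that state has degree at most 3, some end
of α is another state, and a further transition `s` leaves it. With α and all inverses these are
seven transitions. -/
theorem unbranched_cutAut_of_card_le (hA : A.Thick) (hα : ∀ t, A.inv t ≠ t)
    (hf : ¬ A.FinalEdge α) (H : A.BndOn Set.univ 1 2) (hcard : Nat.card A.T ≤ 6) :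
    (A.cutAut α).Unbranched := by
  intro t₀ t₀' hs
  by_contra hne₀
  obtain ⟨t, ho⟩ := t₀
  obtain ⟨t', ho'⟩ := t₀'
  replace ho := off_iff_remove.2 ho
  replace ho' := off_iff_remove.2 ho'
  have hne : t ≠ t' := fun e => hne₀ (Subtype.ext e)
  have hs' : A.src t = A.src t' := hs
  have hw : 2 ≤ A.deg (A.src t) := two_le_deg rfl hs'.symm hne
  obtain ⟨hin, h3⟩ := inner_component_union hA (hα α) hf H hw
  have leaf : ∀ r, A.Off α r → A.src r = A.src t → A.deg (A.tgt r) ≤ 1 := by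
    intro r hr hrs
    by_contra hd
    have : r ∈ A.inner (A.component (A.src α) ∪ A.component (A.src t)) := by
      refine ⟨Or.inr ?_, ?_, by omega⟩
      · rw [hrs]; exact mem_component_self _ _
      · rw [hrs]; exact hw
    rw [hin] at this
    exact hr this
  have l1 := leaf t ho rfl
  have l2 := leaf t' ho' hs'.symm
  have hex : ∃ s, A.Off α s ∧ A.src s ≠ A.src t ∧ 2 ≤ A.deg (A.src s) := by
    obtain ⟨⟨s, hso, hss⟩, ⟨s', hso', hss'⟩⟩ := not_finalEdge_iff.1 hf
    by_cases hu : A.src α = A.src t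
    · by_cases hv : A.tgt α = A.src t
      · have := four_le_deg (hα α) (hu.trans hv.symm) hne ho ho' hu.symm
          (hs'.symm.trans hu.symm)
        rw [hu] at this
        omega
      · exact ⟨s', hso', by rwa [hss'], by rw [hss']; exact two_le_deg_tgt hf⟩
    · exact ⟨s, hso, by rwa [hss], by rw [hss]; exact two_le_deg_src hf⟩
  obtain ⟨s, hso, hsw, hsd⟩ := hex
  have d1 : A.deg (A.src (A.inv t)) ≤ 1 := by rwa [A.src_inv]
  have d2 : A.deg (A.src (A.inv t')) ≤ 1 := by rwa [A.src_inv]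
  have n1 : s ≠ t := fun e => hsw (by rw [e])
  have n2 : s ≠ t' := fun e => hsw (by rw [e, hs'])
  have n3 : s ≠ A.inv t := fun e => by rw [e] at hsd; omega
  have n4 : s ≠ A.inv t' := fun e => by rw [e] at hsd; omega
  have n5 : t ≠ A.inv t' := fun e => by rw [e] at hw; omega
  have n6 : t' ≠ A.inv t := fun e => by rw [hs', e] at hw; omega
  have n7 : A.inv t ≠ A.inv t' := fun e => hne (A.inv_injective e)
  have off : ∀ {r}, A.Off α r → r ≠ α ∧ r ≠ A.inv α := fun h =>
    ⟨fun e => h (Or.inl e), fun e => h (Or.inr e)⟩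
  have o1 := off ho
  have o2 := off ho'
  have o3 := off (Off.inv ho)
  have o4 := off (Off.inv ho')
  have o5 := off hso
  have nd : [α, A.inv α, t, t', A.inv t, A.inv t', s].Nodup := by
    have := hα α
    have := hα t
    have := hα t'
    simp only [List.nodup_cons, List.mem_cons, List.not_mem_nil, or_false, not_or, List.nodup_nil,
      not_false_eq_true, and_true]
    refine ⟨⟨?_, ?_, ?_, ?_, ?_, ?_⟩, ⟨?_, ?_, ?_, ?_, ?_⟩, ⟨?_, ?_, ?_, ?_⟩, ⟨?_, ?_, ?_⟩,
      ⟨?_, ?_⟩, ?_⟩ <;> first | assumption | (apply Ne.symm; assumption) | tauto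
  classical
  have := Fintype.ofFinite A.T
  have hle := nd.length_le_card
  rw [← Nat.card_eq_fintype_card] at hle
  simp only [List.length_cons, List.length_nil] at hle
  omega

theorem finalEdge_of_bndOn_zero (hA : A.Thick) (hα : A.inv α ≠ α) (H : A.BndOn Set.univ 1 0) :
    A.FinalEdge α := by
  by_contra hf
  have h1 := hA.le_component hα hf
  have h2 := H _ (saturated_component A (A.src α)) (Set.subset_univ _)
  omega

theorem mem_of_bndOn_compl (hA : A.Thick) (hα : A.inv α ≠ α) (hf : ¬ A.FinalEdge α) {c : Set A.Q}
    (hc : A.Saturated c) (H : A.BndOn cᶜ 1 0) : A.src α ∈ c := by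
  by_contra hm
  have h1 := hA.le_component hα hf
  have h2 := H _ (saturated_component A (A.src α)) (hc.compl.component_subset hm)
  omega

/-- A single edge branches only if it is a loop. Its two transitions would be inner, which makes the
excess positive. -/
theorem isCDFA_of_card_le_two (hA : A.Thick)
    (hl : ∀ t, FreeGroup.IsReduced (A.label t) ∧ A.label t ≠ []) (H : A.BndOn Set.univ 1 0)
    (hcard : Nat.card A.T ≤ 2) : A.IsCDFA := by
  refine isCDFA_of_unbranched (fun t t' hs => ?_) hl
  by_contra hne
  have hinv := inv_ne (hl t).1 (hl t).2
  have ht' : t' = A.inv t := by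
    by_contra h
    have nd : [t, t', A.inv t].Nodup := by
      simp only [List.nodup_cons, List.mem_cons, List.not_mem_nil, or_false, not_or,
        List.nodup_nil, not_false_eq_true, and_true]
      exact ⟨⟨hne, hinv.symm⟩, h⟩
    have := Fintype.ofFinite A.T
    have hle := nd.length_le_card
    rw [← Nat.card_eq_fintype_card] at hle
    simp only [List.length_cons, List.length_nil] at hle
    omega
  have hd := two_le_deg rfl hs.symm hne
  subst ht'
  have hc := saturated_component A (A.src t)
  obtain ⟨N, L, a, b, e1, e2, e3, e4, -, e5, -⟩ := hA.counts hc
    (fun x hx => one_le_deg_of_mem_component (by omega) hx) (noSegment_component_of_deg hd)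
  have h2 := H _ hc (Set.subset_univ _)
  have h3 : 2 ≤ (A.inner (A.component (A.src t))).ncard := by
    rw [← Set.ncard_pair hne]
    refine Set.ncard_le_ncard ?_ (Set.toFinite _)
    rw [A.src_inv] at hs
    rintro _ (rfl | rfl)
    · exact ⟨mem_component_self _ _, hd, by rwa [← hs]⟩
    · refine ⟨?_, ?_, ?_⟩
      · rw [A.src_inv, ← hs]; exact mem_component_self _ _
      · rwa [A.src_inv, ← hs]
      · rwa [A.tgt_inv]
  omega

/-- Since α is the only inner edge, the component consists of the ends of α and leaves attached to
them, so a + b ≤ 2. The bound for the excess forces N = 2a + 3b, and the formulas of `Thick.counts`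
give 3tc + 4m − 6V = 6(a + b) − 2 ≤ 10. -/
theorem bndOn_component (hA : A.Thick) (hα : A.inv α ≠ α) (hf : ¬ A.FinalEdge α)
    (H : A.BndOn Set.univ 1 2) : A.BndOn (A.component (A.src α)) 2 10 := by
  set c := A.component (A.src α) with hc
  have hs : A.Saturated c := saturated_component A _
  intro h hh hsub
  rcases h.eq_empty_or_nonempty with rfl | ⟨x, hx⟩
  · have h1 : A.tc ∅ ≤ 0 * (∅ : Set A.Q).ncard := A.tc_le_mul_ncard ∅ 0 fun x hx => absurd hx id
    have h2 := A.mc_le_ncard ∅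
    rw [Set.ncard_empty] at *
    omega
  have heq : h = c := by
    refine hsub.antisymm (hh.component_subset ?_)
    obtain ⟨g, hg⟩ := hsub hx
    exact (hh.conn hg).2 hx
  rw [heq]
  have hd := two_le_deg_src hf
  obtain ⟨N, L, a, b, e1, e2, e3, e4, e5, e6, -⟩ := hA.counts hs
    (fun x hx => one_le_deg_of_mem_component (by omega) hx) (noSegment_component_of_deg hd)
  have h2 := H _ hs (Set.subset_univ _)
  have hin : A.inner c = {α, A.inv α} := by
    have := (inner_component_union hA hα hf H hd).1
    rwa [Set.union_self] at this
  have hJ : (A.inner c).ncard = 2 := by rw [hin, Set.ncard_pair hα.symm]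
  -- The ends of α and their leaves form a saturated set, which therefore contains the whole
  -- component.
  have hZ : A.Saturated ({A.src α, A.tgt α} ∪
      {x | A.deg x ≤ 1 ∧ ∃ t, A.src t = x ∧ A.tgt t ∈ ({A.src α, A.tgt α} : Set A.Q)}) := by
    have huv : ∀ y ∈ ({A.src α, A.tgt α} : Set A.Q), y ∈ c ∧ 2 ≤ A.deg y := by
      rintro _ (rfl | rfl)
      · exact ⟨mem_component_self _ _, hd⟩
      · exact ⟨hs _ (mem_component_self _ _), two_le_deg_tgt hf⟩
    rintro t (ht | ⟨h1, t', ht', htgt⟩)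
    · by_cases h1 : A.deg (A.tgt t) ≤ 1
      · exact Or.inr ⟨h1, A.inv t, A.src_inv t, by rwa [A.tgt_inv]⟩
      · have : t ∈ A.inner c := ⟨(huv _ ht).1, (huv _ ht).2, by omega⟩
        rw [hin] at this
        rcases this with rfl | rfl
        · exact Or.inl (Or.inr rfl)
        · exact Or.inl (Or.inl (A.tgt_inv α))
    · obtain rfl := eq_of_deg_le_one h1 ht' rfl
      exact Or.inl htgt
  have hsubZ := hZ.component_subset (x := A.src α) (Or.inl (Or.inl rfl))
  have hab : (c ∩ {x | 2 ≤ A.deg x}).ncard ≤ 2 := by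
    refine (Set.ncard_le_ncard (t := {A.src α, A.tgt α}) ?_ (Set.toFinite _)).trans
      ((Set.ncard_insert_le _ _).trans (by rw [Set.ncard_singleton]))
    rintro x ⟨hxc, hx2⟩
    rcases hsubZ hxc with h | h
    · exact h
    · have h1 := h.1
      have h2 : 2 ≤ A.deg x := hx2
      omega
  omega

/-- The component of α has excess at least 2, so nothing is left for the other components. -/
theorem bndOn_compl_component (hA : A.Thick) (hα : A.inv α ≠ α) (hf : ¬ A.FinalEdge α)
    (H : A.BndOn Set.univ 1 2) : A.BndOn (A.component (A.src α))ᶜ 1 0 := by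
  intro h hh hsub
  have hdis : Disjoint h (A.component (A.src α)) := Set.disjoint_left.2 fun x hx => hsub hx
  have h0 := hA.le_component hα hf
  have h1 := H _ (hh.union (saturated_component A (A.src α))) (Set.subset_univ _)
  have h3 := tc_union (A := A) hdis
  have h4 := mc_union (A := A) hdis
  have h5 := Set.ncard_union_eq hdis (Set.toFinite _) (Set.toFinite _)
  omega

/-- Two transitions from one state that are not mutually inverse come with a third non-empty label.
If they are mutually inverse, both labels are single letters, and a letter differs from its inverse.
-/
theorem isCDFA_of_ls_le_two (hl : ∀ t, FreeGroup.IsReduced (A.label t) ∧ A.label t ≠ [])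
    (h : A.ls Set.univ ≤ 2) : A.IsCDFA := by
  classical
  have hls : A.ls Set.univ = ∑ᶠ t, (A.label t).length :=
    finsum_congr fun t => if_pos trivial
  have hpos : ∀ t, 1 ≤ (A.label t).length := fun t => List.length_pos_iff.2 (hl t).2
  refine ⟨⟨fun t => (hl t).2, fun t t' hs hh => ?_⟩, fun t => (hl t).1⟩
  by_contra hne
  have hinv := inv_ne (hl t).1 (hl t).2
  by_cases ht' : t' = A.inv t
  · subst ht'
    have h2 := sum_le_finsum_of_injective (fun t => (A.label t).length)
      (fun b : Bool => if b then t else A.inv t) (by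
        intro b b' e
        cases b <;> cases b' <;> simp at e ⊢
        · exact hinv e
        · exact hinv e.symm)
    rw [Fintype.sum_bool, ← hls] at h2
    simp only [if_true, Bool.false_eq_true, if_false] at h2
    have p1 := hpos t
    have p2 := hpos (A.inv t)
    obtain ⟨a, ha⟩ := List.length_eq_one_iff.1 (show (A.label t).length = 1 by omega)
    rw [A.label_inv, ha] at hh
    have : some a = some (FreeGroup.invLetter a) := hh
    exact FreeGroup.invLetter_ne a (Option.some_inj.1 this).symm
  · have h2 := sum_le_finsum_of_injective (fun t => (A.label t).length)
      (fun i : Fin 3 => ![t, t', A.inv t] i) (by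
        intro i j e
        fin_cases i <;> fin_cases j <;> simp at e ⊢
        · exact hne e
        · exact hinv e.symm
        · exact hne e.symm
        · exact ht' e
        · exact hinv e
        · exact ht' e.symm)
    rw [Fin.sum_univ_three, ← hls] at h2
    have p1 := hpos t
    have p2 := hpos t'
    have p3 := hpos (A.inv t)
    simp only [Matrix.cons_val_zero, Matrix.cons_val_one, Matrix.cons_val_two] at h2
    change (A.label t).length + (A.label t').length + (A.label (A.inv t)).length ≤ _ at h2
    omega

end

/-- Formal inversion exchanges the positive with the negative letters, so there are equally many of
both. -/
theorem even_length_of_invRev_eq {w : List (S × Bool)} (h : FreeGroup.invRev w = w) :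
    Even w.length := by
  have h1 : (FreeGroup.invRev w).countP (fun a => a.2) = w.countP (fun a => !a.2) := by
    unfold FreeGroup.invRev
    rw [List.countP_reverse, List.countP_map]
    rfl
  rw [h] at h1
  have h2 := List.length_eq_countP_add_countP (fun a : S × Bool => a.2) (l := w)
  have h3 : w.countP (fun a => decide ¬ (a.2 = true)) = w.countP (fun a => !a.2) := by
    congr 1
    funext a
    cases a.2 <;> rfl
  rw [h3, ← h1] at h2
  exact ⟨_, h2⟩

/-- Transitions cancel in pairs modulo 2; one that is its own inverse has a label of even length.
Hence halving the total length loses nothing. -/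
theorem even_ls (A : InvAut S) {c : Set A.Q} (hc : A.Saturated c) : Even (A.ls c) := by
  classical
  have := Fintype.ofFinite A.T
  rw [ls, wt, finsum_eq_sum_of_fintype, even_iff_two_dvd, ← CharP.cast_eq_zero_iff (ZMod 2) 2]
  rw [Nat.cast_sum]
  refine Finset.sum_involution (fun t _ => A.inv t) ?_ ?_ (fun _ _ => Finset.mem_univ _)
    (fun t _ => A.inv_inv t)
  · intro t _
    have h1 : A.src (A.inv t) ∈ c ↔ A.src t ∈ c := by
      rw [A.src_inv]; exact (hc.src_iff_tgt t).symm
    simp only [h1, length_label_inv]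
    exact CharTwo.add_self_eq_zero _
  · intro t _ hne he
    apply hne
    split_ifs
    · have h2 := even_length_of_invRev_eq (w := A.label t) (by rw [← A.label_inv, he])
      rw [CharP.cast_eq_zero_iff (ZMod 2) 2]
      exact h2.two_dvd
    · rfl

end InvAut

namespace InvCNFA

open InvAut

variable {S : Type u}

/-! ### The number of transition folds -/

/-- The iteration on `A` can take `N` transition folds. -/
def Cost (A : InvCNFA S) (N : ℕ) : Prop :=
  ∃ (B : InvCNFA S) (ρ : A.Q → Option B.Q), Run .loop A B ρ N

/-- While it iterates on `A` and has chosen `α`, the algorithm can be called recursively and then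
iterate on `A₀`. -/
structure SubCall (A : InvCNFA S) (α : A.T) (A₀ : InvCNFA S) (ρ : A.Q → Option A₀.Q) : Prop where
  not_isCDFA : ¬ (A.cut α).IsCDFA
  minimalistic : A₀.Minimalistic
  steps : StepPres (A.cut α).toInvAut A₀.toInvAut ρ

/-- After an iteration on `A` with the transition `α`, the algorithm can continue with `C`. -/
structure Iterate (A : InvCNFA S) (α : A.T) (C : InvCNFA S) (σ : A.Q → Option C.Q) : Prop where
  minimalistic : C.Minimalistic
  not_isCDFA : ¬ C.IsCDFA
  pres : Pres A.toInvAut C.toInvAut σ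
  not_final : ¬ A.FinalEdge α
  ls_add_le : ∀ h h', A.Saturated h → C.Saturated h' → Corr σ h h' → A.src α ∈ h →
    C.ls h' + 2 * (A.label α).length ≤ A.ls h
  subStar : (A.cut α).Unbranched → C.SubStar

theorem cut_label (A : InvCNFA S) (hmin : A.Minimalistic) (α : A.T) (t : (A.cut α).T) :
    FreeGroup.IsReduced ((A.cut α).label t) ∧ (A.cut α).label t ≠ [] := hmin.1 t.1

theorem Run.ensure_cases {A B : InvCNFA S} {α : A.T} {ρ : A.Q → Option B.Q} {N : ℕ}
    (h : Run .ensure (A.cut α) B ρ N) (hA : A.Anchored) :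
    N = 0 ∨ ∃ A₀ ρ₀, SubCall A α A₀ ρ₀ ∧ A₀.Cost N := by
  cases h with
  | skip _ h => exact Or.inl rfl
  | call _ A₀ B ρ σ N h hm hr =>
    exact Or.inr ⟨A₀, ρ, ⟨h, hm.2, hm.1.stepPres (anchored_cut hA α)⟩, B, σ, hr⟩

theorem Run.unbranched {A B : InvCNFA S} {α : A.T} {ρ : A.Q → Option B.Q} {N : ℕ}
    (h : Run .ensure (A.cut α) B ρ N) (hmin : A.Minimalistic) (hu : (A.cut α).Unbranched) :
    B.Unbranched := by
  cases h with
  | skip _ h => exact hu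
  | call _ A₀ B ρ σ N h hm hr =>
    exact absurd (isCDFA_of_unbranched hu (cut_label A hmin α)) h

theorem Cost.cases {A : InvCNFA S} {N : ℕ} (h : A.Cost N) (hA : A.Anchored)
    (hmin : A.Minimalistic) : N = 0 ∨ ∃ α, A.Longest α ∧ ∃ N' M, N = N' + 1 + M ∧
      (N' = 0 ∨ ∃ A₀ ρ₀, SubCall A α A₀ ρ₀ ∧ A₀.Cost N') ∧
      (M = 0 ∨ ∃ C σ, Iterate A α C σ ∧ C.Cost M) := by
  obtain ⟨B, ρ, h⟩ := h
  cases h with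
  | trivial _ h => exact Or.inl rfl
  | finish _ A₂ C α ρ σ N hα hr hf h =>
    exact Or.inr ⟨α, hα, N, 0, rfl, hr.ensure_cases hA, Or.inl rfl⟩
  | next _ A₂ C B α ρ σ τ N M hα hr hf h hn =>
    have H := hf.stepResult_of_run hA hmin hr
    exact Or.inr ⟨α, hα, N, M, rfl, hr.ensure_cases hA, Or.inr ⟨C, σ,
      ⟨H.minimalistic, h, H.pres, fun hfin => h (H.isCDFA hfin), H.ls_add_le h,
        fun hu => H.subStar h (hr.unbranched hmin hu)⟩, B, τ, hn⟩⟩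

/-- Half of the total length of the labels. -/
noncomputable def size (A : InvCNFA S) : ℕ := A.ls Set.univ / 2

theorem two_mul_size (A : InvCNFA S) : 2 * A.size = A.ls Set.univ :=
  Nat.two_mul_div_two_of_even (A.even_ls (saturated_univ _))

theorem SubCall.anchored {A : InvCNFA S} {α : A.T} {A₀ : InvCNFA S} {ρ : A.Q → Option A₀.Q}
    (h : SubCall A α A₀ ρ) : A₀.Anchored := h.steps.anch

theorem Iterate.anchored {A : InvCNFA S} {α : A.T} {C : InvCNFA S} {σ : A.Q → Option C.Q}
    (h : Iterate A α C σ) : C.Anchored := h.pres.anch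

theorem SubCall.size_add_le {A : InvCNFA S} {α : A.T} {A₀ : InvCNFA S} {ρ : A.Q → Option A₀.Q}
    (h : SubCall A α A₀ ρ) (hmin : A.Minimalistic) : A₀.size + (A.label α).length ≤ A.size := by
  have h1 := h.steps.toPres.ls_univ_le
  have h2 := ls_cut_add A hmin α (saturated_univ _) trivial
  have h3 := A.two_mul_size
  have h4 := A₀.two_mul_size
  have arith : ∀ a b c d : ℕ, 2 * a = b → b ≤ d → d + 2 * c = 2 * A.size → a + c ≤ A.size := by
    intros; omega
  exact arith _ _ _ _ h4 h1 (h2.trans h3.symm)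

theorem Iterate.size_add_le {A : InvCNFA S} {α : A.T} {C : InvCNFA S} {σ : A.Q → Option C.Q}
    (h : Iterate A α C σ) : C.size + (A.label α).length ≤ A.size := by
  have h1 := h.ls_add_le Set.univ Set.univ (saturated_univ _) (saturated_univ _)
    (fun _ _ _ => Iff.rfl) trivial
  have h3 := A.two_mul_size
  have h4 := C.two_mul_size
  omega

theorem SubCall.card_add_two_le {A : InvCNFA S} {α : A.T} {A₀ : InvCNFA S}
    {ρ : A.Q → Option A₀.Q} (h : SubCall A α A₀ ρ) (hmin : A.Minimalistic) :
    Nat.card A₀.T + 2 ≤ Nat.card A.T := by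
  classical
  have h1 := h.steps.card_T_le
  have h2 := wt_cutAut (inv_ne (hmin.1 α).1 (hmin.1 α).2) (saturated_univ _) (φ := fun _ => 1)
    (fun _ => rfl)
  rw [if_pos (Set.mem_univ _)] at h2
  have h3 : Nat.card (A.cut α).T + 2 = Nat.card A.T := by
    rw [← tc_univ, ← tc_univ]
    exact h2
  omega

theorem ls_le_tc_mul {A : InvCNFA S} {α : A.T} (hα : A.Longest α) (c : Set A.Q) :
    A.ls c ≤ A.tc c * (A.label α).length := by
  classical
  have := Fintype.ofFinite A.T
  rw [ls, tc, wt, wt, finsum_eq_sum_of_fintype, finsum_eq_sum_of_fintype, Finset.sum_mul]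
  refine Finset.sum_le_sum fun t _ => ?_
  split_ifs
  · rw [one_mul]; exact hα t
  · exact Nat.zero_le _

theorem isCDFA_of_size_le_one {A : InvCNFA S} (hmin : A.Minimalistic) (h : A.size ≤ 1) :
    A.IsCDFA := by
  have := A.two_mul_size
  exact isCDFA_of_ls_le_two hmin.1 (by omega)

/-- The rest of the automaton and the possible next automaton have total length at most 2, so they
are CDFAs: neither a recursive call nor a second iteration takes place. -/
theorem Cost.le_one {A : InvCNFA S} {N : ℕ} (h : A.Cost N) (hA : A.Anchored)
    (hmin : A.Minimalistic) (hs : A.size ≤ 2) : N ≤ 1 := by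
  rcases h.cases hA hmin with rfl | ⟨α, hα, N', M, rfl, h1, h2⟩
  · exact Nat.zero_le _
  have hpos := length_pos A hmin α
  have e1 : N' = 0 := by
    rcases h1 with h1 | ⟨A₀, ρ₀, h1, -⟩
    · exact h1
    · refine absurd (isCDFA_of_ls_le_two (cut_label A hmin α) ?_) h1.not_isCDFA
      have h2 := ls_cut_add A hmin α (saturated_univ _) trivial
      have h3 := A.two_mul_size
      have arith : ∀ a : ℕ, a + 2 * (A.label α).length = A.ls Set.univ → a ≤ 2 := by
        intros; omega
      exact arith _ h2
  have e2 : M = 0 := by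
    rcases h2 with h2 | ⟨C, σ, h2, -⟩
    · exact h2
    · have := h2.size_add_le
      exact absurd (isCDFA_of_size_le_one h2.minimalistic (by omega)) h2.not_isCDFA
  omega

/-- The induction by which the number of transition folds is bounded: `P A b` says that `b` is the
bound claimed for `A`. -/
theorem Cost.le_of_step {P : InvCNFA S → ℝ → Prop} (h1 : ∀ A b, P A b → 1 ≤ b)
    (hfin : ∀ (A : InvCNFA S) (b : ℝ), A.Anchored → A.Minimalistic → P A b → 3 ≤ A.size →
      ∀ α, A.Longest α → A.FinalEdge α → ∀ A₀ ρ₀, SubCall A α A₀ ρ₀ → ∃ b', P A₀ b' ∧ b' + 1 ≤ b)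
    (hstep : ∀ (A : InvCNFA S) (b : ℝ), A.Anchored → A.Minimalistic → P A b → 3 ≤ A.size →
      ∀ α, A.Longest α → ¬ A.FinalEdge α → ∃ d : ℝ, 0 ≤ d ∧ d + 1 ≤ b ∧
        (∀ A₀ ρ₀, SubCall A α A₀ ρ₀ → ∀ N', A₀.Cost N' → (N' : ℝ) ≤ d) ∧
        ∀ C σ, Iterate A α C σ → ∃ b', P C b' ∧ d + 1 + b' ≤ b)
    {A : InvCNFA S} {b : ℝ} {N : ℕ} (hA : A.Anchored) (hmin : A.Minimalistic) (hP : P A b)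
    (h : A.Cost N) : (N : ℝ) ≤ b := by
  induction hn : A.size using Nat.strong_induction_on generalizing A b N with
  | _ n ih =>
  subst hn
  by_cases hs : A.size ≤ 2
  · have := h.le_one hA hmin hs
    have h2 : (N : ℝ) ≤ 1 := by exact_mod_cast this
    exact h2.trans (h1 A b hP)
  rcases h.cases hA hmin with rfl | ⟨α, hα, N', M, rfl, hN, hM⟩
  · have := h1 A b hP
    push_cast
    linarith
  have hpos := length_pos A hmin α
  by_cases hf : A.FinalEdge α
  · have e2 : M = 0 := by
      rcases hM with h | ⟨C, σ, h, -⟩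
      · exact h
      · exact absurd hf h.not_final
    subst e2
    rcases hN with rfl | ⟨A₀, ρ₀, hc, hN⟩
    · have := h1 A b hP
      push_cast
      linarith
    · obtain ⟨b', hP', hb⟩ := hfin A b hA hmin hP (by omega) α hα hf A₀ ρ₀ hc
      have hsz := hc.size_add_le hmin
      have := ih _ (by omega) hc.anchored hc.minimalistic hP' hN rfl
      push_cast
      linarith
  · obtain ⟨d, hd0, hd1, hdN, hC⟩ := hstep A b hA hmin hP (by omega) α hα hf
    have hN' : (N' : ℝ) ≤ d := by
      rcases hN with rfl | ⟨A₀, ρ₀, hc, hN⟩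
      · exact_mod_cast hd0
      · exact hdN A₀ ρ₀ hc N' hN
    rcases hM with rfl | ⟨C, σ, hc, hM⟩
    · push_cast
      linarith
    · obtain ⟨b', hP', hb⟩ := hC C σ hc
      have hsz := hc.size_add_le
      have := ih _ (by omega) hc.anchored hc.minimalistic hP' hM rfl
      push_cast
      linarith

/-! ### Logarithmic measures of the size -/

/-- A logarithmic measure of a size. -/
noncomputable def lg (n : ℕ) : ℝ := Real.log (max (n : ℝ) 2 / 2)

theorem lg_nonneg (n : ℕ) : 0 ≤ lg n :=
  Real.log_nonneg (by
    rw [le_div_iff₀ two_pos, one_mul]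
    exact le_max_right _ _)

/-- For n' > 2 the difference of the logarithms is log(1 + y) ≥ 2y/(y + 2) with y = (n − n')/n', and
n ≤ κ(n − n') turns this into 1/(κ − 1/2). For n' ≤ 2 the value `lg n'` is 0, and 1/(κ − 1/2) ≤ 2/5
≤ log(3/2) ≤ `lg n` because of κ ≥ 3. -/
theorem lg_add_le {n n' x κ : ℕ} (hκ : 3 ≤ κ) (hn : 3 ≤ n) (hx : n ≤ κ * x) (h : n' + x ≤ n) :
    lg n' + 1 / ((κ : ℝ) - 1 / 2) ≤ lg n := by
  have hn' : (3 : ℝ) ≤ n := by exact_mod_cast hn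
  have hκ' : (3 : ℝ) ≤ κ := by exact_mod_cast hκ
  have hx' : (n : ℝ) ≤ κ * x := by exact_mod_cast hx
  have h' : (n' : ℝ) + x ≤ n := by exact_mod_cast h
  have hg : lg n = Real.log (n / 2) := by
    unfold lg
    rw [max_eq_left (by linarith)]
  rw [hg]
  by_cases h2 : n' ≤ 2
  · have h2' : (n' : ℝ) ≤ 2 := by exact_mod_cast h2
    have e : lg n' = 0 := by
      unfold lg
      rw [max_eq_right h2', div_self two_ne_zero, Real.log_one]
    rw [e, zero_add]
    have h3 : (1 : ℝ) / (κ - 1 / 2) ≤ 2 / 5 := by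
      rw [div_le_div_iff₀ (by linarith) (by norm_num)]
      linarith
    have h4 : (2 : ℝ) / 5 ≤ Real.log (3 / 2) := by
      rw [Real.le_log_iff_exp_le (by norm_num)]
      have h5 := Real.exp_bound' (x := 2 / 5) (by norm_num) (by norm_num) (n := 5) (by norm_num)
      refine h5.trans ?_
      norm_num [Finset.sum_range_succ, Nat.factorial]
    have h5 : Real.log (3 / 2) ≤ Real.log (n / 2) :=
      Real.log_le_log (by norm_num) (by linarith)
    linarith
  · have h2' : (3 : ℝ) ≤ n' := by exact_mod_cast (show 3 ≤ n' by omega)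
    have e : lg n' = Real.log (n' / 2) := by
      unfold lg
      rw [max_eq_left (by linarith)]
    rw [e]
    have hx0 : (0 : ℝ) ≤ x := Nat.cast_nonneg _
    have e2 : Real.log (n / 2) = Real.log (n' / 2) + Real.log (1 + (n - n') / n') := by
      rw [← Real.log_mul (by positivity)]
      · congr 1
        field_simp
        ring
      · have : (0 : ℝ) ≤ (n - n') / n' := div_nonneg (by linarith) (by linarith)
        positivity
    rw [e2]
    have hy : (0 : ℝ) ≤ (n - n') / n' := div_nonneg (by linarith) (by linarith)
    have h3 := Real.le_log_one_add_of_nonneg hy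
    refine add_le_add le_rfl (le_trans ?_ h3)
    have e3 : 2 * (((n : ℝ) - n') / n') / ((n - n') / n' + 2) = 2 * (n - n') / (n + n') := by
      have hs : ((n : ℝ) - n') / n' + 2 = (n + n') / n' := by
        field_simp
        ring
      rw [hs, ← mul_div_assoc, div_div_div_cancel_right₀ (by linarith)]
    rw [e3, div_le_div_iff₀ (by linarith) (by linarith)]
    have h4 : (κ : ℝ) * x ≤ κ * (n - n') := mul_le_mul_of_nonneg_left (by linarith) (by linarith)
    nlinarith

end InvCNFA

namespace InvAut

theorem even_card_T {S : Type u} {A : InvAut S} (h : ∀ t, A.inv t ≠ t) : Even (Nat.card A.T) := by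
  classical
  have := Fintype.ofFinite A.T
  rw [Nat.card_eq_fintype_card, ← Finset.card_univ, Finset.card_eq_sum_ones, even_iff_two_dvd,
    ← CharP.cast_eq_zero_iff (ZMod 2) 2, Nat.cast_sum]
  exact Finset.sum_involution (fun t _ => A.inv t) (fun _ _ => by simp; decide)
    (fun t _ _ => h t) (fun _ _ => Finset.mem_univ _) fun t _ => A.inv_inv t

end InvAut

/-! ### Bounds at levels 0 and 1, and the passage between levels -/

namespace InvCNFA

open InvAut

variable {S : Type u} {A : InvCNFA S} {α : A.T}

theorem ls_cut_le (A : InvCNFA S) (α : A.T) (c : Set A.Q) : (A.cut α).ls c ≤ A.ls c := by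
  classical
  exact finsum_subtype_le (fun t : A.T => t ∉ ({α} : Set A.T) ∧ A.inv t ∉ ({α} : Set A.T))
    (fun t => if A.src t ∈ c then (A.label t).length else 0)

theorem inv_ne_of_minimalistic (hmin : A.Minimalistic) (t : A.T) : A.inv t ≠ t :=
  inv_ne (hmin.1 t).1 (hmin.1 t).2

theorem cut_bndOn (hmin : A.Minimalistic) (hf : A.FinalEdge α) {c : Set A.Q}
    (hc : A.Saturated c) {r b : ℕ} (hr : r = 1 ∨ r = 2) (H : A.BndOn c r b) :
    (A.cut α).BndOn c r b :=
  hf.bndOn hmin.thick (inv_ne_of_minimalistic hmin α) hc hr H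

theorem SubCall.bndOn_univ {A₀ : InvCNFA S} {ρ : A.Q → Option A₀.Q} (h : SubCall A α A₀ ρ)
    (hA : A.Anchored) {r b : ℕ} (H : (A.cut α).BndOn Set.univ r b) : A₀.BndOn Set.univ r b :=
  h.steps.toPres.bndOn_univ (anchored_cut hA α) H

theorem card_T_le (hmin : A.Minimalistic) {κ : ℕ} (H : A.BndOn Set.univ 2 (2 * κ)) :
    Nat.card A.T ≤ 2 * κ := by
  rw [← tc_univ]
  exact tc_le_of_bound hmin.thick (saturated_univ _) H

/-- Thickness turns the second bound into a bound for the number of edges, and none of them is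
longer than α. -/
theorem Longest.size_le (hα : A.Longest α) (hmin : A.Minimalistic) {κ : ℕ}
    (H : A.BndOn Set.univ 2 (2 * κ)) : A.size ≤ κ * (A.label α).length := by
  have h1 := ls_le_tc_mul hα Set.univ
  have h2 := card_T_le hmin H
  have h3 := A.two_mul_size
  rw [tc_univ] at h1
  have h4 := Nat.mul_le_mul_right (A.label α).length h2
  rw [mul_assoc] at h4
  omega

theorem subStar_cut (h : A.SubStar) : (A.cut α).SubStar := by
  obtain ⟨v, hv⟩ := h
  exact ⟨v, fun t t' hs hne => Subtype.ext (hv t.1 t'.1 hs hne)⟩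

/-- Without edges joining branching parts, each recursive call loses an edge. -/
theorem Cost.add_one_le {N : ℕ} (h : A.Cost N) (hA : A.Anchored) (hmin : A.Minimalistic)
    (H : A.BndOn Set.univ 1 0) {κ : ℕ} (hκ : 2 ≤ κ) (hcard : Nat.card A.T ≤ 2 * κ) :
    N + 1 ≤ κ := by
  have key := Cost.le_of_step (S := S)
    -- With E edges: each call removes at least one, and none is made if the cut leaves at most one
    -- edge; hence at most E − 1 folds, or a single one.
    (P := fun A b => A.BndOn Set.univ 1 0 ∧ b = max 1 ((Nat.card A.T : ℝ) / 2 - 1))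
    (fun A b h => by rw [h.2]; exact le_max_left _ _)
    (fun A b hA hmin hP _ α _ hf A₀ ρ₀ hc => by
      have H' := cut_bndOn hmin hf (saturated_univ _) (Or.inl rfl) hP.1
      refine ⟨_, ⟨hc.bndOn_univ hA H', rfl⟩, ?_⟩
      have h2 : ¬ Nat.card (A.cut α).T ≤ 2 := fun h =>
        hc.not_isCDFA (isCDFA_of_card_le_two (thick_cutAut hmin.thick) (cut_label A hmin α) H' h)
      have h3 : Even (Nat.card (A.cut α).T) := even_card_T fun t ht =>
        inv_ne_of_minimalistic hmin t.1 (congrArg Subtype.val ht)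
      have h4 := hc.card_add_two_le hmin
      have h5 : Nat.card (A.cut α).T + 2 = Nat.card A.T := by
        classical
        have h2 := wt_cutAut (inv_ne_of_minimalistic hmin α) (saturated_univ _) (φ := fun _ => 1)
          (fun _ => rfl)
        rw [if_pos (Set.mem_univ _)] at h2
        rw [← tc_univ, ← tc_univ]
        exact h2
      obtain ⟨m, hm⟩ := h3
      have h6 : (6 : ℝ) ≤ Nat.card A.T := by exact_mod_cast (show 6 ≤ Nat.card A.T by omega)
      have h7 : (Nat.card A₀.T : ℝ) + 2 ≤ Nat.card A.T := by exact_mod_cast h4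
      rw [hP.2, max_eq_right (by linarith : (1 : ℝ) ≤ (Nat.card A.T : ℝ) / 2 - 1)]
      rcases max_cases (1 : ℝ) ((Nat.card A₀.T : ℝ) / 2 - 1) with ⟨e, -⟩ | ⟨e, -⟩ <;> rw [e] <;>
        linarith)
    (fun A b hA hmin hP _ α _ hf => absurd
      (finalEdge_of_bndOn_zero hmin.thick (inv_ne_of_minimalistic hmin α) hP.1) hf)
    hA hmin ⟨H, rfl⟩ h
  have h1 : (2 : ℝ) ≤ κ := by exact_mod_cast hκ
  have h2 : (Nat.card A.T : ℝ) ≤ 2 * κ := by exact_mod_cast hcard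
  have h3 : (N : ℝ) ≤ κ - 1 := key.trans (max_le (by linarith) (by linarith))
  have h4 : ((N + 1 : ℕ) : ℝ) ≤ κ := by
    push_cast
    linarith
  exact_mod_cast h4

/-- Automata in which few states branch. -/
theorem Cost.le_of_subStar {N : ℕ} (h : A.Cost N) (hA : A.Anchored) (hmin : A.Minimalistic)
    (H1 : A.BndOn Set.univ 1 2) (H2 : A.BndOn Set.univ 2 10)
    (hs : A.SubStar ∨ Nat.card A.T ≤ 6) : (N : ℝ) ≤ 1 + 9 / 2 * lg A.size := by
  refine Cost.le_of_step (S := S)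
    -- There are at most κ = 5 edges, and 9/2 = κ − 1/2 makes each fold cost at most the loss of the
    -- logarithm.
    (P := fun A b => (A.BndOn Set.univ 1 2 ∧ A.BndOn Set.univ 2 10 ∧
      (A.SubStar ∨ Nat.card A.T ≤ 6)) ∧ b = 1 + 9 / 2 * lg A.size) ?_ ?_ ?_ hA hmin
      ⟨⟨H1, H2, hs⟩, rfl⟩ h
  · rintro A _ ⟨-, rfl⟩
    have := lg_nonneg A.size
    linarith
  · rintro A _ hA hmin ⟨⟨H1, H2, hs⟩, rfl⟩ h3 α hα hf A₀ ρ₀ hc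
    refine ⟨_, ⟨⟨hc.bndOn_univ hA (cut_bndOn hmin hf (saturated_univ _) (Or.inl rfl) H1),
      hc.bndOn_univ hA (cut_bndOn hmin hf (saturated_univ _) (Or.inr rfl) H2), ?_⟩, rfl⟩, ?_⟩
    · refine hs.imp (fun h => hc.steps.subStar (subStar_cut h)) fun h => ?_
      have := hc.card_add_two_le hmin
      omega
    · have := lg_add_le (κ := 5) (by norm_num) h3 (hα.size_le hmin (κ := 5) H2)
        (hc.size_add_le hmin)
      norm_num at this
      linarith
  · rintro A _ hA hmin ⟨⟨H1, H2, hs⟩, rfl⟩ h3 α hα hf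
    -- What remains after the cut is a CDFA already, so no recursive call is made, and the next
    -- automaton is again a `SubStar`.
    have hu : (A.cut α).Unbranched := by
      rcases hs with hs | hs
      · exact unbranched_cutAut_of_subStar hmin.thick (inv_ne_of_minimalistic hmin α) hf H1 hs
      · exact unbranched_cutAut_of_card_le hmin.thick (inv_ne_of_minimalistic hmin) hf H1 hs
    have := lg_nonneg A.size
    refine ⟨0, le_rfl, by linarith, fun A₀ ρ₀ hc => absurd
      (isCDFA_of_unbranched hu (cut_label A hmin α)) hc.not_isCDFA, fun C σ hc => ?_⟩
    refine ⟨_, ⟨⟨hc.pres.bndOn_univ hA H1, hc.pres.bndOn_univ hA H2, Or.inl (hc.subStar hu)⟩, rfl⟩,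
      ?_⟩
    have := lg_add_le (κ := 5) (by norm_num) h3 (hα.size_le hmin (κ := 5) H2) hc.size_add_le
    norm_num at this
    linarith

theorem corr_compl {A B : InvAut S} {ρ : A.Q → Option B.Q} {h : Set A.Q} {h' : Set B.Q}
    (c : Corr ρ h h') : Corr ρ hᶜ h'ᶜ := fun x y hxy => not_congr (c x y hxy)

open Classical in
/-- The contribution of the part of an automaton in which transitions can be non-final. -/
noncomputable def partBound (n : ℕ) : ℝ := if n ≤ 1 then 0 else 6 * (1 + 9 / 2 * lg n)

theorem lg_mono {m n : ℕ} (h : m ≤ n) : lg m ≤ lg n := by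
  unfold lg
  have h2 : (0 : ℝ) < max (m : ℝ) 2 := lt_of_lt_of_le two_pos (le_max_right _ _)
  refine Real.log_le_log (by positivity) ?_
  have : (m : ℝ) ≤ n := by exact_mod_cast h
  gcongr

theorem partBound_mono {m n : ℕ} (h : m ≤ n) : partBound m ≤ partBound n := by
  unfold partBound
  have h1 := lg_mono h
  have h2 := lg_nonneg n
  split_ifs
  · exact le_rfl
  · positivity
  · omega
  · linarith

/-- Here 6 · (9/2) · 1/(5 − 1/2) = 6. The jump at n = 2 covers the case where the rest is too short
for the logarithmic estimate. -/
theorem partBound_add_le {m n x : ℕ} (hn : 2 ≤ n) (hx : n ≤ 5 * x) (h : m + x ≤ n) :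
    partBound m + 6 ≤ partBound n := by
  unfold partBound
  rw [if_neg (by omega : ¬ n ≤ 1)]
  have h2 := lg_nonneg n
  split_ifs with hm
  · linarith
  · have := lg_add_le (κ := 5) (by norm_num) (by omega : 3 ≤ n) hx h
    norm_num at this
    linarith

/-- Automata in which all transitions that are not final belong to a small part. -/
theorem Cost.le_of_part {N : ℕ} (h : A.Cost N) (hA : A.Anchored) (hmin : A.Minimalistic)
    (H1 : A.BndOn Set.univ 1 2) (H2 : A.BndOn Set.univ 2 16) {c : Set A.Q} (hc : A.Saturated c)
    (H3 : A.BndOn cᶜ 1 0) (H4 : A.BndOn c 2 10) :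
    (N : ℝ) ≤ partBound (A.ls c / 2) + 1 + 15 / 2 * lg A.size := by
  have pb0 : ∀ n, 0 ≤ partBound n := fun n =>
    (if_pos (Nat.zero_le 1)).symm.trans_le (partBound_mono (Nat.zero_le n))
  refine Cost.le_of_step (S := S)
    -- The factor 15/2 = 8 − 1/2 pays one fold in each iteration. Recursive calls from non-final
    -- transitions occur only inside `c` and are paid by `partBound`, since at most five edges share
    -- the length of `c`.
    (P := fun A b => ∃ c, (A.BndOn Set.univ 1 2 ∧ A.BndOn Set.univ 2 16 ∧ A.Saturated c ∧
      A.BndOn cᶜ 1 0 ∧ A.BndOn c 2 10) ∧ b = partBound (A.ls c / 2) + 1 + 15 / 2 * lg A.size)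
      ?_ ?_ ?_ hA hmin ⟨c, ⟨H1, H2, hc, H3, H4⟩, rfl⟩ h
  · rintro A _ ⟨c, -, rfl⟩
    have := lg_nonneg A.size
    have := pb0 (A.ls c / 2)
    linarith
  · rintro A _ hA hmin ⟨c, ⟨H1, H2, sc, H3, H4⟩, rfl⟩ h3 α hα hf A₀ ρ₀ hc
    obtain ⟨c', sc', hcorr, -, hls⟩ := hc.steps.toPres.mono c (saturated_cutAut sc)
    refine ⟨_, ⟨c', ⟨hc.bndOn_univ hA (cut_bndOn hmin hf (saturated_univ _) (Or.inl rfl) H1),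
      hc.bndOn_univ hA (cut_bndOn hmin hf (saturated_univ _) (Or.inr rfl) H2), sc', ?_, ?_⟩, rfl⟩, ?_⟩
    · exact hc.steps.toPres.bndOn (anchored_cut hA α) (saturated_cutAut sc.compl) (corr_compl hcorr)
        (cut_bndOn hmin hf sc.compl (Or.inl rfl) H3)
    · exact hc.steps.toPres.bndOn (anchored_cut hA α) (saturated_cutAut sc) hcorr
        (cut_bndOn hmin hf sc (Or.inr rfl) H4)
    · have h1 := lg_add_le (κ := 8) (by norm_num) h3 (hα.size_le hmin (κ := 8) H2)
        (hc.size_add_le hmin)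
      have h2 := partBound_mono (Nat.div_le_div_right (c := 2) (hls.trans (ls_cut_le A α c)))
      norm_num at h1
      linarith
  · rintro A _ hA hmin ⟨c, ⟨H1, H2, sc, H3, H4⟩, rfl⟩ h3 α hα hf
    have hinv := inv_ne_of_minimalistic hmin α
    have hmem := mem_of_bndOn_compl hmin.thick hinv hf sc H3
    have hev := A.two_mul_size
    have hls := ls_cut_add A hmin α sc hmem
    have hpos := length_pos A hmin α
    have hcut : 1 ≤ (A.cut α).ls c := by
      classical
      obtain ⟨⟨t, ho, ht⟩, -⟩ := not_finalEdge_iff.1 hf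
      have h1 := le_finsum_nat (fun t : (A.cut α).T => if (A.cut α).src t ∈ c then
        ((A.cut α).label t).length else 0) ⟨t, off_iff_remove.1 ho⟩
      have h2 : A.src t ∈ c := by rwa [ht]
      refine le_trans ?_ h1
      exact (length_pos A hmin t).trans_eq (if_pos h2).symm
    have hn2 : 2 ≤ A.ls c / 2 := by
      have hE := Nat.two_mul_div_two_of_even (A.even_ls sc)
      have arith : ∀ a x l n : ℕ, a + 2 * x = l → 1 ≤ a → 0 < x → 2 * n = l → 2 ≤ n := by
        intros; omega
      exact arith _ _ _ _ hls hcut hpos hE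
    have hn5 : A.ls c / 2 ≤ 5 * (A.label α).length := by
      have h1 := ls_le_tc_mul hα c
      have h2 := Nat.mul_le_mul_right (A.label α).length (tc_le_of_bound hmin.thick sc H4)
      omega
    have hp6 : 6 ≤ partBound (A.ls c / 2) := by
      have := partBound_add_le (m := 0) hn2 (x := (A.ls c / 2)) (by omega) (by omega)
      have := pb0 0
      linarith
    have hlg := lg_nonneg A.size
    -- The recursive call starts at level 0 with at most 16 − 2 transitions, that is 7 edges, and so
    -- takes at most 6 folds.
    refine ⟨6, by norm_num, by linarith, fun A₀ ρ₀ hc N' hN' => ?_, fun C σ hc => ?_⟩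
    · have h1 := hc.bndOn_univ hA (bndOn_cutAut_one hmin.thick hinv hf (l := 0) H1)
      have h2 := hc.card_add_two_le hmin
      have h3 := card_T_le hmin (κ := 8) H2
      have h4 := hN'.add_one_le hc.anchored hc.minimalistic h1 (κ := 7) (by norm_num) (by omega)
      have h5 : N' ≤ 6 := by omega
      exact_mod_cast h5
    · obtain ⟨c', sc', hcorr, -, -⟩ := hc.pres.mono c sc
      refine ⟨_, ⟨c', ⟨hc.pres.bndOn_univ hA H1, hc.pres.bndOn_univ hA H2, sc',
        hc.pres.bndOn hA sc.compl (corr_compl hcorr) H3, hc.pres.bndOn hA sc hcorr H4⟩, rfl⟩, ?_⟩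
      have h1 := lg_add_le (κ := 8) (by norm_num) h3 (hα.size_le hmin (κ := 8) H2) hc.size_add_le
      have h2 := hc.ls_add_le c c' sc sc' hcorr hmem
      have h4 := partBound_add_le hn2 hn5 (m := C.ls c' / 2) (by omega)
      norm_num at h1
      linarith

/-- While all transitions are final, each recursive call costs one additional fold and keeps the
bounds. Once some transition is not final, its component carries the whole excess, and
`Cost.le_of_part` applies. The constants are 7 = 6 + 1 and 69/2 = 6 · 9/2 + 15/2. -/
theorem Cost.le_of_one_eight {N : ℕ} (h : A.Cost N) (hA : A.Anchored) (hmin : A.Minimalistic)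
    (H1 : A.BndOn Set.univ 1 2) (H2 : A.BndOn Set.univ 2 16) :
    (N : ℝ) ≤ 7 + 69 / 2 * lg A.size := by
  induction hn : A.size using Nat.strong_induction_on generalizing A N with
  | _ n ih =>
  subst hn
  have hlg := lg_nonneg A.size
  by_cases hex : ∃ t, ¬ A.FinalEdge t
  · obtain ⟨t, ht⟩ := hex
    have hinv := inv_ne_of_minimalistic hmin t
    have h1 := h.le_of_part hA hmin H1 H2 (saturated_component _ _)
      (bndOn_compl_component hmin.thick hinv ht H1) (bndOn_component hmin.thick hinv ht H1)
    have h2 : A.ls (A.component (A.src t)) / 2 ≤ A.size := by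
      refine Nat.div_le_div_right ?_
      classical
      exact finsum_mono_nat fun t => by
        rw [if_pos (Set.mem_univ _)]
        split_ifs
        · exact le_rfl
        · exact Nat.zero_le _
    have h3 := partBound_mono h2
    have h4 : partBound A.size ≤ 6 * (1 + 9 / 2 * lg A.size) := by
      unfold partBound
      split_ifs
      · positivity
      · exact le_rfl
    linarith
  · push Not at hex
    by_cases hs : A.size ≤ 2
    · have := h.le_one hA hmin hs
      have h2 : (N : ℝ) ≤ 1 := by exact_mod_cast this
      linarith
    rcases h.cases hA hmin with rfl | ⟨α, hα, N', M, rfl, hN, hM⟩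
    · push_cast
      linarith
    have e2 : M = 0 := by
      rcases hM with h | ⟨C, σ, h, -⟩
      · exact h
      · exact absurd (hex α) h.not_final
    subst e2
    rcases hN with rfl | ⟨A₀, ρ₀, hc, hN⟩
    · push_cast
      linarith
    · have hpos := length_pos A hmin α
      have hsz := hc.size_add_le hmin
      have h1 := ih _ (by omega) hN hc.anchored hc.minimalistic
        (hc.bndOn_univ hA (cut_bndOn hmin (hex α) (saturated_univ _) (Or.inl rfl) H1))
        (hc.bndOn_univ hA (cut_bndOn hmin (hex α) (saturated_univ _) (Or.inr rfl) H2)) rfl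
      have h2 := lg_add_le (κ := 8) (by norm_num) (by omega) (hα.size_le hmin (κ := 8) H2) hsz
      norm_num at h2
      push_cast
      linarith

/-- Bounds for the two parameters of an automaton on which the number of folds depends. -/
def Bnd (A : InvCNFA S) (l κ : ℕ) : Prop :=
  A.BndOn Set.univ 1 (2 * l) ∧ A.BndOn Set.univ 2 (2 * κ)

/-- The passage from one level of the recursion to the next. -/
theorem Cost.level_step {l κ : ℕ} (hκ : 3 ≤ κ) {Φ Φ' : ℝ → ℝ}
    (hm : ∀ x y, 0 ≤ x → x ≤ y → Φ x ≤ Φ y) (hm' : ∀ x y, 0 ≤ x → x ≤ y → Φ' x ≤ Φ' y)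
    (h1 : ∀ y, 0 ≤ y → 1 ≤ Φ' y) (h2 : ∀ y, 0 ≤ y → 2 ≤ Φ y)
    (hstep : ∀ y, 0 ≤ y → Φ' y + Φ y ≤ Φ (y + 1 / ((κ : ℝ) - 1 / 2)))
    (hprev : ∀ (A : InvCNFA S) (N : ℕ), A.Anchored → A.Minimalistic → A.Bnd l (κ + 1) →
      Nat.card A.T + 2 ≤ 2 * κ → A.Cost N → (N : ℝ) + 1 ≤ Φ' (lg A.size))
    {A : InvCNFA S} {N : ℕ} (hA : A.Anchored) (hmin : A.Minimalistic) (H : A.Bnd (l + 1) κ)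
    (h : A.Cost N) : (N : ℝ) + 1 ≤ Φ (lg A.size) := by
  have key : (N : ℝ) ≤ Φ (lg A.size) - 1 := by
    refine Cost.le_of_step (S := S) (P := fun A b => A.Bnd (l + 1) κ ∧ b = Φ (lg A.size) - 1)
      ?_ ?_ ?_ hA hmin ⟨H, rfl⟩ h
    · rintro A _ ⟨-, rfl⟩
      have := h2 _ (lg_nonneg A.size)
      linarith
    · rintro A _ hA hmin ⟨⟨H1, H2⟩, rfl⟩ h3 α hα hf A₀ ρ₀ hc
      refine ⟨_, ⟨⟨hc.bndOn_univ hA (cut_bndOn hmin hf (saturated_univ _) (Or.inl rfl) H1),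
        hc.bndOn_univ hA (cut_bndOn hmin hf (saturated_univ _) (Or.inr rfl) H2)⟩, rfl⟩, ?_⟩
      have e := lg_add_le hκ h3 (hα.size_le hmin H2) (hc.size_add_le hmin)
      have e0 := lg_nonneg A₀.size
      have e1 := hstep _ e0
      have e2 := hm _ _ (by
        have : (3 : ℝ) ≤ κ := by exact_mod_cast hκ
        have : (0 : ℝ) ≤ 1 / ((κ : ℝ) - 1 / 2) := div_nonneg zero_le_one (by linarith)
        linarith) e
      have e3 := h1 _ e0
      linarith
    · rintro A _ hA hmin ⟨⟨H1, H2⟩, rfl⟩ h3 α hα hf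
      have hinv := inv_ne_of_minimalistic hmin α
      have hsz := hα.size_le hmin H2
      -- An upper bound for the logarithmic size of both the recursive call and the next automaton.
      set y := lg A.size - 1 / ((κ : ℝ) - 1 / 2) with hy
      have hpos := length_pos A hmin α
      have hlen : (A.label α).length ≤ A.size := by
        have e1 := ls_cut_add A hmin α (saturated_univ _) trivial
        have e2 := A.two_mul_size
        have arith : ∀ a x l n : ℕ, a + 2 * x = l → 2 * n = l → x ≤ n := by intros; omega
        exact arith _ _ _ _ e1 e2
      have hy0 : 0 ≤ y := by
        have := lg_add_le (n' := 0) hκ h3 hsz (by omega)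
        have := lg_nonneg 0
        linarith
      have e1 := hstep y hy0
      rw [hy, sub_add_cancel, ← hy] at e1
      have e2 := h1 y hy0
      have e3 := h2 y hy0
      -- The functions bound the number of folds plus one; the two ones account for the fold of α
      -- and for the one contained in Φ.
      refine ⟨Φ' y - 1, by linarith, by linarith, fun A₀ ρ₀ hc N' hN' => ?_, fun C σ hc => ?_⟩
      · have f1 := hc.bndOn_univ hA (bndOn_cutAut_one hmin.thick hinv hf H1)
        have f2 := hc.bndOn_univ hA (bndOn_cutAut_two hmin.thick hinv hf H2)
        have f3 := hc.card_add_two_le hmin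
        have f4 := card_T_le hmin H2
        have f5 := hprev A₀ N' hc.anchored hc.minimalistic ⟨f1, f2⟩ (by omega) hN'
        have f6 := lg_add_le hκ h3 hsz (hc.size_add_le hmin)
        have f7 := hm' (lg A₀.size) y (lg_nonneg _) (by linarith)
        linarith
      · refine ⟨_, ⟨⟨hc.pres.bndOn_univ hA H1, hc.pres.bndOn_univ hA H2⟩, rfl⟩, ?_⟩
        have f6 := lg_add_le hκ h3 hsz hc.size_add_le
        have f7 := hm (lg C.size) y (lg_nonneg _) (by linarith)
        linarith
  linarith

end InvCNFA

/-! ### Inequalities for powers and binomial coefficients -/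

theorem pow_add_mul_le {z c : ℝ} (hz : 0 ≤ z) (hc : 0 ≤ c) (n : ℕ) :
    z ^ (n + 1) + (n + 1) * c * z ^ n ≤ (z + c) ^ (n + 1) := by
  induction n with
  | zero => simp
  | succ n ih =>
    have h1 := mul_le_mul_of_nonneg_right ih (add_nonneg hz hc)
    rw [← pow_succ] at h1
    have h2 : 0 ≤ (n + 1) * c * z ^ n * c := by positivity
    refine le_trans ?_ h1
    push_cast
    have e : (z ^ (n + 1) + (n + 1) * c * z ^ n) * (z + c) =
        z ^ (n + 1 + 1) + (n + 1 + 1) * c * z ^ (n + 1) + (n + 1) * c * z ^ n * c := by ring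
    linarith

theorem two_pow_le_choose (k m : ℕ) (h : m ≤ k) : 2 ^ m ≤ (3 * k - 1).choose m := by
  induction m with
  | zero => simp
  | succ m ih =>
    have h1 := ih (by omega)
    have h2 := Nat.choose_succ_right_eq (3 * k - 1) m
    have h3 : 2 * (m + 1) ≤ 3 * k - 1 - m := by omega
    have h4 := Nat.mul_le_mul h1 h3
    rw [← h2] at h4
    have h5 : 2 ^ (m + 1) * (m + 1) ≤ (3 * k - 1).choose (m + 1) * (m + 1) := by
      refine le_trans (le_of_eq ?_) h4
      ring
    exact Nat.le_of_mul_le_mul_right h5 (Nat.succ_pos m)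

theorem choose_three_mul_succ (k : ℕ) :
    (3 * (k + 1)).choose (k + 1) * ((k + 1) * (2 * k + 2) * (2 * k + 1)) =
      (3 * k).choose k * ((3 * k + 3) * (3 * k + 2) * (3 * k + 1)) := by
  have h1 := Nat.choose_mul_succ_eq (3 * k) k
  have h2 := Nat.choose_mul_succ_eq (3 * k + 1) k
  have h3 := Nat.add_one_mul_choose_eq (3 * k + 2) k
  rw [show 3 * k + 1 - k = 2 * k + 1 by omega] at h1
  rw [show 3 * k + 1 + 1 - k = 2 * k + 2 by omega] at h2
  have e1 : 3 * (k + 1) = 3 * k + 2 + 1 := by ring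
  rw [e1]
  calc _ = ((3 * k + 2 + 1).choose (k + 1) * (k + 1)) * (2 * k + 2) * (2 * k + 1) := by ring
    _ = (3 * k + 2 + 1) * ((3 * k + 1 + 1).choose k * (2 * k + 2)) * (2 * k + 1) := by
      rw [← h3]; ring
    _ = (3 * k + 2 + 1) * (3 * k + 1 + 1) * ((3 * k + 1).choose k * (2 * k + 1)) := by
      rw [← h2]; ring
    _ = _ := by rw [← h1]; ring

/-- Passing from k to k + 1 multiplies C(3k, k) by a quotient which is at most 2(k + 1) by
`choose_three_mul_succ`. The inequality fails for k = 3, where it would read 504 ≤ 216. -/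
theorem choose_three_mul_le (k : ℕ) (hk : 4 ≤ k) : 2 * k * (3 * k).choose k ≤ (2 * k) ^ k := by
  induction k, hk using Nat.le_induction with
  | base => decide
  | succ k hk ih =>
    have h1 := choose_three_mul_succ k
    have h2 : (3 * k).choose k * 2 * k ≤ (2 * k) ^ k := by linarith
    obtain ⟨j, rfl⟩ : ∃ j, k = j + 1 := ⟨k - 1, by omega⟩
    have h3 : (3 * (j + 1)).choose (j + 1) ≤ (2 * (j + 1)) ^ j := by
      rw [pow_succ] at h2
      have : (3 * (j + 1)).choose (j + 1) * (2 * (j + 1)) ≤ (2 * (j + 1)) ^ j * (2 * (j + 1)) := by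
        linarith
      exact Nat.le_of_mul_le_mul_right this (by omega)
    have h4 : (2 * (j + 1)) ^ j ≤ (2 * (j + 1 + 1)) ^ j := Nat.pow_le_pow_left (by omega) j
    have h5 := h3.trans h4
    set C := (3 * (j + 1)).choose (j + 1)
    set D := (3 * (j + 1 + 1)).choose (j + 1 + 1)
    set P := (2 * (j + 1 + 1)) ^ j with hP
    have h6 : (3 * (j + 1) + 3) * (3 * (j + 1) + 2) * (3 * (j + 1) + 1) ≤
        (2 * (j + 1 + 1)) * ((j + 1 + 1) * (2 * (j + 1) + 2) * (2 * (j + 1) + 1)) := by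
      obtain ⟨i, rfl⟩ : ∃ i, j = i + 3 := ⟨j - 3, by omega⟩
      -- After the shift to k ≥ 4 the difference is a polynomial with positive coefficients.
      have : 2 * (i + 3 + 1 + 1) * ((i + 3 + 1 + 1) * (2 * (i + 3 + 1) + 2) * (2 * (i + 3 + 1) + 1)) =
          (3 * (i + 3 + 1) + 3) * (3 * (i + 3 + 1) + 2) * (3 * (i + 3 + 1) + 1) +
            (8 * i ^ 4 + 129 * i ^ 3 + 762 * i ^ 2 + 1939 * i + 1770) := by ring
      exact this ▸ Nat.le_add_right _ _
    have h7 : D ≤ P * (2 * (j + 1 + 1)) := by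
      have h8 : D * ((j + 1 + 1) * (2 * (j + 1) + 2) * (2 * (j + 1) + 1)) ≤
          P * (2 * (j + 1 + 1)) * ((j + 1 + 1) * (2 * (j + 1) + 2) * (2 * (j + 1) + 1)) := by
        rw [h1, mul_assoc P]
        exact Nat.mul_le_mul h5 h6
      exact Nat.le_of_mul_le_mul_right h8 (by positivity)
    calc 2 * (j + 1 + 1) * D ≤ 2 * (j + 1 + 1) * (P * (2 * (j + 1 + 1))) :=
          Nat.mul_le_mul_left _ h7
      _ = (2 * (j + 1 + 1)) ^ (j + 1 + 1) := by rw [hP]; ring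

/-! ### The number of folds in terms of the initial parameters -/

namespace InvCNFA

open InvAut

variable {S : Type u} {A : InvCNFA S}

theorem log_two_bounds : (0.69 : ℝ) ≤ Real.log 2 ∧ Real.log 2 ≤ 0.7 :=
  ⟨by linarith [Real.log_two_gt_d9], by linarith [Real.log_two_lt_d9]⟩

theorem lg_add_log_two (n : ℕ) : lg n + Real.log 2 = Real.log (max (n : ℝ) 2) := by
  have h2 : (0 : ℝ) < max (n : ℝ) 2 := lt_of_lt_of_le two_pos (le_max_right _ _)
  unfold lg
  rw [Real.log_div h2.ne' two_ne_zero, sub_add_cancel]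

/-- The level below is (1, 5) with at most six transitions, where `Cost.le_of_subStar` applies. With
the shift 2/7 the coefficients satisfy 7 · 2/7 = 2 and 79/10 · 4/7 ≥ 9/2, as the recursion requires.
-/
theorem Cost.le_two {N : ℕ} (h : A.Cost N) (hA : A.Anchored) (hmin : A.Minimalistic)
    (H : A.Bnd 2 4) : (N : ℝ) + 1 ≤ 2 + 7 * lg A.size + 79 / 10 * lg A.size ^ 2 := by
  refine Cost.level_step (l := 1) (κ := 4) (by norm_num)
    (Φ := fun y => 2 + 7 * y + 79 / 10 * y ^ 2) (Φ' := fun y => 2 + 9 / 2 * y)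
    (fun x y hx hy => by gcongr) (fun x y hx hy => by gcongr)
    (fun y hy => by linarith) (fun y hy => by nlinarith [sq_nonneg y]) (fun y hy => ?_)
    (fun A N hA hmin H hc hN => ?_) hA hmin H h
  · norm_num
    nlinarith
  · have := hN.le_of_subStar hA hmin H.1 H.2 (Or.inr (by omega))
    linarith

/-- The levels are (1, 8), (2, 7), (3, 6). With the shifts 2/13 and 2/11 the coefficients solve the
recursion to leading order in each degree: 52 · 2/13 = 8 and 897/8 · 4/13 = 69/2; then 11 · 2/11 =
2, 143 · 4/11 = 52 and 3289/16 · 6/11 = 897/8. The other terms of the expansions only help. -/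
theorem Cost.le_three {N : ℕ} (h : A.Cost N) (hA : A.Anchored) (hmin : A.Minimalistic)
    (H : A.Bnd 3 6) :
    (N : ℝ) + 1 ≤ 2 + 11 * lg A.size + 143 * lg A.size ^ 2 + 3289 / 16 * lg A.size ^ 3 := by
  refine Cost.level_step (l := 2) (κ := 6) (by norm_num)
    (Φ := fun y => 2 + 11 * y + 143 * y ^ 2 + 3289 / 16 * y ^ 3)
    (Φ' := fun y => 2 + 52 * y + 897 / 8 * y ^ 2)
    (fun x y hx hy => by gcongr) (fun x y hx hy => by gcongr)
    (fun y hy => by nlinarith [sq_nonneg y])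
    (fun y hy => by
      have : 0 ≤ y ^ 3 := by positivity
      nlinarith [sq_nonneg y]) (fun y hy => ?_)
    (fun A N hA hmin H hc hN => ?_) hA hmin H h
  · norm_num
    have h2 : 0 ≤ y ^ 2 := by positivity
    ring_nf
    nlinarith
  · refine Cost.level_step (l := 1) (κ := 7) (by norm_num)
      (Φ := fun y => 2 + 52 * y + 897 / 8 * y ^ 2) (Φ' := fun y => 8 + 69 / 2 * y)
      (fun x y hx hy => by gcongr) (fun x y hx hy => by gcongr)
      (fun y hy => by linarith) (fun y hy => by nlinarith [sq_nonneg y]) (fun y hy => ?_)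
      (fun A N hA hmin H hc hN => ?_) hA hmin H hN
    · norm_num
      nlinarith
    · have := hN.le_of_one_eight hA hmin H.1 H.2
      linarith

/-- With κ = 2 the size is at least halved from one automaton to the next, and 2 log 2 ≥ 1 pays for
the fold. No recursive call arises from a non-final transition, since at most four transitions are
left. -/
theorem Cost.le_one_two {N : ℕ} (h : A.Cost N) (hA : A.Anchored) (hmin : A.Minimalistic)
    (H : A.Bnd 1 2) : (N : ℝ) ≤ 2 * (lg A.size + Real.log 2) := by
  obtain ⟨hl1, hl2⟩ := log_two_bounds
  have hlog3 : 1 ≤ Real.log 3 := by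
    rw [Real.le_log_iff_exp_le (by norm_num)]
    linarith [Real.exp_one_lt_d9]
  classical
  -- The value 1 at sizes up to 2 is the bound of `Cost.le_one`; the step to size 3 uses log 3 ≥ 1.
  let f : ℕ → ℝ := fun n => if n ≤ 2 then 1 else 2 * Real.log n
  have hf : ∀ n' x n : ℕ, 3 ≤ n → n ≤ 2 * x → n' + x ≤ n → f n' + 1 ≤ f n := by
    intro n' x n h3 hx hn
    simp only [f]
    rw [if_neg (by omega : ¬ n ≤ 2)]
    have e3 : (3 : ℝ) ≤ n := by exact_mod_cast h3
    split_ifs with hm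
    · have := Real.log_le_log (by norm_num) e3
      linarith
    · have e1 : (0 : ℝ) < n' := by exact_mod_cast (by omega : 0 < n')
      have e2 : (2 : ℝ) * n' ≤ n := by exact_mod_cast (by omega : 2 * n' ≤ n)
      have := Real.log_le_log (by positivity) e2
      rw [Real.log_mul two_ne_zero e1.ne'] at this
      linarith
  have hf1 : ∀ n, 1 ≤ f n := by
    intro n
    simp only [f]
    split_ifs with hm
    · exact le_rfl
    · have e3 : (3 : ℝ) ≤ n := by exact_mod_cast (by omega : 3 ≤ n)
      have := Real.log_le_log (by norm_num) e3
      linarith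
  have key : (N : ℝ) ≤ f A.size := by
    refine Cost.le_of_step (S := S) (P := fun A b => A.Bnd 1 2 ∧ b = f A.size) ?_ ?_ ?_ hA hmin
      ⟨H, rfl⟩ h
    · rintro A _ ⟨-, rfl⟩
      exact hf1 _
    · rintro A _ hA hmin ⟨⟨H1, H2⟩, rfl⟩ h3 α hα hfe A₀ ρ₀ hc
      exact ⟨_, ⟨⟨hc.bndOn_univ hA (cut_bndOn hmin hfe (saturated_univ _) (Or.inl rfl) H1),
        hc.bndOn_univ hA (cut_bndOn hmin hfe (saturated_univ _) (Or.inr rfl) H2)⟩, rfl⟩,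
        hf _ _ _ h3 (hα.size_le hmin H2) (hc.size_add_le hmin)⟩
    · rintro A _ hA hmin ⟨⟨H1, H2⟩, rfl⟩ h3 α hα hfe
      have hc4 := card_T_le hmin H2
      have hu : (A.cut α).Unbranched :=
        unbranched_cutAut_of_card_le hmin.thick (inv_ne_of_minimalistic hmin) hfe H1 (by omega)
      refine ⟨0, le_rfl, by linarith [hf1 A.size], fun A₀ ρ₀ hc => absurd
        (isCDFA_of_unbranched hu (cut_label A hmin α)) hc.not_isCDFA, fun C σ hc => ?_⟩
      refine ⟨_, ⟨⟨hc.pres.bndOn_univ hA H1, hc.pres.bndOn_univ hA H2⟩, rfl⟩, ?_⟩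
      have := hf _ _ _ h3 (hα.size_le hmin H2) hc.size_add_le
      linarith
  refine key.trans ?_
  rw [lg_add_log_two]
  simp only [f]
  split_ifs with hm
  · have := Real.log_le_log (by norm_num) (le_max_right (A.size : ℝ) 2)
    linarith
  · have e3 : (3 : ℝ) ≤ A.size := by exact_mod_cast (by omega : 3 ≤ A.size)
    have := Real.log_le_log (by linarith) (le_max_left (A.size : ℝ) 2)
    linarith

/-- With z = y + log 2 and c = 1/(κ − 1/2), Bernoulli's inequality gives z^(l+1) + (l+1)c·z^l ≤ (z +
c)^(l+1). At level l + 1 one has κ = 3k − 1 − l, so (l+1)·C(3k−1, l+1) = κ·C(3k−1, l), and κc ≥ 1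
completes the recursion. -/
theorem Cost.le_level {k : ℕ} (hk : 4 ≤ k) (l : ℕ) (hl : l ≤ k) {A : InvCNFA S} {N : ℕ}
    (h : A.Cost N) (hA : A.Anchored) (hmin : A.Minimalistic) (H : A.Bnd l (3 * k - l)) :
    (N : ℝ) + 1 ≤ 3 * k * (3 * k - 1).choose l * (lg A.size + Real.log 2) ^ l := by
  obtain ⟨hl1, hl2⟩ := log_two_bounds
  have hk' : (4 : ℝ) ≤ k := by exact_mod_cast hk
  -- The shift by log 2 keeps the bounds away from 0: 2^m is at most the binomial coefficient, and 2
  -- log 2 ≥ 1.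
  have hlow : ∀ m, m ≤ k → ∀ y : ℝ, 0 ≤ y →
      2 ≤ 3 * k * ((3 * k - 1).choose m : ℝ) * (y + Real.log 2) ^ m := by
    intro m hm y hy
    have e1 : (2 : ℝ) ^ m ≤ (3 * k - 1).choose m := by exact_mod_cast two_pow_le_choose k m hm
    have e2 : (1 : ℝ) ≤ (2 * (y + Real.log 2)) ^ m := one_le_pow₀ (by linarith)
    rw [mul_pow] at e2
    have e3 : 0 ≤ (y + Real.log 2) ^ m := pow_nonneg (by linarith) m
    have e4 := e2.trans (mul_le_mul_of_nonneg_right e1 e3)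
    rw [mul_assoc]
    nlinarith
  induction l generalizing A N with
  | zero =>
    have h1 := h.add_one_le hA hmin H.1 (κ := 3 * k) (by omega) (card_T_le hmin H.2)
    have h2 : (N : ℝ) + 1 ≤ 3 * k := by exact_mod_cast h1
    simpa using h2
  | succ l ih =>
    have eκ : ((3 * k - (l + 1) : ℕ) : ℝ) = 3 * k - 1 - l := by
      rw [Nat.cast_sub (by omega)]
      push_cast
      ring
    have hlk : (l : ℝ) + 1 ≤ k := by exact_mod_cast hl
    have hmono : ∀ m, ∀ x y : ℝ, 0 ≤ x → x ≤ y →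
        3 * k * ((3 * k - 1).choose m : ℝ) * (x + Real.log 2) ^ m ≤
          3 * k * ((3 * k - 1).choose m : ℝ) * (y + Real.log 2) ^ m := by
      intro m x y hx hy
      have : 0 ≤ x + Real.log 2 := by linarith
      gcongr
    refine Cost.level_step (l := l) (κ := 3 * k - (l + 1)) (by omega)
      (Φ := fun y => 3 * k * ((3 * k - 1).choose (l + 1) : ℝ) * (y + Real.log 2) ^ (l + 1))
      (Φ' := fun y => 3 * k * ((3 * k - 1).choose l : ℝ) * (y + Real.log 2) ^ l)
      (hmono _) (hmono _) (fun y hy => by linarith [hlow l (by omega) y hy])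
      (hlow _ hl) (fun y hy => ?_) (fun A N hA hmin H hc hN => ?_) hA hmin H h
    · rw [eκ]
      set c : ℝ := 1 / (3 * k - 1 - l - 1 / 2) with hc
      have hd : (0 : ℝ) < 3 * k - 1 - l - 1 / 2 := by linarith
      have hc0 : 0 ≤ c := by positivity
      have hz : 0 ≤ y + Real.log 2 := by linarith
      have e1 := pow_add_mul_le hz hc0 l
      have e2 : ((3 * k - 1).choose (l + 1) : ℝ) * (l + 1) =
          (3 * k - 1).choose l * (3 * k - 1 - l) := by
        have := Nat.choose_succ_right_eq (3 * k - 1) l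
        have e : ((3 * k - 1 - l : ℕ) : ℝ) = 3 * k - 1 - l := by
          rw [Nat.sub_sub, add_comm 1 l, eκ]
        rw [← e]
        exact_mod_cast this
      have e3 : 1 ≤ (3 * k - 1 - l) * c := by
        rw [hc, mul_one_div, one_le_div hd]
        linarith
      have e4 : (0 : ℝ) ≤ 3 * k * (3 * k - 1).choose l * (y + Real.log 2) ^ l := by positivity
      have e5 : (0 : ℝ) ≤ 3 * k * (3 * k - 1).choose (l + 1) := by positivity
      have e6 := mul_le_mul_of_nonneg_left e1 e5
      have e7 := mul_le_mul_of_nonneg_left e3 e4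
      have e8 : y + c + Real.log 2 = y + Real.log 2 + c := by ring
      rw [e8]
      refine le_trans ?_ e6
      have e9 : (3 : ℝ) * k * (3 * k - 1).choose (l + 1) *
          ((y + Real.log 2) ^ (l + 1) + (l + 1) * c * (y + Real.log 2) ^ l) =
          3 * k * (3 * k - 1).choose (l + 1) * (y + Real.log 2) ^ (l + 1) +
          3 * k * (((3 * k - 1).choose (l + 1) : ℝ) * (l + 1)) * c * (y + Real.log 2) ^ l := by ring
      rw [e9, e2]
      linarith
    · rw [show 3 * k - (l + 1) + 1 = 3 * k - l by omega] at H
      exact ih (by omega) hN hA hmin H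

/-- The bound for the number of folds in terms of the parameter of the minimalistic automaton. -/
theorem Cost.le_pow {k N : ℕ} (hk : 1 ≤ k) (h : A.Cost N) (hA : A.Anchored)
    (hmin : A.Minimalistic) (H : A.Bnd k (2 * k)) :
    (N : ℝ) ≤ (2 * k * Real.log (max (A.size : ℝ) 2)) ^ k := by
  obtain ⟨hl1, hl2⟩ := log_two_bounds
  have hg := lg_nonneg A.size
  rw [← lg_add_log_two]
  set g := lg A.size with hgdef
  obtain rfl | rfl | rfl | hk4 : k = 1 ∨ k = 2 ∨ k = 3 ∨ 4 ≤ k := by omega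
  · have := h.le_one_two hA hmin H
    norm_num
    exact this
  · have := h.le_two hA hmin H
    rw [← hgdef] at this
    norm_num
    nlinarith [sq_nonneg g]
  · have := h.le_three hA hmin H
    rw [← hgdef] at this
    norm_num
    have e : (6 * (g + 0.69)) ^ 3 ≤ (6 * (g + Real.log 2)) ^ 3 := by gcongr
    refine le_trans ?_ e
    have h3 : 0 ≤ g ^ 3 := by positivity
    norm_num
    nlinarith [sq_nonneg g]
  · have h1 := h.le_level hk4 k le_rfl hA hmin (by
      rwa [show 3 * k - k = 2 * k by omega])
    rw [← hgdef] at h1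
    -- Here 3k · C(3k − 1, k) = 2k · C(3k, k).
    have h2 : 3 * k * (3 * k - 1).choose k ≤ (2 * k) ^ k := by
      have := Nat.choose_mul_succ_eq (3 * k - 1) k
      rw [show 3 * k - 1 + 1 = 3 * k by omega, show 3 * k - k = 2 * k by omega] at this
      rw [mul_comm, this, mul_comm]
      exact choose_three_mul_le k hk4
    have h3 : (3 * k * (3 * k - 1).choose k : ℝ) ≤ (2 * k) ^ k := by exact_mod_cast h2
    have h4 : 0 ≤ (g + Real.log 2) ^ k := pow_nonneg (by linarith) k
    rw [mul_pow]
    have := mul_le_mul_of_nonneg_right h3 h4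
    linarith

end InvCNFA

/-! ### Comparison with the parameters of the given automaton -/

namespace InvAut

variable {S : Type u}

/-- Each state of `B` is connected with the image of a mark of `A`, and all these are reachable from
the initial state. So `B` is connected. -/
theorem saturated_eq_of_accessible {A B : InvAut S} {ρ : A.Q → Option B.Q} (hA : A.Accessible)
    (P : ConnPres A B ρ) {h : Set B.Q} (hh : B.Saturated h) : h = ∅ ∨ h = Set.univ := by
  have key : ∀ y, B.q0 ∈ h ↔ y ∈ h := by
    intro y
    obtain ⟨g, z, hz, hc⟩ := P.anch y
    obtain ⟨x, -, hx⟩ := (P.marks z).1 hz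
    obtain ⟨w, hw⟩ := hA x
    exact (hh.conn ((P.conn P.init hx).1 (Conn.of_path hw))).trans (hh.conn hc).symm
  by_cases h0 : B.q0 ∈ h
  · exact Or.inr (Set.eq_univ_of_forall fun y => (key y).1 h0)
  · exact Or.inl (Set.eq_empty_of_forall_notMem fun y hy => h0 ((key y).2 hy))

theorem n_eq (A : InvAut S) : A.n = (A.ls Set.univ : ℝ) / 2 := by
  have := Fintype.ofFinite A.T
  rw [WordAut.n, ls, wt, finsum_eq_sum_of_fintype, finsum_eq_sum_of_fintype, Nat.cast_sum,
    Finset.sum_div]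
  exact Finset.sum_congr rfl fun t _ => by rw [if_pos (Set.mem_univ _)]

/-- A natural number with the role of `k(A)`. -/
noncomputable def rank (A : InvAut S) : ℕ :=
  3 * (Nat.card A.T / 2 - Nat.card A.Q) + A.mc Set.univ

theorem one_le_rank (A : InvAut S) : 1 ≤ A.rank := by
  have : 1 ≤ A.mc Set.univ := (Set.ncard_pos (Set.toFinite _)).2 ⟨A.q0, trivial, Or.inr rfl⟩
  unfold rank
  omega

/-- The marks are the final states and the initial one, whence the summand 1 in k(A). The difference
of edges and states does not increase, and the boundary term is only added on the larger side. -/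
theorem rank_le_k {A B : InvAut S} {ρ : A.Q → Option B.Q} (P : Pres A B ρ) :
    (B.rank : ℝ) ≤ A.k := by
  obtain ⟨h', s, c, h, -⟩ := P.mono _ A.saturated_univ
  have hm := P.mc_le c
  rw [P.corr_univ s c, tc_univ, tc_univ, Set.ncard_univ, Set.ncard_univ] at h
  rw [P.corr_univ s c] at hm
  have h1 : A.mc Set.univ ≤ A.F.ncard + 1 := by
    refine (Set.ncard_le_ncard Set.inter_subset_right (Set.toFinite _)).trans ?_
    exact (Set.ncard_union_le _ _).trans (by rw [Set.ncard_singleton])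
  have h2 : ((Nat.card B.T / 2 - Nat.card B.Q : ℕ) : ℝ) ≤
      max 0 ((Nat.card A.T : ℝ) / 2 - Nat.card A.Q) := by
    by_cases h0 : Nat.card B.T / 2 ≤ Nat.card B.Q
    · rw [Nat.sub_eq_zero_of_le h0, Nat.cast_zero]
      exact le_max_left _ _
    · refine le_trans ?_ (le_max_right _ _)
      have h3 : 2 * (Nat.card B.T / 2 - Nat.card B.Q) + 2 * Nat.card A.Q ≤ Nat.card A.T := by omega
      have h4 : (2 : ℝ) * ((Nat.card B.T / 2 - Nat.card B.Q : ℕ) : ℝ) + 2 * Nat.card A.Q ≤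
          Nat.card A.T := by exact_mod_cast h3
      linarith
  have h5 : (B.mc Set.univ : ℝ) ≤ A.F.ncard + 1 := by exact_mod_cast hm.trans h1
  have h6 : (0 : ℝ) ≤ A.boundary.ncard := Nat.cast_nonneg _
  unfold rank WordAut.k
  push_cast
  linarith

end InvAut

namespace InvCNFA

open InvAut

variable {S : Type u}

/-- Only the empty and the full set have to be considered. The truncated difference in `rank` is
non-negative, so doubling all of `rank` bounds 3(E − V) + 2m as well. -/
theorem bnd_rank {A : InvCNFA S} (hmin : A.Minimalistic)
    (hsat : ∀ h : Set A.Q, A.Saturated h → h = ∅ ∨ h = Set.univ) :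
    A.Bnd A.rank (2 * A.rank) := by
  obtain ⟨τ, hτ⟩ := even_card_T (inv_ne_of_minimalistic hmin)
  have h0 : A.mc ∅ = 0 := Nat.le_zero.1 ((A.mc_le_ncard ∅).trans_eq (Set.ncard_empty _))
  have h1 : A.tc ∅ = 0 := by
    rw [tc_eq_ncard]
    simp
  have h2 := A.tc_univ
  have h3 : (Set.univ : Set A.Q).ncard = Nat.card A.Q := Set.ncard_univ _
  have h4 : A.rank = 3 * (Nat.card A.T / 2 - Nat.card A.Q) + A.mc Set.univ := rfl
  constructor <;> intro h hh _ <;> rcases hsat h hh with rfl | rfl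
  · rw [h0, h1, Set.ncard_empty]
    omega
  · omega
  · rw [h0, h1, Set.ncard_empty]
    omega
  · omega

/-- The number of transition folds. -/
theorem Converts.le_rpow {A B : InvCNFA S} {N : ℕ} (h : A.Converts B N) (hA : A.Accessible)
    (hn : 1 < A.n) : (N : ℝ) ≤ (2 * A.k * Real.log A.n) ^ A.k := by
  obtain ⟨A₀, ρ, σ, hm, hr⟩ := h
  have P := hm.1.stepPres (anchored_of_accessible hA)
  have h1 := Cost.le_pow A₀.one_le_rank ⟨B, σ, hr⟩ P.anch hm.2
    (bnd_rank hm.2 fun _ hh => saturated_eq_of_accessible hA P.toConnPres hh)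
  have hk := rank_le_k P.toPres
  have hk1 : (1 : ℝ) ≤ A₀.rank := by exact_mod_cast A₀.one_le_rank
  -- The number n(A) is an integer, so n(A) > 1 means n(A) ≥ 2; thus replacing small sizes by 2 does
  -- no harm.
  obtain ⟨m, hm'⟩ := A.even_ls A.saturated_univ
  have hnm : A.n = m := by
    rw [A.n_eq, hm']
    push_cast
    ring
  rw [hnm] at hn ⊢
  have hm1 : 1 < m := by exact_mod_cast hn
  have hsz : A₀.size ≤ m := by
    have h2 := P.toPres.ls_univ_le
    have h3 := A₀.two_mul_size
    omega
  have hlog : Real.log (max (A₀.size : ℝ) 2) ≤ Real.log m := by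
    refine Real.log_le_log (lt_of_lt_of_le two_pos (le_max_right _ _)) (max_le ?_ ?_)
    · exact_mod_cast hsz
    · exact_mod_cast hm1
  have hl2 : Real.log 2 ≤ Real.log (max (A₀.size : ℝ) 2) :=
    Real.log_le_log two_pos (le_max_right _ _)
  have hl := log_two_bounds.1
  -- The base is at least 1 since 2 log 2 ≥ 1, which permits passing from the exponent `rank` to the
  -- larger real exponent k(A).
  have hb : 1 ≤ 2 * (A₀.rank : ℝ) * Real.log (max (A₀.size : ℝ) 2) := by nlinarith
  have hb2 : 2 * (A₀.rank : ℝ) * Real.log (max (A₀.size : ℝ) 2) ≤ 2 * A.k * Real.log m := by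
    have : 0 ≤ Real.log (max (A₀.size : ℝ) 2) := by linarith
    have : 0 ≤ A.k := by linarith
    gcongr
  calc (N : ℝ) ≤ _ := h1
    _ ≤ (2 * A.k * Real.log m) ^ A₀.rank := pow_le_pow_left₀ (by linarith) hb2 _
    _ = (2 * A.k * Real.log m) ^ (A₀.rank : ℝ) := (Real.rpow_natCast _ _).symm
    _ ≤ _ := Real.rpow_le_rpow_of_exponent_le (hb.trans hb2) hk

end InvCNFA

theorem mainTheorem7 {S : Type*} (A : InvCNFA S) (hA : A.Accessible) (hn : 1 < A.n) :
    A.Halts ∧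
      ∀ (B : InvCNFA S) (N : ℕ), A.Converts B N →
        (N : ℝ) ≤ (2 * A.k * Real.log A.n) ^ A.k ∧
          B.IsCDFA ∧ B.groupLang = A.groupLang :=
  have h := InvAut.anchored_of_accessible hA
  ⟨InvCNFA.halts_of_anchored A h, fun _ _ hB => ⟨hB.le_rpow hA hn, hB.isCDFA_and_groupLang h⟩⟩
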